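/- Setting. Spacetimes are smooth oriented 4-manifolds with a metric $g$ of signature $(-,+,+,+)$, Levi-Civita connection $\nabla$, Ricci tensor $R_{\mu\nu}$ and volume form $\epsilon$. Let $S$ be a smooth surface homeomorphic to the 2-sphere, $\Pi:S\times\mathbb R\to S$ the projection and $\ell=\partial_t$ the vector field on $S\times\mathbb R$ with flow $(x,t)\mapsto(x,t+s)$. An isolated horizon (IH) over $S$ is a smooth embedding of $\Delta=S\times\mathbb R$ in a spacetime as a null surface with null normal $\ell$, such that $\nabla$ restricts to a connection $D$ on $\Delta$ and $\mathcal L_\ell q=0$, $[\mathcal L_\ell,D]=0$, where $q$ is the degenerate metric induced on $\Delta$. It is extremal if $D_\ell\ell=0$. It is electrovac if there is a real 2-form $F$, smooth near $\Delta$, such that, with $\mathcal F=F-i\star F$, $J=\star d\mathcal F$ and $T_{ab}=\frac1{4\pi}\bigl(F_{ac}F_b{}^c-\frac14 g_{ab}F_{cd}F^{cd}\bigr)$, the following hold on $\Delta$: the pullback to $\Delta$ of $R_{\mu\nu}-8\pi T_{\mu\nu}$ vanishes; $J(\ell)=0$; $({}^{(\Delta)}\star-i)J|_{T\Delta}=0$;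 the pullback of $\ell\lrcorner\mathcal F$ vanishes; and $\mathcal L_\ell$ annihilates $\mathcal F_\nu{}^\mu$ regarded as a 1-form on $\Delta$ with values in $T\Delta\otimes\mathbb C$. Here $({}^{(\Delta)}\star J)_b=q^{ac}J_c\,\epsilon^{(2)}_{ab}$ and $\epsilon^{(2)}(a,b)=\epsilon(a,b,n,\ell)$ for any $n$ with $g(n,\ell)=-1$. Vacuum horizons are the case $F=0$. A generator of a null symmetry is a smooth vector field $X$ on $\Delta$ with $\mathcal L_Xq=0$, $[\mathcal L_X,D]=0$, $q(X,X)=0$; a null symmetry is a diffeomorphism of $\Delta$ which maps each null geodesic to itself and preserves $q$ and $D$. The IH is null-symmetric if some generator of a null symmetry is not a constant multiple of $\ell$. Foliations of $\Delta$ by cross-sections preserved by the flow of $\ell$ are described by smooth functions $v:\Delta\to\mathbb R$ with $\ell(v)=1$, constant on the leaves. For such $v$, let $n$ be the null field along $\Delta$ orthogonal to the leaves with $g(n,\ell)=-1$, let $D_an_b$ be the $D$-derivative of the pullback to $\Delta$ of the covector $g(n,\cdot)$, and for $q$-orthonormal $e_1,e_2$ tangent to a leaf and $m=(e_1+ie_2)/\sqrt2$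 put $\mu=\bar m^bm^aD_an_b$, $\lambda=\bar m^b\bar m^aD_an_b$ (the overall sign is irrelevant below). An extremal IH has data $(\hat q,\hat\omega)$ on $S$ if $q=\Pi^*\hat q$ and $D\ell=\Pi^*\hat\omega\otimes\ell$. A pair consisting of a smooth Riemannian metric $\hat q$ and a smooth 1-form $\hat\omega$ on $S$ solves the extremal (electrovac) constraints if, for an orientation of $S$ and some smooth $\Phi_1:S\to\mathbb C$, $$\hat\nabla_{(A}\hat\omega_{B)}+\hat\omega_A\hat\omega_B-\tfrac12\hat R_{AB}+2|\Phi_1|^2\hat q_{AB}=0,\qquad \bar m^A(\partial_A\Phi_1+2\hat\omega_A\Phi_1)=0,$$ where $m=(e_1+ie_2)/\sqrt2$ for positively oriented orthonormal $e_1,e_2$. Proposition. (1) An extremal electrovac IH is null-symmetric if and only if there is a smooth $v$ with $\ell(v)=1$ such that $\mu=\lambda=0$ for the foliation $v=\mathrm{const}$. If it is null-symmetric, it has data $(\hat q,\hat\omega)$ which solve the extremal constraints. (2) For a null-symmetric extremal electrovac IH and any $v$ with $\ell(v)=1$ and $\mu=\lambda=0$, let $X=v\ell$. Then $\ell$ and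 $X$ are linearly independent, the generators of null symmetries are exactly the fields $a\ell+cX$ with constants $a,c\in\mathbb R$, and $[\ell,X]=\ell$. The null symmetries are exactly the diffeomorphisms $\varphi$ of $\Delta$ which map each null geodesic to itself and satisfy $v\circ\varphi=cv+a$ with constants $a,c$, so that the group of null symmetries is exactly two-dimensional. (3) Conversely, for every solution $(\hat q,\hat\omega)$ of the extremal constraints on $S$ and every smooth $v$ on $S\times\mathbb R$ with $\ell(v)=1$ there is a null-symmetric extremal electrovac IH with data $(\hat q,\hat\omega)$ and with $\mu=\lambda=0$ for the foliation $v=\mathrm{const}$; and $(\hat q,\hat\omega,v)$ together with $\mu=\lambda=0$ determine the geometry $(q,D)$ uniquely. -/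

import Mathlib

open scoped Manifold ContDiff Topology

universe u

noncomputable section

namespace ExtremalIH

/-! ### Calculus of tensor fields on a manifold -/

section Calculus

variable {E : Type*} [NormedAddCommGroup E] [NormedSpace ℝ E] [FiniteDimensional ℝ E]
  {H : Type*} [TopologicalSpace H] (I : ModelWithCorners ℝ E H)
  {M : Type*} [TopologicalSpace M] [ChartedSpace H M] [IsManifold I ∞ M]

/-- The vector field `X` is differentiable at `x`. -/
def FieldDiffAt (X : Π x : M, TangentSpace I x) (x : M) : Prop :=
  MDifferentiableAt I I.tangent (fun y ↦ (⟨y, X y⟩ : TangentBundle I M)) x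

/-- The vector field `X` is smooth at `x`. -/
def FieldSmoothAt (X : Π x : M, TangentSpace I x) (x : M) : Prop :=
  ContMDiffAt I I.tangent ∞ (fun y ↦ (⟨y, X y⟩ : TangentBundle I M)) x

/-- The 1-form `α` is smooth at `x`: it maps vector fields smooth at `x` to functions smooth
at `x`. -/
def FormSmoothAt (α : Π x : M, TangentSpace I x →L[ℝ] ℝ) (x : M) : Prop :=
  ∀ X : Π y : M, TangentSpace I y, FieldSmoothAt I X x →
    ContMDiffAt I 𝓘(ℝ, ℝ) ∞ (fun y ↦ α y (X y)) x

/-- The covariant 2-tensor `T` is smooth at `x`. -/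
def TensorSmoothAt (T : Π x : M, TangentSpace I x →L[ℝ] TangentSpace I x →L[ℝ] ℝ) (x : M) :
    Prop :=
  ∀ X Y : Π y : M, TangentSpace I y, FieldSmoothAt I X x → FieldSmoothAt I Y x →
    ContMDiffAt I 𝓘(ℝ, ℝ) ∞ (fun y ↦ T y (X y) (Y y)) x

/-- `g` is a smooth Riemannian metric. -/
structure IsRiemannian (g : Π x : M, TangentSpace I x →L[ℝ] TangentSpace I x →L[ℝ] ℝ) :
    Prop where
  smooth : ∀ x, TensorSmoothAt I g x
  symm : ∀ x u w, g x u w = g x w u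
  pos : ∀ x u, u ≠ 0 → 0 < g x u u

/-- `nab` is the Levi-Civita connection of the (pseudo-Riemannian) metric `g`:
torsion-free and metric. Here `nab Y x u` is the covariant derivative of the field `Y` at `x`
in the direction `u`. -/
structure IsLeviCivita (g : Π x : M, TangentSpace I x →L[ℝ] TangentSpace I x →L[ℝ] ℝ)
    (nab : CovariantDerivative I E (fun x : M ↦ TangentSpace I x)) : Prop where
  torsion_free : nab.torsion = 0
  metric : ∀ (x : M) (Y Z : Π y : M, TangentSpace I y), FieldDiffAt I Y x → FieldDiffAt I Z x →
    ∀ u : TangentSpace I x,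
      mvfderiv I (fun y ↦ g y (Y y) (Z y)) x u =
        g x (nab Y x u) (Z x) + g x (Y x) (nab Z x u)

/-- The curvature operator `R(u, v) w` at the point `x`, where
`R(U, V) W = ∇_U ∇_V W - ∇_V ∇_U W - ∇_[U, V] W`, evaluated on smooth local extensions. -/
def curvature (nab : CovariantDerivative I E (fun x : M ↦ TangentSpace I x)) (x : M)
    (u v w : TangentSpace I x) : TangentSpace I x :=
  let U : Π y : M, TangentSpace I y := FiberBundle.extend E u
  let V : Π y : M, TangentSpace I y := FiberBundle.extend E v
  let W : Π y : M, TangentSpace I y := FiberBundle.extend E w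
  nab (fun y ↦ nab W y (V y)) x u - nab (fun y ↦ nab W y (U y)) x v
    - nab W x (VectorField.mlieBracket I U V x)

/-- The tangent space at a point is finite-dimensional. -/
instance tangentFiniteDimensional (x : M) : FiniteDimensional ℝ (TangentSpace I x) :=
  inferInstanceAs (FiniteDimensional ℝ E)

/-- The Ricci tensor `Ric(v, w)`, the trace of `u ↦ R(u, v) w`. -/
def ricci (nab : CovariantDerivative I E (fun x : M ↦ TangentSpace I x)) (x : M)
    (v w : TangentSpace I x) : ℝ :=
  ∑ i, (Module.finBasis ℝ (TangentSpace I x)).coord i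
    (curvature I nab x (Module.finBasis ℝ (TangentSpace I x) i) v w)

/-- The covariant derivative `(∇_u α)(w)` of a 1-form `α` at `x`. -/
def covDerivForm (nab : CovariantDerivative I E (fun x : M ↦ TangentSpace I x))
    (α : Π x : M, TangentSpace I x → ℝ) (x : M) (u w : TangentSpace I x) : ℝ :=
  let W : Π y : M, TangentSpace I y := FiberBundle.extend E w
  mvfderiv I (fun y ↦ α y (W y)) x u - α x (nab W x u)

/-- The exterior derivative of a complex-valued 2-form. -/
def extDeriv (Ψ : Π x : M, TangentSpace I x → TangentSpace I x → ℂ) (x : M)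
    (u v w : TangentSpace I x) : ℂ :=
  let U : Π y : M, TangentSpace I y := FiberBundle.extend E u
  let V : Π y : M, TangentSpace I y := FiberBundle.extend E v
  let W : Π y : M, TangentSpace I y := FiberBundle.extend E w
  mvfderiv I (fun y ↦ Ψ y (V y) (W y)) x u + mvfderiv I (fun y ↦ Ψ y (W y) (U y)) x v
    + mvfderiv I (fun y ↦ Ψ y (U y) (V y)) x w
    - Ψ x (VectorField.mlieBracket I U V x) w - Ψ x (VectorField.mlieBracket I V W x) u
    - Ψ x (VectorField.mlieBracket I W U x) v

end Calculus

/-! ### Spacetime -/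

/-- The model of a 3-manifold of the form surface times line. -/
abbrev I3 : ModelWithCorners ℝ (EuclideanSpace ℝ (Fin 2) × ℝ)
    (ModelProd (EuclideanSpace ℝ (Fin 2)) ℝ) := (𝓡 2).prod 𝓘(ℝ, ℝ)

/-- The model of spacetime: the 4-dimensional vector space `(ℝ² × ℝ) × ℝ`. -/
abbrev I4 : ModelWithCorners ℝ ((EuclideanSpace ℝ (Fin 2) × ℝ) × ℝ)
    (ModelProd (ModelProd (EuclideanSpace ℝ (Fin 2)) ℝ) ℝ) := I3.prod 𝓘(ℝ, ℝ)

/-- The Minkowski signs `(-, +, +, +)`. -/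
def eta (i : Fin 4) : ℝ := if i = 0 then -1 else 1

/-- An oriented 4-dimensional spacetime: a smooth manifold with a smooth metric of signature
`(-, +, +, +)`, its Levi-Civita connection and its volume form (which fixes the orientation). -/
structure Spacetime where
  carrier : Type u
  [top : TopologicalSpace carrier]
  [charted : ChartedSpace (ModelProd (ModelProd (EuclideanSpace ℝ (Fin 2)) ℝ) ℝ) carrier]
  [mfld : IsManifold I4 ∞ carrier]
  [t2 : T2Space carrier]
  [second : SecondCountableTopology carrier]
  g : Π x : carrier, TangentSpace I4 x →L[ℝ] TangentSpace I4 x →L[ℝ] ℝ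
  g_smooth : ∀ x, TensorSmoothAt I4 g x
  g_symm : ∀ x u w, g x u w = g x w u
  g_lorentz : ∀ x, ∃ b : Module.Basis (Fin 4) ℝ (TangentSpace I4 x),
    ∀ i j, g x (b i) (b j) = if i = j then eta i else 0
  nab : CovariantDerivative I4 ((EuclideanSpace ℝ (Fin 2) × ℝ) × ℝ)
    (fun x : carrier ↦ TangentSpace I4 x)
  leviCivita : IsLeviCivita I4 g nab
  vol : Π x : carrier, TangentSpace I4 x [⋀^Fin 4]→ₗ[ℝ] ℝ
  vol_sq : ∀ x (b : Fin 4 → TangentSpace I4 x),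
    vol x b ^ 2 = -(Matrix.of fun i j ↦ g x (b i) (b j)).det
  vol_smooth : ∀ x (X : Fin 4 → Π y : carrier, TangentSpace I4 y),
    (∀ i, FieldSmoothAt I4 (X i) x) →
      ContMDiffAt I4 𝓘(ℝ, ℝ) ∞ (fun y ↦ vol y (fun i ↦ X i y)) x

attribute [instance] Spacetime.top Spacetime.charted Spacetime.mfld Spacetime.t2 Spacetime.second

namespace Spacetime

variable (M : Spacetime.{u})

/-- An orthonormal frame at `x`, used only to write contractions. -/
def frame (x : M.carrier) : Module.Basis (Fin 4) ℝ (TangentSpace I4 x) :=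
  Classical.choose (M.g_lorentz x)

/-- Hodge dual of a 2-form, `(⋆F)_{ab} = ½ ε_{abcd} F^{cd}`. -/
def hodge₂ (F : Π x : M.carrier, TangentSpace I4 x →L[ℝ] TangentSpace I4 x →L[ℝ] ℝ)
    (x : M.carrier) (u w : TangentSpace I4 x) : ℝ :=
  (1 / 2) * ∑ c, ∑ d, eta c * eta d * M.vol x ![u, w, M.frame x c, M.frame x d]
    * F x (M.frame x c) (M.frame x d)

/-- The complex 2-form `F - i ⋆F`. -/
def selfDualPart (F : Π x : M.carrier, TangentSpace I4 x →L[ℝ] TangentSpace I4 x →L[ℝ] ℝ)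
    (x : M.carrier) (u w : TangentSpace I4 x) : ℂ :=
  (F x u w : ℂ) - Complex.I * (M.hodge₂ F x u w : ℂ)

/-- Hodge dual of a complex 3-form at a point, `(⋆G)_a = (1/3!) G^{bcd} ε_{bcda}`. -/
def hodge₃ (x : M.carrier)
    (G : TangentSpace I4 x → TangentSpace I4 x → TangentSpace I4 x → ℂ)
    (u : TangentSpace I4 x) : ℂ :=
  (1 / 6) * ∑ b, ∑ c, ∑ d,
    ((eta b * eta c * eta d * M.vol x ![M.frame x b, M.frame x c, M.frame x d, u] : ℝ) : ℂ)
      * G (M.frame x b) (M.frame x c) (M.frame x d)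

/-- The complex 1-form `⋆ d (F - i ⋆F)`, the left-hand side of the Maxwell equations. -/
def maxwell (F : Π x : M.carrier, TangentSpace I4 x →L[ℝ] TangentSpace I4 x →L[ℝ] ℝ)
    (x : M.carrier) (u : TangentSpace I4 x) : ℂ :=
  M.hodge₃ x (extDeriv I4 (M.selfDualPart F) x) u

/-- The electromagnetic energy-momentum tensor (Gaussian units),
`T_{ab} = (1/4π) (F_{ac} F_b{}^c - ¼ g_{ab} F_{cd} F^{cd})`. -/
def stressEnergy (F : Π x : M.carrier, TangentSpace I4 x →L[ℝ] TangentSpace I4 x →L[ℝ] ℝ)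
    (x : M.carrier) (u w : TangentSpace I4 x) : ℝ :=
  (1 / (4 * Real.pi)) *
    (∑ c, eta c * F x u (M.frame x c) * F x w (M.frame x c)
      - (1 / 4) * M.g x u w *
        ∑ c, ∑ d, eta c * eta d * F x (M.frame x c) (M.frame x d) ^ 2)

end Spacetime

/-! ### Isolated horizons -/

section Horizon

variable {S : Type u} [TopologicalSpace S] [ChartedSpace (EuclideanSpace ℝ (Fin 2)) S]
  [IsManifold (𝓡 2) ∞ S]

/-- The vector field `ℓ = ∂/∂t` on the cylinder `S × ℝ`; its flow is `(x, t) ↦ (x, t + s)`. -/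
def ell : Π p : S × ℝ, TangentSpace I3 p :=
  fun _ ↦ ((0, 1) : EuclideanSpace ℝ (Fin 2) × ℝ)

/-- The differential of the projection `Π : S × ℝ → S`. -/
def dPi (p : S × ℝ) : TangentSpace I3 p →L[ℝ] TangentSpace (𝓡 2) p.1 :=
  mfderiv I3 (𝓡 2) (Prod.fst : S × ℝ → S) p

/-- `X` is (the generator of) a symmetry of the geometry `(q, D)`: `X` is a smooth vector field
with `L_X q = 0` and `[L_X, D] = 0`. -/
structure IsSymmetryOf (q : Π p : S × ℝ, TangentSpace I3 p → TangentSpace I3 p → ℝ)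
    (D : CovariantDerivative I3 (EuclideanSpace ℝ (Fin 2) × ℝ)
      (fun p : S × ℝ ↦ TangentSpace I3 p))
    (X : Π p : S × ℝ, TangentSpace I3 p) : Prop where
  smooth : ∀ p, FieldSmoothAt I3 X p
  lie_q : ∀ (p : S × ℝ) (Y Z : Π p : S × ℝ, TangentSpace I3 p),
    FieldDiffAt I3 Y p → FieldDiffAt I3 Z p →
      mvfderiv I3 (fun p' ↦ q p' (Y p') (Z p')) p (X p) =
        q p (VectorField.mlieBracket I3 X Y p) (Z p)
          + q p (Y p) (VectorField.mlieBracket I3 X Z p)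
  lie_D : ∀ (p : S × ℝ) (Y Z : Π p : S × ℝ, TangentSpace I3 p),
    FieldSmoothAt I3 Y p → FieldSmoothAt I3 Z p →
      VectorField.mlieBracket I3 X (fun p' ↦ D Z p' (Y p')) p =
        D Z p (VectorField.mlieBracket I3 X Y p)
          + D (fun p' ↦ VectorField.mlieBracket I3 X Z p') p (Y p)

variable (S) in
/-- An isolated horizon whose space of null geodesics is the surface `S`: the cylinder `S × ℝ`
smoothly embedded in a spacetime as a null surface with null normal `ℓ`, such that the flow of
`ℓ` preserves the induced degenerate metric `q` and the induced covariant derivative `D`. -/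
structure IsolatedHorizon where
  M : Spacetime.{u}
  emb : S × ℝ → M.carrier
  emb_smooth : Manifold.IsSmoothEmbedding I3 I4 ∞ emb
  null : ∀ (p : S × ℝ) (w : TangentSpace I3 p),
    M.g (emb p) (mfderiv I3 I4 emb p (ell p)) (mfderiv I3 I4 emb p w) = 0
  D : CovariantDerivative I3 (EuclideanSpace ℝ (Fin 2) × ℝ) (fun p : S × ℝ ↦ TangentSpace I3 p)
  /-- `D` is the restriction of the spacetime connection to fields tangent to the horizon:
  if the spacetime field `Y'` extends the horizon field `Y` then `∇_w Y' = D_w Y`. -/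
  D_induced : ∀ (p : S × ℝ) (Y : Π p : S × ℝ, TangentSpace I3 p)
    (Y' : Π x : M.carrier, TangentSpace I4 x),
    FieldDiffAt I3 Y p → FieldDiffAt I4 Y' (emb p) →
    (∀ᶠ p' in 𝓝 p, Y' (emb p') = mfderiv I3 I4 emb p' (Y p')) →
    ∀ w : TangentSpace I3 p,
      mfderiv I3 I4 emb p (D Y p w) = M.nab Y' (emb p) (mfderiv I3 I4 emb p w)
  ell_symmetry : IsSymmetryOf
    (fun p u w ↦ M.g (emb p) (mfderiv I3 I4 emb p u) (mfderiv I3 I4 emb p w)) D ell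

namespace IsolatedHorizon

variable (𝓗 : IsolatedHorizon S)

/-- The differential of the embedding of the horizon. -/
def push (p : S × ℝ) : TangentSpace I3 p →L[ℝ] TangentSpace I4 (𝓗.emb p) :=
  mfderiv I3 I4 𝓗.emb p

/-- The degenerate metric induced on the horizon. -/
def q (p : S × ℝ) (u w : TangentSpace I3 p) : ℝ :=
  𝓗.M.g (𝓗.emb p) (𝓗.push p u) (𝓗.push p w)

/-- The horizon is extremal: the surface gravity vanishes, `D_ℓ ℓ = 0`. -/
def IsExtremal : Prop := ∀ p, 𝓗.D ell p (ell p) = 0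

/-- Invariance under the flow of `ℓ` of the tensor field `Ψ_ν{}^μ e^ν ⊗ e_μ` on the horizon, seen
as the map sending a tangent field `Y` to the tangent field `Z` with `g(Z, ·) = Ψ(Y, ·)`:
`L_ℓ` of it vanishes iff `[ℓ, Y]` is mapped to `[ℓ, Z]`. -/
def IsFlowInvariant (Ψ : Π x : 𝓗.M.carrier, TangentSpace I4 x → TangentSpace I4 x → ℝ) : Prop :=
  ∀ (p : S × ℝ) (Y Z : Π p : S × ℝ, TangentSpace I3 p),
    FieldDiffAt I3 Y p → FieldDiffAt I3 Z p →
    (∀ᶠ p' in 𝓝 p, ∀ w : TangentSpace I4 (𝓗.emb p'),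
      𝓗.M.g (𝓗.emb p') (𝓗.push p' (Z p')) w = Ψ (𝓗.emb p') (𝓗.push p' (Y p')) w) →
    ∀ w : TangentSpace I4 (𝓗.emb p),
      𝓗.M.g (𝓗.emb p) (𝓗.push p (VectorField.mlieBracket I3 ell Z p)) w =
        Ψ (𝓗.emb p) (𝓗.push p (VectorField.mlieBracket I3 ell Y p)) w

/-- The 2-form `F`, defined and smooth near the horizon, is an electromagnetic field which makes
the horizon an electrovac isolated horizon. -/
structure MakesElectrovac
    (F : Π x : 𝓗.M.carrier, TangentSpace I4 x →L[ℝ] TangentSpace I4 x →L[ℝ] ℝ) : Prop where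
  alternating : ∀ x u, F x u u = 0
  smooth : ∀ p, TensorSmoothAt I4 F (𝓗.emb p)
  /-- The pullback of the Einstein equations. -/
  einstein : ∀ (p : S × ℝ) (u w : TangentSpace I3 p),
    ricci I4 𝓗.M.nab (𝓗.emb p) (𝓗.push p u) (𝓗.push p w)
      - 8 * Real.pi * 𝓗.M.stressEnergy F (𝓗.emb p) (𝓗.push p u) (𝓗.push p w) = 0
  /-- `ℓ ⌟ ⋆d(F - i⋆F) = 0`. -/
  maxwell_ell : ∀ p : S × ℝ, 𝓗.M.maxwell F (𝓗.emb p) (𝓗.push p (ell p)) = 0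
  /-- `(⋆ - i) J = 0` where `J` is the pullback of `⋆d(F - i⋆F)` and `⋆` is the intrinsic Hodge
  dual `(⋆J)_b = q^{ac} J_c ε_{ab}`. The area form `ε` is the one of the orientation of the
  spacelike sections for which (section, transversal null direction `n`, `ℓ`) has the
  orientation of spacetime: `ε(a, b) = vol(a, b, n, ℓ)` for any `n` with `g(n, ℓ) = -1`. -/
  maxwell_tangent : ∀ (p : S × ℝ) (n : TangentSpace I4 (𝓗.emb p))
    (e : Fin 2 → TangentSpace I3 p),
    𝓗.M.g (𝓗.emb p) n (𝓗.push p (ell p)) = -1 →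
    (∀ i j, 𝓗.q p (e i) (e j) = if i = j then 1 else 0) →
    ∀ w : TangentSpace I3 p,
      (∑ i, 𝓗.M.maxwell F (𝓗.emb p) (𝓗.push p (e i)) *
        (𝓗.M.vol (𝓗.emb p) ![𝓗.push p (e i), 𝓗.push p w, n, 𝓗.push p (ell p)] : ℂ))
      - Complex.I * 𝓗.M.maxwell F (𝓗.emb p) (𝓗.push p w) = 0
  /-- The pullback of `ℓ ⌟ (F - i⋆F)` vanishes. -/
  ell_contraction : ∀ (p : S × ℝ) (w : TangentSpace I3 p),
    𝓗.M.selfDualPart F (𝓗.emb p) (𝓗.push p (ell p)) (𝓗.push p w) = 0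
  /-- `L_ℓ (F - i⋆F)_ν{}^μ e^ν ⊗ e_μ = 0`, real part. -/
  invariant_re : 𝓗.IsFlowInvariant (fun x u w ↦ F x u w)
  /-- `L_ℓ (F - i⋆F)_ν{}^μ e^ν ⊗ e_μ = 0`, imaginary part. -/
  invariant_im : 𝓗.IsFlowInvariant (𝓗.M.hodge₂ F)

/-- Electrovac isolated horizons; the vacuum ones are those with `F = 0`. -/
def IsElectrovac : Prop := ∃ F, 𝓗.MakesElectrovac F

/-- `X` generates a null symmetry of the geometry `(q, D)`. -/
def IsNullSymmetry (X : Π p : S × ℝ, TangentSpace I3 p) : Prop :=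
  IsSymmetryOf 𝓗.q 𝓗.D X ∧ ∀ p, 𝓗.q p (X p) (X p) = 0

/-- The horizon is null-symmetric: it has a null symmetry generator which is not a constant
multiple of `ℓ`. -/
def IsNullSymmetric : Prop := ∃ X, 𝓗.IsNullSymmetry X ∧ ¬ ∃ c : ℝ, X = c • ell

/-- The diffeomorphism `φ` of the horizon is a null symmetry: it maps every null geodesic to
itself and preserves `q` and `D`. -/
structure IsNullSymmetryMap (φ : Diffeomorph I3 I3 (S × ℝ) (S × ℝ) ∞) : Prop where
  fibre : ∀ p, (φ p).1 = p.1
  map_q : ∀ (p : S × ℝ) (u w : TangentSpace I3 p),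
    𝓗.q (φ p) (mfderiv I3 I3 φ p u) (mfderiv I3 I3 φ p w) = 𝓗.q p u w
  map_D : ∀ (p : S × ℝ) (Z Z' : Π p : S × ℝ, TangentSpace I3 p),
    FieldDiffAt I3 Z p → FieldDiffAt I3 Z' (φ p) →
    (∀ᶠ p' in 𝓝 p, Z' (φ p') = mfderiv I3 I3 φ p' (Z p')) →
    ∀ u : TangentSpace I3 p,
      𝓗.D Z' (φ p) (mfderiv I3 I3 φ p u) = mfderiv I3 I3 φ p (𝓗.D Z p u)

/-- `q̂` and `ω̂` are the metric and the 1-form on `S` induced by the geometry of the (extremal)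
horizon: `q = Π^* q̂` and `Dℓ = Π^* ω̂ ⊗ ℓ`. -/
structure HasData (qh : Π x : S, TangentSpace (𝓡 2) x →L[ℝ] TangentSpace (𝓡 2) x →L[ℝ] ℝ)
    (omh : Π x : S, TangentSpace (𝓡 2) x →L[ℝ] ℝ) : Prop where
  metric : ∀ (p : S × ℝ) (u w : TangentSpace I3 p), 𝓗.q p u w = qh p.1 (dPi p u) (dPi p w)
  rotation : ∀ (p : S × ℝ) (u : TangentSpace I3 p), 𝓗.D ell p u = omh p.1 (dPi p u) • ell p

/-- `n` is the null field along the horizon which is orthogonal to the leaves of the foliation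
`v = const` and satisfies `g(n, ℓ) = -1`. -/
structure IsTransversalNormal (v : S × ℝ → ℝ) (n : Π p : S × ℝ, TangentSpace I4 (𝓗.emb p)) :
    Prop where
  null : ∀ p, 𝓗.M.g (𝓗.emb p) (n p) (n p) = 0
  normalized : ∀ p, 𝓗.M.g (𝓗.emb p) (n p) (𝓗.push p (ell p)) = -1
  orthogonal : ∀ (p : S × ℝ) (w : TangentSpace I3 p), mvfderiv I3 v p w = 0 →
    𝓗.M.g (𝓗.emb p) (n p) (𝓗.push p w) = 0

/-- The component `(D_u n)_w`, where `n` also denotes the pullback to the horizon of the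
covector `g(n, ·)`. -/
def deformation (n : Π p : S × ℝ, TangentSpace I4 (𝓗.emb p)) (p : S × ℝ)
    (u w : TangentSpace I3 p) : ℝ :=
  covDerivForm I3 𝓗.D (fun p' z ↦ 𝓗.M.g (𝓗.emb p') (n p') (𝓗.push p' z)) p u w

/-- The component `μ = m̄^b m^a D_a n_b` for `m = (e₁ + i e₂)/√2`. -/
def mu (n : Π p : S × ℝ, TangentSpace I4 (𝓗.emb p)) (p : S × ℝ)
    (e₁ e₂ : TangentSpace I3 p) : ℂ :=
  (1 / 2) * ((𝓗.deformation n p e₁ e₁ + 𝓗.deformation n p e₂ e₂ : ℝ)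
    + Complex.I * (𝓗.deformation n p e₂ e₁ - 𝓗.deformation n p e₁ e₂ : ℝ))

/-- The component `λ = m̄^b m̄^a D_a n_b` for `m = (e₁ + i e₂)/√2`. -/
def lam (n : Π p : S × ℝ, TangentSpace I4 (𝓗.emb p)) (p : S × ℝ)
    (e₁ e₂ : TangentSpace I3 p) : ℂ :=
  (1 / 2) * ((𝓗.deformation n p e₁ e₁ - 𝓗.deformation n p e₂ e₂ : ℝ)
    - Complex.I * (𝓗.deformation n p e₁ e₂ + 𝓗.deformation n p e₂ e₁ : ℝ))

/-- `μ = λ = 0` in the frames adapted to the foliation `v = const`. -/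
def MuLambdaVanish (v : S × ℝ → ℝ) : Prop :=
  ∀ n, 𝓗.IsTransversalNormal v n → ∀ (p : S × ℝ) (e₁ e₂ : TangentSpace I3 p),
    mvfderiv I3 v p e₁ = 0 → mvfderiv I3 v p e₂ = 0 →
    𝓗.q p e₁ e₁ = 1 → 𝓗.q p e₂ e₂ = 1 → 𝓗.q p e₁ e₂ = 0 →
    𝓗.mu n p e₁ e₂ = 0 ∧ 𝓗.lam n p e₁ e₂ = 0

end IsolatedHorizon

/-- A smooth function `v` with `ℓ(v) = 1`; its level sets are the leaves of a foliation of the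
horizon by cross-sections which is preserved by the flow of `ℓ`. -/
def IsFoliationFunction (v : S × ℝ → ℝ) : Prop :=
  ContMDiff I3 𝓘(ℝ, ℝ) ∞ v ∧ ∀ p, mvfderiv I3 v p (ell p) = 1

/-- `ε` is an area form of the Riemannian metric `qh` on the surface `S`. -/
structure IsAreaForm (qh ε : Π x : S, TangentSpace (𝓡 2) x →L[ℝ] TangentSpace (𝓡 2) x →L[ℝ] ℝ) :
    Prop where
  smooth : ∀ x, TensorSmoothAt (𝓡 2) ε x
  alternating : ∀ x u, ε x u u = 0
  sq : ∀ x u w, ε x u w ^ 2 = qh x u u * qh x w w - qh x u w ^ 2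

/-- `(q̂, ω̂)` is a solution of the extremal electrovac constraints on `S`: for some complex function
`Φ` (for the Levi-Civita connection of `q̂` and an orientation of `S`)
`∇_(A ω_B) + ω_A ω_B - ½ R_AB + 2 |Φ|² q_AB = 0` and `δ̄ Φ + 2 π Φ = 0`, where
`m = (e₁ + i e₂)/√2` for positively oriented orthonormal `e₁, e₂`, `δ̄ = m̄^A ∂_A`, `π = m̄^A ω_A`.
The vacuum constraints are those with `Φ = 0`. -/
structure SolvesConstraints
    (qh : Π x : S, TangentSpace (𝓡 2) x →L[ℝ] TangentSpace (𝓡 2) x →L[ℝ] ℝ)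
    (omh : Π x : S, TangentSpace (𝓡 2) x →L[ℝ] ℝ) : Prop where
  riemannian : IsRiemannian (𝓡 2) qh
  smooth : ∀ x, FormSmoothAt (𝓡 2) omh x
  constraints : ∃ (nab : CovariantDerivative (𝓡 2) (EuclideanSpace ℝ (Fin 2))
      (fun x : S ↦ TangentSpace (𝓡 2) x))
    (ε : Π x : S, TangentSpace (𝓡 2) x →L[ℝ] TangentSpace (𝓡 2) x →L[ℝ] ℝ) (Φ : S → ℂ),
    IsLeviCivita (𝓡 2) qh nab ∧ IsAreaForm qh ε ∧ ContMDiff (𝓡 2) 𝓘(ℝ, ℂ) ∞ Φ ∧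
    (∀ (x : S) (u w : TangentSpace (𝓡 2) x),
      (1 / 2) * (covDerivForm (𝓡 2) nab (fun y z ↦ omh y z) x u w
          + covDerivForm (𝓡 2) nab (fun y z ↦ omh y z) x w u)
        + omh x u * omh x w - (1 / 2) * ricci (𝓡 2) nab x u w
        + 2 * ‖Φ x‖ ^ 2 * qh x u w = 0) ∧
    (∀ (x : S) (e₁ e₂ : TangentSpace (𝓡 2) x),
      qh x e₁ e₁ = 1 → qh x e₂ e₂ = 1 → qh x e₁ e₂ = 0 → ε x e₁ e₂ = 1 →
      (mvfderiv (𝓡 2) Φ x e₁ - Complex.I * mvfderiv (𝓡 2) Φ x e₂)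
        + 2 * ((omh x e₁ : ℂ) - Complex.I * (omh x e₂ : ℂ)) * Φ x = 0)

end Horizon

end ExtremalIH

end

/-!
Notation: `D ℓ = ω ⊗ ℓ` for the rotation 1-form `ω` of the horizon, `Hess f = D df`, and `α` for the
function on the horizon with `(F - i⋆F)(ℓ, ·) = α g(ℓ, ·)`.

*Reduction to the surface.* `D` is torsion-free and compatible with `q`, and the flow of `ℓ` preserves
`q` and `ω`. If the horizon is extremal then `ω(ℓ) = 0`, and both tensors annihilate `ℓ`, so they are
pulled back from the surface `S` of null geodesics (`HorizonGeom.exists_data`).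

*Null symmetries.* A null vector field on the horizon is `f ℓ` for a function `f`. The Lie derivative
of `q` along it vanishes automatically, that of `D` is `(Hess f + df ⊗ ω + ω ⊗ df) ⊗ ℓ`, so `f ℓ` is a
symmetry exactly if `f` solves the linear equation `SymmetryEquation`
(`HorizonGeom.isSymmetryOf_smul_ell_iff`). Its contraction with `ℓ` says that `ℓ(f)` is constant. If
`ℓ(f) = 0` then `f` is a function on the compact surface `S`, so it has a critical point; as the
equation expresses the second derivatives of `f` by the first ones, `f` is constant
(`const_of_critical_point`). Hence a symmetry that is not a multiple of `ℓ` is, up to scaling, `v ℓ` with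
`ℓ(v) = 1`, and every other solution is `c v + a` (`SymmetryEquation.eq_affine`). The pullback of
`g(n, ·)` to the horizon is `-dv`, so `D_a n_b` is `-Hess v`: the condition `μ = λ = 0` is the part of the
symmetry equation along the leaves, and its other components hold for every `v` with `ℓ(v) = 1`
(`IsolatedHorizon.muLambdaVanish_iff`).

*Uniqueness and symmetry maps.* The Koszul formula, valid for the degenerate metric, gives the
projection of `D_u Z` to `S`, and the symmetry equation for `v` gives `dv(D_u Z)`; together they determine
`D_u Z` (`HorizonGeom.unique`). A diffeomorphism `φ` mapping each null geodesic to itself preserves `q` and `ω`, so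
for the same reason it preserves `D` exactly if `v ∘ φ` solves the symmetry equation, that is, if it
is an affine function of `v` (`HorizonGeom.nullSymmetryMap_iff`).

*Constraints.* The horizon is totally geodesic, so tangential curvatures agree with those of
`D`. These project to the curvature of `S`, and the components along `ℓ` follow from `[L_ℓ, D] = 0`. Thus the
pulled back Ricci tensor is `Ric - 2 sym ∇ω - 2 ω ⊗ ω`, with the terms of the data on `S`
(`IsolatedHorizon.ricci_push`). As `ℓ` is an eigenvector of `F` and `⋆F`, the pullback of `8π T` is
`|α|² q`; flow invariance makes `α` constant along `ℓ` and fixes the derivatives along `ℓ` of the remaining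
components of `F - i⋆F`, so the Maxwell equations on the horizon become
`m̄(α) + 2 ω(m̄) α = 0`. These are the constraints for `Φ = α/2` (`IsolatedHorizon.IsAligned.einstein_iff`,
`IsolatedHorizon.IsAligned.maxwell_iff`).

*Existence.* On `(S × ℝ) × ℝ`, with last coordinate `r`, take the metric `q̂ - dV ⊗ θ - θ ⊗ dV`, where
`θ = dr - 2 r ω̂` and `V` is the extension of `v` independent of `r`. The slice `r = 0` is null with normal
`ℓ = ∂/∂V`, a Killing field, so it is an isolated horizon; the Koszul formula on it gives `D ℓ = ω̂ ⊗ ℓ`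
and the symmetry equation for `v`. The 2-form `A dV ∧ θ + B ε` has Hodge dual `-B dV ∧ θ + A ε` and
`α = -(A + i B)`, so `A = -2 Re Φ` and `B = -2 Im Φ` give the electromagnetic field; the equivalences
that derive the constraints also show that they suffice (`exists_isolatedHorizon`).
-/

set_option linter.unusedSectionVars false
open scoped Manifold ContDiff Topology
open Set Filter

noncomputable section

namespace ExtremalIH
open VectorField
open FiberBundle (extend extend_apply_self)
open Finset (sum_congr smul_sum mul_sum sum_add_distrib sum_comm sum_insert sum_eq_single sum_ite_eq sum_ite_eq' sum_smul sum_neg_distrib sum_eq_zero sum_const_zero sum_eq_single_of_mem sum_empty mem_of_mem_insert_of_ne)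

/-! ### Notation

`T[I]` is the tangent space, `Conn[I,E,M]` the type of connections on the tangent bundle, `∂[I] f x u` the
derivative of the function `f` at `x` along `u`, and `Cyl[I]` the model of a product with the line. `V∞[I] X x` and
`V¹[I] X x` say that the vector field `X` is smooth or differentiable at `x`, `C∞[I] f x` and `D¹[I] f x` the
same of a real function. `σ[M,e,n,l]` is the volume form on `(e 0, e 1, n, l)`, which is `±1` on a null frame
and gives its orientation. -/

local notation "T[" I "]" => TangentSpace I
local notation "Conn[" I "," E "," M "]" => CovariantDerivative I E (fun x : M ↦ TangentSpace I x)
local notation "Cyl[" I "]" => ModelWithCorners.prod I 𝓘(ℝ, ℝ)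
local notation "ℝ²" => EuclideanSpace ℝ (Fin 2)
local notation "extend₂" => extend (EuclideanSpace ℝ (Fin 2))
local notation "∂[" I "]" => mvfderiv I
local notation "V∞[" I "]" => FieldSmoothAt I
local notation "V¹[" I "]" => FieldDiffAt I
local notation "C∞[" I "]" => ContMDiffAt I 𝓘(ℝ, ℝ) ∞
local notation "D¹[" I "]" => MDifferentiableAt I 𝓘(ℝ, ℝ)
local notation "σ[" M "," e "," n "," l "]" => Spacetime.vol M _ ![e 0, e 1, n, l]

section Types
variable {E H : Type*} [NormedAddCommGroup E] [NormedSpace ℝ E] [TopologicalSpace H] (I : ModelWithCorners ℝ E H) (M : Type*) [TopologicalSpace M] [ChartedSpace H M]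

/-- Vector fields on `M`. -/
abbrev Vec := Π x : M, TangentSpace I x

/-- Fields of covectors on `M`. -/
abbrev Cov := Π x : M, TangentSpace I x →L[ℝ] ℝ

/-- Fields of bilinear forms on the tangent spaces of `M`. -/
abbrev Cov₂ := Π x : M, TangentSpace I x →L[ℝ] TangentSpace I x →L[ℝ] ℝ

end Types

lemma _root_.ContMDiffAt.mdiff {E H E' H' : Type*} [NormedAddCommGroup E] [NormedSpace ℝ E] [TopologicalSpace H] {I : ModelWithCorners ℝ E H}
    {M M' : Type*} [TopologicalSpace M] [ChartedSpace H M] [NormedAddCommGroup E'] [NormedSpace ℝ E'] [TopologicalSpace H'] {J : ModelWithCorners ℝ E' H'}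
    [TopologicalSpace M'] [ChartedSpace H' M'] {f : M → M'} {x : M} (hf : ContMDiffAt I J ∞ f x) : MDifferentiableAt I J f x :=
  hf.mdifferentiableAt (by simp)

section Fields
variable {E : Type*} [NormedAddCommGroup E] [NormedSpace ℝ E] [FiniteDimensional ℝ E]
  {H : Type*} [TopologicalSpace H] {I : ModelWithCorners ℝ E H} [I.Boundaryless]
  {M : Type*} [TopologicalSpace M] [ChartedSpace H M] [IsManifold I ∞ M]
  {F : Type*} [NormedAddCommGroup F] [NormedSpace ℝ F]
  {E' : Type*} [NormedAddCommGroup E'] [NormedSpace ℝ E'] [FiniteDimensional ℝ E']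
  {H' : Type*} [TopologicalSpace H'] {J : ModelWithCorners ℝ E' H'} [J.Boundaryless]
  {N : Type*} [TopologicalSpace N] [ChartedSpace H' N] [IsManifold J ∞ N]

/-! ### Functions and vector fields in charts -/

lemma mvfderiv_congr {f g : M → F} {x : M} (h : f =ᶠ[𝓝 x] g) : ∂[I] f x = ∂[I] g x := by
  unfold mvfderiv
  rw [h.mfderiv_eq]
  have := h.self_of_nhds
  ext v
  rfl

lemma mvfderiv_comp' {E' H' M' : Type*} [NormedAddCommGroup E'] [NormedSpace ℝ E'] [TopologicalSpace H']
    {I' : ModelWithCorners ℝ E' H'} [TopologicalSpace M'] [ChartedSpace H' M']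
    {f : M' → M} {g : M → F} (x : M') (hg : MDifferentiableAt I 𝓘(ℝ, F) g (f x))
    (hf : MDifferentiableAt I' I f x) (v : TangentSpace I' x) :
    mvfderiv I' (fun y ↦ g (f y)) x v = ∂[I] g (f x) (mfderiv I' I f x v) :=
  mfderiv_comp_apply x hg hf v

lemma mdifferentiableAt_chart_symm {x y : M} (hy : y ∈ (chartAt H x).source) :
    MDifferentiableAt 𝓘(ℝ, E) I (extChartAt I x).symm (extChartAt I x y) :=
  ((contMDiffOn_extChartAt_symm (n := ∞) x).contMDiffAt
      (extChartAt_target_mem_nhds' ((extChartAt I x).map_source (by simpa using hy)))).mdifferentiableAt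
      (by simp)

lemma contMDiffAt_chart_symm {x y : M} (hy : y ∈ (chartAt H x).source) :
    ContMDiffAt 𝓘(ℝ, E) I ∞ (extChartAt I x).symm (extChartAt I x y) :=
  (contMDiffOn_extChartAt_symm (n := ∞) x).contMDiffAt
      (extChartAt_target_mem_nhds' ((extChartAt I x).map_source (by simpa using hy)))

lemma mdifferentiableAt_chart {x y : M} (hy : y ∈ (chartAt H x).source) :
    MDifferentiableAt I 𝓘(ℝ, E) (extChartAt I x) y :=
  (contMDiffAt_extChartAt' (n := ∞) hy).mdiff

/-- The derivative of a function is the derivative of its chart representative on the chart components. -/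
lemma mvfderiv_eq_fderiv_chart {f : M → F} {x y : M} (hy : y ∈ (chartAt H x).source)
    (hf : MDifferentiableAt I 𝓘(ℝ, F) f y) (v : T[I] y) :
    ∂[I] f y v = fderiv ℝ (f ∘ (extChartAt I x).symm) (extChartAt I x y)
      (∂[I] (extChartAt I x) y v) := by
  have hy' : y ∈ (extChartAt I x).source := by simpa using hy
  have h3 : MDifferentiableAt 𝓘(ℝ, E) 𝓘(ℝ, F) (f ∘ (extChartAt I x).symm) (extChartAt I x y) :=
    MDifferentiableAt.comp _ (by rwa [(extChartAt I x).left_inv hy']) (mdifferentiableAt_chart_symm hy)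
  have h4 : f =ᶠ[𝓝 y] (f ∘ (extChartAt I x).symm) ∘ (extChartAt I x) := by
    filter_upwards [extChartAt_source_mem_nhds' hy'] with z hz
    simp only [Function.comp, (extChartAt I x).left_inv hz]
  rw [mvfderiv_congr h4]
  have := mfderiv_comp_apply y h3 (mdifferentiableAt_chart hy) v
  rw [mfderiv_eq_fderiv] at this
  exact this

lemma trivializationAt_snd {x y : M} (hy : y ∈ (chartAt H x).source) (v : T[I] y) :
    (trivializationAt E (T[I] : M → Type _) x ⟨y, v⟩).2 = ∂[I] (extChartAt I x) y v := by
  have := TangentBundle.continuousLinearMapAt_trivializationAt (I := I) hy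
  have h2 := congrArg (fun L ↦ L v) this
  rw [Bundle.Trivialization.continuousLinearMapAt_apply] at h2
  rw [Bundle.Trivialization.linearMapAt_apply, if_pos (by simpa using hy)] at h2
  exact h2

lemma fieldSmoothAt_iff_chart {X : Vec I M} {x₀ x : M} (hx : x ∈ (chartAt H x₀).source) :
    V∞[I] X x ↔
      ContMDiffAt I 𝓘(ℝ, E) ∞ (fun y ↦ ∂[I] (extChartAt I x₀) y (X y)) x := by
  unfold FieldSmoothAt
  have hx' : x ∈ (trivializationAt E (T[I] : M → Type _) x₀).baseSet := by simpa using hx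
  refine ((trivializationAt E (T[I] : M → Type _) x₀).contMDiffAt_section_iff (IB := I) hx').trans ?_
  apply Filter.EventuallyEq.contMDiffAt_iff
  filter_upwards [(chartAt H x₀).open_source.mem_nhds hx] with y hy
  exact trivializationAt_snd hy _

lemma fieldDiffAt_iff_chart {X : Vec I M} {x₀ x : M} (hx : x ∈ (chartAt H x₀).source) :
    V¹[I] X x ↔
      MDifferentiableAt I 𝓘(ℝ, E) (fun y ↦ ∂[I] (extChartAt I x₀) y (X y)) x := by
  unfold FieldDiffAt
  have hx' : x ∈ (trivializationAt E (T[I] : M → Type _) x₀).baseSet := by simpa using hx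
  refine ((trivializationAt E (T[I] : M → Type _) x₀).mdifferentiableAt_section_iff (IB := I) _ hx').trans ?_
  apply Filter.EventuallyEq.mdifferentiableAt_iff
  filter_upwards [(chartAt H x₀).open_source.mem_nhds hx] with y hy
  exact trivializationAt_snd hy _

/-- `extend` extends a tangent vector at `x` to the field with constant components in
the preferred chart at `x`. -/
lemma mvfderiv_chart_extend {x : M} (v : T[I] x) {y : M} (hy : y ∈ (chartAt H x).source) :
    ∂[I] (extChartAt I x) y (extend E v y) = v := by
  rw [← trivializationAt_snd hy]
  unfold extend
  have hy' : y ∈ (trivializationAt E (T[I] : M → Type _) x).baseSet := by simpa using hy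
  rw [Bundle.Trivialization.apply_mk_symm _ hy', trivializationAt_snd (mem_chart_source H x)]
  have := mfderiv_extChartAt_self (I := I) (x := x)
  exact congrArg (fun L : E →L[ℝ] E ↦ L v) this

/-- The differential of a chart is injective, so a tangent vector is determined by its components. -/
lemma mvfderiv_chart_injective {x y : M} (hy : y ∈ (chartAt H x).source) {v w : T[I] y}
    (h : ∂[I] (extChartAt I x) y v = ∂[I] (extChartAt I x) y w) : v = w :=
  (isInvertible_mfderiv_extChartAt (I := I) (x := x) (y := y) (by simpa using hy)).injective h

lemma mvfderiv_chart_self {x : M} (v : T[I] x) :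
    ∂[I] (extChartAt I x) x v = v :=
  congrArg (fun L : E →L[ℝ] E ↦ L v) (mfderiv_extChartAt_self (I := I) (x := x))

lemma FieldSmoothAt.fieldDiffAt {X : Vec I M} {x : M} (h : V∞[I] X x) :
    V¹[I] X x := ContMDiffAt.mdifferentiableAt h (by simp)

lemma FieldSmoothAt.eventually_fieldDiffAt {X : Vec I M} {x : M} (h : V∞[I] X x) :
    ∀ᶠ y in 𝓝 x, V¹[I] X y := by
  have h1 : ContMDiffAt I I.tangent 1 (fun y ↦ (⟨y, X y⟩ : TangentBundle I M)) x := ContMDiffAt.of_le h (by simp)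
  filter_upwards [(contMDiffAt_iff_contMDiffAt_nhds (by simp)).1 h1] with y hy
  exact hy.mdifferentiableAt (by simp)

lemma eventually_mdifferentiableAt {f : M → F} {x : M} (h : ContMDiffAt I 𝓘(ℝ, F) ∞ f x) :
    ∀ᶠ y in 𝓝 x, MDifferentiableAt I 𝓘(ℝ, F) f y := by
  have h1 : ContMDiffAt I 𝓘(ℝ, F) 1 f x := ContMDiffAt.of_le h (by simp)
  filter_upwards [(contMDiffAt_iff_contMDiffAt_nhds (by simp)).1 h1] with y hy
  exact hy.mdifferentiableAt (by simp)

lemma contDiffAt_chart {f : M → F} {x : M} (h : ContMDiffAt I 𝓘(ℝ, F) ∞ f x) :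
    ContDiffAt ℝ ∞ (f ∘ (extChartAt I x).symm) (extChartAt I x x) := by
  have h1 : ContMDiffAt 𝓘(ℝ, E) 𝓘(ℝ, F) ∞ (f ∘ (extChartAt I x).symm) (extChartAt I x x) := by
    apply ContMDiffAt.comp _ _ (contMDiffAt_chart_symm (mem_chart_source H x))
    rwa [extChartAt_to_inv]
  exact h1.contDiffAt

lemma mdiff_fderiv_chart {f : M → F} {x : M} (h : ContMDiffAt I 𝓘(ℝ, F) ∞ f x) :
    ContMDiffAt I 𝓘(ℝ, E →L[ℝ] F) ∞ (fun y ↦ fderiv ℝ (f ∘ (extChartAt I x).symm) (extChartAt I x y)) x := by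
  have h1 := ((contDiffAt_chart h).fderiv_right (m := ∞) (by simp)).contMDiffAt
  exact ContMDiffAt.comp x h1 contMDiffAt_extChartAt

lemma FieldSmoothAt.contMDiffAt_mvfderiv {f : M → F} {x : M} {X : Vec I M}
    (hX : V∞[I] X x) (h : ContMDiffAt I 𝓘(ℝ, F) ∞ f x) :
    ContMDiffAt I 𝓘(ℝ, F) ∞ (fun y ↦ ∂[I] f y (X y)) x := by
  have h1 := (mdiff_fderiv_chart h).clm_apply ((fieldSmoothAt_iff_chart (mem_chart_source H x)).1 hX)
  refine h1.congr_of_eventuallyEq ?_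
  filter_upwards [eventually_mdifferentiableAt h, (chartAt H x).open_source.mem_nhds (mem_chart_source H x)]
    with y hy hy'
  exact mvfderiv_eq_fderiv_chart hy' hy _

lemma FieldDiffAt.mdifferentiableAt_mvfderiv {f : M → F} {x : M} {X : Vec I M}
    (hX : V¹[I] X x) (h : ContMDiffAt I 𝓘(ℝ, F) ∞ f x) :
    MDifferentiableAt I 𝓘(ℝ, F) (fun y ↦ ∂[I] f y (X y)) x := by
  have h1 := ((mdiff_fderiv_chart h).mdiff).clm_apply ((fieldDiffAt_iff_chart (mem_chart_source H x)).1 hX)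
  refine h1.congr_of_eventuallyEq ?_
  filter_upwards [eventually_mdifferentiableAt h, (chartAt H x).open_source.mem_nhds (mem_chart_source H x)]
    with y hy hy'
  exact mvfderiv_eq_fderiv_chart hy' hy _

/-- The representative of a vector field in the preferred chart at `x`. -/
def chartRep (X : Vec I M) (x : M) (z : E) : E :=
  ∂[I] (extChartAt I x) ((extChartAt I x).symm z) (X ((extChartAt I x).symm z))

/-- The chart components of the Lie bracket are given by the coordinate formula. -/
lemma mlieBracket_eq_chartRep (X Y : Vec I M) (x : M) :
    mlieBracket I X Y x =
      fderiv ℝ (chartRep Y x) (extChartAt I x x) (X x) - fderiv ℝ (chartRep X x) (extChartAt I x x) (Y x) := by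
  have key : ∀ Z : Vec I M,
      mpullbackWithin 𝓘(ℝ, E) I (extChartAt I x).symm Z (range I) =ᶠ[𝓝 (extChartAt I x x)]
        chartRep Z x := by
    intro Z
    filter_upwards [extChartAt_target_mem_nhds (I := I) x] with z hz
    have h1 := mfderivWithin_extChartAt_symm_comp_mfderiv_extChartAt (I := I) hz
    have h2 := mfderiv_extChartAt_comp_mfderivWithin_extChartAt_symm (I := I) hz
    rw [mpullbackWithin_apply]
    have := ContinuousLinearMap.inverse_eq h1 h2
    rw [this]
    rfl
  rw [← mlieBracketWithin_univ, mlieBracketWithin_apply]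
  simp only [preimage_univ, univ_inter, I.range_eq_univ] at key ⊢
  have h0 : (mfderiv I 𝓘(ℝ, E) (extChartAt I x) x).inverse = ContinuousLinearMap.id ℝ E := by
    rw [mfderiv_extChartAt_self]; exact ContinuousLinearMap.inverse_id
  have h0' : ∀ w : E, (mfderiv I 𝓘(ℝ, E) (extChartAt I x) x).inverse w = w :=
    fun w ↦ congrArg (fun L : E →L[ℝ] E ↦ L w) h0
  refine (h0' _).trans ?_
  refine (congrFun (lieBracketWithin_univ (𝕜 := ℝ) (E := E)
    (V := mpullbackWithin 𝓘(ℝ, E) I (extChartAt I x).symm X univ)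
    (W := mpullbackWithin 𝓘(ℝ, E) I (extChartAt I x).symm Y univ)) _).trans ?_
  have := Filter.EventuallyEq.lieBracket_vectorField_eq (𝕜 := ℝ) (E := E) (key X) (key Y)
  refine this.trans ?_
  have hs : ∀ Z : Vec I M, chartRep Z x (extChartAt I x x) = Z x := by
    intro Z
    unfold chartRep
    rw [extChartAt_to_inv]
    exact mvfderiv_chart_self _
  rw [lieBracket, hs, hs]

lemma differentiableAt_chart {f : M → F} {x : M} (h : MDifferentiableAt I 𝓘(ℝ, F) f x) :
    DifferentiableAt ℝ (f ∘ (extChartAt I x).symm) (extChartAt I x x) := by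
  have h1 : MDifferentiableAt 𝓘(ℝ, E) 𝓘(ℝ, F) (f ∘ (extChartAt I x).symm) (extChartAt I x x) := by
    apply MDifferentiableAt.comp _ _ (mdifferentiableAt_chart_symm (mem_chart_source H x))
    rwa [extChartAt_to_inv]
  exact h1.differentiableAt

/-- The Lie bracket acts on functions as the commutator of derivations. -/
lemma mvfderiv_mlieBracket {f : M → F} {x : M} {X Y : Vec I M}
    (hf : ContMDiffAt I 𝓘(ℝ, F) ∞ f x) (hX : V¹[I] X x) (hY : V¹[I] Y x) :
    ∂[I] f x (mlieBracket I X Y x) =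
      ∂[I] (fun y ↦ ∂[I] f y (Y y)) x (X x)
        - ∂[I] (fun y ↦ ∂[I] f y (X y)) x (Y x) := by
  have hx := mem_chart_source H x
  set f' : E → F := f ∘ (extChartAt I x).symm with hf'
  have hd : ContDiffAt ℝ ∞ f' (extChartAt I x x) := contDiffAt_chart hf
  have hd1 : DifferentiableAt ℝ (fderiv ℝ f') (extChartAt I x x) :=
    (hd.fderiv_right (m := ∞) (by simp)).differentiableAt (by simp)
  have key : ∀ Z W : Vec I M, V¹[I] Z x →
      ∂[I] (fun y ↦ ∂[I] f y (Z y)) x (W x) =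
        fderiv ℝ (fderiv ℝ f') (extChartAt I x x) (W x) (Z x) +
          fderiv ℝ f' (extChartAt I x x) (fderiv ℝ (chartRep Z x) (extChartAt I x x) (W x)) := by
    intro Z W hZ
    have hZ' := (fieldDiffAt_iff_chart hx).1 hZ
    have hr : DifferentiableAt ℝ (chartRep Z x) (extChartAt I x x) := differentiableAt_chart hZ'
    rw [mvfderiv_eq_fderiv_chart hx (hZ.mdifferentiableAt_mvfderiv hf), mvfderiv_chart_self]
    have e : ((fun y ↦ ∂[I] f y (Z y)) ∘ (extChartAt I x).symm) =ᶠ[𝓝 (extChartAt I x x)]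
        fun z ↦ fderiv ℝ f' z (chartRep Z x z) := by
      have h1 := (continuousAt_extChartAt_symm (I := I) x).eventually
        (by rw [extChartAt_to_inv]; exact eventually_mdifferentiableAt hf)
      filter_upwards [h1, extChartAt_target_mem_nhds (I := I) x] with z hz hz'
      have := (extChartAt I x).map_target hz'
      simp only [Function.comp]
      rw [mvfderiv_eq_fderiv_chart (x := x) (by simpa using this) hz, (extChartAt I x).right_inv hz']
      rfl
    rw [e.fderiv_eq, fderiv_clm_apply hd1 hr]
    have hs : chartRep Z x (extChartAt I x x) = Z x := by
      unfold chartRep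
      rw [extChartAt_to_inv]
      exact mvfderiv_chart_self _
    rw [hs]
    exact add_comm _ _
  rw [key Y X hY, key X Y hX, mvfderiv_eq_fderiv_chart hx (hf.mdiff),
    mvfderiv_chart_self, mlieBracket_eq_chartRep]
  have hsymm : fderiv ℝ (fderiv ℝ f') (extChartAt I x x) (X x) (Y x) =
      fderiv ℝ (fderiv ℝ f') (extChartAt I x x) (Y x) (X x) := by
    exact ((hd.of_le (m := 2) (WithTop.coe_le_coe.2 (le_top : (2 : ℕ∞) ≤ ⊤))).isSymmSndFDerivAt (by simp)) _ _
  rw [hsymm]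
  erw [map_sub]
  abel

/-! ### Vector fields and fields along maps -/

lemma FieldSmoothAt.add {X Y : Vec I M} {x : M} (hX : V∞[I] X x)
    (hY : V∞[I] Y x) : V∞[I] (X + Y) x := ContMDiffAt.add_section hX hY

lemma FieldSmoothAt.sub {X Y : Vec I M} {x : M} (hX : V∞[I] X x)
    (hY : V∞[I] Y x) : V∞[I] (X - Y) x := ContMDiffAt.sub_section hX hY

lemma FieldSmoothAt.smul {X : Vec I M} {x : M} {f : M → ℝ}
    (hf : C∞[I] f x) (hX : V∞[I] X x) : V∞[I] (f • X) x :=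
  ContMDiffAt.smul_section hf hX

lemma FieldSmoothAt.sum {ι : Type*} {s : Finset ι} {X : ι → Vec I M} {x : M}
    (hX : ∀ i ∈ s, V∞[I] (X i) x) : V∞[I] (fun y ↦ ∑ i ∈ s, X i y) x :=
  ContMDiffAt.sum_section hX

lemma FieldDiffAt.add {X Y : Vec I M} {x : M} (hX : V¹[I] X x)
    (hY : V¹[I] Y x) : V¹[I] (X + Y) x := mdifferentiableAt_add_section hX hY

lemma FieldDiffAt.sub {X Y : Vec I M} {x : M} (hX : V¹[I] X x)
    (hY : V¹[I] Y x) : V¹[I] (X - Y) x := mdifferentiableAt_sub_section hX hY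

lemma FieldDiffAt.smul {X : Vec I M} {x : M} {f : M → ℝ}
    (hf : D¹[I] f x) (hX : V¹[I] X x) : V¹[I] (f • X) x :=
  MDifferentiableAt.smul_section hf hX

lemma FieldDiffAt.sum {ι : Type*} {s : Finset ι} {X : ι → Vec I M} {x : M}
    (hX : ∀ i ∈ s, V¹[I] (X i) x) : V¹[I] (fun y ↦ ∑ i ∈ s, X i y) x :=
  MDifferentiableAt.sum_section hX

lemma FieldSmoothAt.congr {X Y : Vec I M} {x : M} (hX : V∞[I] X x)
    (h : ∀ᶠ y in 𝓝 x, Y y = X y) : V∞[I] Y x :=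
  ContMDiffAt.congr_of_eventuallyEq hX (h.mono fun y hy ↦ by simp only [hy])

lemma FieldDiffAt.congr {X Y : Vec I M} {x : M} (hX : V¹[I] X x)
    (h : ∀ᶠ y in 𝓝 x, Y y = X y) : V¹[I] Y x :=
  MDifferentiableAt.congr_of_eventuallyEq hX (h.mono fun y hy ↦ by simp only [hy])

lemma fieldSmoothAt_extend {x : M} (v : T[I] x) {y : M} (hy : y ∈ (chartAt H x).source) :
    V∞[I] (extend E v) y := by
  rw [fieldSmoothAt_iff_chart hy]
  have h0 : ContMDiffAt I 𝓘(ℝ, E) ∞ (fun _ : M ↦ (show E from v)) y := contMDiffAt_const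
  refine h0.congr_of_eventuallyEq ?_
  filter_upwards [(chartAt H x).open_source.mem_nhds hy] with z hz
  exact mvfderiv_chart_extend v hz

lemma fieldSmoothAt_extend_self {x : M} (v : T[I] x) :
    V∞[I] (extend E v) x := fieldSmoothAt_extend v (mem_chart_source H x)

lemma fieldDiffAt_extend_self {x : M} (v : T[I] x) :
    V¹[I] (extend E v) x := (fieldSmoothAt_extend_self v).fieldDiffAt

lemma exists_fieldSmoothAt {x : M} (v : T[I] x) : ∃ V : Vec I M, V∞[I] V x ∧ V x = v := ⟨_, fieldSmoothAt_extend_self v, extend_apply_self _ _⟩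

lemma exists_fieldDiffAt {x : M} (v : T[I] x) : ∃ V : Vec I M, V¹[I] V x ∧ V x = v := ⟨_, fieldDiffAt_extend_self v, extend_apply_self _ _⟩

variable (I) in
/-- The `i`-th coordinate field of the preferred chart at `x`. -/
def coordField (x : M) (i : Fin (Module.finrank ℝ E)) : Vec I M :=
  extend E (x := x) (Module.finBasis ℝ E i)

lemma coordField_smooth {x y : M} (hy : y ∈ (chartAt H x).source) (i) :
    V∞[I] (coordField I x i) y := fieldSmoothAt_extend _ hy

lemma coordField_smooth_self {x : M} (i) : V∞[I] (coordField I x i) x :=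
  coordField_smooth (mem_chart_source H x) i

lemma mvfderiv_chart_coordField {x y : M} (hy : y ∈ (chartAt H x).source) (i) :
    ∂[I] (extChartAt I x) y (coordField I x i y) = Module.finBasis ℝ E i :=
  mvfderiv_chart_extend _ hy

lemma field_chart_expansion {x y : M} (hy : y ∈ (chartAt H x).source) (v : T[I] y) :
    v = ∑ i, (Module.finBasis ℝ E).coord i (∂[I] (extChartAt I x) y v) •
      coordField I x i y := by
  apply mvfderiv_chart_injective hy
  rw [map_sum]
  simp_rw [map_smul, mvfderiv_chart_coordField hy]
  exact ((Module.finBasis ℝ E).sum_repr _).symm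

/-- Smoothness at `y` of a field of tangent vectors of `M` along a map `f : N → M`. -/
def AlongSmoothAt (f : N → M) (V : Π y : N, T[I] (f y)) (y : N) : Prop :=
  ContMDiffAt J 𝓘(ℝ, E) ∞ (fun z ↦ ∂[I] (extChartAt I (f y)) (f z) (V z)) y

/-- Differentiability at `y` of a field of tangent vectors of `M` along a map `f : N → M`. -/
def AlongDiffAt (f : N → M) (V : Π y : N, T[I] (f y)) (y : N) : Prop :=
  MDifferentiableAt J 𝓘(ℝ, E) (fun z ↦ ∂[I] (extChartAt I (f y)) (f z) (V z)) y

lemma eventually_chart_mem {f : N → M} {y : N} (hf : ContinuousAt f y) :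
    ∀ᶠ z in 𝓝 y, f z ∈ (chartAt H (f y)).source :=
  hf.eventually ((chartAt H (f y)).open_source.mem_nhds (mem_chart_source H _))

lemma FieldSmoothAt.along {f : N → M} {y : N} (hf : ContMDiffAt J I ∞ f y)
    {X : Vec I M} (hX : V∞[I] X (f y)) :
    AlongSmoothAt (J := J) (I := I) f (fun z ↦ X (f z)) y :=
  ContMDiffAt.comp y ((fieldSmoothAt_iff_chart (mem_chart_source H (f y))).1 hX) hf

lemma FieldDiffAt.along {f : N → M} {y : N} (hf : MDifferentiableAt J I f y)
    {X : Vec I M} (hX : V¹[I] X (f y)) :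
    AlongDiffAt (J := J) (I := I) f (fun z ↦ X (f z)) y :=
  MDifferentiableAt.comp y ((fieldDiffAt_iff_chart (mem_chart_source H (f y))).1 hX) hf

lemma eventually_mdiff_map {f : N → M} {y : N} (hf : ContMDiffAt J I ∞ f y) :
    ∀ᶠ z in 𝓝 y, MDifferentiableAt J I f z := by
  have h1 : ContMDiffAt J I 1 f y := ContMDiffAt.of_le hf (by simp)
  filter_upwards [(contMDiffAt_iff_contMDiffAt_nhds (by simp)).1 h1] with z hz
  exact hz.mdifferentiableAt (by simp)

lemma mvfderiv_chart_comp {f : N → M} {y : N} (hf : ContMDiffAt J I ∞ f y) (X : Vec J N) :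
    ∀ᶠ z in 𝓝 y, ∂[I] (extChartAt I (f y)) (f z) (mfderiv J I f z (X z)) =
      ∂[J] (fun z ↦ extChartAt I (f y) (f z)) z (X z) := by
  filter_upwards [eventually_mdiff_map hf, eventually_chart_mem (H := H) hf.continuousAt] with z hz hz'
  exact (mvfderiv_comp' z (mdifferentiableAt_chart hz') hz _).symm

lemma contMDiffAt_chart_comp {f : N → M} {y : N} (hf : ContMDiffAt J I ∞ f y) :
    ContMDiffAt J 𝓘(ℝ, E) ∞ (fun z ↦ extChartAt I (f y) (f z)) y :=
  ContMDiffAt.comp y contMDiffAt_extChartAt hf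

lemma FieldSmoothAt.along_mfderiv {f : N → M} {y : N} (hf : ContMDiffAt J I ∞ f y)
    {X : Vec J N} (hX : FieldSmoothAt J X y) :
    AlongSmoothAt (J := J) (I := I) f (fun z ↦ mfderiv J I f z (X z)) y :=
  (hX.contMDiffAt_mvfderiv (contMDiffAt_chart_comp hf)).congr_of_eventuallyEq (mvfderiv_chart_comp hf X)

lemma FieldDiffAt.along_mfderiv {f : N → M} {y : N} (hf : ContMDiffAt J I ∞ f y)
    {X : Vec J N} (hX : FieldDiffAt J X y) :
    AlongDiffAt (J := J) (I := I) f (fun z ↦ mfderiv J I f z (X z)) y :=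
  (hX.mdifferentiableAt_mvfderiv (contMDiffAt_chart_comp hf)).congr_of_eventuallyEq (mvfderiv_chart_comp hf X)

lemma contMDiffAt_coord {y : N} {c : N → E} (hc : ContMDiffAt J 𝓘(ℝ, E) ∞ c y) (i) :
    C∞[J] (fun z ↦ (Module.finBasis ℝ E).coord i (c z)) y :=
  ContMDiffAt.comp y (((Module.finBasis ℝ E).coord i).toContinuousLinearMap.contMDiff.contMDiffAt) hc

lemma mdifferentiableAt_coord {y : N} {c : N → E} (hc : MDifferentiableAt J 𝓘(ℝ, E) c y) (i) :
    D¹[J] (fun z ↦ (Module.finBasis ℝ E).coord i (c z)) y :=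
  MDifferentiableAt.comp y (((Module.finBasis ℝ E).coord i).toContinuousLinearMap.mdifferentiableAt) hc

lemma contMDiffAt_sum {ι : Type*} {s : Finset ι} {c : ι → N → ℝ} {y : N}
    (h : ∀ i ∈ s, C∞[J] (c i) y) :
    C∞[J] (fun z ↦ ∑ i ∈ s, c i z) y := ContMDiffAt.sum h

lemma mdifferentiableAt_sum {ι : Type*} {s : Finset ι} {c : ι → N → ℝ} {y : N}
    (h : ∀ i ∈ s, D¹[J] (c i) y) :
    D¹[J] (fun z ↦ ∑ i ∈ s, c i z) y := by
  classical
  induction s using Finset.induction_on with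
  | empty => simpa using mdifferentiableAt_const
  | insert a s ha ih =>
    simp only [sum_insert ha]
    exact (h a (by simp)).add (ih fun i hi ↦ h i (by simp [hi]))

lemma FormSmoothAt.along {α : Cov I M} {f : N → M} {y : N}
    (hα : FormSmoothAt I α (f y)) (hf : ContMDiffAt J I ∞ f y) {V : Π y : N, T[I] (f y)}
    (hV : AlongSmoothAt (J := J) (I := I) f V y) :
    C∞[J] (fun z ↦ α (f z) (V z)) y := by
  have h : C∞[J] (fun z ↦ ∑ i, (Module.finBasis ℝ E).coord i
      (∂[I] (extChartAt I (f y)) (f z) (V z)) *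
        α (f z) (coordField I (f y) i (f z))) y :=
    contMDiffAt_sum fun i _ ↦ (contMDiffAt_coord hV i).mul
      (ContMDiffAt.comp (g := fun x ↦ α x (coordField I (f y) i x)) y
        (hα _ (coordField_smooth_self _)) hf)
  refine h.congr_of_eventuallyEq ?_
  filter_upwards [eventually_chart_mem (H := H) hf.continuousAt] with z hz
  conv_lhs => rw [field_chart_expansion hz (V z)]
  simp only [map_sum, map_smul, smul_eq_mul]

lemma FormSmoothAt.along_diff {α : Cov I M} {f : N → M} {y : N}
    (hα : FormSmoothAt I α (f y)) (hf : MDifferentiableAt J I f y) {V : Π y : N, T[I] (f y)}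
    (hV : AlongDiffAt (J := J) (I := I) f V y) :
    D¹[J] (fun z ↦ α (f z) (V z)) y := by
  have h : D¹[J] (fun z ↦ ∑ i, (Module.finBasis ℝ E).coord i
      (∂[I] (extChartAt I (f y)) (f z) (V z)) *
        α (f z) (coordField I (f y) i (f z))) y :=
    mdifferentiableAt_sum fun i _ ↦ (mdifferentiableAt_coord hV i).mul
      (MDifferentiableAt.comp (g := fun x ↦ α x (coordField I (f y) i x)) y
        ((hα _ (coordField_smooth_self _)).mdiff) hf)
  refine h.congr_of_eventuallyEq ?_
  filter_upwards [eventually_chart_mem (H := H) hf.continuousAt] with z hz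
  conv_lhs => rw [field_chart_expansion hz (V z)]
  simp only [map_sum, map_smul, smul_eq_mul]

lemma TensorSmoothAt.along {T : Cov₂ I M} {f : N → M} {y : N}
    (hT : TensorSmoothAt I T (f y)) (hf : ContMDiffAt J I ∞ f y) {V W : Π y : N, T[I] (f y)}
    (hV : AlongSmoothAt (J := J) (I := I) f V y) (hW : AlongSmoothAt (J := J) (I := I) f W y) :
    C∞[J] (fun z ↦ T (f z) (V z) (W z)) y := by
  have h : C∞[J] (fun z ↦ ∑ i, (Module.finBasis ℝ E).coord i
      (∂[I] (extChartAt I (f y)) (f z) (V z)) *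
        T (f z) (coordField I (f y) i (f z)) (W z)) y :=
    contMDiffAt_sum fun i _ ↦ (contMDiffAt_coord hV i).mul
      (FormSmoothAt.along (α := fun x ↦ T x (coordField I (f y) i x))
        (fun X hX ↦ hT _ _ (coordField_smooth_self _) hX) hf hW)
  refine h.congr_of_eventuallyEq ?_
  filter_upwards [eventually_chart_mem (H := H) hf.continuousAt] with z hz
  conv_lhs => rw [field_chart_expansion hz (V z)]
  simp only [map_sum, map_smul, smul_eq_mul, _root_.sum_apply, _root_.smul_apply]

lemma TensorSmoothAt.along_diff {T : Cov₂ I M} {f : N → M} {y : N}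
    (hT : TensorSmoothAt I T (f y)) (hf : MDifferentiableAt J I f y) {V W : Π y : N, T[I] (f y)}
    (hV : AlongDiffAt (J := J) (I := I) f V y) (hW : AlongDiffAt (J := J) (I := I) f W y) :
    D¹[J] (fun z ↦ T (f z) (V z) (W z)) y := by
  have h : D¹[J] (fun z ↦ ∑ i, (Module.finBasis ℝ E).coord i
      (∂[I] (extChartAt I (f y)) (f z) (V z)) *
        T (f z) (coordField I (f y) i (f z)) (W z)) y :=
    mdifferentiableAt_sum fun i _ ↦ (mdifferentiableAt_coord hV i).mul
      (FormSmoothAt.along_diff (α := fun x ↦ T x (coordField I (f y) i x))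
        (fun X hX ↦ hT _ _ (coordField_smooth_self _) hX) hf hW)
  refine h.congr_of_eventuallyEq ?_
  filter_upwards [eventually_chart_mem (H := H) hf.continuousAt] with z hz
  conv_lhs => rw [field_chart_expansion hz (V z)]
  simp only [map_sum, map_smul, smul_eq_mul, _root_.sum_apply, _root_.smul_apply]

lemma TensorSmoothAt.mdifferentiableAt {T : Cov₂ I M} {x : M}
    (hT : TensorSmoothAt I T x) {X Y : Vec I M} (hX : V¹[I] X x)
    (hY : V¹[I] Y x) : D¹[I] (fun y ↦ T y (X y) (Y y)) x :=
  TensorSmoothAt.along_diff (f := fun x : M ↦ x) hT mdifferentiableAt_id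
    (hX.along (f := fun x : M ↦ x) mdifferentiableAt_id) (hY.along (f := fun x : M ↦ x) mdifferentiableAt_id)

lemma FormSmoothAt.mdifferentiableAt {α : Cov I M} {x : M}
    (hα : FormSmoothAt I α x) {X : Vec I M} (hX : V¹[I] X x) :
    D¹[I] (fun y ↦ α y (X y)) x :=
  FormSmoothAt.along_diff (f := fun x : M ↦ x) hα mdifferentiableAt_id
    (hX.along (f := fun x : M ↦ x) mdifferentiableAt_id)

/-- Brackets of `f`-related fields are `f`-related. -/
lemma mfderiv_mlieBracket_of_related {f : N → M} {y : N} (hf : ContMDiffAt J I ∞ f y)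
    {X Y : Vec J N} {X' Y' : Vec I M}
    (hX : FieldDiffAt J X y) (hY : FieldDiffAt J Y y) (hX' : V¹[I] X' (f y)) (hY' : V¹[I] Y' (f y))
    (hXX : ∀ᶠ z in 𝓝 y, X' (f z) = mfderiv J I f z (X z)) (hYY : ∀ᶠ z in 𝓝 y, Y' (f z) = mfderiv J I f z (Y z)) :
    mfderiv J I f y (mlieBracket J X Y y) = mlieBracket I X' Y' (f y) := by
  have hc := contMDiffAt_extChartAt (I := I) (x := f y) (n := ∞)
  apply mvfderiv_chart_injective (mem_chart_source H (f y))
  rw [mvfderiv_mlieBracket hc hX' hY', ← mvfderiv_comp' y (hc.mdiff)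
    (hf.mdiff), mvfderiv_mlieBracket (contMDiffAt_chart_comp hf) hX hY]
  have key : ∀ {Z W : Vec J N} {Z' W' : Vec I M},
      V¹[I] Z' (f y) → (∀ᶠ z in 𝓝 y, Z' (f z) = mfderiv J I f z (Z z)) →
      (∀ᶠ z in 𝓝 y, W' (f z) = mfderiv J I f z (W z)) →
      ∂[J] (fun z ↦ ∂[J] (fun z ↦ extChartAt I (f y) (f z)) z (Z z)) y (W y) =
        ∂[I] (fun z ↦ ∂[I] (extChartAt I (f y)) z (Z' z)) (f y) (W' (f y)) := by
    intro Z W Z' W' hZ' hZZ hWW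
    rw [hWW.self_of_nhds, ← mvfderiv_comp' y (hZ'.mdifferentiableAt_mvfderiv hc) (hf.mdiff)]
    rw [mvfderiv_congr]
    filter_upwards [hZZ, mvfderiv_chart_comp hf Z] with z hz hz'
    rw [hz, hz']
  rw [key hY' hYY hXX, key hX' hXX hYY]

/-! ### Immersions and connections along them -/

/-- An immersion has a smooth local left inverse. -/
lemma exists_local_retraction {f : N → M} {p : N} (h : Manifold.IsImmersionAt J I ∞ f p) :
    ∃ ρ : M → N, ContMDiffAt I J ∞ ρ (f p) ∧ ∀ᶠ y in 𝓝 p, ρ (f y) = y := by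
  refine ⟨fun x ↦ (h.domChart.extend J).symm ((h.equiv.symm (h.codChart.extend I x)).1), ?_, ?_⟩
  · have h0 : ∀ y ∈ h.domChart.source,
        (h.equiv.symm (h.codChart.extend I (f y))).1 = h.domChart.extend J y := by
      intro y hy
      have hy' : h.domChart.extend J y ∈ (h.domChart.extend J).target :=
        (h.domChart.extend J).map_source (by simpa using hy)
      have := h.writtenInCharts hy'
      simp only [Function.comp] at this
      rw [(h.domChart.extend J).left_inv (by simpa using hy)] at this
      rw [this]
      simp
    have h1 : ContMDiffAt I 𝓘(ℝ, E) ∞ (h.codChart.extend I) (f p) :=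
      OpenPartialHomeomorph.contMDiffAt_extend h.codChart_mem_maximalAtlas h.mem_codChart_source
    let L : E →L[ℝ] E' := (ContinuousLinearMap.fst ℝ E' h.complement).comp
      (h.equiv.symm : E →L[ℝ] E' × h.complement)
    have h2 : ContMDiffAt I 𝓘(ℝ, E') ∞ (fun x ↦ L (h.codChart.extend I x)) (f p) :=
      ContMDiffAt.comp _ L.contMDiff.contMDiffAt h1
    have h3 : ContMDiffAt 𝓘(ℝ, E') J ∞ (h.domChart.extend J).symm (L (h.codChart.extend I (f p))) := by
      have hm : L (h.codChart.extend I (f p)) ∈ (h.domChart.extend J).target := by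
        have := h0 p h.mem_domChart_source
        have h5 : L (h.codChart.extend I (f p)) = h.domChart.extend J p := this
        rw [h5]
        exact (h.domChart.extend J).map_source (by simpa using h.mem_domChart_source)
      refine (contMDiffOn_extend_symm h.domChart_mem_maximalAtlas).contMDiffAt ?_
      rw [← OpenPartialHomeomorph.extend_target']
      exact h.domChart.isOpen_extend_target.mem_nhds hm
    exact ContMDiffAt.comp _ h3 h2
  · filter_upwards [h.domChart.open_source.mem_nhds h.mem_domChart_source] with y hy
    have hy' : h.domChart.extend J y ∈ (h.domChart.extend J).target :=
      (h.domChart.extend J).map_source (by simpa using hy)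
    have := h.writtenInCharts hy'
    simp only [Function.comp] at this
    rw [(h.domChart.extend J).left_inv (by simpa using hy)] at this
    rw [this]
    simp only [ContinuousLinearEquiv.symm_apply_apply]
    exact (h.domChart.extend J).left_inv (by simpa using hy)

lemma mfderiv_retraction {f : N → M} {ρ : M → N} {p : N} (hf : MDifferentiableAt J I f p)
    (hρ : MDifferentiableAt I J ρ (f p)) (h : ∀ᶠ y in 𝓝 p, ρ (f y) = y) (v : T[J] p) :
    mfderiv I J ρ (f p) (mfderiv J I f p v) = v := by
  have h1 := mfderiv_comp_apply p hρ hf v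
  have h2 : ρ ∘ f =ᶠ[𝓝 p] id := h
  rw [h2.mfderiv_eq, mfderiv_id] at h1
  exact h1.symm

lemma mfderiv_injective_of_immersion {f : N → M} {p : N} (h : Manifold.IsImmersionAt J I ∞ f p) :
    Function.Injective (mfderiv J I f p) := by
  obtain ⟨ρ, hρ, hρf⟩ := exists_local_retraction h
  intro v w hvw
  have hf := h.contMDiffAt.mdiff
  rw [← mfderiv_retraction hf (hρ.mdiff) hρf v, hvw,
    mfderiv_retraction hf (hρ.mdiff) hρf w]

/-- A field along an immersion with chart components `c` extends to the ambient manifold. -/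
lemma exists_extension {f : N → M} {p : N} (h : Manifold.IsImmersionAt J I ∞ f p)
    (V : Π y : N, T[I] (f y)) :
    ∃ X : Vec I M, (∀ᶠ y in 𝓝 p, X (f y) = V y) ∧
      (AlongDiffAt (J := J) (I := I) f V p → V¹[I] X (f p)) ∧
      (AlongSmoothAt (J := J) (I := I) f V p → V∞[I] X (f p)) := by
  obtain ⟨ρ, hρ, hρf⟩ := exists_local_retraction h
  let a : Fin (Module.finrank ℝ E) → N → ℝ := fun i y ↦
    (Module.finBasis ℝ E).coord i (∂[I] (extChartAt I (f p)) (f y) (V y))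
  refine ⟨fun x ↦ ∑ i, ((fun x ↦ a i (ρ x)) • coordField I (f p) i) x, ?_, ?_, ?_⟩
  · filter_upwards [hρf, eventually_chart_mem (H := H) h.continuousAt] with y hy hy'
    conv_rhs => rw [field_chart_expansion hy' (V y)]
    refine sum_congr rfl fun i _ ↦ ?_
    show a i (ρ (f y)) • coordField I (f p) i (f y) = _
    rw [hy]
  · intro hV
    refine FieldDiffAt.sum fun i _ ↦ FieldDiffAt.smul ?_ (coordField_smooth_self i).fieldDiffAt
    have h1 : D¹[J] (a i) (ρ (f p)) := by
      rw [hρf.self_of_nhds]; exact mdifferentiableAt_coord hV i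
    exact MDifferentiableAt.comp (g := a i) (f := ρ) (f p) h1 (hρ.mdiff)
  · intro hV
    refine FieldSmoothAt.sum fun i _ ↦ FieldSmoothAt.smul ?_ (coordField_smooth_self i)
    have h1 : C∞[J] (a i) (ρ (f p)) := by
      rw [hρf.self_of_nhds]; exact contMDiffAt_coord hV i
    exact ContMDiffAt.comp (g := a i) (f := ρ) (f p) h1 hρ

/-- A field on `N` whose image under an immersion extends smoothly is smooth. -/
lemma fieldSmoothAt_of_along {f : N → M} {p : N} (h : Manifold.IsImmersionAt J I ∞ f p)
    {X : Vec J N} {X' : Vec I M} (hX' : V∞[I] X' (f p))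
    (hXX : ∀ᶠ y in 𝓝 p, X' (f y) = mfderiv J I f y (X y)) : FieldSmoothAt J X p := by
  obtain ⟨ρ, hρ, hρf⟩ := exists_local_retraction h
  have hf := h.contMDiffAt
  rw [fieldSmoothAt_iff_chart (mem_chart_source H' p)]
  have e : ContMDiffAt I 𝓘(ℝ, E') ∞ (fun x ↦ extChartAt J p (ρ x)) (f p) := by
    have : ContMDiffAt J 𝓘(ℝ, E') ∞ (extChartAt J p) (ρ (f p)) := by
      rw [hρf.self_of_nhds]; exact contMDiffAt_extChartAt
    exact ContMDiffAt.comp (f p) this hρ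
  have h1 := hX'.contMDiffAt_mvfderiv e
  have h2 : ContMDiffAt J 𝓘(ℝ, E') ∞ (fun y ↦ ∂[I] (fun x ↦ extChartAt J p (ρ x)) (f y) (X' (f y))) p :=
    ContMDiffAt.comp p h1 hf
  refine h2.congr_of_eventuallyEq ?_
  filter_upwards [hXX, eventually_mdiff_map hf, hf.continuousAt.eventually (eventually_mdifferentiableAt e),
    (hρf.eventually_nhds), (chartAt H' p).open_source.mem_nhds (mem_chart_source H' p)] with y h1 h2 h3 h4 h5
  rw [h1, ← mvfderiv_comp' y h3 h2]
  rw [mvfderiv_congr]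
  filter_upwards [h4] with z hz
  rw [hz]

/-! ### Connections -/

lemma nab_add (nab : Conn[I,E,M]) {X Y : Vec I M}
    {x : M} (hX : V¹[I] X x) (hY : V¹[I] Y x) (u : T[I] x) :
    nab (X + Y) x u = nab X x u + nab Y x u := by
  rw [nab.isCovariantDerivativeOnUniv.add hX hY]
  rfl

lemma nab_smul (nab : Conn[I,E,M]) {X : Vec I M}
    {f : M → ℝ} {x : M} (hf : D¹[I] f x) (hX : V¹[I] X x) (u : T[I] x) :
    nab (f • X) x u = f x • nab X x u + ∂[I] f x u • X x := by
  rw [nab.isCovariantDerivativeOnUniv.leibniz hX hf]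
  rfl

lemma nab_zero (nab : Conn[I,E,M]) (x : M) (u : T[I] x) :
    nab (fun _ ↦ 0) x u = 0 := by
  have := nab.zero
  have h2 : nab (0 : Vec I M) x u = 0 := by rw [this]; rfl
  exact h2

lemma nab_congr (nab : Conn[I,E,M]) {X Y : Vec I M}
    {x : M} (hX : V¹[I] X x) (h : ∀ᶠ y in 𝓝 x, Y y = X y) (u : T[I] x) :
    nab Y x u = nab X x u := by
  rw [nab.isCovariantDerivativeOnUniv.congr_of_eventuallyEq (hX.congr h) hX univ_mem h]

lemma nab_sub (nab : Conn[I,E,M]) {X Y : Vec I M}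
    {x : M} (hX : V¹[I] X x) (hY : V¹[I] Y x) (u : T[I] x) :
    nab (X - Y) x u = nab X x u - nab Y x u := by
  have h := nab_add nab (hX.sub hY) hY u
  rw [sub_add_cancel] at h
  rw [h, add_sub_cancel_right]

lemma nab_sum (nab : Conn[I,E,M]) {ι : Type*} {s : Finset ι}
    {X : ι → Vec I M} {x : M} (hX : ∀ i ∈ s, V¹[I] (X i) x) (u : T[I] x) :
    nab (fun y ↦ ∑ i ∈ s, X i y) x u = ∑ i ∈ s, nab (X i) x u := by
  classical
  induction s using Finset.induction_on with
  | empty => simpa using nab_zero nab x u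
  | insert a s ha ih =>
    simp only [sum_insert ha]
    rw [← ih fun i hi ↦ hX i (by simp [hi])]
    exact nab_add nab (hX a (by simp)) (FieldDiffAt.sum fun i hi ↦ hX i (by simp [hi])) u

lemma nab_torsion {nab : Conn[I,E,M]} (h : nab.torsion = 0)
    {X Y : Vec I M} {x : M} (hX : V¹[I] X x) (hY : V¹[I] Y x) :
    nab Y x (X x) - nab X x (Y x) = mlieBracket I X Y x :=
  nab.torsion_eq_zero_iff.1 h hX hY

/-- The covariant derivative in a direction tangent to the image of `f` only depends on the values
on the image. -/
lemma nab_eq_zero_of_along (nab : Conn[I,E,M]) {f : N → M} {p : N}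
    (hf : MDifferentiableAt J I f p) {X : Vec I M} (hX : V¹[I] X (f p))
    (h0 : ∀ᶠ y in 𝓝 p, X (f y) = 0) (u : T[J] p) :
    nab X (f p) (mfderiv J I f p u) = 0 := by
  have hc := (fieldDiffAt_iff_chart (mem_chart_source H (f p))).1 hX
  let a : Fin (Module.finrank ℝ E) → M → ℝ := fun i x ↦
    (Module.finBasis ℝ E).coord i (∂[I] (extChartAt I (f p)) x (X x))
  have ha : ∀ i, D¹[I] (a i) (f p) := fun i ↦ mdifferentiableAt_coord hc i
  have hb : ∀ i, V¹[I] (coordField I (f p) i) (f p) := fun i ↦ (coordField_smooth_self i).fieldDiffAt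
  have h1 : ∀ᶠ x in 𝓝 (f p), X x = ∑ i, (a i • coordField I (f p) i) x := by
    filter_upwards [(chartAt H (f p)).open_source.mem_nhds (mem_chart_source H (f p))] with x hx
    exact field_chart_expansion hx (X x)
  have ha0 : ∀ i, ∀ᶠ y in 𝓝 p, a i (f y) = 0 := by
    intro i
    filter_upwards [h0] with y hy
    show (Module.finBasis ℝ E).coord i (∂[I] (extChartAt I (f p)) (f y) (X (f y))) = 0
    rw [hy, map_zero, map_zero]
  rw [nab_congr nab (FieldDiffAt.sum fun i _ ↦ (hb i).smul (ha i)) h1, nab_sum nab fun i _ ↦ (hb i).smul (ha i)]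
  refine sum_eq_zero fun i _ ↦ ?_
  rw [nab_smul nab (ha i) (hb i), (ha0 i).self_of_nhds, ← mvfderiv_comp' p (ha i) hf,
    mvfderiv_congr (g := fun _ ↦ (0 : ℝ)) (ha0 i)]
  have : ∂[J] (fun _ : N ↦ (0 : ℝ)) p u = 0 := by
    have := congrArg (fun L : E' →L[ℝ] ℝ ↦ L u) (mfderiv_const (I := J) (I' := 𝓘(ℝ, ℝ)) (x := p) (c := (0 : ℝ)))
    exact this
  rw [this, zero_smul, zero_smul, add_zero]

/-- Two extensions of the same field along `f` have the same covariant derivatives tangent to the image of `f`. -/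
lemma nab_congr_along (nab : Conn[I,E,M]) {f : N → M} {p : N}
    (hf : MDifferentiableAt J I f p) {X Y : Vec I M} (hX : V¹[I] X (f p))
    (hY : V¹[I] Y (f p)) (h0 : ∀ᶠ y in 𝓝 p, X (f y) = Y (f y)) (u : T[J] p) :
    nab X (f p) (mfderiv J I f p u) = nab Y (f p) (mfderiv J I f p u) := by
  rw [← sub_eq_zero, ← nab_sub nab hX hY]
  refine nab_eq_zero_of_along nab hf (hX.sub hY) ?_ u
  filter_upwards [h0] with y hy
  exact sub_eq_zero.2 hy

/-! ### Rules of differentiation and pseudo-Riemannian metrics -/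

section Deriv
variable {f h : M → F} {a b : M → ℝ} {x : M}

lemma dd_add (hf : MDifferentiableAt I 𝓘(ℝ, F) f x) (hh : MDifferentiableAt I 𝓘(ℝ, F) h x) (u : T[I] x) :
    ∂[I] (fun y ↦ f y + h y) x u = ∂[I] f x u + ∂[I] h x u :=
  congrArg (fun L : E →L[ℝ] F ↦ L u) (mvfderiv_add (I := I) hf hh)

lemma dd_sub (hf : MDifferentiableAt I 𝓘(ℝ, F) f x) (hh : MDifferentiableAt I 𝓘(ℝ, F) h x) (u : T[I] x) :
    ∂[I] (fun y ↦ f y - h y) x u = ∂[I] f x u - ∂[I] h x u :=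
  congrArg (fun L : E →L[ℝ] F ↦ L u) (mvfderiv_sub (I := I) hf hh)

lemma dd_neg (u : T[I] x) :
    ∂[I] (fun y ↦ - f y) x u = - ∂[I] f x u :=
  congrArg (fun L : E →L[ℝ] F ↦ L u) (mvfderiv_neg (I := I) (g := f) (x := x))

lemma dd_mul (ha : D¹[I] a x) (hb : D¹[I] b x) (u : T[I] x) :
    ∂[I] (fun y ↦ a y * b y) x u = a x * ∂[I] b x u + ∂[I] a x u * b x := by
  have := congrArg (fun L : E →L[ℝ] ℝ ↦ L u) (mvfderiv_mul (I := I) ha hb)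
  refine this.trans ?_
  show a x * ∂[I] b x u + b x * ∂[I] a x u = _
  ring

lemma dd_const (c : F) (u : T[I] x) : ∂[I] (fun _ : M ↦ c) x u = 0 :=
  congrArg (fun L : E →L[ℝ] F ↦ L u) (mvfderiv_const (I := I) c (x := x))

lemma dd_eventually_const {c : F} (hf : ∀ᶠ y in 𝓝 x, f y = c) (u : T[I] x) : ∂[I] f x u = 0 := by
  rw [mvfderiv_congr (g := fun _ ↦ c) hf]
  exact dd_const c u

lemma dd_const_mul (c : ℝ) (hb : D¹[I] b x) (u : T[I] x) :
    ∂[I] (fun y ↦ c * b y) x u = c * ∂[I] b x u := by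
  rw [dd_mul mdifferentiableAt_const hb, dd_const]
  ring

end Deriv

lemma minSmoothness_le_infty (k : ℕ) : minSmoothness ℝ (k : WithTop ℕ∞) ≤ ∞ := by
  rw [minSmoothness_of_isRCLikeNormedField]
  exact WithTop.coe_le_coe.2 (le_top : (k : ℕ∞) ≤ ⊤)

section Bracket
variable {X Y Z : Vec I M} {x : M} {f : M → ℝ}

lemma br_smul_right (hf : D¹[I] f x) (hY : V¹[I] Y x) :
    mlieBracket I X (f • Y) x = ∂[I] f x (X x) • Y x + f x • mlieBracket I X Y x :=
  have : IsManifold I (minSmoothness ℝ 2) M := IsManifold.of_le (minSmoothness_le_infty 2)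
  mlieBracket_smul_right hf hY

lemma br_smul_left (hf : D¹[I] f x) (hX : V¹[I] X x) :
    mlieBracket I (f • X) Y x = - (∂[I] f x (Y x) • X x) + f x • mlieBracket I X Y x := by
  have : IsManifold I (minSmoothness ℝ 2) M := IsManifold.of_le (minSmoothness_le_infty 2)
  rw [← neg_smul]; exact mlieBracket_smul_left hf hX

lemma br_add_right (hX : V¹[I] Y x) (hY : V¹[I] Z x) :
    mlieBracket I X (Y + Z) x = mlieBracket I X Y x + mlieBracket I X Z x :=
  have : IsManifold I (minSmoothness ℝ 2) M := IsManifold.of_le (minSmoothness_le_infty 2)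
  mlieBracket_add_right hX hY

lemma br_add_left (hX : V¹[I] X x) (hY : V¹[I] Y x) :
    mlieBracket I (X + Y) Z x = mlieBracket I X Z x + mlieBracket I Y Z x :=
  have : IsManifold I (minSmoothness ℝ 2) M := IsManifold.of_le (minSmoothness_le_infty 2)
  mlieBracket_add_left hX hY

lemma br_swap : mlieBracket I X Y x = - mlieBracket I Y X x := mlieBracket_swap_apply

lemma br_smooth (hX : V∞[I] X x) (hY : V∞[I] Y x) : V∞[I] (mlieBracket I X Y) x :=
  have : IsManifold I ((⊤ : ℕ∞) + 1) M := ‹IsManifold I ∞ M›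
  have : IsManifold I (minSmoothness ℝ 2) M := IsManifold.of_le (minSmoothness_le_infty 2)
  ContMDiffAt.mlieBracket_vectorField (n := (⊤ : ℕ∞)) (m := (⊤ : ℕ∞)) hX hY (by simp)

lemma br_congr {X' Y' : Vec I M} (hX : ∀ᶠ y in 𝓝 x, X y = X' y) (hY : ∀ᶠ y in 𝓝 x, Y y = Y' y) :
    mlieBracket I X Y x = mlieBracket I X' Y' x :=
  Filter.EventuallyEq.mlieBracket_vectorField_eq hX hY

lemma br_jacobi (hX : V∞[I] X x) (hY : V∞[I] Y x) (hZ : V∞[I] Z x) :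
    mlieBracket I X (mlieBracket I Y Z) x =
      mlieBracket I (mlieBracket I X Y) Z x + mlieBracket I Y (mlieBracket I X Z) x := by
  have : IsManifold I (minSmoothness ℝ 3) M := IsManifold.of_le (minSmoothness_le_infty 3)
  have h2 := minSmoothness_le_infty 2
  exact leibniz_identity_mlieBracket_apply (ContMDiffAt.of_le hX h2) (ContMDiffAt.of_le hY h2) (ContMDiffAt.of_le hZ h2)

end Bracket

variable (I) in
/-- A smooth pseudo-Riemannian metric whose orthonormal frames have the signs `s`. -/
structure IsPseudoMetric {ι : Type*} [DecidableEq ι] (s : ι → ℝ)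
    (g : Cov₂ I M) : Prop where
  smooth : ∀ x, TensorSmoothAt I g x
  symm : ∀ x u w, g x u w = g x w u
  sign : ∀ i, s i * s i = 1
  frame : ∀ x, ∃ b : Module.Basis ι ℝ (T[I] x), ∀ i j, g x (b i) (b j) = if i = j then s i else 0

section Metric
variable {ι : Type*} [Fintype ι] [DecidableEq ι] {s : ι → ℝ}
  {g : Cov₂ I M}

/-- The Gram–Schmidt process for the vectors with indices in a finite set, by induction on that set. -/
lemma exists_frame_finset (hg : IsPseudoMetric I s g) {x : M} {b : ι → T[I] x}
    (hb : ∀ i j, g x (b i) (b j) = if i = j then s i else 0) (t : Finset ι) :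
    ∃ V : ι → Vec I M, (∀ i ∈ t, V∞[I] (V i) x) ∧ (∀ i ∈ t, V i x = b i) ∧
      ∀ᶠ y in 𝓝 x, ∀ i ∈ t, ∀ j ∈ t, g y (V i y) (V j y) = if i = j then s i else 0 := by
  induction t using Finset.induction_on with
  | empty => exact ⟨fun _ _ ↦ 0, by simp⟩
  | insert a t ha ih =>
    obtain ⟨V, hV, hVx, hVo⟩ := ih
    let X : Vec I M := extend E (b a)
    have hX : V∞[I] X x := fieldSmoothAt_extend_self _
    have hXx : X x = b a := extend_apply_self E (b a)
    -- the component of `X` orthogonal to the fields found so far; it is normalized by `N`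
    let Y : Vec I M := X - fun y ↦ ∑ j ∈ t, ((fun y ↦ s j * g y (X y) (V j y)) • V j) y
    have hgs := hg.smooth x
    have hY : V∞[I] Y x := hX.sub (FieldSmoothAt.sum fun j hj ↦
      FieldSmoothAt.smul (contMDiffAt_const.mul (hgs _ _ hX (hV j hj))) (hV j hj))
    have hYy : ∀ y, Y y = X y - ∑ j ∈ t, (s j * g y (X y) (V j y)) • V j y := fun y ↦ rfl
    have hYx : Y x = b a := by
      rw [hYy, hXx, sum_eq_zero, sub_zero]
      intro j hj
      rw [hVx j hj, hb, if_neg (fun h : a = j ↦ ha (h ▸ hj)), mul_zero, zero_smul]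
    let N : M → ℝ := fun y ↦ s a * g y (Y y) (Y y)
    have hN : C∞[I] N x := contMDiffAt_const.mul (hgs _ _ hY hY)
    have hNx : N x = 1 := by
      show s a * g x (Y x) (Y x) = 1
      rw [hYx, hb, if_pos rfl, hg.sign]
    have hNpos : ∀ᶠ y in 𝓝 x, 0 < N y :=
      hN.continuousAt.eventually (lt_mem_nhds (by rw [hNx]; exact one_pos))
    have hr : C∞[I] (fun y ↦ (Real.sqrt (N y))⁻¹) x := by
      have h1 : ContDiffAt ℝ ∞ (fun r : ℝ ↦ (Real.sqrt r)⁻¹) (N x) := by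
        rw [hNx]
        exact (Real.contDiffAt_sqrt one_ne_zero).inv (by simp)
      exact ContMDiffAt.comp (g := fun r : ℝ ↦ (Real.sqrt r)⁻¹) (f := N) x h1.contMDiffAt hN
    refine ⟨Function.update V a ((fun y ↦ (Real.sqrt (N y))⁻¹) • Y), ?_, ?_, ?_⟩
    · intro i hi
      by_cases h : i = a
      · subst h; rw [Function.update_self]; exact hY.smul hr
      · rw [Function.update_of_ne h]; exact hV i (mem_of_mem_insert_of_ne hi h)
    · intro i hi
      by_cases h : i = a
      · subst h; rw [Function.update_self]
        show (Real.sqrt (N x))⁻¹ • Y x = _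
        rw [hNx, hYx]; simp
      · rw [Function.update_of_ne h]; exact hVx i (mem_of_mem_insert_of_ne hi h)
    · filter_upwards [hVo, hNpos] with y hy hyN
      have hYV : ∀ k ∈ t, g y (Y y) (V k y) = 0 := by
        intro k hk
        rw [hYy, map_sub, _root_.sub_apply, map_sum, _root_.sum_apply]
        rw [sum_eq_single_of_mem k hk]
        · rw [map_smul, _root_.smul_apply, hy k hk k hk, if_pos rfl, smul_eq_mul, mul_right_comm, hg.sign, one_mul,
            sub_self]
        · intro j hj hjk
          rw [map_smul, _root_.smul_apply, hy j hj k hk, if_neg hjk, smul_zero]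
      have haa : g y ((Real.sqrt (N y))⁻¹ • Y y) ((Real.sqrt (N y))⁻¹ • Y y) = s a := by
        simp only [map_smul, _root_.smul_apply, smul_eq_mul]
        have h1 : g y (Y y) (Y y) = s a * N y := by
          show _ = s a * (s a * _)
          rw [← mul_assoc, hg.sign, one_mul]
        have h2 := Real.mul_self_sqrt hyN.le
        have h3 : Real.sqrt (N y) ≠ 0 := (Real.sqrt_pos.2 hyN).ne'
        rw [h1]
        field_simp
        rw [sq, h2]
        ring
      have haV : ∀ k ∈ t, g y ((Real.sqrt (N y))⁻¹ • Y y) (V k y) = 0 := by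
        intro k hk
        rw [map_smul, _root_.smul_apply, hYV k hk, smul_zero]
      intro i hi j hj
      by_cases hia : i = a <;> by_cases hja : j = a
      · rw [hia, hja, if_pos rfl, Function.update_self]; exact haa
      · rw [if_neg (by rw [hia]; exact fun h ↦ hja h.symm), hia, Function.update_self, Function.update_of_ne hja]
        exact haV j (mem_of_mem_insert_of_ne hj hja)
      · rw [if_neg (by rw [hja]; exact hia), hja, Function.update_self, Function.update_of_ne hia, hg.symm]
        exact haV i (mem_of_mem_insert_of_ne hi hia)
      · rw [Function.update_of_ne hja, Function.update_of_ne hia]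
        exact hy i (mem_of_mem_insert_of_ne hi hia) j (mem_of_mem_insert_of_ne hj hja)

/-- Every orthonormal basis of a tangent space extends to a smooth local orthonormal frame
(Gram–Schmidt). -/
lemma exists_orthonormal_frame (hg : IsPseudoMetric I s g) {x : M} {b : ι → T[I] x}
    (hb : ∀ i j, g x (b i) (b j) = if i = j then s i else 0) :
    ∃ V : ι → Vec I M, (∀ i, V∞[I] (V i) x) ∧ (∀ i, V i x = b i) ∧
      ∀ᶠ y in 𝓝 x, ∀ i j, g y (V i y) (V j y) = if i = j then s i else 0 := by
  obtain ⟨V, h1, h2, h3⟩ := exists_frame_finset hg hb Finset.univ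
  exact ⟨V, fun i ↦ h1 i (Finset.mem_univ i), fun i ↦ h2 i (Finset.mem_univ i),
    h3.mono fun y hy i j ↦ hy i (Finset.mem_univ i) j (Finset.mem_univ j)⟩

/-- As the signs `s i` are their own inverses, they appear as factors of the coefficients. -/
lemma orthonormal_expansion (hg : IsPseudoMetric I s g) {x : M} {b : ι → T[I] x}
    (hb : ∀ i j, g x (b i) (b j) = if i = j then s i else 0) (u : T[I] x) :
    u = ∑ i, (s i * g x u (b i)) • b i := by
  have hli : LinearIndependent ℝ b := by
    rw [Fintype.linearIndependent_iff]
    intro c hc i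
    have h1 : g x (∑ j, c j • b j) (b i) = 0 := by rw [hc]; simp
    rw [map_sum, _root_.sum_apply, sum_eq_single i] at h1
    · rw [map_smul, _root_.smul_apply, hb, if_pos rfl, smul_eq_mul] at h1
      have h2 := hg.sign i
      have h3 : s i ≠ 0 := fun h ↦ by rw [h] at h2; simp at h2
      exact (mul_eq_zero.1 h1).resolve_right h3
    · intro j _ hj
      rw [map_smul, _root_.smul_apply, hb, if_neg hj, smul_zero]
    · simp
  obtain ⟨b0, -⟩ := hg.frame x
  have hcard : Fintype.card ι = Module.finrank ℝ (T[I] x) := (Module.finrank_eq_card_basis b0).symm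
  have htop := hli.span_eq_top_of_card_eq_finrank' hcard
  have hu : u ∈ Submodule.span ℝ (range b) := by rw [htop]; trivial
  obtain ⟨c, hc⟩ := (Submodule.mem_span_range_iff_exists_fun ℝ).1 hu
  have hci : ∀ i, s i * g x u (b i) = c i := by
    intro i
    rw [← hc, map_sum, _root_.sum_apply, sum_eq_single i]
    · rw [map_smul, _root_.smul_apply, hb, if_pos rfl, smul_eq_mul, mul_left_comm, hg.sign, mul_one]
    · intro j _ hj
      rw [map_smul, _root_.smul_apply, hb, if_neg hj, smul_zero]
    · simp
  simp_rw [hci]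
  exact hc.symm

lemma IsPseudoMetric.ext (hg : IsPseudoMetric I s g) {x : M} {u w : T[I] x}
    (h : ∀ z, g x u z = g x w z) : u = w := by
  obtain ⟨b, hb⟩ := hg.frame x
  rw [orthonormal_expansion hg hb u, orthonormal_expansion hg hb w]
  simp_rw [h]

/-- A field is smooth as soon as its products with smooth fields are. -/
lemma fieldSmoothAt_of_metric (hg : IsPseudoMetric I s g) {x : M} {X : Vec I M}
    (h : ∀ Z : Vec I M, V∞[I] Z x →
      C∞[I] (fun y ↦ g y (X y) (Z y)) x) : V∞[I] X x := by
  obtain ⟨b, hb⟩ := hg.frame x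
  obtain ⟨V, hV, -, hVo⟩ := exists_orthonormal_frame hg hb
  have h1 : V∞[I] (fun y ↦ ∑ i, ((fun y ↦ s i * g y (X y) (V i y)) • V i) y) x :=
    FieldSmoothAt.sum fun i _ ↦ FieldSmoothAt.smul (contMDiffAt_const.mul (h _ (hV i))) (hV i)
  refine h1.congr ?_
  filter_upwards [hVo] with y hy
  exact orthonormal_expansion hg hy (X y)

/-- The vector dual to a covector. -/
def sharp (hg : IsPseudoMetric I s g) (x : M) (φ : T[I] x → ℝ) : T[I] x :=
  ∑ i, (s i * φ ((hg.frame x).choose i)) • (hg.frame x).choose i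

lemma sharp_spec (hg : IsPseudoMetric I s g) (x : M) (φ : T[I] x →L[ℝ] ℝ) (w : T[I] x) :
    g x (sharp hg x φ) w = φ w := by
  have hb := (hg.frame x).choose_spec
  unfold sharp
  rw [map_sum, _root_.sum_apply]
  conv_rhs => rw [orthonormal_expansion hg hb w, map_sum]
  refine sum_congr rfl fun i _ ↦ ?_
  rw [map_smul, _root_.smul_apply, map_smul, smul_eq_mul, smul_eq_mul, hg.symm x w]
  ring

end Metric

/-! ### The Koszul formula and the Levi-Civita connection -/

section Koszul
variable {g : Cov₂ I M} {x : M}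
  {X Y Z W : Vec I M} {f : M → ℝ}

/-- The right-hand side of the Koszul formula for `2 g(∇_X Y, Z)`. -/
def koszul (g : Cov₂ I M)
    (X Y Z : Vec I M) (x : M) : ℝ :=
  ∂[I] (fun y ↦ g y (Y y) (Z y)) x (X x) + ∂[I] (fun y ↦ g y (X y) (Z y)) x (Y x)
    - ∂[I] (fun y ↦ g y (X y) (Y y)) x (Z x) + g x (mlieBracket I X Y x) (Z x)
    - g x (mlieBracket I X Z x) (Y x) - g x (mlieBracket I Y Z x) (X x)

/-- The Koszul formula; `g` may be degenerate. -/
lemma IsLeviCivita.koszul {nab : Conn[I,E,M]}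
    (h : IsLeviCivita I g nab) (hs : ∀ x u w, g x u w = g x w u) (hX : V¹[I] X x)
    (hY : V¹[I] Y x) (hZ : V¹[I] Z x) :
    2 * g x (nab Y x (X x)) (Z x) = koszul g X Y Z x := by
  unfold ExtremalIH.koszul
  rw [h.metric x Y Z hY hZ, h.metric x X Z hX hZ, h.metric x X Y hX hY, ← nab_torsion h.torsion_free hX hY,
    ← nab_torsion h.torsion_free hX hZ, ← nab_torsion h.torsion_free hY hZ]
  simp only [map_sub, _root_.sub_apply]
  rw [hs x (Y x), hs x (X x) (nab Z x (Y x)), hs x (X x) (nab Y x (Z x))]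
  ring

lemma koszul_add_left (hg : TensorSmoothAt I g x) (hX : V¹[I] X x) (hW : V¹[I] W x)
    (hY : V¹[I] Y x) (hZ : V¹[I] Z x) :
    koszul g (X + W) Y Z x = koszul g X Y Z x + koszul g W Y Z x := by
  unfold koszul
  simp only [Pi.add_apply, map_add, _root_.add_apply]
  rw [dd_add (hg.mdifferentiableAt hX hZ) (hg.mdifferentiableAt hW hZ),
    dd_add (hg.mdifferentiableAt hX hY) (hg.mdifferentiableAt hW hY), br_add_left hX hW, br_add_left hX hW]
  simp only [map_add, _root_.add_apply]
  ring

lemma koszul_add_mid (hg : TensorSmoothAt I g x) (hX : V¹[I] X x) (hW : V¹[I] W x)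
    (hY : V¹[I] Y x) (hZ : V¹[I] Z x) :
    koszul g X (Y + W) Z x = koszul g X Y Z x + koszul g X W Z x := by
  unfold koszul
  simp only [Pi.add_apply, map_add, _root_.add_apply]
  rw [dd_add (hg.mdifferentiableAt hY hZ) (hg.mdifferentiableAt hW hZ),
    dd_add (hg.mdifferentiableAt hX hY) (hg.mdifferentiableAt hX hW), br_add_right hY hW, br_add_left hY hW]
  simp only [map_add, _root_.add_apply]
  ring

lemma koszul_add_right (hg : TensorSmoothAt I g x) (hX : V¹[I] X x) (hW : V¹[I] W x)
    (hY : V¹[I] Y x) (hZ : V¹[I] Z x) :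
    koszul g X Y (Z + W) x = koszul g X Y Z x + koszul g X Y W x := by
  unfold koszul
  simp only [Pi.add_apply, map_add]
  rw [dd_add (hg.mdifferentiableAt hY hZ) (hg.mdifferentiableAt hY hW),
    dd_add (hg.mdifferentiableAt hX hZ) (hg.mdifferentiableAt hX hW), br_add_right hZ hW, br_add_right hZ hW]
  simp only [map_add, _root_.add_apply]
  ring

lemma koszul_smul_left (hg : TensorSmoothAt I g x) (hs : ∀ x u w, g x u w = g x w u)
    (hf : D¹[I] f x) (hX : V¹[I] X x)
    (hY : V¹[I] Y x) (hZ : V¹[I] Z x) :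
    koszul g (f • X) Y Z x = f x * koszul g X Y Z x := by
  unfold koszul
  simp only [Pi.smul_apply', map_smul, _root_.smul_apply, smul_eq_mul]
  rw [dd_mul hf (hg.mdifferentiableAt hX hZ), dd_mul hf (hg.mdifferentiableAt hX hY), br_smul_left hf hX,
    br_smul_left hf hX]
  simp only [map_add, map_neg, map_smul, _root_.add_apply, _root_.neg_apply, _root_.smul_apply, smul_eq_mul]
  rw [hs x (X x) (Z x), hs x (X x) (Y x)]
  ring

lemma koszul_smul_mid (hg : TensorSmoothAt I g x) (hs : ∀ x u w, g x u w = g x w u)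
    (hf : D¹[I] f x) (hX : V¹[I] X x)
    (hY : V¹[I] Y x) (hZ : V¹[I] Z x) :
    koszul g X (f • Y) Z x = f x * koszul g X Y Z x + 2 * (∂[I] f x (X x) * g x (Y x) (Z x)) := by
  unfold koszul
  simp only [Pi.smul_apply', map_smul, _root_.smul_apply, smul_eq_mul]
  rw [dd_mul hf (hg.mdifferentiableAt hY hZ), dd_mul hf (hg.mdifferentiableAt hX hY), br_smul_left hf hY,
    br_smul_right hf hY]
  simp only [map_add, map_neg, map_smul, _root_.add_apply, _root_.neg_apply, _root_.smul_apply, smul_eq_mul]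
  rw [hs x (Y x) (X x)]
  ring

lemma koszul_smul_right (hg : TensorSmoothAt I g x) (hs : ∀ x u w, g x u w = g x w u)
    (hf : D¹[I] f x) (hX : V¹[I] X x)
    (hY : V¹[I] Y x) (hZ : V¹[I] Z x) :
    koszul g X Y (f • Z) x = f x * koszul g X Y Z x := by
  unfold koszul
  simp only [Pi.smul_apply', map_smul, smul_eq_mul]
  rw [dd_mul hf (hg.mdifferentiableAt hY hZ), dd_mul hf (hg.mdifferentiableAt hX hZ), br_smul_right hf hZ,
    br_smul_right hf hZ]
  simp only [map_add, map_smul, _root_.add_apply, _root_.smul_apply, smul_eq_mul]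
  rw [hs x (Z x) (X x), hs x (Z x) (Y x)]
  ring

lemma koszul_swap (hs : ∀ x u w, g x u w = g x w u) :
    koszul g X Y Z x - koszul g Y X Z x = 2 * g x (mlieBracket I X Y x) (Z x) := by
  unfold koszul
  rw [br_swap (X := Y) (Y := X)]
  simp only [hs _ (Y _) (X _), map_neg, _root_.neg_apply]
  ring

lemma koszul_metric (hs : ∀ x u w, g x u w = g x w u) :
    koszul g X Y Z x + koszul g X Z Y x = 2 * ∂[I] (fun y ↦ g y (Y y) (Z y)) x (X x) := by
  unfold koszul
  rw [br_swap (X := Z) (Y := Y)]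
  simp only [hs _ (Z _) (Y _), map_neg, _root_.neg_apply]
  ring

lemma koszul_smooth (hg : ∀ y, TensorSmoothAt I g y) (hX : V∞[I] X x) (hY : V∞[I] Y x)
    (hZ : V∞[I] Z x) : C∞[I] (koszul g X Y Z) x := by
  have h := hg x
  exact (((((hX.contMDiffAt_mvfderiv (h _ _ hY hZ)).add (hY.contMDiffAt_mvfderiv (h _ _ hX hZ))).sub
    (hZ.contMDiffAt_mvfderiv (h _ _ hX hY))).add (h _ _ (br_smooth hX hY) hZ)).sub
    (h _ _ (br_smooth hX hZ) hY)).sub (h _ _ (br_smooth hY hZ) hX)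

end Koszul

variable (I) in
/-- The connection `nab` maps smooth fields to smooth fields. -/
def IsSmoothConn (nab : Conn[I,E,M]) : Prop :=
  ∀ (x : M) (V W : Vec I M), V∞[I] V x → V∞[I] W x →
    V∞[I] (fun y ↦ nab W y (V y)) x

section LeviCivita
variable {ι : Type*} [Fintype ι] [DecidableEq ι] {s : ι → ℝ}
  {g : Cov₂ I M}

lemma IsLeviCivita.isSmoothConn {nab : Conn[I,E,M]}
    (h : IsLeviCivita I g nab) (hg : IsPseudoMetric I s g) : IsSmoothConn I nab := by
  intro x V W hV hW
  refine fieldSmoothAt_of_metric hg fun Z hZ ↦ ?_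
  have h1 : C∞[I] (fun y ↦ (1 / 2) * ExtremalIH.koszul g V W Z y) x :=
    contMDiffAt_const.mul (koszul_smooth hg.smooth hV hW hZ)
  refine h1.congr_of_eventuallyEq ?_
  filter_upwards [hV.eventually_fieldDiffAt, hW.eventually_fieldDiffAt, hZ.eventually_fieldDiffAt] with y h1 h2 h3
  rw [← h.koszul hg.symm h1 h2 h3]
  ring

lemma koszul_tensorial_left (hg : IsPseudoMetric I s g) {x : M} {Y : Vec I M}
    (hY : V¹[I] Y x) (Z : Vec I M) (hZ : V¹[I] Z x) :
    TensorialAt I E (fun X ↦ ExtremalIH.koszul g X Y Z x) x where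
  smul hf hX := koszul_smul_left (hg.smooth x) hg.symm hf hX hY hZ
  add hX hX' := koszul_add_left (hg.smooth x) hX hX' hY hZ

lemma koszul_tensorial_right (hg : IsPseudoMetric I s g) {x : M} {Y : Vec I M}
    (hY : V¹[I] Y x) (X : Vec I M) (hX : V¹[I] X x) :
    TensorialAt I E (fun Z ↦ ExtremalIH.koszul g X Y Z x) x where
  smul hf hZ := koszul_smul_right (hg.smooth x) hg.symm hf hX hY hZ
  add hZ hZ' := koszul_add_right (hg.smooth x) hX hZ' hY hZ

open Classical in
/-- The bilinear form `(u, w) ↦ g(∇_u Y, w)` given by the Koszul formula. -/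
def koszulForm (hg : IsPseudoMetric I s g) (Y : Vec I M) (x : M) :
    T[I] x →L[ℝ] T[I] x →L[ℝ] ℝ :=
  if hY : V¹[I] Y x then
    TensorialAt.mkHom₂ (fun X Z ↦ ExtremalIH.koszul g X Y Z x) x (koszul_tensorial_left hg hY)
      (koszul_tensorial_right hg hY)
  else 0

lemma koszulForm_apply (hg : IsPseudoMetric I s g) {X Y Z : Vec I M} {x : M}
    (hX : V¹[I] X x) (hY : V¹[I] Y x) (hZ : V¹[I] Z x) :
    koszulForm hg Y x (X x) (Z x) = ExtremalIH.koszul g X Y Z x := by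
  unfold koszulForm
  rw [dif_pos hY]
  exact TensorialAt.mkHom₂_apply (koszul_tensorial_left hg hY) (koszul_tensorial_right hg hY) hX hZ

/-- The Levi-Civita covariant derivative, defined by the Koszul formula. -/
def koszulNab (hg : IsPseudoMetric I s g) (Y : Vec I M) (x : M) :
    T[I] x →L[ℝ] T[I] x :=
  show E →L[ℝ] E from ∑ i, ((1 / 2 * s i) • (show E →L[ℝ] E →L[ℝ] ℝ from koszulForm hg Y x).flip
    ((hg.frame x).choose i)).smulRight ((hg.frame x).choose i)

lemma koszulNab_spec (hg : IsPseudoMetric I s g) (Y : Vec I M) (x : M) (u w : T[I] x) :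
    g x (koszulNab hg Y x u) w = 1 / 2 * koszulForm hg Y x u w := by
  have h := sharp_spec hg x (((1 / 2 : ℝ) • koszulForm hg Y x u)) w
  refine Eq.trans (congrArg (fun v ↦ g x v w) ?_) h
  refine (_root_.sum_apply (F := E →L[ℝ] E) Finset.univ (fun i ↦ ((1 / 2 * s i) •
    (show E →L[ℝ] E →L[ℝ] ℝ from koszulForm hg Y x).flip
    ((hg.frame x).choose i)).smulRight ((hg.frame x).choose i : E)) u).trans ?_
  refine sum_congr rfl fun i _ ↦ ?_
  refine congrArg (fun a : ℝ ↦ a • (hg.frame x).choose i) ?_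
  show 1 / 2 * s i * koszulForm hg Y x u ((hg.frame x).choose i) =
    s i * (1 / 2 * koszulForm hg Y x u ((hg.frame x).choose i))
  ring

/-- The defining property of `koszulNab`; fields may be used in place of vectors as the Koszul expression is tensorial. -/
lemma koszulNab_apply (hg : IsPseudoMetric I s g) {X Y Z : Vec I M} {x : M}
    (hX : V¹[I] X x) (hY : V¹[I] Y x) (hZ : V¹[I] Z x) :
    2 * g x (koszulNab hg Y x (X x)) (Z x) = ExtremalIH.koszul g X Y Z x := by
  rw [koszulNab_spec, koszulForm_apply hg hX hY hZ]
  ring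

/-- Existence of the Levi-Civita connection. -/
lemma exists_leviCivita (hg : IsPseudoMetric I s g) :
    ∃ nab : Conn[I,E,M], IsLeviCivita I g nab := by
  have hE : ∀ {x : M} (u : T[I] x), V¹[I] (extend E u) x := fun u ↦ fieldDiffAt_extend_self u
  have hEx : ∀ {x : M} (u : T[I] x), extend E u x = u := fun u ↦ extend_apply_self E u
  let nab : Conn[I,E,M] :=
    { toFun := koszulNab hg
      isCovariantDerivativeOnUniv :=
        { add := by
            intro Y Y' x hY hY' _
            ext1 u
            refine hg.ext fun w ↦ ?_
            have h1 := koszulNab_apply hg (hE u) (FieldDiffAt.add hY hY') (hE w)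
            have h2 := koszulNab_apply hg (hE u) hY (hE w)
            have h3 := koszulNab_apply hg (hE u) hY' (hE w)
            rw [koszul_add_mid (hg.smooth x) (hE u) hY' hY (hE w), ← h2, ← h3] at h1
            simp only [hEx] at h1
            rw [_root_.add_apply, map_add, _root_.add_apply]
            linarith
          leibniz := by
            intro Y f x hY hf _
            ext1 u
            refine hg.ext fun w ↦ ?_
            have h1 := koszulNab_apply hg (hE u) (FieldDiffAt.smul hf hY) (hE w)
            have h2 := koszulNab_apply hg (hE u) hY (hE w)
            rw [koszul_smul_mid (hg.smooth x) hg.symm hf (hE u) hY (hE w), ← h2] at h1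
            simp only [hEx] at h1
            rw [_root_.add_apply, map_add, _root_.add_apply, _root_.smul_apply, map_smul, _root_.smul_apply,
              ContinuousLinearMap.smulRight_apply, map_smul, _root_.smul_apply, smul_eq_mul, smul_eq_mul]
            linarith } }
  have hk : ∀ {X Y Z : Vec I M} {x : M}, V¹[I] X x → V¹[I] Y x →
      V¹[I] Z x → 2 * g x (nab Y x (X x)) (Z x) = ExtremalIH.koszul g X Y Z x :=
    fun hX hY hZ ↦ koszulNab_apply hg hX hY hZ
  refine ⟨nab, ?_, ?_⟩
  · rw [nab.torsion_eq_zero_iff]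
    intro X Y x hX hY
    refine hg.ext fun w ↦ ?_
    have h1 := hk hX hY (hE w)
    have h2 := hk hY hX (hE w)
    have h3 := koszul_swap (X := X) (Y := Y) (Z := extend E w) (x := x) hg.symm
    rw [← h1, ← h2] at h3
    simp only [hEx] at h3
    rw [map_sub, _root_.sub_apply]
    linarith
  · intro x Y Z hY hZ u
    have h1 := hk (hE u) hY hZ
    have h2 := hk (hE u) hZ hY
    have h3 := koszul_metric (X := extend E u) (Y := Y) (Z := Z) (x := x) hg.symm
    rw [← h1, ← h2] at h3
    simp only [hEx] at h3
    rw [hg.symm x (Y x)]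
    linarith

end LeviCivita

/-! ### Curvature and Killing fields -/

section Tensorial

/-- A map on smooth fields which is additive, local and linear over smooth functions only depends
on the value of the field at the point. -/
lemma smooth_tensorial {A : Type*} [AddCommGroup A] [Module ℝ A] {Φ : (Vec I M) → A} {x : M}
    (hadd : ∀ X Y, V∞[I] X x → V∞[I] Y x → Φ (X + Y) = Φ X + Φ Y)
    (hsmul : ∀ (f : M → ℝ) (X), C∞[I] f x → V∞[I] X x → Φ (f • X) = f x • Φ X)
    (hcongr : ∀ X Y, V∞[I] X x → V∞[I] Y x → (∀ᶠ y in 𝓝 x, X y = Y y) → Φ X = Φ Y)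
    {X Y : Vec I M} (hX : V∞[I] X x) (hY : V∞[I] Y x) (h : X x = Y x) :
    Φ X = Φ Y := by
  classical
  have hs : ∀ (a : Fin (Module.finrank ℝ E) → M → ℝ), (∀ i, C∞[I] (a i) x) →
      ∀ t : Finset (Fin (Module.finrank ℝ E)),
      Φ (fun y ↦ ∑ i ∈ t, (a i • coordField I x i) y) = ∑ i ∈ t, a i x • Φ (coordField I x i) := by
    intro a ha t
    induction t using Finset.induction_on with
    | empty =>
      simp only [sum_empty]
      have h0 : V∞[I] (fun y : M ↦ (0 : T[I] y)) x := by
        have := FieldSmoothAt.sum (I := I) (s := (∅ : Finset ℕ)) (X := fun _ _ ↦ 0) (x := x) (by simp)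
        simpa using this
      have := hadd _ _ h0 h0
      have h2 : ((fun y : M ↦ (0 : T[I] y)) + fun y : M ↦ (0 : T[I] y)) = fun y : M ↦ (0 : T[I] y) := by
        ext1 y; exact add_zero _
      rw [h2] at this
      simpa using this
    | insert i t hi ih =>
      simp only [sum_insert hi]
      rw [← ih, ← hsmul _ _ (ha i) (coordField_smooth_self i)]
      exact hadd _ _ ((coordField_smooth_self i).smul (ha i)) (FieldSmoothAt.sum fun j _ ↦ (coordField_smooth_self j).smul (ha j))
  have key : ∀ Z : Vec I M, V∞[I] Z x →
      Φ Z = ∑ i, (Module.finBasis ℝ E).coord i (∂[I] (extChartAt I x) x (Z x)) • Φ (coordField I x i) := by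
    intro Z hZ
    have hc := (fieldSmoothAt_iff_chart (mem_chart_source H x)).1 hZ
    have ha : ∀ i, C∞[I] (fun y ↦ (Module.finBasis ℝ E).coord i (∂[I] (extChartAt I x) y (Z y))) x :=
      fun i ↦ contMDiffAt_coord hc i
    rw [← hs _ ha]
    refine hcongr _ _ hZ (FieldSmoothAt.sum fun j _ ↦ (coordField_smooth_self j).smul (ha j)) ?_
    filter_upwards [(chartAt H x).open_source.mem_nhds (mem_chart_source H x)] with y hy
    exact field_chart_expansion hy (Z y)
  rw [key X hX, key Y hY, h]

/-- The fields `extend u` have constant components in the chart at `x`, so they commute. -/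
lemma extend_bracket {x : M} (u v : T[I] x) {y : M} (hy : y ∈ (chartAt H x).source) :
    mlieBracket I (extend E u) (extend E v) y = 0 := by
  apply mvfderiv_chart_injective hy
  rw [mvfderiv_mlieBracket (contMDiffAt_extChartAt' hy) (fieldSmoothAt_extend u hy).fieldDiffAt
    (fieldSmoothAt_extend v hy).fieldDiffAt, map_zero]
  have h : ∀ w : T[I] x, ∀ᶠ z in 𝓝 y, ∂[I] (extChartAt I x) z (extend E w z) = (show E from w) := by
    intro w
    filter_upwards [(chartAt H x).open_source.mem_nhds hy] with z hz
    exact mvfderiv_chart_extend w hz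
  rw [dd_eventually_const (h u), dd_eventually_const (h v), sub_zero]

end Tensorial

section Curvature
variable {nab : Conn[I,E,M]} {x : M}
  {U V W Z U' V' W' : Vec I M}

/-- The curvature `∇_U ∇_V W - ∇_V ∇_U W - ∇_[U, V] W` of vector fields. -/
def curvField (nab : Conn[I,E,M]) (U V W : Vec I M)
    (x : M) : T[I] x :=
  nab (fun y ↦ nab W y (V y)) x (U x) - nab (fun y ↦ nab W y (U y)) x (V x) - nab W x (mlieBracket I U V x)

lemma nab_dir_add {Y : Vec I M} :
    (fun y ↦ nab Y y ((U + V) y)) = (fun y ↦ nab Y y (U y)) + fun y ↦ nab Y y (V y) := by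
  ext1 y; exact map_add _ _ _

lemma nab_dir_smul {Y : Vec I M} (f : M → ℝ) :
    (fun y ↦ nab Y y ((f • U) y)) = f • (fun y ↦ nab Y y (U y)) := by
  ext1 y; exact map_smul _ _ _

lemma curvField_swap : curvField nab U V W x = - curvField nab V U W x := by
  unfold curvField
  rw [br_swap (X := V) (Y := U), map_neg]
  abel

lemma curvField_add_left (hn : IsSmoothConn I nab) (hU : V∞[I] U x) (hU' : V∞[I] U' x)
    (hW : V∞[I] W x) :
    curvField nab (U + U') V W x = curvField nab U V W x + curvField nab U' V W x := by
  unfold curvField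
  rw [nab_dir_add, nab_add nab (hn x _ _ hU hW).fieldDiffAt (hn x _ _ hU' hW).fieldDiffAt, Pi.add_apply, map_add,
    br_add_left hU.fieldDiffAt hU'.fieldDiffAt, map_add]
  abel

lemma curvField_smul_left (hn : IsSmoothConn I nab) {f : M → ℝ} (hf : C∞[I] f x)
    (hU : V∞[I] U x) (hW : V∞[I] W x) :
    curvField nab (f • U) V W x = f x • curvField nab U V W x := by
  unfold curvField
  have hf' := hf.mdiff
  rw [nab_dir_smul, nab_smul nab hf' (hn x _ _ hU hW).fieldDiffAt, Pi.smul_apply', map_smul,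
    br_smul_left hf' hU.fieldDiffAt, map_add, map_neg, map_smul, map_smul]
  module

lemma nab_congr_eventually {X Y : Vec I M} (hX : V∞[I] X x)
    (h : ∀ᶠ y in 𝓝 x, Y y = X y) : ∀ᶠ y in 𝓝 x, ∀ u, nab Y y u = nab X y u := by
  filter_upwards [hX.eventually_fieldDiffAt, h.eventually_nhds] with y hy hy' u
  exact nab_congr nab hy hy' u

lemma curvField_congr_left (hn : IsSmoothConn I nab) (hU : V∞[I] U x)
    (hW : V∞[I] W x) (h : ∀ᶠ y in 𝓝 x, U' y = U y) :
    curvField nab U' V W x = curvField nab U V W x := by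
  unfold curvField
  rw [h.self_of_nhds, br_congr h (Eventually.of_forall fun _ ↦ rfl),
    nab_congr nab (Y := fun y ↦ nab W y (U' y)) (hn x _ _ hU hW).fieldDiffAt (h.mono fun y hy ↦ by rw [hy])]

lemma curvField_add_right (hn : IsSmoothConn I nab) (hU : V∞[I] U x) (hW' : V∞[I] W' x)
    (hV : V∞[I] V x) (hW : V∞[I] W x) :
    curvField nab U V (W + W') x = curvField nab U V W x + curvField nab U V W' x := by
  unfold curvField
  have h : ∀ {Y}, V∞[I] Y x → ∀ u, nab (fun y ↦ nab (W + W') y (Y y)) x u =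
      nab (fun y ↦ nab W y (Y y)) x u + nab (fun y ↦ nab W' y (Y y)) x u := by
    intro Y hY u
    rw [← nab_add nab (hn x _ _ hY hW).fieldDiffAt (hn x _ _ hY hW').fieldDiffAt]
    refine nab_congr nab ((hn x _ _ hY hW).add (hn x _ _ hY hW')).fieldDiffAt ?_ u
    filter_upwards [hW.eventually_fieldDiffAt, hW'.eventually_fieldDiffAt] with y h1 h2
    exact nab_add nab h1 h2 _
  rw [h hV, h hU, nab_add nab hW.fieldDiffAt hW'.fieldDiffAt]
  abel

lemma curvField_smul_right (hn : IsSmoothConn I nab) {f : M → ℝ} (hf : C∞[I] f x)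
    (hU : V∞[I] U x) (hV : V∞[I] V x) (hW : V∞[I] W x) :
    curvField nab U V (f • W) x = f x • curvField nab U V W x := by
  unfold curvField
  have hf' := hf.mdiff
  have h : ∀ {Y}, V∞[I] Y x → ∀ u, nab (fun y ↦ nab (f • W) y (Y y)) x u =
      f x • nab (fun y ↦ nab W y (Y y)) x u + ∂[I] f x u • nab W x (Y x) +
      (∂[I] f x (Y x) • nab W x u + ∂[I] (fun y ↦ ∂[I] f y (Y y)) x u • W x) := by
    intro Y hY u
    have hg := hY.contMDiffAt_mvfderiv hf
    have hg' := hg.mdiff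
    rw [← nab_smul nab hf' (hn x _ _ hY hW).fieldDiffAt, ← nab_smul nab hg' hW.fieldDiffAt,
      ← nab_add nab ((hn x _ _ hY hW).smul hf).fieldDiffAt (hW.smul hg).fieldDiffAt]
    refine nab_congr nab (((hn x _ _ hY hW).smul hf).add (hW.smul hg)).fieldDiffAt ?_ u
    filter_upwards [hW.eventually_fieldDiffAt, eventually_mdifferentiableAt hf] with y h1 h2
    exact nab_smul nab h2 h1 _
  rw [h hV, h hU, nab_smul nab hf' hW.fieldDiffAt, mvfderiv_mlieBracket hf hU.fieldDiffAt hV.fieldDiffAt]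
  module

lemma curvField_congr_right (hn : IsSmoothConn I nab) (hU : V∞[I] U x) (hV : V∞[I] V x)
    (hW : V∞[I] W x) (h : ∀ᶠ y in 𝓝 x, W' y = W y) :
    curvField nab U V W' x = curvField nab U V W x := by
  unfold curvField
  rw [nab_congr nab (hn x _ _ hV hW).fieldDiffAt ((nab_congr_eventually (nab := nab) hW h).mono fun y hy ↦ hy _),
    nab_congr nab (hn x _ _ hU hW).fieldDiffAt ((nab_congr_eventually (nab := nab) hW h).mono fun y hy ↦ hy _),
    nab_congr nab hW.fieldDiffAt h]

/-- The curvature of smooth fields is tensorial. -/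
lemma curvField_eq (hn : IsSmoothConn I nab) (hU : V∞[I] U x) (hV : V∞[I] V x)
    (hW : V∞[I] W x) (hU' : V∞[I] U' x) (hV' : V∞[I] V' x) (hW' : V∞[I] W' x)
    (h1 : U x = U' x) (h2 : V x = V' x) (h3 : W x = W' x) :
    curvField nab U V W x = curvField nab U' V' W' x := by
  have key : ∀ {U U' V : Vec I M}, V∞[I] U x → V∞[I] U' x → V∞[I] V x →
      U x = U' x → curvField nab U V W x = curvField nab U' V W x := fun {U U' V} hU hU' hV h ↦
    smooth_tensorial (Φ := fun U ↦ curvField nab U V W x) (fun X Y hX hY ↦ curvField_add_left hn hX hY hW)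
      (fun f X hf hX ↦ curvField_smul_left hn hf hX hW)
      (fun X Y hX hY h ↦ curvField_congr_left hn hY hW h) hU hU' h
  have e1 := key hU hU' hV h1
  have e2 : curvField nab U' V W x = curvField nab U' V' W x := by
    rw [curvField_swap, key hV hV' hU' h2, ← curvField_swap]
  have e3 : curvField nab U' V' W x = curvField nab U' V' W' x :=
    smooth_tensorial (Φ := fun W ↦ curvField nab U' V' W x) (fun X Y hX hY ↦ curvField_add_right hn hU' hY hV' hX)
      (fun f X hf hX ↦ curvField_smul_right hn hf hU' hV' hX)
      (fun X Y hX hY h ↦ curvField_congr_right hn hU' hV' hY h) hW hW' h3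
  rw [e1, e2, e3]

lemma curvature_eq_curvField (hn : IsSmoothConn I nab) (hU : V∞[I] U x) (hV : V∞[I] V x)
    (hW : V∞[I] W x) : curvature I nab x (U x) (V x) (W x) = curvField nab U V W x := by
  have hx : ∀ u : T[I] x, extend E u x = u := fun u ↦ extend_apply_self E u
  rw [← curvField_eq hn (fieldSmoothAt_extend_self (U x)) (fieldSmoothAt_extend_self (V x))
    (fieldSmoothAt_extend_self (W x)) hU hV hW (hx _) (hx _) (hx _)]
  unfold curvature curvField
  simp only [hx]

lemma curvature_eq_curvField_extend (u v w : T[I] x) : curvature I nab x u v w =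
    curvField nab (extend E u) (extend E v) (extend E w) x := by
  have hx : ∀ u : T[I] x, extend E u x = u := fun u ↦ extend_apply_self E u
  unfold curvature curvField
  simp only [hx]

lemma curvature_swap (u v w : T[I] x) : curvature I nab x u v w = - curvature I nab x v u w := by
  rw [curvature_eq_curvField_extend, curvField_swap, ← curvature_eq_curvField_extend]

lemma curvature_add_left (hn : IsSmoothConn I nab) (u u' v w : T[I] x) :
    curvature I nab x (u + u') v w = curvature I nab x u v w + curvature I nab x u' v w := by
  have hx : ∀ u : T[I] x, extend E u x = u := fun u ↦ extend_apply_self E u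
  have hs : ∀ u : T[I] x, V∞[I] (extend E u) x := fun u ↦ fieldSmoothAt_extend_self u
  rw [curvature_eq_curvField_extend u, curvature_eq_curvField_extend u', ← curvField_add_left hn (hs u) (hs u') (hs w),
    ← curvature_eq_curvField hn ((hs u).add (hs u')) (hs v) (hs w)]
  simp only [Pi.add_apply, hx]

lemma curvature_smul_left (hn : IsSmoothConn I nab) (c : ℝ) (u v w : T[I] x) :
    curvature I nab x (c • u) v w = c • curvature I nab x u v w := by
  have hx : ∀ u : T[I] x, extend E u x = u := fun u ↦ extend_apply_self E u
  have hs : ∀ u : T[I] x, V∞[I] (extend E u) x := fun u ↦ fieldSmoothAt_extend_self u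
  have hc : C∞[I] (fun _ : M ↦ c) x := contMDiffAt_const
  rw [curvature_eq_curvField_extend u, ← curvField_smul_left hn hc (hs u) (hs w),
    ← curvature_eq_curvField hn ((hs u).smul hc) (hs v) (hs w)]
  simp only [Pi.smul_apply', hx]

/-- The first Bianchi identity. -/
lemma curvature_bianchi (hn : IsSmoothConn I nab) (ht : nab.torsion = 0) (u v w : T[I] x) :
    curvature I nab x u v w + curvature I nab x v w u + curvature I nab x w u v = 0 := by
  have hs : ∀ u : T[I] x, V∞[I] (extend E u) x := fun u ↦ fieldSmoothAt_extend_self u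
  have hc : ∀ u v : T[I] x, ∀ᶠ y in 𝓝 x, nab (extend E u) y (extend E v y) =
      nab (extend E v) y (extend E u y) := by
    intro u v
    filter_upwards [(chartAt H x).open_source.mem_nhds (mem_chart_source H x)] with y hy
    have := nab_torsion ht (fieldSmoothAt_extend u hy).fieldDiffAt (fieldSmoothAt_extend v hy).fieldDiffAt
    rw [extend_bracket u v hy, sub_eq_zero] at this
    exact this.symm
  have hb : ∀ u v : T[I] x, mlieBracket I (extend E u) (extend E v) x = 0 :=
    fun u v ↦ extend_bracket u v (mem_chart_source H x)
  simp only [curvature_eq_curvField_extend]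
  unfold curvField
  simp only [hb, map_zero, sub_zero]
  rw [nab_congr nab (hn x _ _ (hs w) (hs v)).fieldDiffAt (hc w v),
    nab_congr nab (hn x _ _ (hs u) (hs w)).fieldDiffAt (hc u w),
    nab_congr nab (hn x _ _ (hs v) (hs u)).fieldDiffAt (hc v u)]
  abel

variable {g : Cov₂ I M}

/-- The curvature operator of a metric connection is skew. -/
lemma curvField_skew (h : IsLeviCivita I g nab) (hn : IsSmoothConn I nab) (hg : ∀ y, TensorSmoothAt I g y)
    (hU : V∞[I] U x) (hV : V∞[I] V x) (hW : V∞[I] W x) (hZ : V∞[I] Z x) :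
    g x (curvField nab U V W x) (Z x) + g x (W x) (curvField nab U V Z x) = 0 := by
  have hf := hg x W Z hW hZ
  have h1 := mvfderiv_mlieBracket hf hU.fieldDiffAt hV.fieldDiffAt
  have key : ∀ {Y Y' : Vec I M}, V∞[I] Y x →
      ∂[I] (fun y ↦ ∂[I] (fun y ↦ g y (W y) (Z y)) y (Y y)) x (Y' x) =
        (g x (nab (fun y ↦ nab W y (Y y)) x (Y' x)) (Z x) + g x (nab W x (Y x)) (nab Z x (Y' x))) +
        (g x (nab W x (Y' x)) (nab Z x (Y x)) + g x (W x) (nab (fun y ↦ nab Z y (Y y)) x (Y' x))) := by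
    intro Y Y' hY
    have hYW := hn x _ _ hY hW
    have hYZ := hn x _ _ hY hZ
    rw [← h.metric x _ _ hYW.fieldDiffAt hZ.fieldDiffAt, ← h.metric x _ _ hW.fieldDiffAt hYZ.fieldDiffAt,
      ← dd_add ((hg x _ _ hYW hZ).mdiff) ((hg x _ _ hW hYZ).mdiff)]
    rw [mvfderiv_congr]
    filter_upwards [hW.eventually_fieldDiffAt, hZ.eventually_fieldDiffAt] with y h1 h2
    exact h.metric y W Z h1 h2 _
  rw [key hV, key hU, h.metric x W Z hW.fieldDiffAt hZ.fieldDiffAt] at h1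
  unfold curvField
  simp only [map_sub, _root_.sub_apply]
  linarith

lemma curvature_skew (h : IsLeviCivita I g nab) (hn : IsSmoothConn I nab) (hg : ∀ y, TensorSmoothAt I g y)
    (u v w z : T[I] x) :
    g x (curvature I nab x u v w) z + g x w (curvature I nab x u v z) = 0 := by
  have hx : ∀ u : T[I] x, extend E u x = u := fun u ↦ extend_apply_self E u
  have hs : ∀ u : T[I] x, V∞[I] (extend E u) x := fun u ↦ fieldSmoothAt_extend_self u
  have := curvField_skew h hn hg (hs u) (hs v) (hs w) (hs z)
  rw [← curvature_eq_curvField_extend, ← curvature_eq_curvField_extend, hx, hx] at this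
  exact this

/-- The pair symmetry of the curvature tensor. -/
lemma curvature_pair_symm (h : IsLeviCivita I g nab) (hn : IsSmoothConn I nab) (hg : ∀ y, TensorSmoothAt I g y)
    (hs : ∀ x u w, g x u w = g x w u) (u v w z : T[I] x) :
    g x (curvature I nab x u v w) z = g x (curvature I nab x w z u) v := by
  have B : ∀ a b c d, g x (curvature I nab x a b c) d + g x (curvature I nab x b c a) d + g x (curvature I nab x c a b) d = 0 := by
    intro a b c d
    have := congrArg (fun y ↦ g x y d) (curvature_bianchi hn h.torsion_free a b c)
    simpa using this
  have S : ∀ a b c d, g x (curvature I nab x a b c) d = - g x (curvature I nab x a b d) c := by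
    intro a b c d
    have := curvature_skew h hn hg a b c d
    rw [hs x c] at this
    linarith
  have A : ∀ a b c d, g x (curvature I nab x a b c) d = - g x (curvature I nab x b a c) d := by
    intro a b c d
    rw [curvature_swap a b]
    simp
  have b1 := B u v w z
  have b2 := B v w z u
  have b3 := B w z u v
  have b4 := B z u v w
  linarith [S u v w z, S v w u z, S w u v z, S v w z u, S w z v u, S z v w u, S w z u v, S z u w v, S u w z v,
    S z u v w, S u v z w, S v z u w, A u v w z, A v w u z, A w u v z, A w z u v, A z u w v, A u w z v, A z u v w, A v z u w, A u v z w, A z v w u, A v z w u,  A w z v u]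

/-- The Ricci tensor may be computed in any basis. -/
lemma ricci_eq_trace (hn : IsSmoothConn I nab) {ι : Type*} [Fintype ι] [DecidableEq ι]
    (b : Module.Basis ι ℝ (T[I] x)) (v w : T[I] x) :
    ricci I nab x v w = ∑ i, b.coord i (curvature I nab x (b i) v w) := by
  let A : T[I] x →ₗ[ℝ] T[I] x :=
    { toFun := fun u ↦ curvature I nab x u v w
      map_add' := fun u u' ↦ curvature_add_left hn u u' v w
      map_smul' := fun c u ↦ curvature_smul_left hn c u v w }
  have k1 : LinearMap.trace ℝ _ A = ∑ i, (Module.finBasis ℝ (T[I] x)).coord i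
      (A (Module.finBasis ℝ (T[I] x) i)) := by
    rw [LinearMap.trace_eq_matrix_trace ℝ (Module.finBasis ℝ (T[I] x)), Matrix.trace]
    simp [LinearMap.toMatrix_apply]
  have k2 : LinearMap.trace ℝ _ A = ∑ i, b.coord i (A (b i)) := by
    rw [LinearMap.trace_eq_matrix_trace ℝ b, Matrix.trace]
    simp [LinearMap.toMatrix_apply]
  exact k1.symm.trans k2

/-- The flow of a Killing field preserves the Levi-Civita connection (up to the kernel of the
metric, which may be degenerate). -/
lemma lie_nab_of_killing (h : IsLeviCivita I g nab) (hn : IsSmoothConn I nab) (hg : ∀ y, TensorSmoothAt I g y)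
    (hs : ∀ x u w, g x u w = g x w u) {X : Vec I M} (hX : V∞[I] X x)
    (hK : ∀ᶠ y in 𝓝 x, ∀ Y Z : Vec I M, V¹[I] Y y → V¹[I] Z y →
      ∂[I] (fun y ↦ g y (Y y) (Z y)) y (X y) = g y (mlieBracket I X Y y) (Z y) + g y (Y y) (mlieBracket I X Z y))
    {Y Z W : Vec I M} (hY : V∞[I] Y x) (hZ : V∞[I] Z x) (hW : V∞[I] W x) :
    g x (mlieBracket I X (fun y ↦ nab Z y (Y y)) x - nab Z x (mlieBracket I X Y x)
      - nab (fun y ↦ mlieBracket I X Z y) x (Y x)) (W x) = 0 := by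
  let C : (Vec I M) → (Vec I M) → T[I] x := fun Y Z ↦
    mlieBracket I X (fun y ↦ nab Z y (Y y)) x - nab Z x (mlieBracket I X Y x) - nab (fun y ↦ mlieBracket I X Z y) x (Y x)
  have sy : ∀ {Y Z}, V∞[I] Y x → V∞[I] Z x → C Y Z = C Z Y := by
    intro Y Z hY hZ
    -- the Jacobi identity and the absence of torsion
    have e1 : mlieBracket I X (mlieBracket I Y Z) x = mlieBracket I X (fun y ↦ nab Z y (Y y)) x - mlieBracket I X (fun y ↦ nab Y y (Z y)) x := by
      have h1 := hn x _ _ hY hZ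
      have h2 := hn x _ _ hZ hY
      have h3 : mlieBracket I X (mlieBracket I Y Z) x = mlieBracket I X ((fun y ↦ nab Z y (Y y)) + (fun _ : M ↦ (-1 : ℝ)) • fun y ↦ nab Y y (Z y)) x := by
        refine br_congr (Eventually.of_forall fun _ ↦ rfl) ?_
        filter_upwards [hY.eventually_fieldDiffAt, hZ.eventually_fieldDiffAt] with y hy hz
        rw [← nab_torsion h.torsion_free hy hz]
        show _ = nab Z y (Y y) + (-1 : ℝ) • nab Y y (Z y)
        module
      rw [h3, br_add_right h1.fieldDiffAt (h2.smul contMDiffAt_const).fieldDiffAt, br_smul_right mdifferentiableAt_const h2.fieldDiffAt,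
        dd_const]
      module
    have e2 := br_jacobi hX hY hZ
    have e3 := nab_torsion h.torsion_free (br_smooth hX hY).fieldDiffAt hZ.fieldDiffAt
    have e4 := nab_torsion h.torsion_free hY.fieldDiffAt (br_smooth hX hZ).fieldDiffAt
    rw [e1, ← e3, ← e4] at e2
    rw [← sub_eq_zero] at e2 ⊢
    rw [← e2]
    show _ - nab Z x (mlieBracket I X Y x) - nab (mlieBracket I X Z) x (Y x) - (_ - nab Y x (mlieBracket I X Z x) - nab (mlieBracket I X Y) x (Z x)) = _
    abel
  -- the commutator of the derivations along `X` and `Y` on `g(Z, W)`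
  have sk : ∀ {Y Z W}, V∞[I] Y x → V∞[I] Z x → V∞[I] W x →
      g x (C Y Z) (W x) + g x (Z x) (C Y W) = 0 := by
    intro Y Z W hY hZ hW
    have hf := hg x Z W hZ hW
    have h1 := mvfderiv_mlieBracket hf hX.fieldDiffAt hY.fieldDiffAt
    have hYZ := hn x _ _ hY hZ
    have hYW := hn x _ _ hY hW
    have hXZ := br_smooth hX hZ
    have hXW := br_smooth hX hW
    have k1 : ∂[I] (fun y ↦ ∂[I] (fun y ↦ g y (Z y) (W y)) y (Y y)) x (X x) =
        (g x (mlieBracket I X (fun y ↦ nab Z y (Y y)) x) (W x) + g x (nab Z x (Y x)) (mlieBracket I X W x)) +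
        (g x (mlieBracket I X Z x) (nab W x (Y x)) + g x (Z x) (mlieBracket I X (fun y ↦ nab W y (Y y)) x)) := by
      have hK' := hK.self_of_nhds
      rw [← hK' _ _ hYZ.fieldDiffAt hW.fieldDiffAt, ← hK' _ _ hZ.fieldDiffAt hYW.fieldDiffAt,
        ← dd_add ((hg x _ _ hYZ hW).mdiff) ((hg x _ _ hZ hYW).mdiff)]
      rw [mvfderiv_congr]
      filter_upwards [hZ.eventually_fieldDiffAt, hW.eventually_fieldDiffAt] with y h1 h2
      exact h.metric y Z W h1 h2 _
    have k2 : ∂[I] (fun y ↦ ∂[I] (fun y ↦ g y (Z y) (W y)) y (X y)) x (Y x) =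
        (g x (nab (mlieBracket I X Z) x (Y x)) (W x) + g x (mlieBracket I X Z x) (nab W x (Y x))) +
        (g x (nab Z x (Y x)) (mlieBracket I X W x) + g x (Z x) (nab (mlieBracket I X W) x (Y x))) := by
      rw [← h.metric x _ _ hXZ.fieldDiffAt hW.fieldDiffAt, ← h.metric x _ _ hZ.fieldDiffAt hXW.fieldDiffAt,
        ← dd_add ((hg x _ _ hXZ hW).mdiff) ((hg x _ _ hZ hXW).mdiff)]
      rw [mvfderiv_congr]
      filter_upwards [hZ.eventually_fieldDiffAt, hW.eventually_fieldDiffAt, hK] with y h1 h2 h3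
      exact h3 Z W h1 h2
    rw [k1, k2, h.metric x Z W hZ.fieldDiffAt hW.fieldDiffAt] at h1
    simp only [C, map_sub, _root_.sub_apply]
    linarith
  -- a trilinear form skew in the last two arguments and symmetric in the first two vanishes
  have t1 := sk hY hZ hW
  have t2 := sk hZ hW hY
  have t3 := sk hW hY hZ
  rw [hs x (W x)] at t2
  rw [sy hW hY, hs x (Y x)] at t3
  rw [hs x (Z x)] at t1
  rw [sy hZ hY] at t2
  rw [sy hW hZ] at t3
  show g x (C Y Z) (W x) = 0
  linarith

end Curvature

/-! ### Unique continuation for functions with a critical point -/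

section UniqueContinuation

/-- Along a segment from `z₀` the derivative of `f` satisfies a linear differential inequality with initial value `0`,
so it vanishes by the Grönwall lemma. -/
lemma fderiv_eq_zero_near {f : E → ℝ} {z₀ : E} (hf : ContDiffAt ℝ ∞ f z₀) {T : E → E →L[ℝ] E →L[ℝ] E}
    (hT : ContinuousAt T z₀) (h : ∀ᶠ z in 𝓝 z₀, ∀ u v, fderiv ℝ (fderiv ℝ f) z u v = fderiv ℝ f z (T z u v))
    (h0 : fderiv ℝ f z₀ = 0) : ∀ᶠ z in 𝓝 z₀, fderiv ℝ f z = 0 := by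
  have hG : ∀ᶠ z in 𝓝 z₀, DifferentiableAt ℝ (fderiv ℝ f) z := by
    have h1 : ContDiffAt ℝ 1 (fderiv ℝ f) z₀ := (hf.fderiv_right (m := ∞) (by simp)).of_le (by simp)
    filter_upwards [h1.eventually (by simp)] with z hz
    exact hz.differentiableAt (by simp)
  have hB : ∀ᶠ z in 𝓝 z₀, ‖T z‖ < ‖T z₀‖ + 1 := by
    have hTn : ContinuousAt (fun z ↦ ‖T z‖) z₀ := ContinuousAt.comp (g := fun L : E →L[ℝ] E →L[ℝ] E ↦ ‖L‖)
      (continuous_norm (E := E →L[ℝ] E →L[ℝ] E)).continuousAt hT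
    exact hTn.eventually (gt_mem_nhds (lt_add_one _))
  obtain ⟨r, hr, hball⟩ := Metric.eventually_nhds_iff_ball.1 (hG.and (hB.and h))
  filter_upwards [Metric.ball_mem_nhds z₀ hr] with z hz
  set w : E := z - z₀ with hw
  have hseg : ∀ t ∈ Icc (0 : ℝ) 1, z₀ + t • w ∈ Metric.ball z₀ r := by
    intro t ht
    rw [Metric.mem_ball, dist_eq_norm] at hz ⊢
    rw [add_sub_cancel_left, norm_smul, Real.norm_of_nonneg ht.1]
    exact lt_of_le_of_lt (mul_le_of_le_one_left (norm_nonneg _) ht.2) hz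
  have hd : ∀ t ∈ Icc (0 : ℝ) 1, HasDerivAt (fun t : ℝ ↦ fderiv ℝ f (z₀ + t • w))
      (fderiv ℝ (fderiv ℝ f) (z₀ + t • w) w) t := by
    intro t ht
    have h1 : HasDerivAt (fun t : ℝ ↦ z₀ + t • w) w t := by
      simpa using ((hasDerivAt_id t).smul_const w).const_add z₀
    exact (hball _ (hseg t ht)).1.hasFDerivAt.comp_hasDerivAt t h1
  have := eq_zero_of_abs_deriv_le_mul_abs_self_of_eq_zero_right (f := fun t : ℝ ↦ fderiv ℝ f (z₀ + t • w))
    (K := (‖T z₀‖ + 1) * ‖w‖) (a := 0) (b := 1)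
    (fun t ht ↦ (hd t ht).continuousAt.continuousWithinAt)
    (fun t ht ↦ (hd t (Ico_subset_Icc_self ht)).hasDerivWithinAt) (by simpa using h0) (by
      intro t ht
      obtain ⟨-, h2, h3⟩ := hball _ (hseg t (Ico_subset_Icc_self ht))
      refine ContinuousLinearMap.opNorm_le_bound _ (by positivity) fun v ↦ ?_
      rw [h3]
      refine (ContinuousLinearMap.le_opNorm _ _).trans ?_
      have h4 : ‖T (z₀ + t • w) w v‖ ≤ (‖T z₀‖ + 1) * ‖w‖ * ‖v‖ :=
        (ContinuousLinearMap.le_opNorm₂ _ _ _).trans (by gcongr)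
      calc _ ≤ ‖fderiv ℝ f (z₀ + t • w)‖ * ((‖T z₀‖ + 1) * ‖w‖ * ‖v‖) := by gcongr
        _ = _ := by ring) 1 (by simp)
  simpa [hw] using this

/-- A function whose second derivatives are locally linear combinations of its first derivatives is
locally constant near each of its critical points. -/
lemma mvfderiv_eq_zero_near {f : M → ℝ} (hf : ∀ x, C∞[I] f x) {x : M}
    (W : Fin (Module.finrank ℝ E) → Fin (Module.finrank ℝ E) → Vec I M)
    (hW : ∀ i j, V∞[I] (W i j) x)
    (h : ∀ i j, ∀ᶠ y in 𝓝 x, ∂[I] (fun z ↦ ∂[I] f z (coordField I x j z)) y (coordField I x i y) =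
      ∂[I] f y (W i j y))
    (h0 : ∀ u, ∂[I] f x u = 0) : ∀ᶠ y in 𝓝 x, ∀ u, ∂[I] f y u = 0 := by
  have hx := mem_chart_source H x
  set b := Module.finBasis ℝ E with hb
  set z₀ := extChartAt I x x with hz₀
  set f' : E → ℝ := f ∘ (extChartAt I x).symm with hf'
  let cl : Fin (Module.finrank ℝ E) → E →L[ℝ] ℝ := fun i ↦ (b.coord i).toContinuousLinearMap
  let T : E → E →L[ℝ] E →L[ℝ] E := fun z ↦ ∑ i, ∑ j, (cl i).smulRight ((cl j).smulRight (chartRep (W i j) x z))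
  have hTb : ∀ z i j, T z (b i) (b j) = chartRep (W i j) x z := by
    intro z i j
    simp only [T, _root_.sum_apply, ContinuousLinearMap.smulRight_apply, _root_.smul_apply, cl,
      LinearMap.coe_toContinuousLinearMap', Module.Basis.coord_apply, Module.Basis.repr_self]
    rw [sum_eq_single i, sum_eq_single j]
    · simp
    · intro k _ hk; simp [hk.symm]
    · simp
    · intro k _ hk; simp [hk.symm]
    · simp
  have hT : ContinuousAt T z₀ := by
    refine tendsto_finsetSum _ fun i _ ↦ tendsto_finsetSum _ fun j _ ↦ ?_
    have h1 : ContinuousAt (chartRep (W i j) x) z₀ :=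
      (differentiableAt_chart ((fieldDiffAt_iff_chart hx).1 (hW i j).fieldDiffAt)).continuousAt
    have h2 : Continuous fun c : E ↦ (cl i).smulRight ((cl j).smulRight c) :=
      ((ContinuousLinearMap.smulRightL ℝ E (E →L[ℝ] E) (cl i)).continuous).comp
        (ContinuousLinearMap.smulRightL ℝ E E (cl j)).continuous
    exact (h2.continuousAt.comp h1)
  have hmem : ∀ᶠ z in 𝓝 z₀, z ∈ (extChartAt I x).target := extChartAt_target_mem_nhds (I := I) x
  have hG : ∀ᶠ z in 𝓝 z₀, DifferentiableAt ℝ (fderiv ℝ f') z := by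
    have h1 : ContDiffAt ℝ 1 (fderiv ℝ f') z₀ := ((contDiffAt_chart (hf x)).fderiv_right (m := ∞) (by simp)).of_le (by simp)
    filter_upwards [h1.eventually (by simp)] with z hz
    exact hz.differentiableAt (by simp)
  have hsrc : ∀ z ∈ (extChartAt I x).target, (extChartAt I x).symm z ∈ (chartAt H x).source := by
    intro z hz
    have := (extChartAt I x).map_target hz
    rwa [extChartAt_source] at this
  have hfd : ∀ z ∈ (extChartAt I x).target, ∀ u : T[I] ((extChartAt I x).symm z),
      ∂[I] f ((extChartAt I x).symm z) u = fderiv ℝ f' z (∂[I] (extChartAt I x) ((extChartAt I x).symm z) u) := by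
    intro z hz u
    rw [mvfderiv_eq_fderiv_chart (hsrc z hz) ((hf _).mdiff), (extChartAt I x).right_inv hz]
  have key : ∀ᶠ z in 𝓝 z₀, ∀ u v, fderiv ℝ (fderiv ℝ f') z u v = fderiv ℝ f' z (T z u v) := by
    have h1 : ∀ᶠ z in 𝓝 z₀, ∀ i j, ∂[I] (fun z ↦ ∂[I] f z (coordField I x j z)) ((extChartAt I x).symm z) (coordField I x i ((extChartAt I x).symm z)) =
      ∂[I] f ((extChartAt I x).symm z) (W i j ((extChartAt I x).symm z)) := by
      have hc : Tendsto (extChartAt I x).symm (𝓝 z₀) (𝓝 x) := by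
        have := continuousAt_extChartAt_symm (I := I) x
        rwa [ContinuousAt, extChartAt_to_inv] at this
      refine hc.eventually (p := fun y ↦ ∀ i j, ∂[I] (fun z ↦ ∂[I] f z (coordField I x j z)) y
        (coordField I x i y) = ∂[I] f y (W i j y)) ?_
      exact Filter.eventually_all.2 fun i ↦ Filter.eventually_all.2 fun j ↦ h i j
    filter_upwards [h1, hmem.eventually_nhds, hG] with z hz hz' hzG u v
    have hzt := hz'.self_of_nhds
    have hbil : ∀ i j, fderiv ℝ (fderiv ℝ f') z (b i) (b j) = fderiv ℝ f' z (T z (b i) (b j)) := by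
      intro i j
      have h2 := hz i j
      rw [hTb]
      rw [hfd z hzt] at h2
      refine Eq.trans ?_ h2
      have hs := hsrc z hzt
      have h3 : D¹[I] (fun z ↦ ∂[I] f z (coordField I x j z)) ((extChartAt I x).symm z) :=
        ((coordField_smooth hs j).contMDiffAt_mvfderiv (hf _)).mdiff
      rw [mvfderiv_eq_fderiv_chart hs h3, mvfderiv_chart_coordField hs, (extChartAt I x).right_inv hzt]
      have h4 : (fun z ↦ ∂[I] f z (coordField I x j z)) ∘ (extChartAt I x).symm =ᶠ[𝓝 z] fun z ↦ fderiv ℝ f' z (b j) := by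
        filter_upwards [hz'] with y hy
        simp only [Function.comp]
        rw [hfd y hy, mvfderiv_chart_coordField (hsrc y hy)]
      rw [h4.fderiv_eq, fderiv_clm_apply hzG (differentiableAt_const _)]
      simp [hb]
    have hu := b.sum_repr u
    have hv := b.sum_repr v
    rw [← hu, ← hv]
    simp only [map_sum, map_smul, _root_.sum_apply, _root_.smul_apply, hbil]
  have hz0 : fderiv ℝ f' z₀ = 0 := by
    ext u
    have h1 : ∂[I] f x u = fderiv ℝ f' z₀ u :=
      (mvfderiv_eq_fderiv_chart hx ((hf x).mdiff) (u : T[I] x)).trans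
        (congrArg (fderiv ℝ f' z₀) (mvfderiv_chart_self (I := I) (x := x) u))
    exact h1.symm.trans (h0 u)
  have hfin := fderiv_eq_zero_near (contDiffAt_chart (hf x)) hT key hz0
  have h5 := (continuousAt_extChartAt (I := I) x).eventually hfin
  filter_upwards [h5, (chartAt H x).open_source.mem_nhds hx] with y hy hy' u
  rw [mvfderiv_eq_fderiv_chart hy' ((hf y).mdiff), hy]
  rfl

lemma eq_of_mvfderiv_eq_zero [PreconnectedSpace M] {f : M → ℝ} (hf : ∀ x, C∞[I] f x)
    (h : ∀ x u, ∂[I] f x u = 0) (x y : M) : f x = f y := by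
  refine IsLocallyConstant.apply_eq_of_preconnectedSpace ?_ x y
  rw [IsLocallyConstant.iff_eventually_eq]
  intro x
  have hx := mem_chart_source H x
  obtain ⟨r, hr, hball⟩ := Metric.mem_nhds_iff.1 (extChartAt_target_mem_nhds (I := I) x)
  have hsrc : ∀ z ∈ (extChartAt I x).target, (extChartAt I x).symm z ∈ (chartAt H x).source := by
    intro z hz
    have := (extChartAt I x).map_target hz
    rwa [extChartAt_source] at this
  have hd : ∀ z ∈ (extChartAt I x).target, DifferentiableAt ℝ (f ∘ (extChartAt I x).symm) z ∧ fderiv ℝ (f ∘ (extChartAt I x).symm) z = 0 := by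
    intro z hz
    have hs := hsrc z hz
    have h3 : MDifferentiableAt 𝓘(ℝ, E) 𝓘(ℝ, ℝ) (f ∘ (extChartAt I x).symm) z := by
      have := mdifferentiableAt_chart_symm (I := I) hs
      rw [(extChartAt I x).right_inv hz] at this
      exact MDifferentiableAt.comp z ((hf _).mdiff) this
    refine ⟨h3.differentiableAt, ?_⟩
    ext u
    have h4 := (isInvertible_mfderiv_extChartAt (I := I) (x := x) (y := (extChartAt I x).symm z) (by simpa using hs)).surjective u
    obtain ⟨w, hw⟩ := h4
    have h5 := mvfderiv_eq_fderiv_chart hs ((hf _).mdiff) w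
    rw [(extChartAt I x).right_inv hz, h] at h5
    rw [← hw]
    exact h5.symm
  have hc : ∀ z ∈ Metric.ball (extChartAt I x x) r, (f ∘ (extChartAt I x).symm) z = (f ∘ (extChartAt I x).symm) (extChartAt I x x) := by
    intro z hz
    refine (convex_ball _ _).is_const_of_fderivWithin_eq_zero (𝕜 := ℝ) (fun w hw ↦ (hd w (hball hw)).1.differentiableWithinAt) ?_ hz (Metric.mem_ball_self hr)
    intro w hw
    rw [fderivWithin_of_isOpen Metric.isOpen_ball hw]
    exact (hd w (hball hw)).2
  filter_upwards [(chartAt H x).open_source.mem_nhds hx, (continuousAt_extChartAt (I := I) x).eventually (Metric.ball_mem_nhds _ hr)] with y hy hy'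
  have h6 := hc _ hy'
  simp only [Function.comp] at h6
  rwa [extChartAt_to_inv, (extChartAt I x).left_inv (by simpa using hy)] at h6

/-- Unique continuation: on a connected manifold, a function whose second derivatives are locally linear
combinations of its first derivatives and which has a critical point is constant. -/
lemma const_of_critical_point [PreconnectedSpace M] {f : M → ℝ} (hf : ∀ x, C∞[I] f x)
    (hW : ∀ x, ∃ W : Fin (Module.finrank ℝ E) → Fin (Module.finrank ℝ E) → Vec I M,
      (∀ i j, V∞[I] (W i j) x) ∧ ∀ i j, ∀ᶠ y in 𝓝 x,
      ∂[I] (fun z ↦ ∂[I] f z (coordField I x j z)) y (coordField I x i y) = ∂[I] f y (W i j y))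
    {x₀ : M} (h0 : ∀ u, ∂[I] f x₀ u = 0) (x : M) : f x = f x₀ := by
  -- the set of critical points is open by the equation and closed by continuity
  have hopen : IsOpen {x : M | ∀ u, ∂[I] f x u = 0} := by
    rw [isOpen_iff_mem_nhds]
    intro x hx
    obtain ⟨W, h1, h2⟩ := hW x
    exact mvfderiv_eq_zero_near hf W h1 h2 hx
  have hclosed : IsClosed {x : M | ∀ u, ∂[I] f x u = 0} := by
    rw [← isOpen_compl_iff, isOpen_iff_mem_nhds]
    intro x hx
    simp only [mem_compl_iff, mem_ofPred_eq, not_forall] at hx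
    obtain ⟨u, hu⟩ := hx
    have h1 := (fieldSmoothAt_extend_self u).contMDiffAt_mvfderiv (hf x)
    have h2 := h1.continuousAt.eventually_ne (by rwa [extend_apply_self])
    filter_upwards [h2] with y hy
    exact fun h ↦ hy (h _)
  have huniv := IsClopen.eq_univ ⟨hclosed, hopen⟩ ⟨x₀, h0⟩
  exact eq_of_mvfderiv_eq_zero hf (fun y u ↦ (huniv ▸ mem_univ y : y ∈ {x : M | ∀ u, ∂[I] f x u = 0}) u) x x₀

end UniqueContinuation

/-! ### Products with the line and the Hessian -/

lemma dd_clm {F' : Type*} [NormedAddCommGroup F'] [NormedSpace ℝ F'] (A : F →L[ℝ] F') {f : M → F} {x : M}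
    (hf : MDifferentiableAt I 𝓘(ℝ, F) f x) (u : T[I] x) :
    ∂[I] (fun y ↦ A (f y)) x u = A (∂[I] f x u) := by
  have h1 := mfderiv_comp_apply (I := I) (I' := 𝓘(ℝ, F)) (I'' := 𝓘(ℝ, F')) (g := A) (f := f) x A.mdifferentiableAt hf u
  rw [A.mfderiv_eq] at h1
  exact h1

section Product

/-- The vertical unit field on a product with the line. -/
def vert : Vec Cyl[I] (M × ℝ) := fun _ ↦ ((0, 1) : E × ℝ)

/-- The horizontal lift of a vector field to the product with the line. -/
def lift (X : Vec I M) : Vec Cyl[I] (M × ℝ) :=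
  fun p ↦ ((X p.1, 0) : E × ℝ)

lemma dfst_mk (p : M × ℝ) (u : T[I] p.1) (c : ℝ) :
    mfderiv Cyl[I] I Prod.fst p ((u, c) : E × ℝ) = u := by
  have := mfderiv_fst (I := I) (I' := 𝓘(ℝ, ℝ)) (x := p)
  exact congrArg (fun L : E × ℝ →L[ℝ] E ↦ L (u, c)) this

lemma dsnd_mk (p : M × ℝ) (u : T[I] p.1) (c : ℝ) :
    ∂[Cyl[I]] (Prod.snd : M × ℝ → ℝ) p ((u, c) : E × ℝ) = c := by
  have := mfderiv_snd (I := I) (I' := 𝓘(ℝ, ℝ)) (x := p)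
  exact congrArg (fun L : E × ℝ →L[ℝ] ℝ ↦ L (u, c)) this

lemma prod_tangent_ext {p : M × ℝ} {u w : T[Cyl[I]] p}
    (h1 : mfderiv Cyl[I] I Prod.fst p u = mfderiv Cyl[I] I Prod.fst p w)
    (h2 : ∂[Cyl[I]] (Prod.snd : M × ℝ → ℝ) p u = ∂[Cyl[I]] (Prod.snd : M × ℝ → ℝ) p w) :
    u = w := by
  obtain ⟨u1, u2⟩ := u
  obtain ⟨w1, w2⟩ := w
  have e1 : u1 = w1 := ((dfst_mk p u1 u2).symm.trans h1).trans (dfst_mk p w1 w2)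
  have e2 : u2 = w2 := ((dsnd_mk p u1 u2).symm.trans h2).trans (dsnd_mk p w1 w2)
  rw [e1, e2]

lemma dfst_vert (p : M × ℝ) : mfderiv Cyl[I] I Prod.fst p (vert (I := I) p) = 0 := dfst_mk p 0 1
lemma dsnd_vert (p : M × ℝ) : ∂[Cyl[I]] (Prod.snd : M × ℝ → ℝ) p (vert (I := I) p) = 1 := dsnd_mk p 0 1
lemma dfst_lift (X : Vec I M) (p : M × ℝ) : mfderiv Cyl[I] I Prod.fst p (lift X p) = X p.1 :=
  dfst_mk p _ 0
lemma dsnd_lift (X : Vec I M) (p : M × ℝ) : ∂[Cyl[I]] (Prod.snd : M × ℝ → ℝ) p (lift X p) = 0 :=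
  dsnd_mk p (X p.1) 0

lemma prod_decomp (p : M × ℝ) (u : T[Cyl[I]] p) :
    u = lift (extend E (mfderiv Cyl[I] I Prod.fst p u)) p
      + ∂[Cyl[I]] (Prod.snd : M × ℝ → ℝ) p u • vert (I := I) p := by
  apply prod_tangent_ext
  · rw [map_add, map_smul, dfst_vert, smul_zero, add_zero, dfst_lift, extend_apply_self]
  · rw [map_add, map_smul, dsnd_vert, dsnd_lift, zero_add, smul_eq_mul, mul_one]

lemma prod_ker_dfst {p : M × ℝ} {u : T[Cyl[I]] p}
    (h : mfderiv Cyl[I] I Prod.fst p u = 0) :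
    u = ∂[Cyl[I]] (Prod.snd : M × ℝ → ℝ) p u • vert (I := I) p := by
  apply prod_tangent_ext
  · rw [map_smul, dfst_vert, smul_zero, h]
  · rw [map_smul, dsnd_vert, smul_eq_mul, mul_one]

lemma contMDiffAt_fst' (p : M × ℝ) : ContMDiffAt Cyl[I] I ∞ (Prod.fst : M × ℝ → M) p := contMDiffAt_fst
lemma contMDiffAt_snd' (p : M × ℝ) : C∞[Cyl[I]] (Prod.snd : M × ℝ → ℝ) p := contMDiffAt_snd
lemma mdiff_fst (p : M × ℝ) : MDifferentiableAt Cyl[I] I (Prod.fst : M × ℝ → M) p := mdifferentiableAt_fst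
lemma mdiff_snd (p : M × ℝ) : D¹[Cyl[I]] (Prod.snd : M × ℝ → ℝ) p := mdifferentiableAt_snd

/-- In a product chart the components of a tangent vector are those of its two projections. -/
lemma mvfderiv_prod_chart {p q : M × ℝ} (hq : q.1 ∈ (chartAt H p.1).source) (u : T[Cyl[I]] q) :
    ∂[Cyl[I]] (extChartAt Cyl[I] p) q u =
      (∂[I] (extChartAt I p.1) q.1 (mfderiv Cyl[I] I Prod.fst q u),
        ∂[Cyl[I]] (Prod.snd : M × ℝ → ℝ) q u) := by
  have h1 : MDifferentiableAt Cyl[I] 𝓘(ℝ, E) (fun q : M × ℝ ↦ extChartAt I p.1 q.1) q :=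
    MDifferentiableAt.comp q (mdifferentiableAt_chart hq) (mdiff_fst q)
  have h2 := mdiff_snd (I := I) q
  rw [← mvfderiv_comp' q (mdifferentiableAt_chart hq) (mdiff_fst q)]
  have h3 : (extChartAt Cyl[I] p : M × ℝ → E × ℝ) = fun q ↦ (extChartAt I p.1 q.1, q.2) := by
    ext1 q
    rw [extChartAt_prod]
    rfl
  have h4 : ∂[Cyl[I]] (fun q : M × ℝ ↦ ((extChartAt I p.1 q.1, q.2) : E × ℝ)) q u =
      (∂[Cyl[I]] (fun q : M × ℝ ↦ extChartAt I p.1 q.1) q u,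
        ∂[Cyl[I]] (Prod.snd : M × ℝ → ℝ) q u) := by
    have h5 : MDifferentiableAt Cyl[I] 𝓘(ℝ, E × ℝ) (fun q : M × ℝ ↦ ((extChartAt I p.1 q.1, q.2) : E × ℝ)) q :=
      h1.prodMk_space h2
    apply Prod.ext
    · exact (dd_clm (ContinuousLinearMap.fst ℝ E ℝ) h5 u).symm
    · exact (dd_clm (ContinuousLinearMap.snd ℝ E ℝ) h5 u).symm
  rw [← h4, h3]

lemma fieldSmoothAt_prod_iff {Z : Vec Cyl[I] (M × ℝ)} {p : M × ℝ} :
    FieldSmoothAt Cyl[I] Z p ↔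
      AlongSmoothAt (J := Cyl[I]) (I := I) Prod.fst (fun q ↦ mfderiv Cyl[I] I Prod.fst q (Z q)) p ∧
      C∞[Cyl[I]] (fun q ↦ ∂[Cyl[I]] (Prod.snd : M × ℝ → ℝ) q (Z q)) p := by
  constructor
  · exact fun h ↦ ⟨h.along_mfderiv (contMDiffAt_fst' p), h.contMDiffAt_mvfderiv (contMDiffAt_snd' p)⟩
  · rintro ⟨h1, h2⟩
    rw [fieldSmoothAt_iff_chart (mem_chart_source _ p)]
    refine (h1.prodMk_space h2).congr_of_eventuallyEq ?_
    filter_upwards [(contMDiffAt_fst' (I := I) p).continuousAt.eventually ((chartAt H p.1).open_source.mem_nhds (mem_chart_source H _))]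
      with q hq
    exact mvfderiv_prod_chart hq _

lemma fieldDiffAt_prod_iff {Z : Vec Cyl[I] (M × ℝ)} {p : M × ℝ} :
    FieldDiffAt Cyl[I] Z p ↔
      AlongDiffAt (J := Cyl[I]) (I := I) Prod.fst (fun q ↦ mfderiv Cyl[I] I Prod.fst q (Z q)) p ∧
      D¹[Cyl[I]] (fun q ↦ ∂[Cyl[I]] (Prod.snd : M × ℝ → ℝ) q (Z q)) p := by
  constructor
  · exact fun h ↦ ⟨h.along_mfderiv (contMDiffAt_fst' p), h.mdifferentiableAt_mvfderiv (contMDiffAt_snd' p)⟩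
  · rintro ⟨h1, h2⟩
    rw [fieldDiffAt_iff_chart (mem_chart_source _ p)]
    refine (h1.prodMk_space h2).congr_of_eventuallyEq ?_
    filter_upwards [(contMDiffAt_fst' (I := I) p).continuousAt.eventually ((chartAt H p.1).open_source.mem_nhds (mem_chart_source H _))]
      with q hq
    exact mvfderiv_prod_chart hq _

lemma vert_smooth (p : M × ℝ) : FieldSmoothAt Cyl[I] (vert (I := I)) p := by
  rw [fieldSmoothAt_prod_iff]
  constructor
  · have h0 : ContMDiffAt Cyl[I] 𝓘(ℝ, E) ∞ (fun _ : M × ℝ ↦ (0 : E)) p := contMDiffAt_const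
    refine h0.congr_of_eventuallyEq (Eventually.of_forall fun q ↦ ?_)
    exact (congrArg (∂[I] (extChartAt I p.1) q.1) (dfst_vert q)).trans (map_zero _)
  · have h0 : C∞[Cyl[I]] (fun _ : M × ℝ ↦ (1 : ℝ)) p := contMDiffAt_const
    exact h0.congr_of_eventuallyEq (Eventually.of_forall fun q ↦ dsnd_vert q)

lemma lift_smooth {X : Vec I M} {p : M × ℝ} (hX : V∞[I] X p.1) :
    FieldSmoothAt Cyl[I] (lift X) p := by
  rw [fieldSmoothAt_prod_iff]
  constructor
  · refine (hX.along (contMDiffAt_fst' p)).congr_of_eventuallyEq (Eventually.of_forall fun q ↦ ?_)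
    exact congrArg (∂[I] (extChartAt I p.1) q.1) (dfst_lift X q)
  · have h0 : C∞[Cyl[I]] (fun _ : M × ℝ ↦ (0 : ℝ)) p := contMDiffAt_const
    exact h0.congr_of_eventuallyEq (Eventually.of_forall fun q ↦ dsnd_lift X q)

lemma lift_diff {X : Vec I M} {p : M × ℝ} (hX : V¹[I] X p.1) :
    FieldDiffAt Cyl[I] (lift X) p := by
  rw [fieldDiffAt_prod_iff]
  constructor
  · refine (hX.along (mdiff_fst p)).congr_of_eventuallyEq (Eventually.of_forall fun q ↦ ?_)
    exact congrArg (∂[I] (extChartAt I p.1) q.1) (dfst_lift X q)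
  · have h0 : D¹[Cyl[I]] (fun _ : M × ℝ ↦ (0 : ℝ)) p := mdifferentiableAt_const
    exact h0.congr_of_eventuallyEq (Eventually.of_forall fun q ↦ dsnd_lift X q)

lemma zero_smooth (x : M) : V∞[I] (fun y : M ↦ (0 : T[I] y)) x := by
  have := FieldSmoothAt.sum (I := I) (s := (∅ : Finset ℕ)) (X := fun _ _ ↦ 0) (x := x) (by simp)
  simpa using this

/-- The bracket of projectable fields projects to the bracket. -/
lemma dfst_bracket {Y Z : Vec Cyl[I] (M × ℝ)} {p : M × ℝ} {Y' Z' : Vec I M}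
    (hY : FieldDiffAt Cyl[I] Y p) (hZ : FieldDiffAt Cyl[I] Z p) (hY' : V¹[I] Y' p.1)
    (hZ' : V¹[I] Z' p.1) (hYY : ∀ᶠ q in 𝓝 p, mfderiv Cyl[I] I Prod.fst q (Y q) = Y' q.1)
    (hZZ : ∀ᶠ q in 𝓝 p, mfderiv Cyl[I] I Prod.fst q (Z q) = Z' q.1) :
    mfderiv Cyl[I] I Prod.fst p (mlieBracket Cyl[I] Y Z p) = mlieBracket I Y' Z' p.1 :=
  mfderiv_mlieBracket_of_related (contMDiffAt_fst' p) hY hZ hY' hZ' (hYY.mono fun _ h ↦ h.symm) (hZZ.mono fun _ h ↦ h.symm)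

lemma dfst_bracket_vert {Z : Vec Cyl[I] (M × ℝ)} {p : M × ℝ} {Z' : Vec I M}
    (hZ : FieldDiffAt Cyl[I] Z p) (hZ' : V¹[I] Z' p.1)
    (hZZ : ∀ᶠ q in 𝓝 p, mfderiv Cyl[I] I Prod.fst q (Z q) = Z' q.1) :
    mfderiv Cyl[I] I Prod.fst p (mlieBracket Cyl[I] vert Z p) = 0 := by
  rw [dfst_bracket (vert_smooth p).fieldDiffAt hZ (zero_smooth p.1).fieldDiffAt hZ' (Eventually.of_forall dfst_vert) hZZ]
  have := mlieBracket_zero_left (I := I) (W := Z')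
  exact congrFun this p.1

lemma dsnd_bracket {Y Z : Vec Cyl[I] (M × ℝ)} {p : M × ℝ} {a b : ℝ}
    (hY : FieldDiffAt Cyl[I] Y p) (hZ : FieldDiffAt Cyl[I] Z p)
    (hYY : ∀ᶠ q in 𝓝 p, ∂[Cyl[I]] (Prod.snd : M × ℝ → ℝ) q (Y q) = a)
    (hZZ : ∀ᶠ q in 𝓝 p, ∂[Cyl[I]] (Prod.snd : M × ℝ → ℝ) q (Z q) = b) :
    ∂[Cyl[I]] (Prod.snd : M × ℝ → ℝ) p (mlieBracket Cyl[I] Y Z p) = 0 := by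
  rw [mvfderiv_mlieBracket (contMDiffAt_snd' p) hY hZ, dd_eventually_const hYY, dd_eventually_const hZZ, sub_zero]

lemma bracket_vert_lift {X : Vec I M} {p : M × ℝ} (hX : V¹[I] X p.1) :
    mlieBracket Cyl[I] vert (lift X) p = 0 := by
  apply prod_tangent_ext
  · rw [dfst_bracket_vert (lift_diff hX) hX (Eventually.of_forall (dfst_lift X)), map_zero]
  · rw [dsnd_bracket (vert_smooth p).fieldDiffAt (lift_diff hX) (Eventually.of_forall dsnd_vert)
      (Eventually.of_forall (dsnd_lift X)), map_zero]

lemma bracket_lift_lift {X Y : Vec I M} {p : M × ℝ} (hX : V¹[I] X p.1) (hY : V¹[I] Y p.1) :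
    mlieBracket Cyl[I] (lift X) (lift Y) p = lift (mlieBracket I X Y) p := by
  apply prod_tangent_ext
  · rw [dfst_bracket (lift_diff hX) (lift_diff hY) hX hY (Eventually.of_forall (dfst_lift X))
      (Eventually.of_forall (dfst_lift Y)), dfst_lift]
  · rw [dsnd_bracket (lift_diff hX) (lift_diff hY) (Eventually.of_forall (dsnd_lift X))
      (Eventually.of_forall (dsnd_lift Y)), dsnd_lift]

lemma contMDiff_slice (c : ℝ) : ContMDiff I Cyl[I] ∞ (fun x : M ↦ (x, c)) :=
  contMDiff_id.prodMk contMDiff_const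

lemma mfderiv_slice (c : ℝ) (x : M) (u : T[I] x) :
    mfderiv I Cyl[I] (fun x : M ↦ (x, c)) x u = ((u, 0) : E × ℝ) := by
  have := mfderiv_prod_left (I := I) (I' := 𝓘(ℝ, ℝ)) (x₀ := x) (y₀ := c)
  exact congrArg (fun L : E →L[ℝ] E × ℝ ↦ L u) this

lemma hasDerivAt_vertical {f : M × ℝ → F} {p : M × ℝ} (hf : MDifferentiableAt Cyl[I] 𝓘(ℝ, F) f p) :
    HasDerivAt (fun t : ℝ ↦ f (p.1, t)) (∂[Cyl[I]] f p (vert p)) p.2 := by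
  have h1 : MDifferentiableAt 𝓘(ℝ, ℝ) Cyl[I] (fun t : ℝ ↦ (p.1, t)) p.2 :=
    mdifferentiableAt_const.prodMk mdifferentiableAt_id
  have h2 : MDifferentiableAt 𝓘(ℝ, ℝ) 𝓘(ℝ, F) (fun t : ℝ ↦ f (p.1, t)) p.2 := MDifferentiableAt.comp p.2 hf h1
  have h3 := mfderiv_comp_apply p.2 hf h1 (1 : ℝ)
  have h4 : mfderiv 𝓘(ℝ, ℝ) Cyl[I] (fun t : ℝ ↦ (p.1, t)) p.2 (1 : ℝ) = vert (I := I) p :=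
    congrArg (fun L : ℝ →L[ℝ] E × ℝ ↦ L 1) (mfderiv_prod_right (I := I) (I' := 𝓘(ℝ, ℝ)) (x₀ := p.1) (y₀ := p.2))
  rw [mfderiv_eq_fderiv] at h3
  have h5 : deriv (fun t : ℝ ↦ f (p.1, t)) p.2 = ∂[Cyl[I]] f p (vert p) :=
    h3.trans (congrArg (∂[Cyl[I]] f p) h4)
  rw [← h5]
  exact h2.differentiableAt.hasDerivAt

/-- A function with constant vertical derivative is affine along the fibres. -/
lemma eq_of_vertical_deriv {f : M × ℝ → ℝ} {x : M} (hf : ∀ t, D¹[Cyl[I]] f (x, t)) {c : ℝ}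
    (h : ∀ t, ∂[Cyl[I]] f (x, t) (vert (x, t)) = c) (t : ℝ) : f (x, t) = f (x, 0) + c * t := by
  have h1 : ∀ t : ℝ, HasDerivAt (fun t : ℝ ↦ f (x, t) - c * t) 0 t := by
    intro t
    have := (hasDerivAt_vertical (hf t)).sub ((hasDerivAt_id t).const_mul c)
    rw [h] at this
    exact this.congr_deriv (by simp)
  have h2 := is_const_of_deriv_eq_zero (fun t ↦ (h1 t).differentiableAt) (fun t ↦ (h1 t).deriv) t 0
  simp only [mul_zero, sub_zero] at h2
  linarith

end Product

/-- The Koszul expression is natural under pulling back the tensor. -/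
lemma koszul_pullback {f : N → M} {y : N} (hf : ContMDiffAt J I ∞ f y)
    {gM : Cov₂ I M}
    {gN : Cov₂ J N} (hgM : TensorSmoothAt I gM (f y))
    (hg : ∀ᶠ z in 𝓝 y, ∀ u w, gN z u w = gM (f z) (mfderiv J I f z u) (mfderiv J I f z w))
    {X Y Z : Vec J N} {X' Y' Z' : Vec I M}
    (hX : FieldDiffAt J X y) (hY : FieldDiffAt J Y y) (hZ : FieldDiffAt J Z y)
    (hX' : V¹[I] X' (f y)) (hY' : V¹[I] Y' (f y)) (hZ' : V¹[I] Z' (f y))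
    (hXX : ∀ᶠ z in 𝓝 y, mfderiv J I f z (X z) = X' (f z)) (hYY : ∀ᶠ z in 𝓝 y, mfderiv J I f z (Y z) = Y' (f z))
    (hZZ : ∀ᶠ z in 𝓝 y, mfderiv J I f z (Z z) = Z' (f z)) :
    koszul gN X Y Z y = koszul gM X' Y' Z' (f y) := by
  have hfd := hf.mdifferentiableAt (by simp : (∞ : WithTop ℕ∞) ≠ 0)
  have key : ∀ {X Y Z : Vec J N} {X' Y' Z' : Vec I M},
      V¹[I] Y' (f y) → V¹[I] Z' (f y) →
      (∀ᶠ z in 𝓝 y, mfderiv J I f z (X z) = X' (f z)) → (∀ᶠ z in 𝓝 y, mfderiv J I f z (Y z) = Y' (f z)) →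
      (∀ᶠ z in 𝓝 y, mfderiv J I f z (Z z) = Z' (f z)) →
      ∂[J] (fun z ↦ gN z (Y z) (Z z)) y (X y) = ∂[I] (fun z ↦ gM z (Y' z) (Z' z)) (f y) (X' (f y)) := by
    intro X Y Z X' Y' Z' hY' hZ' hXX hYY hZZ
    rw [← hXX.self_of_nhds, ← mvfderiv_comp' y (hgM.mdifferentiableAt hY' hZ') hfd, mvfderiv_congr]
    filter_upwards [hg, hYY, hZZ] with z h1 h2 h3
    rw [h1, h2, h3]
  have kb : ∀ {X Y : Vec J N} {X' Y' : Vec I M},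
      FieldDiffAt J X y → FieldDiffAt J Y y → V¹[I] X' (f y) → V¹[I] Y' (f y) →
      (∀ᶠ z in 𝓝 y, mfderiv J I f z (X z) = X' (f z)) → (∀ᶠ z in 𝓝 y, mfderiv J I f z (Y z) = Y' (f z)) →
      mfderiv J I f y (mlieBracket J X Y y) = mlieBracket I X' Y' (f y) := by
    intro X Y X' Y' hX hY hX' hY' hXX hYY
    exact mfderiv_mlieBracket_of_related hf hX hY hX' hY' (hXX.mono fun _ h ↦ h.symm) (hYY.mono fun _ h ↦ h.symm)
  have hg0 := hg.self_of_nhds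
  unfold koszul
  rw [key hY' hZ' hXX hYY hZZ, key hX' hZ' hYY hXX hZZ, key hX' hY' hZZ hXX hYY, hg0, hg0, hg0, kb hX hY hX' hY' hXX hYY,
    kb hX hZ hX' hZ' hXX hZZ, kb hY hZ hY' hZ' hYY hZZ, hXX.self_of_nhds, hYY.self_of_nhds, hZZ.self_of_nhds]

section Hessian
variable {nab : Conn[I,E,M]} {f : M → ℝ} {x : M}

/-- The Hessian `(∇_u df)(w)` of a function. -/
def hess (nab : Conn[I,E,M]) (f : M → ℝ) (x : M) (u w : T[I] x) : ℝ :=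
  covDerivForm I nab (fun y z ↦ ∂[I] f y z) x u w

lemma covDerivForm_eq {α : Cov I M} (hα : FormSmoothAt I α x)
    {W : Vec I M} (hW : V¹[I] W x) (u : T[I] x) :
    covDerivForm I nab (fun y z ↦ α y z) x u (W x) = ∂[I] (fun y ↦ α y (W y)) x u - α x (nab W x u) := by
  have ht : TensorialAt I E (fun W : Π y : M, T[I] y ↦ ∂[I] (fun y ↦ α y (W y)) x u - α x (nab W x u)) x :=
    { smul := by
        intro f X hf hX
        rw [nab_smul nab hf hX]
        simp only [Pi.smul_apply', map_smul, map_add, smul_eq_mul]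
        rw [dd_mul hf (hα.mdifferentiableAt hX)]
        ring
      add := by
        intro X Y hX hY
        rw [nab_add nab hX hY]
        simp only [Pi.add_apply, map_add]
        rw [dd_add (hα.mdifferentiableAt hX) (hα.mdifferentiableAt hY)]
        ring }
  exact ht.pointwise (fieldDiffAt_extend_self (W x)) hW (extend_apply_self E _)

lemma formSmoothAt_mvfderiv (hf : C∞[I] f x) : FormSmoothAt I (fun y ↦ ∂[I] f y) x :=
  fun _ hX ↦ hX.contMDiffAt_mvfderiv hf

lemma hess_eq (hf : C∞[I] f x) {W : Vec I M} (hW : V¹[I] W x)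
    (u : T[I] x) :
    hess nab f x u (W x) = ∂[I] (fun y ↦ ∂[I] f y (W y)) x u - ∂[I] f x (nab W x u) :=
  covDerivForm_eq (α := fun y ↦ ∂[I] f y) (formSmoothAt_mvfderiv hf) hW u

lemma hess_symm (ht : nab.torsion = 0) (hf : C∞[I] f x) (u w : T[I] x) :
    hess nab f x u w = hess nab f x w u := by
  have hx : ∀ u : T[I] x, extend E u x = u := fun u ↦ extend_apply_self E u
  have hs : ∀ u : T[I] x, V¹[I] (extend E u) x := fun u ↦ fieldDiffAt_extend_self u
  have h1 := hess_eq (nab := nab) hf (hs w) u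
  have h2 := hess_eq (nab := nab) hf (hs u) w
  have h3 := mvfderiv_mlieBracket hf (hs u) (hs w)
  rw [← nab_torsion ht (hs u) (hs w)] at h3
  simp only [hx, map_sub] at h1 h2 h3
  rw [h1, h2]
  linarith

lemma hess_add_left (u u' w : T[I] x) : hess nab f x (u + u') w = hess nab f x u w + hess nab f x u' w := by
  simp only [hess, covDerivForm, map_add]; ring

lemma hess_smul_left (c : ℝ) (u w : T[I] x) : hess nab f x (c • u) w = c * hess nab f x u w := by
  simp only [hess, covDerivForm, map_smul, smul_eq_mul]; ring

end Hessian

/-! ### Push-forward of vector fields -/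

/-- The image of a vector field under a diffeomorphism. -/
def pushField (φ : Diffeomorph I I M M ∞) (X : Vec I M) : Vec I M :=
  fun y ↦ show E from mfderiv I I φ (φ.symm y) (X (φ.symm y))

lemma pushField_apply (φ : Diffeomorph I I M M ∞) (X : Vec I M) (x : M) :
    pushField φ X (φ x) = mfderiv I I φ x (X x) :=
  congrArg (fun z : M ↦ (show E from mfderiv I I φ z (X z))) (φ.symm_apply_apply x)

lemma pushField_smooth (φ : Diffeomorph I I M M ∞) {X : Vec I M} {x : M} (hX : V∞[I] X x) :
    V∞[I] (pushField φ X) (φ x) := by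
  have h1 := hX.along_mfderiv (φ.contMDiff.contMDiffAt (x := x))
  rw [fieldSmoothAt_iff_chart (mem_chart_source H (φ x))]
  have h2 : ContMDiffAt I 𝓘(ℝ, E) ∞ (fun y ↦ ∂[I] (extChartAt I (φ x)) (φ y) (mfderiv I I φ y (X y))) (φ.symm (φ x)) := by
    rw [φ.symm_apply_apply]; exact h1
  refine (ContMDiffAt.comp (φ x) h2 (φ.symm.contMDiff.contMDiffAt (x := φ x))).congr_of_eventuallyEq (Eventually.of_forall fun y ↦ ?_)
  exact congrArg (fun z : M ↦ ∂[I] (extChartAt I (φ x)) z (show E from mfderiv I I φ (φ.symm y) (X (φ.symm y)))) (φ.apply_symm_apply y).symm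

/-! ### Contractions and Lorentzian null frames -/

section Contraction
variable {ι : Type*} [Fintype ι] [DecidableEq ι] {s : ι → ℝ}
  {g : Cov₂ I M} {x : M}

lemma IsPseudoMetric.sign_ne_zero (hg : IsPseudoMetric I s g) (i : ι) : s i ≠ 0 := fun h ↦ by
  have := hg.sign i
  rw [h, zero_mul] at this
  exact zero_ne_one this

lemma linearIndependent_of_orthonormal (hs : ∀ i, s i ≠ 0) {b : ι → T[I] x}
    (hb : ∀ i j, g x (b i) (b j) = if i = j then s i else 0) : LinearIndependent ℝ b := by
  rw [Fintype.linearIndependent_iff]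
  intro c hc i
  have h1 : g x (∑ j, c j • b j) (b i) = 0 := by rw [hc, map_zero]; rfl
  rw [map_sum, _root_.sum_apply] at h1
  simp only [map_smul, _root_.smul_apply, hb, smul_eq_mul, mul_ite, mul_zero, sum_ite_eq', Finset.mem_univ, if_true] at h1
  exact (mul_eq_zero.1 h1).resolve_right (hs i)

/-- An orthonormal family as a basis. -/
def orthonormalBasis (hg : IsPseudoMetric I s g) {b : ι → T[I] x}
    (hb : ∀ i j, g x (b i) (b j) = if i = j then s i else 0) : Module.Basis ι ℝ (T[I] x) :=
  Module.Basis.mk (linearIndependent_of_orthonormal hg.sign_ne_zero hb) fun u _ ↦ by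
    rw [orthonormal_expansion hg hb u]
    exact Submodule.sum_mem _ fun i _ ↦ Submodule.smul_mem _ _ (Submodule.subset_span (mem_range_self i))

lemma orthonormalBasis_apply (hg : IsPseudoMetric I s g) {b : ι → T[I] x}
    (hb : ∀ i j, g x (b i) (b j) = if i = j then s i else 0) (i : ι) : orthonormalBasis hg hb i = b i := Module.Basis.mk_apply _ _ i

lemma orthonormalBasis_coord (hg : IsPseudoMetric I s g) {b : ι → T[I] x}
    (hb : ∀ i j, g x (b i) (b j) = if i = j then s i else 0) (i : ι) (u : T[I] x) :
    (orthonormalBasis hg hb).coord i u = s i * g x u (b i) := by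
  conv_lhs => rw [orthonormal_expansion hg hb u]
  simp only [map_sum, map_smul, ← orthonormalBasis_apply hg hb, Module.Basis.coord_apply, Module.Basis.repr_self, smul_eq_mul]
  rw [sum_eq_single i]
  · simp
  · intro j _ hj; simp [hj]
  · simp

lemma ricci_eq_orthonormal {nab : Conn[I,E,M]} (hn : IsSmoothConn I nab)
    (hg : IsPseudoMetric I s g) {b : ι → T[I] x} (hb : ∀ i j, g x (b i) (b j) = if i = j then s i else 0)
    (v w : T[I] x) : ricci I nab x v w = ∑ i, s i * g x (curvature I nab x (b i) v w) (b i) := by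
  rw [ricci_eq_trace hn (orthonormalBasis hg hb)]
  simp only [orthonormalBasis_coord, orthonormalBasis_apply]

/-- The metric contraction of a bilinear map does not depend on the orthonormal frame. -/
lemma contraction_eq {A : Type*} [AddCommGroup A] [Module ℝ A] (hg : IsPseudoMetric I s g) {b b' : ι → T[I] x}
    (hb : ∀ i j, g x (b i) (b j) = if i = j then s i else 0) (hb' : ∀ i j, g x (b' i) (b' j) = if i = j then s i else 0)
    (B : T[I] x →ₗ[ℝ] T[I] x →ₗ[ℝ] A) :
    ∑ i, s i • B (b i) (b i) = ∑ i, s i • B (b' i) (b' i) := by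
  have h1 : ∀ i, s i • B (b i) (b i) = ∑ j, ∑ k, (s j * s k * (s i * (g x (b i) (b' j) * g x (b i) (b' k)))) • B (b' j) (b' k) := by
    intro i
    conv_lhs => rw [orthonormal_expansion hg hb' (b i)]
    simp only [map_sum, map_smul, LinearMap.sum_apply, LinearMap.smul_apply, smul_sum, smul_smul]
    rw [sum_comm]
    exact sum_congr rfl fun j _ ↦ sum_congr rfl fun k _ ↦ congrArg (· • _) (by ring)
  have h2 : ∀ j k, ∑ i, s i * (g x (b i) (b' j) * g x (b i) (b' k)) = if j = k then s j else 0 := by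
    intro j k
    rw [← hb' j k]
    conv_rhs => rw [orthonormal_expansion hg hb (b' j)]
    simp only [map_sum, map_smul, _root_.sum_apply, _root_.smul_apply, smul_eq_mul]
    exact sum_congr rfl fun i _ ↦ by rw [hg.symm x (b' j) (b i)]; ring
  simp only [h1]
  rw [sum_comm]
  refine sum_congr rfl fun j _ ↦ ?_
  rw [sum_comm]
  have h3 : ∀ k, ∑ i, (s j * s k * (s i * (g x (b i) (b' j) * g x (b i) (b' k)))) • B (b' j) (b' k) = (s j * s k * if j = k then s j else 0) • B (b' j) (b' k) := by
    intro k
    rw [← sum_smul, ← mul_sum, h2]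
  simp only [h3]
  rw [sum_eq_single j]
  · rw [if_pos rfl, hg.sign, one_mul]
  · intro k _ hk; rw [if_neg hk.symm, mul_zero, zero_smul]
  · simp

end Contraction

lemma eta_zero : eta 0 = -1 := rfl
lemma eta_one : eta 1 = 1 := by simp [eta]
lemma eta_two : eta 2 = 1 := if_neg (by decide)
lemma eta_three : eta 3 = 1 := if_neg (by decide)

/-- The coordinate form of the equality case of the reversed Cauchy–Schwarz inequality. -/
lemma proportional_of_null {l0 l1 l2 l3 w0 w1 w2 w3 : ℝ} (e1 : l0 * l0 = l1 * l1 + l2 * l2 + l3 * l3)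
    (e2 : l0 * w0 = l1 * w1 + l2 * w2 + l3 * w3) (e3 : w1 * w1 + w2 * w2 + w3 * w3 ≤ w0 * w0) (h0 : l0 ≠ 0) :
    w1 * l0 = w0 * l1 ∧ w2 * l0 = w0 * l2 ∧ w3 * l0 = w0 * l3 := by
  have hL : (l0 * l0) * (w1 * w1 + w2 * w2 + w3 * w3 - w0 * w0) = (l1 * w2 - l2 * w1) ^ 2 + (l1 * w3 - l3 * w1) ^ 2 + (l2 * w3 - l3 * w2) ^ 2 := by
    have : (l0 * l0) * (w1 * w1 + w2 * w2 + w3 * w3 - w0 * w0) = (l0 * l0) * (w1 * w1 + w2 * w2 + w3 * w3) - (l0 * w0) ^ 2 := by ring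
    rw [this, e1, e2]
    ring
  have hz : (l0 * l0) * (w1 * w1 + w2 * w2 + w3 * w3 - w0 * w0) ≤ 0 :=
    mul_nonpos_of_nonneg_of_nonpos (mul_self_nonneg _) (by linarith)
  rw [hL] at hz
  have s1 := sq_nonneg (l1 * w2 - l2 * w1)
  have s2 := sq_nonneg (l1 * w3 - l3 * w1)
  have s3 := sq_nonneg (l2 * w3 - l3 * w2)
  have c1 : l1 * w2 - l2 * w1 = 0 := pow_eq_zero_iff (two_ne_zero) |>.1 (le_antisymm (by linarith) s1)
  have c2 : l1 * w3 - l3 * w1 = 0 := pow_eq_zero_iff (two_ne_zero) |>.1 (le_antisymm (by linarith) s2)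
  have c3 : l2 * w3 - l3 * w2 = 0 := pow_eq_zero_iff (two_ne_zero) |>.1 (le_antisymm (by linarith) s3)
  refine ⟨mul_left_cancel₀ h0 ?_, mul_left_cancel₀ h0 ?_, mul_left_cancel₀ h0 ?_⟩
  · linear_combination w1 * e1 - l1 * e2 - l2 * c1 - l3 * c2
  · linear_combination w2 * e1 - l2 * e2 + l1 * c1 - l3 * c3
  · linear_combination w3 * e1 - l3 * e2 + l1 * c2 + l2 * c3

section Lorentz
variable {g : Cov₂ I M} {x : M}

/-- A vector orthogonal to a null vector `l` of a Lorentzian metric is spacelike or a multiple of `l`. -/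
lemma pos_of_orthogonal_null (hg : IsPseudoMetric I eta g) {l w : T[I] x} (hl0 : l ≠ 0) (hl : g x l l = 0)
    (hw : g x l w = 0) (hne : ∀ c : ℝ, w ≠ c • l) : 0 < g x w w := by
  obtain ⟨b, hb⟩ := hg.frame x
  have key : ∀ u z : T[I] x, g x u z = -(g x u (b 0) * g x z (b 0)) + (g x u (b 1) * g x z (b 1)) + (g x u (b 2) * g x z (b 2)) + (g x u (b 3) * g x z (b 3)) := by
    intro u z
    conv_lhs => rw [orthonormal_expansion hg hb z]
    simp only [Fin.sum_univ_four, map_add, map_smul, smul_eq_mul, eta_zero, eta_one, eta_two, eta_three]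
    ring
  have hext : ∀ u z : T[I] x, (∀ i, g x u (b i) = g x z (b i)) → u = z := by
    intro u z h
    rw [orthonormal_expansion hg hb u, orthonormal_expansion hg hb z]
    simp only [h]
  have e1 := key l l
  have e2 := key l w
  have e3 := key w w
  rw [hl] at e1
  rw [hw] at e2
  rw [e3]
  set l0 := g x l (b 0)
  set l1 := g x l (b 1)
  set l2 := g x l (b 2)
  set l3 := g x l (b 3)
  set w0 := g x w (b 0)
  set w1 := g x w (b 1)
  set w2 := g x w (b 2)
  set w3 := g x w (b 3)
  have hl00 : l0 ≠ 0 := by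
    intro h0
    apply hl0
    apply hext
    have h1 : l1 = 0 := by nlinarith [sq_nonneg l1, sq_nonneg l2, sq_nonneg l3]
    have h2 : l2 = 0 := by nlinarith [sq_nonneg l1, sq_nonneg l2, sq_nonneg l3]
    have h3 : l3 = 0 := by nlinarith [sq_nonneg l1, sq_nonneg l2, sq_nonneg l3]
    intro i
    rw [map_zero]
    fin_cases i <;> assumption
  by_contra hneg
  rw [not_lt] at hneg
  obtain ⟨q1, q2, q3⟩ := proportional_of_null (l0 := l0) (w0 := w0) (w1 := w1) (w2 := w2) (w3 := w3) (l1 := l1) (l2 := l2) (l3 := l3)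
    (by linarith) (by linarith) (by linarith) hl00
  refine hne (w0 / l0) (hext _ _ fun i ↦ ?_)
  rw [map_smul, _root_.smul_apply, smul_eq_mul, div_mul_eq_mul_div, eq_div_iff hl00]
  fin_cases i
  · rfl
  · exact q1
  · exact q2
  · exact q3

/-- A null frame `(e₁, e₂, n, l)`: `e₁, e₂` are orthonormal, `n` and `l` are null and orthogonal to them and `g(n, l) = -1`. -/
structure IsNullFrame (g : Cov₂ I M) (x : M)
    (e : Fin 2 → T[I] x) (n l : T[I] x) : Prop where
  ee : ∀ i j, g x (e i) (e j) = if i = j then 1 else 0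
  en : ∀ i, g x n (e i) = 0
  el : ∀ i, g x l (e i) = 0
  nn : g x n n = 0
  ll : g x l l = 0
  nl : g x n l = -1

lemma exists_null_frame (hg : IsPseudoMetric I eta g) {e : Fin 2 → T[I] x} {l : T[I] x}
    (ee : ∀ i j, g x (e i) (e j) = if i = j then 1 else 0) (el : ∀ i, g x l (e i) = 0) (hl0 : l ≠ 0) (ll : g x l l = 0) :
    ∃ n, IsNullFrame g x e n l := by
  obtain ⟨z, hz⟩ : ∃ z, g x z l ≠ 0 := by
    by_contra! h
    exact hl0 (hg.ext fun z ↦ by rw [hg.symm, h, map_zero]; rfl)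
  obtain ⟨m, hml⟩ : ∃ m, g x m l = -1 := ⟨(-(g x z l)⁻¹) • z, by
    rw [map_smul, _root_.smul_apply, smul_eq_mul, neg_mul, inv_mul_cancel₀ hz]⟩
  set m' := m - g x m (e 0) • e 0 - g x m (e 1) • e 1 with hm'
  have g1 : ∀ u, g x m' u = g x m u - g x m (e 0) * g x (e 0) u - g x m (e 1) * g x (e 1) u := fun u ↦ by
    simp only [hm', map_sub, map_smul, _root_.sub_apply, _root_.smul_apply, smul_eq_mul]
  have el' : ∀ i, g x (e i) l = 0 := fun i ↦ by rw [hg.symm, el]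
  have hm'l : g x m' l = -1 := by rw [g1, el', el', hml]; ring
  have hm'e : ∀ i, g x m' (e i) = 0 := fun i ↦ by
    rw [g1, ee, ee]
    fin_cases i <;> simp
  have g2 : ∀ u, g x (m' + (g x m' m' / 2) • l) u = g x m' u + g x m' m' / 2 * g x l u := fun u ↦ by
    rw [map_add, map_smul]; rfl
  refine ⟨m' + (g x m' m' / 2) • l, ee, fun i ↦ ?_, el, ?_, ll, ?_⟩
  · rw [g2, hm'e, el]; ring
  · rw [g2, map_add, map_add, map_smul, map_smul, hm'l, ll, hg.symm x l m', hm'l]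
    simp only [smul_eq_mul]
    ring
  · rw [g2, hm'l, ll]; ring

lemma inv_sqrt_two_mul_self : (√2)⁻¹ * (√2)⁻¹ = 1 / 2 := by
  rw [← mul_inv, Real.mul_self_sqrt (by norm_num), one_div]

/-- The orthonormal frame `((n + l)/√2, e₁, e₂, (n - l)/√2)` of a null frame. -/
def nullONFrame (e : Fin 2 → T[I] x) (n l : T[I] x) : Fin 4 → T[I] x :=
  ![(√2)⁻¹ • (n + l), e 0, e 1, (√2)⁻¹ • (n - l)]

section
variable (e : Fin 2 → T[I] x) (n l : T[I] x)

lemma nullONFrame_zero : nullONFrame e n l 0 = (√2)⁻¹ • (n + l) := rfl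
lemma nullONFrame_one : nullONFrame e n l 1 = e 0 := rfl
lemma nullONFrame_two : nullONFrame e n l 2 = e 1 := rfl
lemma nullONFrame_three : nullONFrame e n l 3 = (√2)⁻¹ • (n - l) := rfl

end

lemma IsNullFrame.orthonormal (hs : ∀ u w, g x u w = g x w u) {e : Fin 2 → T[I] x} {n l : T[I] x} (h : IsNullFrame g x e n l) (i j : Fin 4) :
    g x (nullONFrame e n l i) (nullONFrame e n l j) = if i = j then eta i else 0 := by
  have h2 := inv_sqrt_two_mul_self
  have ne := fun i ↦ (hs _ _).trans (h.en i)
  have le := fun i ↦ (hs _ _).trans (h.el i)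
  have ln := (hs _ _).trans h.nl
  fin_cases i <;> fin_cases j <;>
    simp [nullONFrame, eta, h.ee, h.en, h.el, h.nn, h.ll, h.nl, ne, le, ln] <;> linarith

lemma IsNullFrame.sum_eta {A : Type*} [AddCommGroup A] [Module ℝ A] (B : T[I] x →ₗ[ℝ] T[I] x →ₗ[ℝ] A)
    (e : Fin 2 → T[I] x) (n l : T[I] x) :
    ∑ i, eta i • B (nullONFrame e n l i) (nullONFrame e n l i) = B (e 0) (e 0) + B (e 1) (e 1) - B n l - B l n := by
  have h2 := inv_sqrt_two_mul_self
  have e0 : B (nullONFrame e n l 0) (nullONFrame e n l 0) = (1 / 2 : ℝ) • B (n + l) (n + l) := by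
    rw [← h2, mul_smul]
    exact (LinearMap.map_smul₂ B _ _ _).trans (congrArg _ (map_smul (B (n + l)) _ _))
  have e3 : B (nullONFrame e n l 3) (nullONFrame e n l 3) = (1 / 2 : ℝ) • B (n - l) (n - l) := by
    rw [← h2, mul_smul]
    exact (LinearMap.map_smul₂ B _ _ _).trans (congrArg _ (map_smul (B (n - l)) _ _))
  have e1 : nullONFrame e n l 1 = e 0 := rfl
  have e2 : nullONFrame e n l 2 = e 1 := rfl
  rw [Fin.sum_univ_four, e0, e1, e2, e3, eta_zero, eta_one, eta_two, eta_three]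
  simp only [map_add, map_sub, LinearMap.add_apply, LinearMap.sub_apply]
  module

end Lorentz

/-! ### The Ricci tensor in a null frame -/

/-- The Ricci tensor in a null frame. -/
lemma IsNullFrame.ricci_eq {g : Cov₂ I M} {nab : Conn[I,E,M]}
    (hg : IsPseudoMetric I eta g) (hL : IsLeviCivita I g nab) {x : M} {e : Fin 2 → T[I] x} {n l : T[I] x}
    (h : IsNullFrame g x e n l) (v w : T[I] x) :
    ricci I nab x v w = g x (curvature I nab x (e 0) v w) (e 0) + g x (curvature I nab x (e 1) v w) (e 1)
      - g x (curvature I nab x l w v) n - g x (curvature I nab x l v w) n := by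
  have hc := hL.isSmoothConn hg
  let B : T[I] x →ₗ[ℝ] T[I] x →ₗ[ℝ] ℝ := LinearMap.mk₂ ℝ (fun u z ↦ g x (curvature I nab x u v w) z)
    (fun u u' z ↦ by rw [curvature_add_left hc, map_add]; rfl) (fun c u z ↦ by rw [curvature_smul_left hc, map_smul]; rfl)
    (fun u z z' ↦ map_add _ _ _) (fun c u z ↦ map_smul _ _ _)
  have h1 : ricci I nab x v w = B (e 0) (e 0) + B (e 1) (e 1) - B n l - B l n :=
    (ricci_eq_orthonormal hc hg (h.orthonormal (hg.symm x)) v w).trans (IsNullFrame.sum_eta B e n l)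
  have h2 : g x (curvature I nab x n v w) l = g x (curvature I nab x l w v) n := by
    rw [curvature_pair_symm hL hc hg.smooth hg.symm]
    have h1 := curvature_skew hL hc hg.smooth w l n v
    rw [curvature_swap w l v, map_neg, hg.symm x n] at h1
    linarith
  rw [h1, ← h2]
  rfl

/-! ### Covariant derivatives of 2-tensors -/

section CovariantTensor
variable {nab : Conn[I,E,M]} {T : Cov₂ I M} {x : M}
  {V V' W W' : Vec I M}

/-- The covariant derivative `(∇_u T)(V, W)` of a covariant 2-tensor, evaluated on vector fields. -/
def covTensorField (nab : Conn[I,E,M]) (T : Cov₂ I M)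
    (V W : Vec I M) (x : M) (u : T[I] x) : ℝ :=
  ∂[I] (fun y ↦ T y (V y) (W y)) x u - T x (nab V x u) (W x) - T x (V x) (nab W x u)

lemma covTensorField_eq_left (hT : TensorSmoothAt I T x) (hV : V∞[I] V x) (hV' : V∞[I] V' x) (hW : V∞[I] W x)
    (h : V x = V' x) (u : T[I] x) : covTensorField nab T V W x u = covTensorField nab T V' W x u := by
  have hd : ∀ {X}, V∞[I] X x → D¹[I] (fun y ↦ T y (X y) (W y)) x := fun hX ↦
    (hT _ _ hX hW).mdiff
  refine smooth_tensorial (Φ := fun V ↦ covTensorField nab T V W x u) (fun X Y hX hY ↦ ?_) (fun f X hf hX ↦ ?_) (fun X Y hX hY hXY ↦ ?_) hV hV' h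
  · have e : (fun y ↦ T y ((X + Y) y) (W y)) = fun y ↦ T y (X y) (W y) + T y (Y y) (W y) := by
      ext y; exact congrArg (fun L : T[I] y →L[ℝ] ℝ ↦ L (W y)) (map_add (T y) (X y) (Y y))
    have e2 : T x ((X + Y) x) (nab W x u) = T x (X x) (nab W x u) + T x (Y x) (nab W x u) :=
      congrArg (fun L : T[I] x →L[ℝ] ℝ ↦ L (nab W x u)) (map_add (T x) (X x) (Y x))
    simp only [covTensorField]
    rw [e, e2, dd_add (hd hX) (hd hY), nab_add nab hX.fieldDiffAt hY.fieldDiffAt, map_add, _root_.add_apply]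
    ring
  · have e : (fun y ↦ T y ((f • X) y) (W y)) = fun y ↦ f y * T y (X y) (W y) := by
      ext y; exact congrArg (fun L : T[I] y →L[ℝ] ℝ ↦ L (W y)) (map_smul (T y) (f y) (X y))
    have e2 : T x ((f • X) x) (nab W x u) = f x * T x (X x) (nab W x u) :=
      congrArg (fun L : T[I] x →L[ℝ] ℝ ↦ L (nab W x u)) (map_smul (T x) (f x) (X x))
    have hfd := hf.mdifferentiableAt (n := ∞) (by simp)
    simp only [covTensorField]
    rw [e, e2, dd_mul hfd (hd hX), nab_smul nab hfd hX.fieldDiffAt, map_add, map_smul, map_smul, _root_.add_apply, _root_.smul_apply, _root_.smul_apply]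
    simp only [smul_eq_mul]
    ring
  · have e : ∂[I] (fun y ↦ T y (X y) (W y)) x = ∂[I] (fun y ↦ T y (Y y) (W y)) x :=
      mvfderiv_congr (hXY.mono fun y hy ↦ by change T y (X y) (W y) = T y (Y y) (W y); rw [hy])
    simp only [covTensorField]
    rw [e, nab_congr nab hY.fieldDiffAt hXY, hXY.self_of_nhds]

variable (halt : ∀ y u, T y u u = 0)

lemma tensor_skew (halt : ∀ y u, T y u u = 0) (x : M) (u w : T[I] x) : T x u w = -T x w u := by
  have h := halt x (u + w)
  simp only [map_add, _root_.add_apply, halt] at h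
  linarith

lemma covTensorField_swap (halt : ∀ y u, T y u u = 0) (u : T[I] x) :
    covTensorField nab T W V x u = -covTensorField nab T V W x u := by
  have e : (fun y ↦ T y (W y) (V y)) = fun y ↦ -T y (V y) (W y) := funext fun y ↦ tensor_skew halt y _ _
  rw [covTensorField, e, dd_neg, tensor_skew halt x (nab W x u) (V x), tensor_skew halt x (W x), covTensorField]
  ring

lemma covTensorField_eq (hT : TensorSmoothAt I T x) (halt : ∀ y u, T y u u = 0) (hV : V∞[I] V x) (hV' : V∞[I] V' x)
    (hW : V∞[I] W x) (hW' : V∞[I] W' x) (h : V x = V' x) (h' : W x = W' x) (u : T[I] x) :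
    covTensorField nab T V W x u = covTensorField nab T V' W' x u := by
  rw [covTensorField_eq_left hT hV hV' hW h, covTensorField_swap halt, covTensorField_eq_left hT hW hW' hV' h', ← covTensorField_swap halt]

/-- The covariant derivative `(∇_u T)(v, w)` of a covariant 2-tensor. -/
def covTensor (nab : Conn[I,E,M]) (T : Cov₂ I M)
    (x : M) (u v w : T[I] x) : ℝ :=
  covTensorField nab T (extend E v) (extend E w) x u

lemma covTensor_eq (hT : TensorSmoothAt I T x) (halt : ∀ y u, T y u u = 0) (hV : V∞[I] V x) (hW : V∞[I] W x)
    (u : T[I] x) : covTensor nab T x u (V x) (W x) = covTensorField nab T V W x u :=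
  covTensorField_eq hT halt (fieldSmoothAt_extend_self _) hV (fieldSmoothAt_extend_self _) hW (extend_apply_self _ _)
    (extend_apply_self _ _) u

lemma covTensor_swap (halt : ∀ y u, T y u u = 0) (u v w : T[I] x) : covTensor nab T x u w v = -covTensor nab T x u v w :=
  covTensorField_swap halt u

lemma covTensor_add₁ (u u' v w : T[I] x) : covTensor nab T x (u + u') v w = covTensor nab T x u v w + covTensor nab T x u' v w := by
  simp only [covTensor, covTensorField, map_add, _root_.add_apply]
  ring

lemma covTensor_smul₁ (r : ℝ) (u v w : T[I] x) : covTensor nab T x (r • u) v w = r * covTensor nab T x u v w := by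
  simp only [covTensor, covTensorField, map_smul, _root_.smul_apply, smul_eq_mul]
  ring

lemma covTensor_add₂ (hT : TensorSmoothAt I T x) (halt : ∀ y u, T y u u = 0) (u v v' w : T[I] x) :
    covTensor nab T x u (v + v') w = covTensor nab T x u v w + covTensor nab T x u v' w := by
  set V := extend E v
  set V' := extend E v'
  set W := extend E w
  have hV : V∞[I] V x := fieldSmoothAt_extend_self v
  have hV' : V∞[I] V' x := fieldSmoothAt_extend_self v'
  have hW : V∞[I] W x := fieldSmoothAt_extend_self w
  have h1 : V x + V' x = v + v' := congrArg₂ (· + ·) (extend_apply_self _ _) (extend_apply_self _ _)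
  have h2 : W x = w := extend_apply_self _ _
  have h3 := covTensor_eq (nab := nab) hT halt (hV.add hV') hW u
  have h4 : (V + V') x = v + v' := h1
  rw [h4, h2] at h3
  rw [h3]
  have e : (fun y ↦ T y ((V + V') y) (W y)) = fun y ↦ T y (V y) (W y) + T y (V' y) (W y) := by
    ext y; exact congrArg (fun L : T[I] y →L[ℝ] ℝ ↦ L (W y)) (map_add (T y) (V y) (V' y))
  have e2 : T x ((V + V') x) (nab W x u) = T x (V x) (nab W x u) + T x (V' x) (nab W x u) :=
    congrArg (fun L : T[I] x →L[ℝ] ℝ ↦ L (nab W x u)) (map_add (T x) (V x) (V' x))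
  change covTensorField nab T (V + V') W x u = covTensorField nab T V W x u + covTensorField nab T V' W x u
  simp only [covTensorField]
  rw [e, e2, dd_add ((hT _ _ hV hW).mdiff) ((hT _ _ hV' hW).mdiff),
    nab_add nab hV.fieldDiffAt hV'.fieldDiffAt, map_add, _root_.add_apply]
  ring

lemma covTensor_smul₂ (hT : TensorSmoothAt I T x) (halt : ∀ y u, T y u u = 0) (r : ℝ) (u v w : T[I] x) :
    covTensor nab T x u (r • v) w = r * covTensor nab T x u v w := by
  set V := extend E v
  set W := extend E w
  have hV : V∞[I] V x := fieldSmoothAt_extend_self v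
  have hW : V∞[I] W x := fieldSmoothAt_extend_self w
  have hc : V∞[I] ((fun _ : M ↦ r) • V) x := hV.smul contMDiffAt_const
  have h1 : V x = v := extend_apply_self _ _
  have h2 : W x = w := extend_apply_self _ _
  have h3 := covTensor_eq (nab := nab) hT halt hc hW u
  have h4 : ((fun _ : M ↦ r) • V) x = r • v := congrArg (r • ·) h1
  rw [h4, h2] at h3
  rw [h3]
  have e : (fun y ↦ T y (((fun _ : M ↦ r) • V) y) (W y)) = fun y ↦ r * T y (V y) (W y) := by
    ext y; exact congrArg (fun L : T[I] y →L[ℝ] ℝ ↦ L (W y)) (map_smul (T y) r (V y))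
  have e2 : T x (((fun _ : M ↦ r) • V) x) (nab W x u) = r * T x (V x) (nab W x u) :=
    congrArg (fun L : T[I] x →L[ℝ] ℝ ↦ L (nab W x u)) (map_smul (T x) r (V x))
  change covTensorField nab T ((fun _ : M ↦ r) • V) W x u = r * covTensorField nab T V W x u
  simp only [covTensorField]
  rw [e, e2, dd_const_mul r ((hT _ _ hV hW).mdiff), nab_smul nab mdifferentiableAt_const hV.fieldDiffAt, dd_const, zero_smul, add_zero,
    map_smul, _root_.smul_apply, smul_eq_mul]
  ring

/-- The exterior derivative of a 2-form in terms of a torsion-free connection. -/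
def extCov (nab : Conn[I,E,M]) (T : Cov₂ I M)
    (x : M) (u v w : T[I] x) : ℝ :=
  covTensor nab T x u v w + covTensor nab T x v w u + covTensor nab T x w u v

lemma extCov_cycle (u v w : T[I] x) : extCov nab T x v w u = extCov nab T x u v w := by
  simp only [extCov]; ring

lemma extCov_swap (halt : ∀ y u, T y u u = 0) (u v w : T[I] x) : extCov nab T x v u w = -extCov nab T x u v w := by
  simp only [extCov, covTensor_swap halt _ w u, covTensor_swap halt _ v w, covTensor_swap halt _ u v]; ring

lemma extCov_add (hT : TensorSmoothAt I T x) (halt : ∀ y u, T y u u = 0) (u u' v w : T[I] x) :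
    extCov nab T x (u + u') v w = extCov nab T x u v w + extCov nab T x u' v w := by
  simp only [extCov, covTensor_add₁, covTensor_add₂ hT halt]
  rw [covTensor_swap halt v (u + u') w, covTensor_swap halt v u w, covTensor_swap halt v u' w, covTensor_add₂ hT halt]
  ring

lemma extCov_smul (hT : TensorSmoothAt I T x) (halt : ∀ y u, T y u u = 0) (r : ℝ) (u v w : T[I] x) :
    extCov nab T x (r • u) v w = r * extCov nab T x u v w := by
  simp only [extCov, covTensor_smul₁, covTensor_smul₂ hT halt]
  rw [covTensor_swap halt v (r • u) w, covTensor_swap halt v u w, covTensor_smul₂ hT halt]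
  ring

/-- The exterior derivative of the complex combination `F - i H` of two real 2-forms. -/
lemma extDeriv_complex (ht : nab.torsion = 0) {F G : Cov₂ I M} (hF : TensorSmoothAt I F x)
    (hG : TensorSmoothAt I G x) (hFa : ∀ y u, F y u u = 0) (hGa : ∀ y u, G y u u = 0) (u v w : T[I] x) :
    extDeriv I (fun y a b ↦ (F y a b : ℂ) - Complex.I * (G y a b : ℂ)) x u v w =
      (extCov nab F x u v w : ℂ) - Complex.I * (extCov nab G x u v w : ℂ) := by
  have hs : ∀ z : T[I] x, V∞[I] (extend E z) x := fun z ↦ fieldSmoothAt_extend_self z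
  have hd : ∀ (a b c : T[I] x), ∂[I] (fun y ↦ (F y (extend E a y) (extend E b y) : ℂ)
      - Complex.I * (G y (extend E a y) (extend E b y) : ℂ)) x c =
      (∂[I] (fun y ↦ F y (extend E a y) (extend E b y)) x c : ℂ)
        - Complex.I * (∂[I] (fun y ↦ G y (extend E a y) (extend E b y)) x c : ℂ) := by
    intro a b c
    have h1 := (hF _ _ (hs a) (hs b)).mdifferentiableAt (n := ∞) (by simp)
    have h2 := (hG _ _ (hs a) (hs b)).mdifferentiableAt (n := ∞) (by simp)
    have k1 := dd_clm Complex.ofRealCLM h1 c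
    have k2 := dd_clm (Complex.I • Complex.ofRealCLM) h2 c
    have m1 : MDifferentiableAt I 𝓘(ℝ, ℂ) (fun y ↦ Complex.ofRealCLM (F y (extend E a y) (extend E b y))) x :=
      Complex.ofRealCLM.differentiable.mdifferentiable.mdifferentiableAt.comp x h1
    have m2 : MDifferentiableAt I 𝓘(ℝ, ℂ) (fun y ↦ (Complex.I • Complex.ofRealCLM) (G y (extend E a y) (extend E b y))) x :=
      (Complex.I • Complex.ofRealCLM).differentiable.mdifferentiable.mdifferentiableAt.comp x h2
    refine (dd_sub m1 m2 c).trans ?_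
    rw [k1, k2]
    rfl
  have hb : ∀ a b : T[I] x, mlieBracket I (extend E a) (extend E b) x =
      nab (extend E b) x a - nab (extend E a) x b := by
    intro a b
    rw [← nab_torsion ht (hs a).fieldDiffAt (hs b).fieldDiffAt, extend_apply_self, extend_apply_self]
  have ha : ∀ z : T[I] x, extend E z x = z := fun z ↦ extend_apply_self _ _
  simp only [extDeriv, hd, hb, extCov, covTensor, covTensorField, map_sub, _root_.sub_apply, ha]
  rw [tensor_skew hFa x v (nab _ x u), tensor_skew hFa x w (nab _ x v), tensor_skew hFa x u (nab _ x w),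
    tensor_skew hGa x v (nab _ x u), tensor_skew hGa x w (nab _ x v), tensor_skew hGa x u (nab _ x w)]
  push_cast
  ring

end CovariantTensor

end Fields

section Horizon
variable {S : Type u} [TopologicalSpace S] [ChartedSpace ℝ² S]
  [IsManifold (𝓡 2) ∞ S]

/-! ### The geometry of extremal horizons -/

lemma dPi_ell (p : S × ℝ) : dPi p (ell p) = 0 := dfst_vert (I := 𝓡 2) p
lemma dPi_lift (X : Vec (𝓡 2) S) (p : S × ℝ) : dPi p (lift X p) = X p.1 := dfst_lift X p
lemma ell_smooth (p : S × ℝ) : V∞[I3] ell p := vert_smooth (I := 𝓡 2) p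

lemma eq_smul_ell {p : S × ℝ} {u : T[I3] p} (h : dPi p u = 0) :
    u = ∂[I3] (Prod.snd : S × ℝ → ℝ) p u • ell p := prod_ker_dfst (I := 𝓡 2) h

lemma ell_ne_zero (p : S × ℝ) : (ell p : T[I3] p) ≠ 0 := by
  intro h
  have h1 := dsnd_vert (I := 𝓡 2) p
  have h2 : ∂[I3] (Prod.snd : S × ℝ → ℝ) p (ell p) = 1 := h1
  rw [h, map_zero] at h2
  exact zero_ne_one h2

lemma smul_ell_eq {p : S × ℝ} {a b : ℝ} (h : a • ell p = b • ell p) : a = b :=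
  smul_left_injective ℝ (ell_ne_zero p) h

lemma dPi_mfderiv_of_fibre {φ : S × ℝ → S × ℝ} {p : S × ℝ} (hφ : MDifferentiableAt I3 I3 φ p) (h : ∀ p, (φ p).1 = p.1)
    (u : T[I3] p) : (dPi (φ p) (mfderiv I3 I3 φ p u) : ℝ²) = dPi p u := by
  have h1 := mfderiv_comp_apply p (mdiff_fst (I := 𝓡 2) (φ p)) hφ u
  have h2 : (Prod.fst : S × ℝ → S) ∘ φ = Prod.fst := funext h
  rw [h2] at h1
  exact h1.symm

/-- The geometry `(q, D)` of an isolated horizon. -/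
structure HorizonGeom (q : Cov₂ I3 (S × ℝ))
    (D : Conn[I3,ℝ² × ℝ,S × ℝ]) : Prop where
  smooth : ∀ p, TensorSmoothAt I3 q p
  symm : ∀ p u w, q p u w = q p w u
  null : ∀ p w, q p (ell p) w = 0
  pos : ∀ p u, dPi p u ≠ 0 → 0 < q p u u
  lc : IsLeviCivita I3 q D
  conn : IsSmoothConn I3 D
  sym : IsSymmetryOf (fun p u w ↦ q p u w) D ell

/-- The geometry `(q, D)` is extremal with data `(q̂, ω̂)`. -/
structure GeomData (q : Cov₂ I3 (S × ℝ))
    (D : Conn[I3,ℝ² × ℝ,S × ℝ])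
    (qh : Cov₂ (𝓡 2) S)
    (omh : Cov (𝓡 2) S) : Prop where
  metric : ∀ (p : S × ℝ) (u w : T[I3] p), q p u w = qh p.1 (dPi p u) (dPi p w)
  rotation : ∀ (p : S × ℝ) (u : T[I3] p), D ell p u = omh p.1 (dPi p u) • ell p

/-- The pullback of a 1-form from the surface to the cylinder. -/
def pull (omh : Cov (𝓡 2) S) (p : S × ℝ) : T[I3] p →L[ℝ] ℝ :=
  (omh p.1).comp (dPi p)

lemma pull_apply (omh : Cov (𝓡 2) S) (p : S × ℝ) (u : T[I3] p) :
    pull omh p u = omh p.1 (dPi p u) := rfl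

section Geom
variable {q : Cov₂ I3 (S × ℝ)}
  {D : Conn[I3,ℝ² × ℝ,S × ℝ]}
  {qh : Cov₂ (𝓡 2) S}
  {omh : Cov (𝓡 2) S} {p : S × ℝ}

lemma HorizonGeom.null' (h : HorizonGeom q D) (w : T[I3] p) : q p w (ell p) = 0 := by
  rw [h.symm, h.null]

/-- The kernel of the degenerate metric is spanned by `ℓ`, so `q` sees a vector only through its projection and determines
that projection. -/
lemma HorizonGeom.dPi_eq (h : HorizonGeom q D) {u w : T[I3] p} (hu : ∀ z, q p u z = q p w z) :
    dPi p u = dPi p w := by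
  by_contra hne
  have h1 := h.pos p (u - w) (by rw [map_sub]; exact sub_ne_zero.2 hne)
  have e : q p (u - w) (u - w) = q p u (u - w) - q p w (u - w) := by rw [map_sub (q p) u w]; rfl
  rw [e, hu, sub_self] at h1
  exact lt_irrefl _ h1

/-- `q(ℓ, ·) = 0` and `D` preserves `q`, so `q(D_u ℓ, ·) = 0` and `D_u ℓ` is vertical. -/
lemma HorizonGeom.nab_ell (h : HorizonGeom q D) (u : T[I3] p) : dPi p (D ell p u) = 0 := by
  rw [← map_zero (dPi p)]
  refine h.dPi_eq fun z ↦ ?_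
  have h1 := h.lc.metric p ell (extend _ z) (ell_smooth p).fieldDiffAt (fieldDiffAt_extend_self z) u
  rw [dd_eventually_const (Eventually.of_forall fun y ↦ h.null y _), h.null] at h1
  rw [extend_apply_self] at h1
  rw [map_zero, _root_.zero_apply]
  linarith

/-- The rotation 1-form `ω`, defined by `D ℓ = ω ⊗ ℓ`. -/
def rotationForm (D : Conn[I3,ℝ² × ℝ,S × ℝ])
    (p : S × ℝ) : T[I3] p →L[ℝ] ℝ :=
  (∂[I3] (Prod.snd : S × ℝ → ℝ) p).comp (D ell p)

lemma HorizonGeom.nab_ell_eq (h : HorizonGeom q D) (u : T[I3] p) : D ell p u = rotationForm D p u • ell p :=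
  eq_smul_ell (h.nab_ell u)

lemma HorizonGeom.rotationForm_smooth (h : HorizonGeom q D) (p : S × ℝ) : FormSmoothAt I3 (rotationForm D) p :=
  fun X hX ↦ FieldSmoothAt.contMDiffAt_mvfderiv (h.conn p X ell hX (ell_smooth p)) (contMDiffAt_snd' (I := 𝓡 2) p)

lemma bracket_ell_lift {X : Vec (𝓡 2) S} (hX : FieldDiffAt (𝓡 2) X p.1) :
    mlieBracket I3 ell (lift X) p = 0 := bracket_vert_lift (I := 𝓡 2) hX

/-- The rotation form of an isolated horizon is preserved by the flow of `ℓ`. -/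
lemma HorizonGeom.rotationForm_invariant (h : HorizonGeom q D) {X : Vec I3 (S × ℝ)} (hX : V∞[I3] X p) :
    ∂[I3] (fun y ↦ rotationForm D y (X y)) p (ell p) = rotationForm D p (mlieBracket I3 ell X p) := by
  have h1 := h.sym.lie_D p X ell hX (ell_smooth p)
  have h2 : (fun y ↦ D ell y (X y)) = (fun y ↦ rotationForm D y (X y)) • (ell : Vec I3 (S × ℝ)) := by
    ext1 y; exact h.nab_ell_eq (X y)
  have h3 : (fun y : S × ℝ ↦ mlieBracket I3 ell (ell : Vec I3 (S × ℝ)) y) = fun _ ↦ 0 := by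
    ext1 y
    exact congrFun (mlieBracket_self (I := I3)) y
  rw [h2, h3, nab_zero, add_zero, br_smul_right ((h.rotationForm_smooth p X hX).mdiff) (ell_smooth p).fieldDiffAt,
    h.nab_ell_eq, congrFun h3 p, smul_zero, add_zero] at h1
  exact smul_ell_eq h1

lemma lift_at_zero (x : S) (u : T[𝓡 2] x) (t : ℝ) :
    (lift (extend₂ u) (x, t) : ℝ² × ℝ) = (u, 0) := by
  have := extend_apply_self ℝ² u
  unfold lift
  rw [this]
  rfl

/-- The geometry of an extremal isolated horizon is determined by tensors on the space of null geodesics. -/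
lemma HorizonGeom.exists_data (h : HorizonGeom q D) (hex : ∀ p, D ell p (ell p) = 0) : ∃ qh omh, GeomData q D qh omh := by
  let e : Π x : S, T[𝓡 2] x →L[ℝ] T[I3] ((x, 0) : S × ℝ) := fun x ↦
    ContinuousLinearMap.inl ℝ ℝ² ℝ
  let qh : Cov₂ (𝓡 2) S := fun x ↦
    show ℝ² →L[ℝ] ℝ² →L[ℝ] ℝ from ContinuousLinearMap.bilinearComp
      (show ℝ² × ℝ →L[ℝ] ℝ² × ℝ →L[ℝ] ℝ from q (x, 0))
      (show ℝ² →L[ℝ] ℝ² × ℝ from e x)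
      (show ℝ² →L[ℝ] ℝ² × ℝ from e x)
  let omh : Cov (𝓡 2) S := fun x ↦ (rotationForm D (x, 0)).comp (e x)
  have he : ∀ (x : S) (u : T[𝓡 2] x) , e x u = lift (extend₂ u) (x, (0 : ℝ)) := fun x u ↦ (lift_at_zero x u 0).symm
  have hs : ∀ (x : S) (u : T[𝓡 2] x) (t : ℝ), V∞[I3] (lift (extend₂ u)) (x, t) :=
    fun x u t ↦ lift_smooth (I := 𝓡 2) (p := (x, t)) (fieldSmoothAt_extend_self u)
  have hb : ∀ (x : S) (u : T[𝓡 2] x) (t : ℝ), mlieBracket I3 ell (lift (extend₂ u)) (x, t) = 0 :=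
    fun x u t ↦ bracket_ell_lift (p := (x, t)) (fieldDiffAt_extend_self u)
  refine ⟨qh, omh, ?_, ?_⟩
  · rintro ⟨x, t⟩ u w
    -- the components on lifts, which commute with `ℓ`, are constant along the null geodesic
    have hc := eq_of_vertical_deriv (I := 𝓡 2) (x := x) (c := 0)
      (f := fun p ↦ q p (lift (extend₂ (dPi (x, t) u)) p) (lift (extend₂ (dPi (x, t) w)) p))
      (fun t' ↦ (h.smooth _ _ _ (hs x _ t') (hs x _ t')).mdiff) (fun t' ↦ by
        refine (h.sym.lie_q (x, t') _ _ (hs x _ t').fieldDiffAt (hs x _ t').fieldDiffAt).trans ?_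
        rw [hb, hb]; simp) t
    have hd : ∀ u : T[I3] (x, t), u = lift (extend₂ (dPi (x, t) u)) (x, t) + ∂[I3] (Prod.snd : S × ℝ → ℝ) (x, t) u • ell (x, t) :=
      fun u ↦ prod_decomp (I := 𝓡 2) (x, t) u
    have hqd : q (x, t) u w = q (x, t) (lift (extend₂ (dPi (x, t) u)) (x, t)) (lift (extend₂ (dPi (x, t) w)) (x, t)) := by
      conv_lhs => rw [hd u, hd w]
      simp only [map_add, map_smul, _root_.add_apply, _root_.smul_apply, h.null, h.null', smul_zero, add_zero]
    rw [hqd, hc, zero_mul, add_zero, ← he, ← he]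
    rfl
  · rintro ⟨x, t⟩ u
    have hc := eq_of_vertical_deriv (I := 𝓡 2) (x := x) (c := 0)
      (f := fun p ↦ rotationForm D p (lift (extend₂ (dPi (x, t) u)) p))
      (fun t' ↦ (h.rotationForm_smooth _ _ (hs x _ t')).mdiff) (fun t' ↦ by
        refine (h.rotationForm_invariant (p := (x, t')) (hs x _ t')).trans ?_
        rw [hb, map_zero]) t
    have hd : u = lift (extend₂ (dPi (x, t) u)) (x, t) + ∂[I3] (Prod.snd : S × ℝ → ℝ) (x, t) u • ell (x, t) :=
      prod_decomp (I := 𝓡 2) (x, t) u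
    have h0 : rotationForm D (x, t) (ell (x, t)) = 0 := by
      apply smul_ell_eq (p := (x, t))
      rw [← h.nab_ell_eq, hex, zero_smul]
    have hod : rotationForm D (x, t) u = rotationForm D (x, t) (lift (extend₂ (dPi (x, t) u)) (x, t)) := by
      conv_lhs => rw [hd]
      rw [map_add, map_smul, h0, smul_zero, add_zero]
    rw [h.nab_ell_eq, hod, hc, zero_mul, add_zero, ← he]
    rfl

variable (h : HorizonGeom q D) (hd : GeomData q D qh omh)

lemma GeomData.rotationForm_eq (h : HorizonGeom q D) (hd : GeomData q D qh omh) : rotationForm D = pull omh := by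
  ext p u
  apply smul_ell_eq (p := p)
  rw [← h.nab_ell_eq, hd.rotation, pull_apply]

lemma GeomData.omh_smooth (h : HorizonGeom q D) (hd : GeomData q D qh omh) (x : S) : FormSmoothAt (𝓡 2) omh x := by
  intro X hX
  have h1 := h.rotationForm_smooth (x, 0) (lift X) (lift_smooth (I := 𝓡 2) (p := (x, (0 : ℝ))) hX)
  rw [hd.rotationForm_eq h] at h1
  have h2 := ContMDiffAt.comp x h1 ((contMDiff_slice (I := 𝓡 2) (0 : ℝ)).contMDiffAt)
  refine h2.congr_of_eventuallyEq (Eventually.of_forall fun y ↦ ?_)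
  exact congrArg (omh y) (dPi_lift X (y, 0)).symm

lemma GeomData.riemannian (h : HorizonGeom q D) (hd : GeomData q D qh omh) : IsRiemannian (𝓡 2) qh where
  smooth := by
    intro x X Y hX hY
    have h1 := h.smooth (x, 0) (lift X) (lift Y) (lift_smooth (I := 𝓡 2) (p := (x, (0 : ℝ))) hX) (lift_smooth (I := 𝓡 2) (p := (x, (0 : ℝ))) hY)
    have h2 := ContMDiffAt.comp x h1 ((contMDiff_slice (I := 𝓡 2) (0 : ℝ)).contMDiffAt)
    refine h2.congr_of_eventuallyEq (Eventually.of_forall fun y ↦ ?_)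
    refine Eq.trans ?_ (hd.metric (y, 0) (lift X (y, 0)) (lift Y (y, 0))).symm
    rw [dPi_lift, dPi_lift]
  symm := by
    intro x u w
    have h1 := hd.metric (x, 0) (lift (extend₂ u) (x, 0)) (lift (extend₂ w) (x, 0))
    have h2 := hd.metric (x, 0) (lift (extend₂ w) (x, 0)) (lift (extend₂ u) (x, 0))
    rw [h.symm] at h1
    rw [dPi_lift, dPi_lift] at h1 h2
    simp only [extend_apply_self] at h1 h2
    rw [← h1, ← h2]
  pos := by
    intro x u hu
    have h1 := hd.metric (x, 0) (lift (extend₂ u) (x, 0)) (lift (extend₂ u) (x, 0))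
    have h2 := h.pos (x, 0) (lift (extend₂ u) (x, 0))
    rw [dPi_lift] at h1 h2
    simp only [extend_apply_self] at h1 h2
    rw [← h1]
    exact h2 hu

end Geom

/-! ### Null symmetries and the symmetry equation -/

section Symmetries
variable {q : Cov₂ I3 (S × ℝ)}
  {D : Conn[I3,ℝ² × ℝ,S × ℝ]}
  {qh : Cov₂ (𝓡 2) S}
  {omh : Cov (𝓡 2) S} {p : S × ℝ} {f v : S × ℝ → ℝ}

/-- The equation `Hess f + df ⊗ ω + ω ⊗ df = 0`, satisfied exactly if `f ℓ` is a symmetry. -/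
def SymmetryEquation (D : Conn[I3,ℝ² × ℝ,S × ℝ])
    (f : S × ℝ → ℝ) : Prop :=
  ∀ (p : S × ℝ) (u w : T[I3] p),
    hess D f p u w + ∂[I3] f p u * rotationForm D p w + rotationForm D p u * ∂[I3] f p w = 0

lemma bracket_smul_ell (hf : ∀ p, C∞[I3] f p) (Y : Vec I3 (S × ℝ)) (p : S × ℝ) :
    mlieBracket I3 (fun y ↦ f y • ell y) Y p = f p • mlieBracket I3 ell Y p - ∂[I3] f p (Y p) • ell p := by
  have := br_smul_left (Y := Y) ((hf p).mdiff) (ell_smooth p).fieldDiffAt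
  refine this.trans ?_
  abel

/-- The Lie derivative of `D` along `f ℓ` is the tensor of the symmetry equation times `ℓ`. -/
lemma HorizonGeom.lie_D_smul_ell (h : HorizonGeom q D) (hf : ∀ p, C∞[I3] f p) {Y Z : Vec I3 (S × ℝ)}
    (hY : V∞[I3] Y p) (hZ : V∞[I3] Z p) :
    mlieBracket I3 (fun y ↦ f y • ell y) (fun p' ↦ D Z p' (Y p')) p
      - (D Z p (mlieBracket I3 (fun y ↦ f y • ell y) Y p) + D (fun p' ↦ mlieBracket I3 (fun y ↦ f y • ell y) Z p') p (Y p)) =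
    (hess D f p (Y p) (Z p) + ∂[I3] f p (Y p) * rotationForm D p (Z p) + rotationForm D p (Y p) * ∂[I3] f p (Z p)) • ell p := by
  have hl := (ell_smooth p).fieldDiffAt
  have hfd := (hf p).mdifferentiableAt (n := ∞) (by simp)
  have hZf := FieldSmoothAt.contMDiffAt_mvfderiv hZ (hf p)
  have h1 : (fun p' ↦ mlieBracket I3 (fun y ↦ f y • ell y) Z p') =
      f • (fun p' ↦ mlieBracket I3 ell Z p') - (fun p' ↦ ∂[I3] f p' (Z p')) • ell := by
    ext1 p'; exact bracket_smul_ell hf Z p'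
  have hb : V∞[I3] (fun p' ↦ mlieBracket I3 ell Z p') p := br_smooth (ell_smooth p) hZ
  have ht := nab_torsion h.lc.torsion_free hl hZ.fieldDiffAt
  rw [h1, nab_sub D (hb.fieldDiffAt.smul hfd) (hl.smul (hZf.mdiff)),
    nab_smul D hfd hb.fieldDiffAt, nab_smul D (hZf.mdiff) hl,
    bracket_smul_ell hf, bracket_smul_ell hf, h.sym.lie_D p Y Z hY hZ, map_sub, map_smul, map_smul, hess_eq (hf p) hZ.fieldDiffAt,
    ← ht, h.nab_ell_eq, h.nab_ell_eq]
  module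

/-- Only the invariance of `D` is a condition on `f`: the Lie derivative of `q` along `f ℓ` is zero as `ℓ` is null. -/
lemma HorizonGeom.isSymmetryOf_smul_ell_iff (h : HorizonGeom q D) (hf : ∀ p, C∞[I3] f p) :
    IsSymmetryOf (fun p u w ↦ q p u w) D (fun p ↦ f p • ell p) ↔ SymmetryEquation D f := by
  constructor
  · intro hs p u w
    have h1 := h.lie_D_smul_ell hf (p := p) (fieldSmoothAt_extend_self u) (fieldSmoothAt_extend_self w)
    rw [hs.lie_D p _ _ (fieldSmoothAt_extend_self u) (fieldSmoothAt_extend_self w), sub_self] at h1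
    simp only [extend_apply_self] at h1
    exact (smul_ell_eq (p := p) ((zero_smul ℝ _).trans h1)).symm
  · intro hs
    refine ⟨fun p ↦ (ell_smooth p).smul (hf p), fun p Y Z hY hZ ↦ ?_, fun p Y Z hY hZ ↦ ?_⟩
    · have h1 := h.sym.lie_q p Y Z hY hZ
      rw [bracket_smul_ell hf, bracket_smul_ell hf, map_smul, h1]
      simp only [map_sub, map_smul, _root_.sub_apply, _root_.smul_apply, h.null, h.null', smul_eq_mul]
      ring
    · rw [← sub_eq_zero, h.lie_D_smul_ell hf hY hZ, hs, zero_smul]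

/-- The coefficient is the `dt`-component of the field, hence smooth. -/
lemma HorizonGeom.eq_smul_ell_of_null (h : HorizonGeom q D) {X : Vec I3 (S × ℝ)} (hX : ∀ p, V∞[I3] X p)
    (h0 : ∀ p, q p (X p) (X p) = 0) : ∃ f : S × ℝ → ℝ, (∀ p, C∞[I3] f p) ∧ X = fun p ↦ f p • ell p := by
  refine ⟨fun p ↦ ∂[I3] (Prod.snd : S × ℝ → ℝ) p (X p),
    fun p ↦ (hX p).contMDiffAt_mvfderiv (contMDiffAt_snd' (I := 𝓡 2) p), funext fun p ↦ eq_smul_ell ?_⟩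
  by_contra hne
  exact (h.pos p _ hne).ne' (h0 p)

lemma HorizonGeom.null_smul_ell (h : HorizonGeom q D) (p : S × ℝ) (a : ℝ) : q p (a • ell p) (a • ell p) = 0 := by
  rw [map_smul, h.null', smul_zero]

lemma hess_ell (h : HorizonGeom q D) (hf : ∀ p, C∞[I3] f p) (u : T[I3] p) :
    hess D f p u (ell p) = ∂[I3] (fun y ↦ ∂[I3] f y (ell y)) p u - rotationForm D p u * ∂[I3] f p (ell p) := by
  rw [hess_eq (hf p) (ell_smooth p).fieldDiffAt, h.nab_ell_eq, map_smul, smul_eq_mul]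

lemma mvfderiv_sub_affine (hf : ∀ p, C∞[I3] f p) (hv : ∀ p, C∞[I3] v p) (c a : ℝ)
    (w : T[I3] p) :
    ∂[I3] (fun y ↦ f y - (c * v y + a)) p w = ∂[I3] f p w - c * ∂[I3] v p w := by
  have hvd := (hv p).mdifferentiableAt (n := ∞) (by simp)
  have hcv : D¹[I3] (fun y ↦ c * v y) p := mdifferentiableAt_const.mul hvd
  have hca : D¹[I3] (fun y ↦ c * v y + a) p := hcv.add mdifferentiableAt_const
  rw [dd_sub ((hf p).mdiff) hca, dd_add hcv mdifferentiableAt_const,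
    dd_const_mul c hvd, dd_const, add_zero]

lemma sub_affine_smooth (hf : ∀ p, C∞[I3] f p) (hv : ∀ p, C∞[I3] v p) (c a : ℝ) (p : S × ℝ) :
    C∞[I3] (fun y ↦ f y - (c * v y + a)) p :=
  (hf p).sub ((contMDiffAt_const.mul (hv p)).add contMDiffAt_const)

lemma hess_sub_affine (hf : ∀ p, C∞[I3] f p) (hv : ∀ p, C∞[I3] v p) (c a : ℝ)
    (u w : T[I3] p) :
    hess D (fun y ↦ f y - (c * v y + a)) p u w = hess D f p u w - c * hess D v p u w := by
  obtain ⟨W, hW, rfl⟩ := exists_fieldSmoothAt w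
  have hfW := hW.fieldDiffAt.mdifferentiableAt_mvfderiv (hf p)
  have hvW := hW.fieldDiffAt.mdifferentiableAt_mvfderiv (hv p)
  rw [hess_eq (sub_affine_smooth hf hv c a p) hW.fieldDiffAt, hess_eq (hf p) hW.fieldDiffAt, hess_eq (hv p) hW.fieldDiffAt,
    mvfderiv_sub_affine hf hv]
  simp only [mvfderiv_sub_affine hf hv]
  have hcW : D¹[I3] (fun y ↦ c * ∂[I3] v y (W y)) p := mdifferentiableAt_const.mul hvW
  rw [dd_sub hfW hcW, dd_const_mul c hvW]
  ring

/-- The symmetry equation is linear and holds for constants. -/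
lemma SymmetryEquation.sub_affine (hf : ∀ p, C∞[I3] f p) (hv : ∀ p, C∞[I3] v p)
    (hfs : SymmetryEquation D f) (hvs : SymmetryEquation D v) (c a : ℝ) : SymmetryEquation D (fun y ↦ f y - (c * v y + a)) := by
  intro p u w
  rw [hess_sub_affine hf hv, mvfderiv_sub_affine hf hv, mvfderiv_sub_affine hf hv]
  linear_combination hfs p u w - c * hvs p u w

lemma SymmetryEquation.zero : SymmetryEquation D (fun _ : S × ℝ ↦ (0 : ℝ)) := by
  intro p u w
  have : hess D (fun _ : S × ℝ ↦ (0 : ℝ)) p u w = 0 := by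
    rw [← extend_apply_self (ℝ² × ℝ) w]
    rw [hess_eq contMDiffAt_const (fieldDiffAt_extend_self w)]
    simp only [dd_const, sub_zero]
  rw [this, dd_const, dd_const]
  ring

/-- The contraction of the symmetry equation with `ℓ` is `d(ℓ(f)) = 0`: the terms `ω ℓ(f)` cancel and `ω(ℓ) = 0`. -/
lemma SymmetryEquation.deriv_ell_const [PreconnectedSpace S] (h : HorizonGeom q D) (h0 : ∀ p, rotationForm D p (ell p) = 0)
    (hf : ∀ p, C∞[I3] f p) (hs : SymmetryEquation D f) (p p' : S × ℝ) :
    ∂[I3] f p (ell p) = ∂[I3] f p' (ell p') := by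
  refine eq_of_mvfderiv_eq_zero (I := I3) (f := fun y ↦ ∂[I3] f y (ell y)) (fun y ↦ (ell_smooth y).contMDiffAt_mvfderiv (hf y)) (fun y u ↦ ?_) p p'
  have := hs y u (ell y)
  rw [hess_ell h hf, h0] at this
  linarith

/-- A flow-invariant solution of the symmetry equation has a critical point by compactness, hence is constant. -/
lemma SymmetryEquation.const_of_deriv_ell [PreconnectedSpace S] [CompactSpace S] [Nonempty S] (h : HorizonGeom q D)
    (hf : ∀ p, C∞[I3] f p) (hs : SymmetryEquation D f) (hl : ∀ p, ∂[I3] f p (ell p) = 0) :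
    ∃ c, ∀ p, f p = c := by
  have hfc : Continuous f := continuous_iff_continuousAt.2 fun p ↦ (hf p).continuousAt
  obtain ⟨x₀, -, hx₀⟩ := isCompact_univ.exists_isMaxOn (univ_nonempty (α := S)) (f := fun x ↦ f (x, 0)) (by fun_prop)
  have hinv : ∀ p : S × ℝ, f p = f (p.1, 0) := fun p ↦ by
    have := eq_of_vertical_deriv (I := 𝓡 2) (f := f) (x := p.1) (c := 0) (fun t ↦ (hf _).mdiff) (fun t ↦ hl _) p.2
    rw [zero_mul, add_zero] at this
    exact this
  -- a maximum over the compact surface is a maximum over the whole cylinder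
  have hmax : ∀ p, f p ≤ f (x₀, 0) := fun p ↦ by rw [hinv p]; exact hx₀ (mem_univ p.1)
  have hcrit : ∀ u : T[I3] ((x₀, 0) : S × ℝ), ∂[I3] f (x₀, 0) u = 0 := by
    intro u
    rw [mvfderiv_eq_fderiv_chart (mem_chart_source _ _) ((hf _).mdiff)]
    have : IsLocalMax (f ∘ (extChartAt I3 ((x₀, 0) : S × ℝ)).symm) (extChartAt I3 ((x₀, 0) : S × ℝ) (x₀, 0)) := by
      refine Eventually.of_forall fun z ↦ ?_
      simp only [Function.comp_apply, extChartAt_to_inv]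
      exact hmax _
    rw [this.fderiv_eq_zero]
    rfl
  refine ⟨f (x₀, 0), const_of_critical_point (I := I3) hf (fun x ↦ ?_) hcrit⟩
  -- the symmetry equation expresses the second derivatives of `f` by the derivative of `f` along a field
  refine ⟨fun i j ↦ (fun y ↦ D (coordField I3 x j) y (coordField I3 x i y)) - (fun y ↦ rotationForm D y (coordField I3 x j y)) • coordField I3 x i
    - (fun y ↦ rotationForm D y (coordField I3 x i y)) • coordField I3 x j, fun i j ↦ ?_, fun i j ↦ ?_⟩
  · exact ((h.conn x _ _ (coordField_smooth_self i) (coordField_smooth_self j)).sub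
      ((coordField_smooth_self i).smul (h.rotationForm_smooth x _ (coordField_smooth_self j)))).sub
      ((coordField_smooth_self j).smul (h.rotationForm_smooth x _ (coordField_smooth_self i)))
  · filter_upwards [(chartAt (ModelProd ℝ² ℝ) x).open_source.mem_nhds (mem_chart_source _ x)] with y hy
    have h1 := hs y (coordField I3 x i y) (coordField I3 x j y)
    rw [hess_eq (hf y) (coordField_smooth hy j).fieldDiffAt] at h1
    refine Eq.trans ?_ (map_sub (∂[I3] f y) (D (coordField I3 x j) y (coordField I3 x i y) - rotationForm D y (coordField I3 x j y) • coordField I3 x i y) (rotationForm D y (coordField I3 x i y) • coordField I3 x j y)).symm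
    rw [map_sub, map_smul, map_smul, smul_eq_mul, smul_eq_mul]
    linarith

lemma IsFoliationFunction.smoothAt (hv : IsFoliationFunction v) (p : S × ℝ) : C∞[I3] v p := hv.1 p

/-- All solutions of the symmetry equation are affine functions of a given nonconstant one. -/
lemma SymmetryEquation.eq_affine [PreconnectedSpace S] [CompactSpace S] [Nonempty S] (h : HorizonGeom q D)
    (h0 : ∀ p, rotationForm D p (ell p) = 0) (hv : IsFoliationFunction v) (hvs : SymmetryEquation D v)
    (hf : ∀ p, C∞[I3] f p) (hs : SymmetryEquation D f) : ∃ c a : ℝ, ∀ p, f p = c * v p + a := by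
  obtain ⟨x₀⟩ := ‹Nonempty S›
  -- the function `f - c v` is flow-invariant for this constant `c`
  set c := ∂[I3] f (x₀, 0) (ell (x₀, 0)) with hc
  obtain ⟨a, ha⟩ := SymmetryEquation.const_of_deriv_ell h (sub_affine_smooth hf hv.smoothAt c 0) (hs.sub_affine hf hv.smoothAt hvs c 0) (fun p ↦ by
    rw [mvfderiv_sub_affine hf hv.smoothAt, hv.2, hs.deriv_ell_const h h0 hf p (x₀, 0), ← hc]; ring)
  exact ⟨c, a, fun p ↦ by linarith [ha p]⟩

/-- A symmetry along the null generators that is not a multiple of `ℓ` is the same as a solution `v` of the symmetry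
equation with `ℓ(v) = 1`. -/
lemma HorizonGeom.exists_symmetry_iff [PreconnectedSpace S] [CompactSpace S] [Nonempty S] (h : HorizonGeom q D)
    (h0 : ∀ p, rotationForm D p (ell p) = 0) :
    (∃ X, (IsSymmetryOf (fun p u w ↦ q p u w) D X ∧ ∀ p, q p (X p) (X p) = 0) ∧ ¬ ∃ c : ℝ, X = c • ell) ↔
      ∃ v, IsFoliationFunction v ∧ SymmetryEquation D v := by
  constructor
  · rintro ⟨X, ⟨hX, hn⟩, hne⟩
    obtain ⟨f, hf, rfl⟩ := h.eq_smul_ell_of_null hX.smooth hn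
    have hs := (h.isSymmetryOf_smul_ell_iff hf).1 hX
    obtain ⟨x₀⟩ := ‹Nonempty S›
    set c := ∂[I3] f (x₀, 0) (ell (x₀, 0)) with hc
    have hcp : ∀ p, ∂[I3] f p (ell p) = c := fun p ↦ hs.deriv_ell_const h h0 hf p (x₀, 0)
    by_cases hc0 : c = 0
    · -- if `ℓ(f) = 0` then `f` is constant and `f ℓ` is a multiple of `ℓ`
      obtain ⟨a, ha⟩ := hs.const_of_deriv_ell h hf (fun p ↦ by rw [hcp, hc0])
      exact absurd ⟨a, funext fun p ↦ by simp only [ha]; rfl⟩ hne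
    · have hz : ∀ p : S × ℝ, C∞[I3] (fun _ : S × ℝ ↦ (0 : ℝ)) p := fun p ↦ contMDiffAt_const
      -- the function `f / c`, written so that linearity of the equation applies
      refine ⟨fun y ↦ 0 - (-c⁻¹ * f y + 0), ⟨fun p ↦ sub_affine_smooth hz hf _ _ p, fun p ↦ ?_⟩, SymmetryEquation.zero.sub_affine hz hf hs _ _⟩
      rw [mvfderiv_sub_affine hz hf, dd_const, hcp]
      field_simp
      ring
  · rintro ⟨v, hv, hs⟩
    refine ⟨fun p ↦ v p • ell p, ⟨(h.isSymmetryOf_smul_ell_iff hv.smoothAt).2 hs, fun p ↦ ?_⟩, ?_⟩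
    · exact h.null_smul_ell p _
    · rintro ⟨c, hc⟩
      have hvc : v = fun _ ↦ c := funext fun p ↦ smul_ell_eq (p := p) (congrFun hc p)
      obtain ⟨x₀⟩ := ‹Nonempty S›
      have := hv.2 (x₀, 0)
      rw [hvc, dd_const] at this
      exact zero_ne_one this

/-- The null symmetries form the span of `ℓ` and `v ℓ`, for any solution `v` of the symmetry equation with `ℓ(v) = 1`. -/
lemma HorizonGeom.symmetries_eq_span [PreconnectedSpace S] [CompactSpace S] [Nonempty S] (h : HorizonGeom q D)
    (h0 : ∀ p, rotationForm D p (ell p) = 0) (hv : IsFoliationFunction v) (hvs : SymmetryEquation D v) :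
    {X | IsSymmetryOf (fun p u w ↦ q p u w) D X ∧ ∀ p, q p (X p) (X p) = 0} =
      (Submodule.span ℝ {ell, fun p ↦ v p • ell p} : Set (Vec I3 (S × ℝ))) := by
  ext X
  rw [SetLike.mem_coe, Submodule.mem_span_pair]
  constructor
  · rintro ⟨hX, hn⟩
    obtain ⟨f, hf, rfl⟩ := h.eq_smul_ell_of_null hX.smooth hn
    obtain ⟨c, a, hca⟩ := SymmetryEquation.eq_affine h h0 hv hvs hf ((h.isSymmetryOf_smul_ell_iff hf).1 hX)
    refine ⟨a, c, funext fun p ↦ ?_⟩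
    rw [hca]
    exact (by module : a • ell p + c • (v p • ell p) = (c * v p + a) • ell p)
  · rintro ⟨a, c, rfl⟩
    have hz : ∀ p : S × ℝ, C∞[I3] (fun _ : S × ℝ ↦ (0 : ℝ)) p := fun p ↦ contMDiffAt_const
    have hX : a • (ell : Vec I3 (S × ℝ)) + c • (fun p ↦ v p • ell p) = fun p ↦ (0 - (-c * v p + -a)) • ell p :=
      funext fun p ↦ (by module : a • ell p + c • (v p • ell p) = (0 - (-c * v p + -a)) • ell p)
    rw [hX]
    refine ⟨(h.isSymmetryOf_smul_ell_iff (sub_affine_smooth hz hv.smoothAt _ _)).2 (SymmetryEquation.zero.sub_affine hz hv.smoothAt hvs _ _), fun p ↦ ?_⟩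
    exact h.null_smul_ell p _

lemma linearIndependent_ell [Nonempty S] (hv : IsFoliationFunction v) :
    LinearIndependent ℝ ![(ell : Vec I3 (S × ℝ)), fun p ↦ v p • ell p] := by
  rw [LinearIndependent.pair_iff]
  intro a c hac
  have hp : ∀ p, a + c * v p = 0 := fun p ↦ by
    apply smul_ell_eq (p := p)
    rw [zero_smul]
    refine Eq.trans ?_ (congrFun hac p)
    exact (by module : (a + c * v p) • ell p = a • ell p + c • (v p • ell p))
  obtain ⟨x₀⟩ := ‹Nonempty S›
  have hc : c = 0 := by
    have h1 := mvfderiv_sub_affine (f := fun _ ↦ 0) (p := (x₀, (0 : ℝ))) (fun p ↦ contMDiffAt_const) hv.smoothAt c a (ell (x₀, 0))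
    rw [hv.2, dd_const, dd_eventually_const (c := 0) (Eventually.of_forall fun p ↦ by linarith [hp p])] at h1
    linarith
  refine ⟨?_, hc⟩
  have := hp (x₀, 0)
  rw [hc] at this
  linarith

lemma bracket_ell_smul_ell (hv : IsFoliationFunction v) (p : S × ℝ) :
    mlieBracket I3 ell (fun p' ↦ v p' • ell p') p = ell p := by
  rw [br_swap, bracket_smul_ell hv.smoothAt, hv.2, congrFun (mlieBracket_self (I := I3)) p]
  exact (by module : -(v p • (0 : T[I3] p) - (1 : ℝ) • ell p) = ell p)

end Symmetries

/-! ### Uniqueness of the connection and null symmetry maps -/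

section Maps
variable {q : Cov₂ I3 (S × ℝ)}
  {D D' : Conn[I3,ℝ² × ℝ,S × ℝ]}
  {qh : Cov₂ (𝓡 2) S}
  {omh : Cov (𝓡 2) S} {p : S × ℝ} {f v : S × ℝ → ℝ}

/-- A tangent vector is determined by its projection to the surface and its derivative of `v`. -/
lemma IsFoliationFunction.tangent_ext (hv : IsFoliationFunction v) {u w : T[I3] p} (h1 : dPi p u = dPi p w)
    (h2 : ∂[I3] v p u = ∂[I3] v p w) : u = w := by
  have h3 := eq_smul_ell (p := p) (u := u - w) (by rw [map_sub, h1, sub_self])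
  have h4 : ∂[I3] v p (u - w) = 0 := by rw [map_sub, h2, sub_self]
  rw [h3, map_smul, hv.2, smul_eq_mul, mul_one] at h4
  rw [h4, zero_smul] at h3
  exact sub_eq_zero.1 h3

/-- The symmetry equation, read as a formula for the `df`-component of `D_u Z`. -/
lemma SymmetryEquation.deriv_nab (hf : ∀ p, C∞[I3] f p) (hs : SymmetryEquation D f) {Z : Vec I3 (S × ℝ)}
    (hZ : V¹[I3] Z p) (u : T[I3] p) : ∂[I3] f p (D Z p u) =
      ∂[I3] (fun y ↦ ∂[I3] f y (Z y)) p u + ∂[I3] f p u * rotationForm D p (Z p) + rotationForm D p u * ∂[I3] f p (Z p) := by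
  have := hs p u (Z p)
  rw [hess_eq (hf p) hZ] at this
  linarith

lemma HorizonGeom.koszul (h : HorizonGeom q D) {Z : Vec I3 (S × ℝ)} (hZ : V¹[I3] Z p) (u w : T[I3] p) :
    2 * q p (D Z p u) w = koszul q (extend (ℝ² × ℝ) u) Z (extend (ℝ² × ℝ) w) p := by
  rw [← h.lc.koszul h.symm (fieldDiffAt_extend_self u) hZ (fieldDiffAt_extend_self w), extend_apply_self, extend_apply_self]

/-- The connection of an extremal null-symmetric horizon is determined by `q`, `ω` and the function `v`. -/
lemma HorizonGeom.unique (h : HorizonGeom q D) (h' : HorizonGeom q D') (hω : rotationForm D = rotationForm D') (hv : IsFoliationFunction v)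
    (hs : SymmetryEquation D v) (hs' : SymmetryEquation D' v) {Z : Vec I3 (S × ℝ)} (hZ : V¹[I3] Z p)
    (u : T[I3] p) : D Z p u = D' Z p u := by
  refine hv.tangent_ext (h.dPi_eq fun w ↦ ?_) ?_
  · have := (h.koszul hZ u w).trans (h'.koszul hZ u w).symm
    linarith
  · rw [hs.deriv_nab hv.smoothAt hZ, hs'.deriv_nab hv.smoothAt hZ, hω]

lemma mdiff_diffeo (φ : Diffeomorph I3 I3 (S × ℝ) (S × ℝ) ∞) (p : S × ℝ) : MDifferentiableAt I3 I3 φ p :=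
  φ.contMDiff.contMDiffAt.mdiff

/-- The rotation form is a pullback from the surface, so every map preserving the null geodesics preserves it. -/
lemma GeomData.rotationForm_map (h : HorizonGeom q D) (hd : GeomData q D qh omh) {φ : Diffeomorph I3 I3 (S × ℝ) (S × ℝ) ∞}
    (hφ : ∀ p, (φ p).1 = p.1) (p : S × ℝ) (u : T[I3] p) :
    rotationForm D (φ p) (mfderiv I3 I3 φ p u) = rotationForm D p u := by
  rw [hd.rotationForm_eq h, pull_apply, pull_apply]
  have h1 := dPi_mfderiv_of_fibre (mdiff_diffeo φ p) hφ u
  have h2 : ∀ x y : S, x = y → ∀ z : ℝ², omh x z = omh y z := by rintro x _ rfl z; rfl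
  exact (congrArg (omh (φ p).1) h1).trans (h2 _ _ (hφ p) _)

/-- The metric is a pullback from the surface, so every map preserving the null geodesics preserves it. -/
lemma GeomData.q_map (hd : GeomData q D qh omh) {φ : Diffeomorph I3 I3 (S × ℝ) (S × ℝ) ∞}
    (hφ : ∀ p, (φ p).1 = p.1) (p : S × ℝ) (u w : T[I3] p) :
    q (φ p) (mfderiv I3 I3 φ p u) (mfderiv I3 I3 φ p w) = q p u w := by
  rw [hd.metric, hd.metric]
  have h1 := dPi_mfderiv_of_fibre (mdiff_diffeo φ p) hφ u
  have h1' := dPi_mfderiv_of_fibre (mdiff_diffeo φ p) hφ w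
  have h2 : ∀ x y : S, x = y → ∀ z z' : ℝ², qh x z z' = qh y z z' := by rintro x _ rfl z z'; rfl
  exact (congrArg₂ (fun a b ↦ qh (φ p).1 a b) h1 h1').trans (h2 _ _ (hφ p) _ _)

lemma mvfderiv_comp_diffeo (φ : Diffeomorph I3 I3 (S × ℝ) (S × ℝ) ∞) (hf : ∀ p, C∞[I3] f p) (p : S × ℝ) (u : T[I3] p) :
    ∂[I3] (fun y ↦ f (φ y)) p u = ∂[I3] f (φ p) (mfderiv I3 I3 φ p u) :=
  mvfderiv_comp' p ((hf _).mdiff) (mdiff_diffeo φ p) u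

lemma comp_diffeo_smooth (φ : Diffeomorph I3 I3 (S × ℝ) (S × ℝ) ∞) (hf : ∀ p, C∞[I3] f p) (p : S × ℝ) :
    C∞[I3] (fun y ↦ f (φ y)) p :=
  ContMDiffAt.comp p (hf _) φ.contMDiff.contMDiffAt

/-- The derivative of `Z'(f)` along a field `φ`-related to `Z`. -/
lemma mvfderiv_related (φ : Diffeomorph I3 I3 (S × ℝ) (S × ℝ) ∞) (hf : ∀ p, C∞[I3] f p) {Z Z' : Vec I3 (S × ℝ)}
    (hZ' : V¹[I3] Z' (φ p)) (hZZ : ∀ᶠ p' in 𝓝 p, Z' (φ p') = mfderiv I3 I3 φ p' (Z p')) (u : T[I3] p) :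
    ∂[I3] (fun y ↦ ∂[I3] (fun y ↦ f (φ y)) y (Z y)) p u =
      ∂[I3] (fun y ↦ ∂[I3] f y (Z' y)) (φ p) (mfderiv I3 I3 φ p u) := by
  rw [← mvfderiv_comp' p (hZ'.mdifferentiableAt_mvfderiv (hf _)) (mdiff_diffeo φ p) u]
  refine congrArg (fun L : T[I3] p →L[ℝ] ℝ ↦ L u) (mvfderiv_congr ?_)
  filter_upwards [hZZ] with y hy
  rw [mvfderiv_comp_diffeo φ hf, hy]

/-- A diffeomorphism preserving the null geodesics preserves `D` exactly if it maps `v` to an affine function of `v`: it always preserves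
the projection of `D` to the surface, and the remaining component of `D` is determined by the symmetry equation for `v`. -/
lemma HorizonGeom.nullSymmetryMap_iff [PreconnectedSpace S] [CompactSpace S] [Nonempty S] (h : HorizonGeom q D) (hd : GeomData q D qh omh)
    (hv : IsFoliationFunction v) (hs : SymmetryEquation D v) (φ : Diffeomorph I3 I3 (S × ℝ) (S × ℝ) ∞) (hφ : ∀ p, (φ p).1 = p.1) :
    (∀ (p : S × ℝ) (Z Z' : Vec I3 (S × ℝ)),
      V¹[I3] Z p → V¹[I3] Z' (φ p) → (∀ᶠ p' in 𝓝 p, Z' (φ p') = mfderiv I3 I3 φ p' (Z p')) →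
      ∀ u : T[I3] p, D Z' (φ p) (mfderiv I3 I3 φ p u) = mfderiv I3 I3 φ p (D Z p u)) ↔
    ∃ c a : ℝ, ∀ p, v (φ p) = c * v p + a := by
  have h0 : ∀ p, rotationForm D p (ell p) = 0 := fun p ↦ by rw [hd.rotationForm_eq h, pull_apply, dPi_ell, map_zero]
  have hf := comp_diffeo_smooth φ hv.smoothAt
  constructor
  · intro hD
    -- if `φ` preserves `D` and `ω` then it maps solutions of the symmetry equation to solutions
    refine SymmetryEquation.eq_affine h h0 hv hs (f := fun y ↦ v (φ y)) hf fun p u w ↦ ?_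
    obtain ⟨W, hW, rfl⟩ := exists_fieldSmoothAt w
    have hW' := (pushField_smooth φ hW).fieldDiffAt
    have hWW : ∀ᶠ p' in 𝓝 p, pushField φ W (φ p') = mfderiv I3 I3 φ p' (W p') := Eventually.of_forall (pushField_apply φ W)
    have h1 := hs.deriv_nab hv.smoothAt hW' (mfderiv I3 I3 φ p u)
    rw [hD p W _ hW.fieldDiffAt hW' hWW, ← mvfderiv_comp_diffeo φ hv.smoothAt, ← mvfderiv_comp_diffeo φ hv.smoothAt,
      ← mvfderiv_related φ hv.smoothAt hW' hWW, pushField_apply, ← mvfderiv_comp_diffeo φ hv.smoothAt, hd.rotationForm_map h hφ, hd.rotationForm_map h hφ] at h1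
    rw [hess_eq (hf p) hW.fieldDiffAt]
    linarith
  · rintro ⟨c, a, hca⟩ p Z Z' hZ hZ' hZZ u
    have hfs : SymmetryEquation D (fun y ↦ v (φ y)) := by
      have hz : ∀ p : S × ℝ, C∞[I3] (fun _ : S × ℝ ↦ (0 : ℝ)) p := fun p ↦ contMDiffAt_const
      have := (SymmetryEquation.zero (D := D)).sub_affine hz hv.smoothAt hs (-c) (-a)
      have e : (fun y ↦ v (φ y)) = fun y ↦ 0 - (-c * v y + -a) := funext fun y ↦ by rw [hca]; ring
      rw [e]; exact this
    refine hv.tangent_ext (h.dPi_eq fun w ↦ ?_) ?_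
    · obtain ⟨w, rfl⟩ : ∃ w', mfderiv I3 I3 φ p w' = w := by
        refine ⟨(φ.mfderivToContinuousLinearEquiv (by simp) p).symm w, ?_⟩
        exact (φ.mfderivToContinuousLinearEquiv (by simp) p).apply_symm_apply w
      rw [hd.q_map hφ]
      have hext : ∀ w : T[I3] p, pushField φ (extend (ℝ² × ℝ) w) (φ p) = mfderiv I3 I3 φ p w := fun w ↦ by
        rw [pushField_apply, extend_apply_self]
      have hsm : ∀ w : T[I3] p, V¹[I3] (pushField φ (extend (ℝ² × ℝ) w)) (φ p) :=
        fun w ↦ (pushField_smooth φ (fieldSmoothAt_extend_self w)).fieldDiffAt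
      -- the projections agree by naturality of the Koszul formula under `φ`
      have h1 := h.koszul hZ u w
      have h2 := h.lc.koszul h.symm (hsm u) hZ' (hsm w)
      rw [hext, hext] at h2
      have h3 := koszul_pullback (f := φ) (y := p) (gM := q) (gN := q) φ.contMDiff.contMDiffAt (h.smooth _) (Eventually.of_forall fun z u w ↦ (hd.q_map hφ z u w).symm)
        (fieldDiffAt_extend_self u) hZ (fieldDiffAt_extend_self w) (hsm u) hZ' (hsm w)
        (Eventually.of_forall fun z ↦ (pushField_apply φ _ z).symm) (hZZ.mono fun z hz ↦ hz.symm) (Eventually.of_forall fun z ↦ (pushField_apply φ _ z).symm)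
      linarith
    · -- the `dv`-components agree as `v` and `v ∘ φ` both solve the symmetry equation
      rw [hs.deriv_nab hv.smoothAt hZ', ← mvfderiv_comp_diffeo φ hv.smoothAt, ← mvfderiv_comp_diffeo φ hv.smoothAt, hfs.deriv_nab hf hZ,
        ← mvfderiv_related φ hv.smoothAt hZ' hZZ, hZZ.self_of_nhds, ← mvfderiv_comp_diffeo φ hv.smoothAt, hd.rotationForm_map h hφ, hd.rotationForm_map h hφ]

end Maps

/-! ### Projection to the surface of null geodesics -/

section Projection

lemma exists_orthonormal_of_pos {x : S} {g : T[𝓡 2] x →L[ℝ] T[𝓡 2] x →L[ℝ] ℝ} (hs : ∀ u w, g u w = g w u)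
    (hp : ∀ u, u ≠ 0 → 0 < g u u) : ∃ b : Module.Basis (Fin 2) ℝ (T[𝓡 2] x), ∀ i j, g (b i) (b j) = if i = j then 1 else 0 := by
  let B : LinearMap.BilinForm ℝ (T[𝓡 2] x) := LinearMap.mk₂ ℝ (fun u w ↦ g u w)
    (fun u u' w ↦ by rw [map_add]; rfl) (fun c u w ↦ by rw [map_smul]; rfl) (fun u w w' ↦ map_add (g u) _ _) (fun c u w ↦ map_smul (g u) _ _)
  have hB : LinearMap.IsSymm B := ⟨fun u w ↦ hs u w⟩
  obtain ⟨b, hb⟩ := LinearMap.BilinForm.exists_orthogonal_basis hB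
  have hf : Module.finrank ℝ (T[𝓡 2] x) = 2 := finrank_euclideanSpace_fin
  let b' := b.reindex (finCongr hf)
  have hb' : ∀ i j, i ≠ j → g (b' i) (b' j) = 0 := fun i j hij ↦ by
    have := LinearMap.isOrthoᵢ_def.1 hb ((finCongr hf).symm i) ((finCongr hf).symm j) (fun h ↦ hij ((finCongr hf).symm.injective h))
    simp only [b', Module.Basis.reindex_apply]
    exact this
  have hpos : ∀ i, 0 < g (b' i) (b' i) := fun i ↦ hp _ (b'.ne_zero i)
  refine ⟨b'.isUnitSMul (w := fun i ↦ (Real.sqrt (g (b' i) (b' i)))⁻¹) (fun i ↦ (inv_ne_zero (Real.sqrt_pos.2 (hpos i)).ne').isUnit), fun i j ↦ ?_⟩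
  rw [Module.Basis.isUnitSMul_apply, Module.Basis.isUnitSMul_apply, map_smul, map_smul, _root_.smul_apply, smul_eq_mul, smul_eq_mul]
  split_ifs with hij
  · subst hij
    have := Real.mul_self_sqrt (hpos i).le
    have h2 := (Real.sqrt_pos.2 (hpos i)).ne'
    field_simp
    rw [sq, this]
  · rw [hb' i j hij]; ring

/-- A vector field through `u` that projects to the space of null geodesics. -/
def projField (p : S × ℝ) (u : T[I3] p) : Vec I3 (S × ℝ) :=
  lift (extend₂ (dPi p u)) + (fun _ : S × ℝ ↦ ∂[I3] (Prod.snd : S × ℝ → ℝ) p u) • ell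

lemma projField_smooth' (p : S × ℝ) (u : T[I3] p) {p' : S × ℝ}
    (h : FieldSmoothAt (𝓡 2) (extend₂ (dPi p u)) p'.1) : V∞[I3] (projField p u) p' :=
  (lift_smooth (I := 𝓡 2) (p := p') h).add ((ell_smooth p').smul contMDiffAt_const)

lemma projField_smooth (p : S × ℝ) (u : T[I3] p) : V∞[I3] (projField p u) p :=
  projField_smooth' p u (fieldSmoothAt_extend_self _)

lemma dPi_projField (p : S × ℝ) (u : T[I3] p) (p' : S × ℝ) :
    dPi p' (projField p u p') = extend₂ (dPi p u) p'.1 := by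
  refine (map_add (dPi p') (lift _ p') (∂[I3] (Prod.snd : S × ℝ → ℝ) p u • ell p')).trans ?_
  rw [dPi_lift, map_smul, dPi_ell, smul_zero, add_zero]

lemma projField_self (p : S × ℝ) (u : T[I3] p) : projField p u p = u := (prod_decomp (I := 𝓡 2) p u).symm

variable {qh : Cov₂ (𝓡 2) S}

lemma IsRiemannian.isPseudoMetric (h : IsRiemannian (𝓡 2) qh) : IsPseudoMetric (𝓡 2) (fun _ : Fin 2 ↦ (1 : ℝ)) qh where
  smooth := h.smooth
  symm := h.symm
  sign := by simp
  frame := fun x ↦ exists_orthonormal_of_pos (h.symm x) (h.pos x)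

variable {q : Cov₂ I3 (S × ℝ)}
  {D : Conn[I3,ℝ² × ℝ,S × ℝ]}
  {omh : Cov (𝓡 2) S} {p : S × ℝ}
  {nabh : Conn[𝓡 2,ℝ²,S]}

/-- The connection of the horizon projects to the Levi-Civita connection of the space of null geodesics. -/
lemma GeomData.dPi_nab (h : HorizonGeom q D) (hd : GeomData q D qh omh) (hn : IsLeviCivita (𝓡 2) qh nabh)
    {Z : Vec I3 (S × ℝ)} {Zh : Vec (𝓡 2) S} (hZ : V¹[I3] Z p) (hZh : FieldDiffAt (𝓡 2) Zh p.1)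
    (hZZ : ∀ᶠ p' in 𝓝 p, dPi p' (Z p') = Zh p'.1) (u : T[I3] p) :
    dPi p (D Z p u) = nabh Zh p.1 (dPi p u) := by
  have hr := hd.riemannian h
  refine hr.isPseudoMetric.ext fun w ↦ ?_
  set U := extend₂ (dPi p u) with hU
  set W := extend₂ w with hW
  have hUs : FieldSmoothAt (𝓡 2) U p.1 := fieldSmoothAt_extend_self _
  have hWs : FieldSmoothAt (𝓡 2) W p.1 := fieldSmoothAt_extend_self _
  have hU' := projField_smooth p u
  have hVU := dPi_projField p u
  have hVu := projField_self p u
  have hW' := lift_smooth (I := 𝓡 2) (p := p) hWs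
  have hU1 : U p.1 = dPi p u := extend_apply_self _ _
  have hW1 : W p.1 = w := extend_apply_self _ _
  have h1 := h.lc.koszul h.symm hU'.fieldDiffAt hZ hW'.fieldDiffAt
  have h2 := hn.koszul hr.symm hUs.fieldDiffAt hZh hWs.fieldDiffAt
  have h3 := koszul_pullback (f := Prod.fst) (y := p) (gM := qh) (gN := q) (contMDiffAt_fst' (I := 𝓡 2) p) (hr.smooth _)
    (Eventually.of_forall fun z u w ↦ hd.metric z u w)
    hU'.fieldDiffAt hZ hW'.fieldDiffAt hUs.fieldDiffAt hZh hWs.fieldDiffAt (Eventually.of_forall hVU) hZZ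
    (Eventually.of_forall fun z ↦ dPi_lift W z)
  rw [h3, ← h2, hd.metric, dPi_lift, hVu, hU1, hW1] at h1
  linarith

lemma dPi_bracket {Y Z : Vec I3 (S × ℝ)} {Y' Z' : Vec (𝓡 2) S}
    (hY : V¹[I3] Y p) (hZ : V¹[I3] Z p) (hY' : FieldDiffAt (𝓡 2) Y' p.1)
    (hZ' : FieldDiffAt (𝓡 2) Z' p.1) (hYY : ∀ᶠ q in 𝓝 p, dPi q (Y q) = Y' q.1) (hZZ : ∀ᶠ q in 𝓝 p, dPi q (Z q) = Z' q.1) :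
    dPi p (mlieBracket I3 Y Z p) = mlieBracket (𝓡 2) Y' Z' p.1 :=
  dfst_bracket (I := 𝓡 2) hY hZ hY' hZ' hYY hZZ

lemma GeomData.dPi_nab_nab (h : HorizonGeom q D) (hd : GeomData q D qh omh) (hn : IsLeviCivita (𝓡 2) qh nabh)
    {V W : Vec I3 (S × ℝ)} {Vh Wh : Vec (𝓡 2) S} (hV : V∞[I3] V p) (hW : V∞[I3] W p)
    (hVh : FieldSmoothAt (𝓡 2) Vh p.1) (hWh : FieldSmoothAt (𝓡 2) Wh p.1)
    (hVV : ∀ p', dPi p' (V p') = Vh p'.1) (hWW : ∀ p', dPi p' (W p') = Wh p'.1) (u : T[I3] p) :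
    dPi p (D (fun y ↦ D W y (V y)) p u) = nabh (fun y ↦ nabh Wh y (Vh y)) p.1 (dPi p u) := by
  have hnc := hn.isSmoothConn (hd.riemannian h).isPseudoMetric
  refine hd.dPi_nab h hn (h.conn p V W hV hW).fieldDiffAt (hnc p.1 Vh Wh hVh hWh).fieldDiffAt ?_ u
  have h1 : ∀ᶠ p' in 𝓝 p, FieldDiffAt (𝓡 2) Wh p'.1 := (continuous_fst.tendsto p).eventually hWh.eventually_fieldDiffAt
  filter_upwards [hW.eventually_fieldDiffAt, h1] with p' h2 h3
  rw [hd.dPi_nab h hn h2 h3 (Eventually.of_forall hWW), hVV]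

/-- The curvature of the horizon projects to the curvature of the space of null geodesics. -/
lemma GeomData.dPi_curvature (h : HorizonGeom q D) (hd : GeomData q D qh omh) (hn : IsLeviCivita (𝓡 2) qh nabh)
    (u v w : T[I3] p) :
    dPi p (curvature I3 D p u v w) = curvature (𝓡 2) nabh p.1 (dPi p u) (dPi p v) (dPi p w) := by
  have e : curvature I3 D p u v w = curvField D (projField p u) (projField p v) (projField p w) p := by
    rw [← curvature_eq_curvField h.conn (projField_smooth p u) (projField_smooth p v) (projField_smooth p w), projField_self, projField_self, projField_self]
  have hs : ∀ z : T[I3] p, FieldSmoothAt (𝓡 2) (extend₂ (dPi p z)) p.1 := fun z ↦ fieldSmoothAt_extend_self _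
  rw [e, curvature_eq_curvField_extend, curvField, curvField, map_sub, map_sub,
    hd.dPi_nab_nab h hn (projField_smooth p v) (projField_smooth p w) (hs v) (hs w) (dPi_projField p v) (dPi_projField p w),
    hd.dPi_nab_nab h hn (projField_smooth p u) (projField_smooth p w) (hs u) (hs w) (dPi_projField p u) (dPi_projField p w),
    hd.dPi_nab h hn (projField_smooth p w).fieldDiffAt (hs w).fieldDiffAt (Eventually.of_forall (dPi_projField p w)),
    dPi_bracket (projField_smooth p u).fieldDiffAt (projField_smooth p v).fieldDiffAt (hs u).fieldDiffAt (hs v).fieldDiffAt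
      (Eventually.of_forall (dPi_projField p u)) (Eventually.of_forall (dPi_projField p v)), dPi_projField, dPi_projField]

/-- The curvature components along `ℓ` follow from the invariance of `D` under the flow of `ℓ`. -/
lemma GeomData.curvature_ell (h : HorizonGeom q D) (hd : GeomData q D qh omh) (hn : IsLeviCivita (𝓡 2) qh nabh)
    (w v : T[I3] p) :
    curvature I3 D p (ell p) w v =
      -(covDerivForm (𝓡 2) nabh (fun y z ↦ omh y z) p.1 (dPi p w) (dPi p v) + omh p.1 (dPi p w) * omh p.1 (dPi p v)) • ell p := by
  set W := projField p w with hWdef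
  set V := projField p v with hVdef
  have hW : V∞[I3] W p := projField_smooth p w
  have hV : V∞[I3] V p := projField_smooth p v
  have e : curvature I3 D p (ell p) w v = curvField D ell W V p := by
    rw [← curvature_eq_curvField h.conn (ell_smooth p) hW hV, hWdef, hVdef, projField_self, projField_self]
  have hω := hd.rotationForm_eq h
  -- torsion-freeness turns `D_ℓ X` into the bracket `[ℓ, X]` and the rotation form
  have hl : ∀ X : Vec I3 (S × ℝ), ∀ p', V∞[I3] X p' → D X p' (ell p') = mlieBracket I3 ell X p' + rotationForm D p' (X p') • ell p' := by
    intro X p' hX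
    rw [← nab_torsion h.lc.torsion_free (ell_smooth p').fieldDiffAt hX.fieldDiffAt, h.nab_ell_eq, sub_add_cancel]
  have hl' : ∀ᶠ p' in 𝓝 p, D V p' (ell p') = mlieBracket I3 ell V p' + rotationForm D p' (V p') • ell p' := by
    filter_upwards [hV.eventually_fieldDiffAt] with p' hp'
    rw [← nab_torsion h.lc.torsion_free (ell_smooth p').fieldDiffAt hp', h.nab_ell_eq, sub_add_cancel]
  have hωV := h.rotationForm_smooth p V hV
  have hb : V∞[I3] (mlieBracket I3 ell V) p := br_smooth (ell_smooth p) hV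
  have h2 := nab_congr (u := W p) D (X := mlieBracket I3 ell V + (fun p' ↦ rotationForm D p' (V p')) • ell)
    (hb.add ((ell_smooth p).smul hωV)).fieldDiffAt hl'
  rw [nab_add D hb.fieldDiffAt ((ell_smooth p).smul hωV).fieldDiffAt, nab_smul D (hωV.mdiff) (ell_smooth p).fieldDiffAt] at h2
  rw [e, curvField, hl _ p (h.conn p W V hW hV), h.sym.lie_D p W V hW hV, h2, h.nab_ell_eq]
  -- the covariant derivative of the rotation form is a pullback
  have h3 : rotationForm D p (D V p (W p)) = omh p.1 (nabh (extend₂ (dPi p v)) p.1 (dPi p w)) := by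
    rw [hω, pull_apply, hd.dPi_nab h hn hV.fieldDiffAt (fieldDiffAt_extend_self _) (Eventually.of_forall (dPi_projField p v)), hWdef, projField_self]
  have h4 : ∂[I3] (fun p' ↦ rotationForm D p' (V p')) p (W p) =
      ∂[𝓡 2] (fun y ↦ omh y (extend₂ (dPi p v) y)) p.1 (dPi p w) := by
    have : (fun p' ↦ rotationForm D p' (V p')) = fun p' : S × ℝ ↦ (fun y ↦ omh y (extend₂ (dPi p v) y)) p'.1 :=
      funext fun p' ↦ by rw [hω, pull_apply, hVdef, dPi_projField]
    rw [this, mvfderiv_comp' (g := fun y ↦ omh y (extend₂ (dPi p v) y)) p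
      ((hd.omh_smooth h p.1).mdifferentiableAt (fieldDiffAt_extend_self _)) (mdiff_fst (I := 𝓡 2) p), hWdef, projField_self]
    rfl
  have h5 : rotationForm D p (V p) = omh p.1 (dPi p v) := by rw [hω, hVdef, projField_self, pull_apply]
  have h6 : rotationForm D p (W p) = omh p.1 (dPi p w) := by rw [hω, hWdef, projField_self, pull_apply]
  rw [h3, h4, h5, h6, covDerivForm]
  module

end Projection

/-! ### The induced geometry and the Gauss equation -/

lemma Spacetime.isPseudoMetric (M : Spacetime.{u}) : IsPseudoMetric I4 eta M.g where
  smooth := M.g_smooth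
  symm := M.g_symm
  sign := fun i ↦ by unfold eta; split_ifs <;> norm_num
  frame := M.g_lorentz

lemma Spacetime.isSmoothConn (M : Spacetime.{u}) : IsSmoothConn I4 M.nab := M.leviCivita.isSmoothConn M.isPseudoMetric

namespace IsolatedHorizon
variable (Δ : IsolatedHorizon S) {p : S × ℝ}

lemma immersion (p : S × ℝ) : Manifold.IsImmersionAt I3 I4 ∞ Δ.emb p := Δ.emb_smooth.isImmersion.isImmersionAt p

lemma emb_contMDiffAt (p : S × ℝ) : ContMDiffAt I3 I4 ∞ Δ.emb p := (Δ.immersion p).contMDiffAt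

lemma emb_mdiff (p : S × ℝ) : MDifferentiableAt I3 I4 Δ.emb p := (Δ.emb_contMDiffAt p).mdiff

lemma push_injective (p : S × ℝ) : Function.Injective (Δ.push p) := mfderiv_injective_of_immersion (Δ.immersion p)

/-- The induced degenerate metric as a continuous bilinear form. -/
def qForm (p : S × ℝ) : T[I3] p →L[ℝ] T[I3] p →L[ℝ] ℝ :=
  show ℝ² × ℝ →L[ℝ] ℝ² × ℝ →L[ℝ] ℝ from ContinuousLinearMap.bilinearComp
    (show (ℝ² × ℝ) × ℝ →L[ℝ] (ℝ² × ℝ) × ℝ →L[ℝ] ℝ from Δ.M.g (Δ.emb p))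
    (show ℝ² × ℝ →L[ℝ] (ℝ² × ℝ) × ℝ from Δ.push p)
    (show ℝ² × ℝ →L[ℝ] (ℝ² × ℝ) × ℝ from Δ.push p)

lemma qForm_eq (p : S × ℝ) (u w : T[I3] p) : Δ.qForm p u w = Δ.M.g (Δ.emb p) (Δ.push p u) (Δ.push p w) := rfl

/-- Fields on the horizon extend locally to spacetime, keeping their differentiability. -/
lemma exists_ext {X : Vec I3 (S × ℝ)} (p : S × ℝ) : ∃ X' : Vec I4 Δ.M.carrier,
    (∀ᶠ y in 𝓝 p, X' (Δ.emb y) = Δ.push y (X y)) ∧ (V¹[I3] X p → V¹[I4] X' (Δ.emb p)) ∧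
    (V∞[I3] X p → V∞[I4] X' (Δ.emb p)) := by
  obtain ⟨X', h1, h2, h3⟩ := exists_extension (Δ.immersion p) (fun y ↦ Δ.push y (X y))
  exact ⟨X', h1, fun h ↦ h2 (h.along_mfderiv (Δ.emb_contMDiffAt p)), fun h ↦ h3 (h.along_mfderiv (Δ.emb_contMDiffAt p))⟩

lemma qForm_smooth (p : S × ℝ) : TensorSmoothAt I3 Δ.qForm p := fun _ _ hX hY ↦
  TensorSmoothAt.along (Δ.M.g_smooth _) (Δ.emb_contMDiffAt p) (hX.along_mfderiv (Δ.emb_contMDiffAt p)) (hY.along_mfderiv (Δ.emb_contMDiffAt p))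

lemma push_D {Y : Vec I3 (S × ℝ)} {Y' : Vec I4 Δ.M.carrier} (hY : V¹[I3] Y p)
    (hY' : V¹[I4] Y' (Δ.emb p)) (h : ∀ᶠ p' in 𝓝 p, Y' (Δ.emb p') = Δ.push p' (Y p')) (w : T[I3] p) :
    Δ.push p (Δ.D Y p w) = Δ.M.nab Y' (Δ.emb p) (Δ.push p w) := Δ.D_induced p Y Y' hY hY' h w

/-- The covariant derivatives of an extension restrict to those of the horizon, also near the point. -/
lemma push_D_eventually {X Y : Vec I3 (S × ℝ)} {X' Y' : Vec I4 Δ.M.carrier} (hY : V∞[I3] Y p)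
    (hY' : V∞[I4] Y' (Δ.emb p)) (h : ∀ᶠ p' in 𝓝 p, Y' (Δ.emb p') = Δ.push p' (Y p'))
    (hX : ∀ᶠ p' in 𝓝 p, X' (Δ.emb p') = Δ.push p' (X p')) :
    ∀ᶠ p' in 𝓝 p, Δ.M.nab Y' (Δ.emb p') (X' (Δ.emb p')) = Δ.push p' (Δ.D Y p' (X p')) := by
  have h1 : ∀ᶠ p' in 𝓝 p, V¹[I4] Y' (Δ.emb p') := (Δ.emb_contMDiffAt p).continuousAt.eventually hY'.eventually_fieldDiffAt
  filter_upwards [h1, hY.eventually_fieldDiffAt, hX, eventually_eventually_nhds.2 h] with p' h2 h3 h4 h5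
  rw [Δ.push_D h3 h2 h5, h4]

lemma push_bracket {X Y : Vec I3 (S × ℝ)} {X' Y' : Vec I4 Δ.M.carrier} (hX : V¹[I3] X p) (hY : V¹[I3] Y p)
    (hX' : V¹[I4] X' (Δ.emb p)) (hY' : V¹[I4] Y' (Δ.emb p))
    (hXX : ∀ᶠ p' in 𝓝 p, X' (Δ.emb p') = Δ.push p' (X p')) (hYY : ∀ᶠ p' in 𝓝 p, Y' (Δ.emb p') = Δ.push p' (Y p')) :
    Δ.push p (mlieBracket I3 X Y p) = mlieBracket I4 X' Y' (Δ.emb p) :=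
  mfderiv_mlieBracket_of_related (Δ.emb_contMDiffAt p) hX hY hX' hY' hXX hYY

/-- The restriction of the spacetime connection is torsion-free and preserves the degenerate metric. -/
lemma D_leviCivita : IsLeviCivita I3 Δ.qForm Δ.D where
  torsion_free := by
    rw [Δ.D.torsion_eq_zero_iff]
    intro X Y p hX hY
    obtain ⟨X', hX1, hX2, -⟩ := Δ.exists_ext (X := X) p
    obtain ⟨Y', hY1, hY2, -⟩ := Δ.exists_ext (X := Y) p
    apply Δ.push_injective p
    rw [Δ.push_bracket hX hY (hX2 hX) (hY2 hY) hX1 hY1, map_sub, Δ.push_D hX (hX2 hX) hX1, Δ.push_D hY (hY2 hY) hY1,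
      ← hX1.self_of_nhds, ← hY1.self_of_nhds, nab_torsion Δ.M.leviCivita.torsion_free (hX2 hX) (hY2 hY)]
  metric := by
    intro p X Y hX hY u
    obtain ⟨X', hX1, hX2, -⟩ := Δ.exists_ext (X := X) p
    obtain ⟨Y', hY1, hY2, -⟩ := Δ.exists_ext (X := Y) p
    have h1 := Δ.M.leviCivita.metric (Δ.emb p) X' Y' (hX2 hX) (hY2 hY) (Δ.push p u)
    rw [← Δ.push_D hX (hX2 hX) hX1, ← Δ.push_D hY (hY2 hY) hY1, hX1.self_of_nhds, hY1.self_of_nhds] at h1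
    rw [qForm_eq, qForm_eq, ← h1]
    refine Eq.trans ?_ (mvfderiv_comp' p (TensorSmoothAt.mdifferentiableAt (Δ.M.g_smooth _) (hX2 hX) (hY2 hY)) (Δ.emb_mdiff p) u)
    refine congrArg (fun L : T[I3] p →L[ℝ] ℝ ↦ L u) (mvfderiv_congr ?_)
    filter_upwards [hX1, hY1] with y h2 h3
    rw [qForm_eq, h2, h3]

lemma D_smooth : IsSmoothConn I3 Δ.D := by
  intro p X Y hX hY
  obtain ⟨X', hX1, -, hX2⟩ := Δ.exists_ext (X := X) p
  obtain ⟨Y', hY1, -, hY2⟩ := Δ.exists_ext (X := Y) p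
  exact fieldSmoothAt_of_along (Δ.immersion p) (Δ.M.isSmoothConn _ X' Y' (hX2 hX) (hY2 hY)) (Δ.push_D_eventually hY (hY2 hY) hY1 hX1)

lemma push_ell_ne_zero (p : S × ℝ) : Δ.push p (ell p) ≠ 0 := fun h ↦
  ell_ne_zero p (Δ.push_injective p (by rw [h, map_zero]))

/-- The null direction of the horizon is unique: other tangent vectors are orthogonal to the null vector `ℓ`, hence spacelike. -/
lemma q_pos (p : S × ℝ) {u : T[I3] p} (hu : dPi p u ≠ 0) : 0 < Δ.qForm p u u := by
  refine pos_of_orthogonal_null Δ.M.isPseudoMetric (Δ.push_ell_ne_zero p) (Δ.null p _) (Δ.null p u) fun c hc ↦ hu ?_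
  have : u = c • ell p := Δ.push_injective p ((show Δ.push p u = c • Δ.push p (ell p) from hc).trans (map_smul _ _ _).symm)
  rw [this, map_smul, dPi_ell, smul_zero]

lemma horizonGeom : HorizonGeom Δ.qForm Δ.D where
  smooth := Δ.qForm_smooth
  symm := fun _ _ _ ↦ Δ.M.g_symm _ _ _
  null := fun p w ↦ Δ.null p w
  pos := fun p _ hu ↦ Δ.q_pos p hu
  lc := Δ.D_leviCivita
  conn := Δ.D_smooth
  sym := Δ.ell_symmetry

lemma geomData_iff {qh : Cov₂ (𝓡 2) S}
    {omh : Cov (𝓡 2) S} : GeomData Δ.qForm Δ.D qh omh ↔ Δ.HasData qh omh :=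
  ⟨fun h ↦ ⟨h.metric, h.rotation⟩, fun h ↦ ⟨h.metric, h.rotation⟩⟩

/-- The Gauss equation: the horizon is totally geodesic. -/
lemma push_curvature (p : S × ℝ) (u v w : T[I3] p) :
    Δ.push p (curvature I3 Δ.D p u v w) = curvature I4 Δ.M.nab (Δ.emb p) (Δ.push p u) (Δ.push p v) (Δ.push p w) := by
  set U := extend (ℝ² × ℝ) u with hUdef
  set V := extend (ℝ² × ℝ) v with hVdef
  set W := extend (ℝ² × ℝ) w with hWdef
  have hU : V∞[I3] U p := fieldSmoothAt_extend_self u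
  have hV : V∞[I3] V p := fieldSmoothAt_extend_self v
  have hW : V∞[I3] W p := fieldSmoothAt_extend_self w
  have hUp : U p = u := extend_apply_self _ _
  have hVp : V p = v := extend_apply_self _ _
  have hWp : W p = w := extend_apply_self _ _
  obtain ⟨U', hU1, -, hU2⟩ := Δ.exists_ext (X := U) p
  obtain ⟨V', hV1, -, hV2⟩ := Δ.exists_ext (X := V) p
  obtain ⟨W', hW1, -, hW2⟩ := Δ.exists_ext (X := W) p
  rw [curvature_eq_curvField_extend, ← hUdef, ← hVdef, ← hWdef, ← hUp, ← hVp, ← hWp, ← hU1.self_of_nhds, ← hV1.self_of_nhds, ← hW1.self_of_nhds,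
    curvature_eq_curvField Δ.M.isSmoothConn (hU2 hU) (hV2 hV) (hW2 hW), curvField, curvField, map_sub, map_sub,
    Δ.push_D (Δ.D_smooth p V W hV hW).fieldDiffAt (Δ.M.isSmoothConn _ V' W' (hV2 hV) (hW2 hW)).fieldDiffAt (Δ.push_D_eventually hW (hW2 hW) hW1 hV1),
    Δ.push_D (Δ.D_smooth p U W hU hW).fieldDiffAt (Δ.M.isSmoothConn _ U' W' (hU2 hU) (hW2 hW)).fieldDiffAt (Δ.push_D_eventually hW (hW2 hW) hW1 hU1),
    Δ.push_D hW.fieldDiffAt (hW2 hW).fieldDiffAt hW1,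
    Δ.push_bracket hU.fieldDiffAt hV.fieldDiffAt (hU2 hU).fieldDiffAt (hV2 hV).fieldDiffAt hU1 hV1, hU1.self_of_nhds, hV1.self_of_nhds]

end IsolatedHorizon

/-! ### Spin coefficients and the Ricci tensor of the horizon -/

section Frame
variable {q : Cov₂ I3 (S × ℝ)}
  {D : Conn[I3,ℝ² × ℝ,S × ℝ]}
  {qh : Cov₂ (𝓡 2) S}
  {omh : Cov (𝓡 2) S} {p : S × ℝ} {v : S × ℝ → ℝ}

lemma isFoliationFunction_snd : IsFoliationFunction (Prod.snd : S × ℝ → ℝ) :=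
  ⟨contMDiff_snd, fun p ↦ dsnd_vert (I := 𝓡 2) p⟩

/-- An orthonormal frame of a leaf of the foliation `v = const`. -/
lemma GeomData.exists_adapted_frame (h : HorizonGeom q D) (hd : GeomData q D qh omh) (hv : IsFoliationFunction v) (p : S × ℝ) :
    ∃ e : Fin 2 → T[I3] p, (∀ i, ∂[I3] v p (e i) = 0) ∧ (∀ i j, q p (e i) (e j) = if i = j then 1 else 0) ∧
      ∀ u, u = (∑ i, q p u (e i) • e i) + ∂[I3] v p u • ell p := by
  have hr := hd.riemannian h
  obtain ⟨b, hb⟩ := hr.isPseudoMetric.frame p.1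
  have hE : ∀ i, ∃ E : T[I3] p, dPi p E = b i ∧ ∂[I3] v p E = 0 := fun i ↦ by
    set E₀ : T[I3] p := lift (extend₂ (b i)) p
    refine ⟨E₀ - ∂[I3] v p E₀ • ell p, ?_, ?_⟩
    · rw [map_sub, map_smul, dPi_ell, smul_zero, sub_zero, dPi_lift, extend_apply_self]
    · rw [map_sub, map_smul, hv.2, smul_eq_mul, mul_one, sub_self]
  choose e he1 he2 using hE
  refine ⟨e, he2, fun i j ↦ by rw [hd.metric, he1, he1, hb], fun u ↦ hv.tangent_ext ?_ ?_⟩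
  · rw [map_add, map_sum, map_smul, dPi_ell, smul_zero, add_zero]
    refine (orthonormal_expansion hr.isPseudoMetric hb (dPi p u)).trans (sum_congr rfl fun i _ ↦ ?_)
    rw [map_smul, he1, hd.metric, he1, one_mul]
  · rw [map_add, map_sum, map_smul, hv.2, smul_eq_mul, mul_one]
    simp only [map_smul, he2, smul_zero, sum_const_zero, zero_add]

/-- With `ℓ(v) = 1` the contraction of the symmetry equation with `ℓ` holds for every geometry. -/
lemma hess_ell_foliation (h : HorizonGeom q D) (hv : IsFoliationFunction v) (u : T[I3] p) :
    hess D v p u (ell p) = -rotationForm D p u := by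
  rw [hess_ell h hv.smoothAt, dd_eventually_const (Eventually.of_forall hv.2), hv.2]
  ring

/-- A foliation function solves the symmetry equation if its Hessian vanishes on the leaves. -/
lemma GeomData.symmetryEquation_iff (h : HorizonGeom q D) (hd : GeomData q D qh omh) (hv : IsFoliationFunction v) :
    SymmetryEquation D v ↔ ∀ (p : S × ℝ) (u w : T[I3] p), ∂[I3] v p u = 0 → ∂[I3] v p w = 0 → hess D v p u w = 0 := by
  constructor
  · intro hs p u w hu hw
    have := hs p u w
    rw [hu, hw] at this
    linarith
  · intro hH p u w
    have hsym := hess_symm (nab := D) h.lc.torsion_free (hv.smoothAt p)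
    have hd0 : ∀ z : T[I3] p, ∂[I3] v p (z - ∂[I3] v p z • ell p) = 0 := fun z ↦ by
      rw [map_sub, map_smul, hv.2, smul_eq_mul, mul_one, sub_self]
    have h0 : rotationForm D p (ell p) = 0 := by rw [hd.rotationForm_eq h, pull_apply, dPi_ell, map_zero]
    have key : ∀ z y : T[I3] p, ∀ a : ℝ, hess D v p (z + a • ell p) y = hess D v p z y - a * rotationForm D p y := fun z y a ↦ by
      rw [hess_add_left, hess_smul_left, hsym (ell p) y, hess_ell_foliation h hv]; ring
    set a := ∂[I3] v p u
    set b := ∂[I3] v p w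
    have h1 := hH p _ _ (hd0 u) (hd0 w)
    have h2 := key (u - a • ell p) w a
    rw [sub_add_cancel] at h2
    have h3 := key (w - b • ell p) (u - a • ell p) b
    rw [sub_add_cancel, hsym w, hsym (w - b • ell p), h1, map_sub, map_smul, h0] at h3
    rw [h2, h3, smul_zero]
    ring

end Frame

namespace IsolatedHorizon
variable (Δ : IsolatedHorizon S) {p : S × ℝ}
  {qh : Cov₂ (𝓡 2) S} {omh : Cov (𝓡 2) S}
  {nabh : Conn[𝓡 2,ℝ²,S]} {v : S × ℝ → ℝ}

lemma exists_transversal (p : S × ℝ) {e : Fin 2 → T[I3] p} (he : ∀ i j, Δ.qForm p (e i) (e j) = if i = j then 1 else 0) :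
    ∃ n, IsNullFrame Δ.M.g (Δ.emb p) (fun i ↦ Δ.push p (e i)) n (Δ.push p (ell p)) :=
  exists_null_frame Δ.M.isPseudoMetric he (fun i ↦ Δ.null p (e i)) (Δ.push_ell_ne_zero p) (Δ.null p _)

lemma exists_transversalNormal (hd : GeomData Δ.qForm Δ.D qh omh) (hv : IsFoliationFunction v) : ∃ n, Δ.IsTransversalNormal v n := by
  have : ∀ p, ∃ n, Δ.M.g (Δ.emb p) n n = 0 ∧ Δ.M.g (Δ.emb p) n (Δ.push p (ell p)) = -1 ∧
      ∀ w : T[I3] p, ∂[I3] v p w = 0 → Δ.M.g (Δ.emb p) n (Δ.push p w) = 0 := by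
    intro p
    obtain ⟨e, he0, he1, he2⟩ := hd.exists_adapted_frame Δ.horizonGeom hv p
    obtain ⟨n, hn⟩ := Δ.exists_transversal p he1
    refine ⟨n, hn.nn, hn.nl, fun w hw ↦ ?_⟩
    rw [he2 w, hw, zero_smul, add_zero, map_sum, map_sum]
    exact sum_eq_zero fun i _ ↦ by rw [map_smul, map_smul, hn.en, smul_zero]
  choose n h1 h2 h3 using this
  exact ⟨n, h1, h2, h3⟩

/-- The pullback of `g(n, ·)` to the horizon is `-dv`. -/
lemma IsTransversalNormal.apply_push {n : Π p : S × ℝ, T[I4] (Δ.emb p)} (hn : Δ.IsTransversalNormal v n) (hv : IsFoliationFunction v)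
    (p : S × ℝ) (w : T[I3] p) : Δ.M.g (Δ.emb p) (n p) (Δ.push p w) = -∂[I3] v p w := by
  have h1 := hn.orthogonal p (w - ∂[I3] v p w • ell p) (by rw [map_sub, map_smul, hv.2, smul_eq_mul, mul_one, sub_self])
  rw [map_sub, map_sub, map_smul, map_smul, hn.normalized, smul_eq_mul] at h1
  linarith

/-- As `n` pulls back to `-dv`, its derivative is minus the Hessian of `v`. -/
lemma IsTransversalNormal.deformation_eq {n : Π p : S × ℝ, T[I4] (Δ.emb p)} (hn : Δ.IsTransversalNormal v n) (hv : IsFoliationFunction v)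
    (p : S × ℝ) (u w : T[I3] p) : Δ.deformation n p u w = -hess Δ.D v p u w := by
  have e : (fun (p' : S × ℝ) (z : T[I3] p') ↦ Δ.M.g (Δ.emb p') (n p') (Δ.push p' z)) = fun p' z ↦ -∂[I3] v p' z :=
    funext fun p' ↦ funext fun z ↦ hn.apply_push Δ hv p' z
  rw [deformation, e, hess, covDerivForm, covDerivForm]
  simp only [dd_neg]
  ring

/-- The spin coefficients `μ` and `λ` are the components of the Hessian of `v` along the leaves. -/
lemma muLambdaVanish_iff (hd : GeomData Δ.qForm Δ.D qh omh) (hv : IsFoliationFunction v) : Δ.MuLambdaVanish v ↔ SymmetryEquation Δ.D v := by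
  rw [hd.symmetryEquation_iff Δ.horizonGeom hv]
  constructor
  · intro h p u w hu hw
    obtain ⟨n, hn⟩ := Δ.exists_transversalNormal hd hv
    obtain ⟨e, he0, he1, he2⟩ := hd.exists_adapted_frame Δ.horizonGeom hv p
    obtain ⟨hm, hl⟩ := h n hn p (e 0) (e 1) (he0 0) (he0 1) (he1 0 0) (he1 1 1) (he1 0 1)
    rw [mu, hn.deformation_eq Δ hv, hn.deformation_eq Δ hv, hn.deformation_eq Δ hv, hn.deformation_eq Δ hv] at hm
    rw [lam, hn.deformation_eq Δ hv, hn.deformation_eq Δ hv, hn.deformation_eq Δ hv, hn.deformation_eq Δ hv] at hl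
    -- the real and imaginary parts of `μ` and `λ` are the four components of the Hessian on the leaf
    have m1 := congrArg Complex.re hm
    have m2 := congrArg Complex.im hm
    have l1 := congrArg Complex.re hl
    have l2 := congrArg Complex.im hl
    simp at m1 m2 l1 l2
    have hz : ∀ i j, hess Δ.D v p (e i) (e j) = 0 := by
      intro i j
      fin_cases i <;> fin_cases j <;> simp <;> linarith
    have hsym := hess_symm (nab := Δ.D) Δ.D_leviCivita.torsion_free (hv.smoothAt p)
    have hleft : ∀ (y z : T[I3] p), ∂[I3] v p y = 0 → (∀ i, hess Δ.D v p (e i) z = 0) → hess Δ.D v p y z = 0 := by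
      intro y z hy hi
      rw [he2 y, hy, zero_smul, add_zero, Fin.sum_univ_two, hess_add_left, hess_smul_left, hess_smul_left, hi, hi]
      ring
    exact hleft u w hu fun i ↦ by rw [hsym]; exact hleft w (e i) hw fun j ↦ hz j i
  · intro h n hn p e₁ e₂ h1 h2 _ _ _
    rw [mu, lam, hn.deformation_eq Δ hv, hn.deformation_eq Δ hv, hn.deformation_eq Δ hv, hn.deformation_eq Δ hv,
      h p _ _ h1 h1, h p _ _ h1 h2, h p _ _ h2 h1, h p _ _ h2 h2]
    simp

/-- The pullback of the spacetime Ricci tensor to an extremal horizon. -/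
lemma ricci_push (hd : GeomData Δ.qForm Δ.D qh omh) (hn : IsLeviCivita (𝓡 2) qh nabh) (p : S × ℝ) (v w : T[I3] p) :
    ricci I4 Δ.M.nab (Δ.emb p) (Δ.push p v) (Δ.push p w) =
      ricci (𝓡 2) nabh p.1 (dPi p v) (dPi p w)
        - (covDerivForm (𝓡 2) nabh (fun y z ↦ omh y z) p.1 (dPi p v) (dPi p w)
          + covDerivForm (𝓡 2) nabh (fun y z ↦ omh y z) p.1 (dPi p w) (dPi p v))
        - 2 * (omh p.1 (dPi p v) * omh p.1 (dPi p w)) := by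
  obtain ⟨e, -, he1, -⟩ := hd.exists_adapted_frame Δ.horizonGeom isFoliationFunction_snd p
  obtain ⟨n, hnf⟩ := Δ.exists_transversal p he1
  have hr := (hd.riemannian Δ.horizonGeom).isPseudoMetric
  have hBe : ∀ i, Δ.M.g (Δ.emb p) (curvature I4 Δ.M.nab (Δ.emb p) (Δ.push p (e i)) (Δ.push p v) (Δ.push p w)) (Δ.push p (e i)) =
      qh p.1 (curvature (𝓡 2) nabh p.1 (dPi p (e i)) (dPi p v) (dPi p w)) (dPi p (e i)) := fun i ↦ by
    rw [← Δ.push_curvature, ← hd.dPi_curvature Δ.horizonGeom hn, ← hd.metric, qForm_eq]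
  have hBl : ∀ y z : T[I3] p, Δ.M.g (Δ.emb p) (curvature I4 Δ.M.nab (Δ.emb p) (Δ.push p (ell p)) (Δ.push p y) (Δ.push p z)) n =
      covDerivForm (𝓡 2) nabh (fun y z ↦ omh y z) p.1 (dPi p y) (dPi p z) + omh p.1 (dPi p y) * omh p.1 (dPi p z) := fun y z ↦ by
    rw [← Δ.push_curvature, hd.curvature_ell Δ.horizonGeom hn, map_smul, Δ.M.g_symm, map_smul, hnf.nl, smul_eq_mul]
    ring
  have hrich : ricci (𝓡 2) nabh p.1 (dPi p v) (dPi p w) = ∑ i, qh p.1 (curvature (𝓡 2) nabh p.1 (dPi p (e i)) (dPi p v) (dPi p w)) (dPi p (e i)) := by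
    rw [ricci_eq_orthonormal (hn.isSmoothConn hr) hr (b := fun i ↦ dPi p (e i)) (fun i j ↦ by rw [← hd.metric, he1])]
    simp only [one_mul]
  rw [hnf.ricci_eq Δ.M.isPseudoMetric Δ.M.leviCivita, hBe, hBe, hBl, hBl, hrich, Fin.sum_univ_two]
  ring

end IsolatedHorizon

end Horizon

/-! ### Alternating 4-forms and Hodge duals in frames -/

section Alternating
variable {V : Type*} [AddCommGroup V] [Module ℝ V] (Ω : V [⋀^Fin 4]→ₗ[ℝ] ℝ) (a a' b c d : V)

lemma alt_swap01 : Ω ![b, a, c, d] = -Ω ![a, b, c, d] := by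
  rw [← Ω.map_swap ![a, b, c, d] (show (0 : Fin 4) ≠ 1 by decide)]
  congr 1; ext i; fin_cases i <;> rfl

lemma alt_swap12 : Ω ![a, c, b, d] = -Ω ![a, b, c, d] := by
  rw [← Ω.map_swap ![a, b, c, d] (show (1 : Fin 4) ≠ 2 by decide)]
  congr 1; ext i; fin_cases i <;> rfl

lemma alt_swap23 : Ω ![a, b, d, c] = -Ω ![a, b, c, d] := by
  rw [← Ω.map_swap ![a, b, c, d] (show (2 : Fin 4) ≠ 3 by decide)]
  congr 1; ext i; fin_cases i <;> rfl

lemma alt_eq01 : Ω ![a, a, c, d] = 0 := Ω.map_eq_zero_of_eq (i := 0) (j := 1) _ rfl (by decide)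
lemma alt_eq03 : Ω ![a, b, c, a] = 0 := Ω.map_eq_zero_of_eq (i := 0) (j := 3) _ rfl (by decide)
lemma alt_eq13 : Ω ![a, b, c, b] = 0 := Ω.map_eq_zero_of_eq (i := 1) (j := 3) _ rfl (by decide)

lemma alt_add0 : Ω ![a + a', b, c, d] = Ω ![a, b, c, d] + Ω ![a', b, c, d] := Ω.map_vecCons_add _ _ _
lemma alt_smul0 (r : ℝ) : Ω ![r • a, b, c, d] = r * Ω ![a, b, c, d] := Ω.map_vecCons_smul _ _ _
lemma alt_add1 : Ω ![b, a + a', c, d] = Ω ![b, a, c, d] + Ω ![b, a', c, d] := by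
  rw [alt_swap01 Ω (a + a') b, alt_add0, alt_swap01 Ω a b, alt_swap01 Ω a' b]; ring
lemma alt_smul1 (r : ℝ) : Ω ![b, r • a, c, d] = r * Ω ![b, a, c, d] := by
  rw [alt_swap01 Ω (r • a) b, alt_smul0, alt_swap01 Ω a b]; ring
lemma alt_add2 : Ω ![b, c, a + a', d] = Ω ![b, c, a, d] + Ω ![b, c, a', d] := by
  rw [alt_swap12 Ω b (a + a') c, alt_add1, alt_swap12 Ω b a c, alt_swap12 Ω b a' c]; ring
lemma alt_smul2 (r : ℝ) : Ω ![b, c, r • a, d] = r * Ω ![b, c, a, d] := by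
  rw [alt_swap12 Ω b (r • a) c, alt_smul1, alt_swap12 Ω b a c]; ring
lemma alt_add3 : Ω ![b, c, d, a + a'] = Ω ![b, c, d, a] + Ω ![b, c, d, a'] := by
  rw [alt_swap23 Ω b c (a + a') d, alt_add2, alt_swap23 Ω b c a d, alt_swap23 Ω b c a' d]; ring
lemma alt_smul3 (r : ℝ) : Ω ![b, c, d, r • a] = r * Ω ![b, c, d, a] := by
  rw [alt_swap23 Ω b c (r • a) d, alt_smul2, alt_swap23 Ω b c a d]; ring

lemma alt_sub3 : Ω ![b, c, d, a - a'] = Ω ![b, c, d, a] - Ω ![b, c, d, a'] := by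
  rw [sub_eq_add_neg, ← neg_one_smul ℝ a', alt_add3, alt_smul3]; ring

/-- The value of an alternating form on members of a frame; the product of differences is `12` times the sign of `(i, j, k, l)` if this is a
permutation, and `0` otherwise. -/
lemma alt_frame (f : Fin 4 → V) (i j k l : Fin 4) :
    Ω ![f i, f j, f k, f l] = ((j : ℝ) - i) * (k - i) * (l - i) * (k - j) * (l - j) * (l - k) / 12 * Ω f := by
  rw [show ![f i, f j, f k, f l] = f ∘ ![i, j, k, l] by ext m; fin_cases m <;> rfl]
  by_cases h : Function.Injective ![i, j, k, l]
  · have hs : ∀ τ : Equiv.Perm (Fin 4), ((τ 1 : ℤ) - τ 0) * (τ 2 - τ 0) * (τ 3 - τ 0) * (τ 2 - τ 1) * (τ 3 - τ 1) * (τ 3 - τ 2) =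
        12 * (Equiv.Perm.sign τ : ℤ) := by decide
    have h1 := congrArg (fun t : ℤ ↦ (t : ℝ)) (hs (Equiv.ofBijective _ (Finite.injective_iff_bijective.1 h)))
    have h2 := Ω.map_perm f (Equiv.ofBijective _ (Finite.injective_iff_bijective.1 h))
    rw [Units.smul_def, zsmul_eq_mul] at h2
    refine h2.trans ?_
    simp at h1
    rw [h1]; ring
  · rw [Ω.map_eq_zero_of_not_injective _ fun hf ↦ h hf.of_comp, eq_comm]
    by_contra hne
    simp only [div_eq_mul_inv, mul_eq_zero, not_or, sub_eq_zero, Nat.cast_inj, Fin.val_inj] at hne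
    refine h fun a b hab ↦ ?_
    fin_cases a <;> fin_cases b <;> simp_all

end Alternating

namespace Spacetime
variable (M : Spacetime.{u}) {x : M.carrier} {f : Fin 4 → T[I4] x} {e : Fin 2 → T[I4] x} {n l : T[I4] x}
  {F : Cov₂ I4 M.carrier} {G : T[I4] x → T[I4] x → T[I4] x → ℂ}

/-- Orthonormal frames of the tangent space at `x`. -/
abbrev IsONFrame (f : Fin 4 → T[I4] x) : Prop := ∀ i j, M.g x (f i) (f j) = if i = j then eta i else 0

lemma frame_orthonormal (x : M.carrier) : M.IsONFrame (M.frame x) := Classical.choose_spec (M.g_lorentz x)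

lemma contraction_eq_frame {A : Type*} [AddCommGroup A] [Module ℝ A] (hf : M.IsONFrame f) (B : T[I4] x → T[I4] x → A)
    (hB : ∀ (r : ℝ) u u' w, B (u + r • u') w = B u w + r • B u' w ∧ B w (u + r • u') = B w u + r • B w u') :
    ∑ i, eta i • B (M.frame x i) (M.frame x i) = ∑ i, eta i • B (f i) (f i) := by
  have z (w) : B 0 w = 0 ∧ B w 0 = 0 := by simpa using hB (-1) 0 0 w
  exact contraction_eq M.isPseudoMetric (M.frame_orthonormal x) hf (LinearMap.mk₂ ℝ B (fun u u' w ↦ by simpa using (hB 1 u u' w).1)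
    (fun r u w ↦ by simpa [z] using (hB r 0 u w).1) (fun w u u' ↦ by simpa using (hB 1 u u' w).2) (fun r w u ↦ by simpa [z] using (hB r 0 u w).2))

/-- The Hodge dual may be computed in any orthonormal frame. -/
lemma hodge₂_eq (F : Cov₂ I4 M.carrier) (hf : M.IsONFrame f) (u w : T[I4] x) :
    M.hodge₂ F x u w = (1 / 2) * ∑ c, ∑ d, eta c * eta d * M.vol x ![u, w, f c, f d] * F x (f c) (f d) := by
  have h1 (z z' : T[I4] x) := M.contraction_eq_frame hf (fun y y' ↦ M.vol x ![u, w, z, y] * F x z' y') fun _ _ _ _ ↦ by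
    constructor <;> simp only [alt_add3, alt_smul3, map_add, map_smul, smul_eq_mul] <;> ring
  have h2 := M.contraction_eq_frame hf (fun y y' ↦ ∑ d, eta d • (M.vol x ![u, w, y, f d] * F x y' (f d))) fun _ _ _ _ ↦ by
    constructor <;> simp only [Fin.sum_univ_four, alt_add2, alt_smul2, map_add, map_smul, _root_.add_apply, _root_.smul_apply, smul_eq_mul] <;> ring
  have h3 (φ : Fin 4 → T[I4] x) : ∑ c, ∑ d, eta c * eta d * M.vol x ![u, w, φ c, φ d] * F x (φ c) (φ d) =
      ∑ c, eta c • ∑ d, eta d • (M.vol x ![u, w, φ c, φ d] * F x (φ c) (φ d)) := by simp only [smul_eq_mul, mul_sum, mul_assoc]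
  rw [hodge₂, h3 f, h3 (M.frame x), ← h2]
  simp only [h1]

/-- Alternating 3-forms at a point, with complex values. -/
structure IsThreeForm (G : T[I4] x → T[I4] x → T[I4] x → ℂ) : Prop where
  add : ∀ u u' v w, G (u + u') v w = G u v w + G u' v w
  smul : ∀ (r : ℝ) u v w, G (r • u) v w = r * G u v w
  swap : ∀ u v w, G v u w = -G u v w
  cycle : ∀ u v w, G v w u = G u v w

lemma IsThreeForm.perm (h : M.IsThreeForm G) (u v w : T[I4] x) :
    G v u w = -G u v w ∧ G v w u = G u v w ∧ G w u v = G u v w ∧ G u w v = -G u v w ∧ G w v u = -G u v w :=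
  ⟨h.swap u v w, h.cycle u v w, (h.cycle w u v).symm, by rw [h.cycle v u w, h.swap], by rw [h.swap, h.cycle]⟩

lemma IsThreeForm.eq_zero (h : M.IsThreeForm G) (u w : T[I4] x) : G u u w = 0 ∧ G u w u = 0 ∧ G w u u = 0 := by
  have z : G u u w = 0 := by linear_combination (1 / 2 : ℂ) * h.swap u u w
  exact ⟨z, by rw [(h.perm M u u w).2.2.2.1, z, neg_zero], by rw [(h.perm M u u w).2.2.1, z]⟩

/-- The Hodge dual of a 3-form may be computed in any orthonormal frame. -/
lemma hodge₃_eq (hG : M.IsThreeForm G) (hf : M.IsONFrame f) (u : T[I4] x) :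
    M.hodge₃ x G u = (1 / 6) * ∑ b, ∑ c, ∑ d, ((eta b * eta c * eta d * M.vol x ![f b, f c, f d, u] : ℝ) : ℂ) * G (f b) (f c) (f d) := by
  have a2 (u u' v w) : G v (u + u') w = G v u w + G v u' w := by rw [hG.swap, hG.add, hG.swap v u, hG.swap v u']; ring
  have s2 (r : ℝ) (u v w) : G v (r • u) w = r * G v u w := by rw [hG.swap, hG.smul, hG.swap v u]; ring
  have a3 (u u' v w) : G v w (u + u') = G v w u + G v w u' := by rw [hG.cycle (u + u') v w, hG.add, hG.cycle u v w, hG.cycle u' v w]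
  have s3 (r : ℝ) (u v w) : G v w (r • u) = r * G v w u := by rw [hG.cycle (r • u) v w, hG.smul, hG.cycle u v w]
  let T : T[I4] x → T[I4] x → T[I4] x → T[I4] x → T[I4] x → T[I4] x → ℂ :=
    fun b c d b' c' d' ↦ ((M.vol x ![b, c, d, u] : ℝ) : ℂ) * G b' c' d'
  have h1 (b c b' c') := M.contraction_eq_frame hf (fun y y' ↦ T b c y b' c' y') fun _ _ _ _ ↦ by
    constructor <;> simp only [T, alt_add2, alt_smul2, a3, s3, Complex.real_smul] <;> push_cast <;> ring
  have h2 (b b') := M.contraction_eq_frame hf (fun y y' ↦ ∑ d, eta d • T b y (f d) b' y' (f d)) fun _ _ _ _ ↦ by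
    constructor <;> simp only [T, Fin.sum_univ_four, alt_add1, alt_smul1, a2, s2, Complex.real_smul] <;> push_cast <;> ring
  have h3 := M.contraction_eq_frame hf (fun y y' ↦ ∑ c, eta c • ∑ d, eta d • T y (f c) (f d) y' (f c) (f d)) fun _ _ _ _ ↦ by
    constructor <;> simp only [T, Fin.sum_univ_four, alt_add0, alt_smul0, hG.add, hG.smul, Complex.real_smul] <;> push_cast <;> ring
  have h4 (φ : Fin 4 → T[I4] x) : ∑ b, ∑ c, ∑ d, ((eta b * eta c * eta d * M.vol x ![φ b, φ c, φ d, u] : ℝ) : ℂ) * G (φ b) (φ c) (φ d) =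
      ∑ b, eta b • ∑ c, eta c • ∑ d, eta d • T (φ b) (φ c) (φ d) (φ b) (φ c) (φ d) := by
    simp only [T, smul_sum, Complex.real_smul, Complex.ofReal_mul, mul_assoc]
  rw [hodge₃, h4 f, h4 (M.frame x), ← h3]
  simp only [h1, h2]

/-- The energy-momentum tensor may be computed in any orthonormal frame. -/
lemma stressEnergy_eq (F : Cov₂ I4 M.carrier) (hf : M.IsONFrame f) (u w : T[I4] x) :
    M.stressEnergy F x u w = (1 / (4 * Real.pi)) * (∑ c, eta c * F x u (f c) * F x w (f c)
      - (1 / 4) * M.g x u w * ∑ c, ∑ d, eta c * eta d * F x (f c) (f d) ^ 2) := by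
  have h0 (u w : T[I4] x) := M.contraction_eq_frame hf (fun y y' ↦ F x u y * F x w y') fun _ _ _ _ ↦ by
    constructor <;> simp only [map_add, map_smul, smul_eq_mul] <;> ring
  have h2 := M.contraction_eq_frame hf (fun y y' ↦ ∑ d, eta d • (F x y (f d) * F x y' (f d))) fun _ _ _ _ ↦ by
    constructor <;> simp only [Fin.sum_univ_four, map_add, map_smul, _root_.add_apply, _root_.smul_apply, smul_eq_mul] <;> ring
  have h3 (φ : Fin 4 → T[I4] x) : ∑ c, ∑ d, eta c * eta d * F x (φ c) (φ d) ^ 2 = ∑ c, eta c • ∑ d, eta d • (F x (φ c) (φ d) * F x (φ c) (φ d)) := by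
    simp only [smul_eq_mul, mul_sum, mul_assoc, sq]
  have h4 (φ : Fin 4 → T[I4] x) : ∑ c, eta c * F x u (φ c) * F x w (φ c) = ∑ c, eta c • (F x u (φ c) * F x w (φ c)) := by
    simp only [smul_eq_mul, mul_assoc]
  rw [stressEnergy, h3 f, h3 (M.frame x), h4 f, h4 (M.frame x), h0, ← h2]
  simp only [h0]

/-! ### The Hodge dual of a 2-form -/

lemma skew_of_alternating (hF : ∀ u, F x u u = 0) (u w : T[I4] x) : F x u w = -F x w u := by
  have h := hF (u + w)
  simp only [map_add, _root_.add_apply, hF] at h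
  linarith

/-- The relations between the components of a 2-form `A` and of its Hodge dual `B` in the frame `f`. -/
abbrev DualComponents (f : Fin 4 → T[I4] x) (A B : T[I4] x → T[I4] x → ℝ) : Prop :=
  B (f 0) (f 1) = M.vol x f * A (f 2) (f 3) ∧ B (f 0) (f 2) = -(M.vol x f * A (f 1) (f 3)) ∧ B (f 0) (f 3) = M.vol x f * A (f 1) (f 2) ∧
  B (f 1) (f 2) = -(M.vol x f * A (f 0) (f 3)) ∧ B (f 1) (f 3) = M.vol x f * A (f 0) (f 2) ∧ B (f 2) (f 3) = -(M.vol x f * A (f 0) (f 1))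

lemma hodge₂_components (hF : ∀ u, F x u u = 0) (hf : M.IsONFrame f) : M.DualComponents f (fun u w ↦ F x u w) (M.hodge₂ F x) := by
  have s := M.skew_of_alternating hF
  refine ⟨?_, ?_, ?_, ?_, ?_, ?_⟩ <;> simp only [M.hodge₂_eq F hf, alt_frame, Fin.sum_univ_four, eta_zero, eta_one, eta_two, eta_three, hF,
    s (f 1) (f 0), s (f 2) (f 0), s (f 3) (f 0), s (f 2) (f 1), s (f 3) (f 1), s (f 3) (f 2)] <;> norm_num <;> ring

lemma hodge₂_add_left (u u' w : T[I4] x) : M.hodge₂ F x (u + u') w = M.hodge₂ F x u w + M.hodge₂ F x u' w := by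
  simp only [hodge₂, alt_add0, ← mul_add, ← sum_add_distrib]
  exact congrArg _ (sum_congr rfl fun _ _ ↦ sum_congr rfl fun _ _ ↦ by ring)

lemma hodge₂_smul_left (r : ℝ) (u w : T[I4] x) : M.hodge₂ F x (r • u) w = r * M.hodge₂ F x u w := by
  simp only [hodge₂, alt_smul0, mul_sum]
  exact sum_congr rfl fun _ _ ↦ sum_congr rfl fun _ _ ↦ by ring

lemma hodge₂_swap (u w : T[I4] x) : M.hodge₂ F x w u = -M.hodge₂ F x u w := by
  simp only [hodge₂, alt_swap01 _ u w, ← mul_neg, ← sum_neg_distrib]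
  exact congrArg _ (sum_congr rfl fun _ _ ↦ sum_congr rfl fun _ _ ↦ by ring)

lemma hodge₂_self (u : T[I4] x) : M.hodge₂ F x u u = 0 := by
  have := M.hodge₂_swap (F := F) u u
  linarith

lemma hodge₂_add_right (u u' w : T[I4] x) : M.hodge₂ F x w (u + u') = M.hodge₂ F x w u + M.hodge₂ F x w u' := by
  rw [hodge₂_swap, hodge₂_add_left, M.hodge₂_swap w u, M.hodge₂_swap w u']; ring

lemma hodge₂_smul_right (r : ℝ) (u w : T[I4] x) : M.hodge₂ F x w (r • u) = r * M.hodge₂ F x w u := by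
  rw [hodge₂_swap, hodge₂_smul_left, M.hodge₂_swap w u]; ring

/-- The Hodge dual of a 2-form as a continuous bilinear form. -/
def hodgeForm (F : Cov₂ I4 M.carrier) (x : M.carrier) :
    T[I4] x →L[ℝ] T[I4] x →L[ℝ] ℝ :=
  show (ℝ² × ℝ) × ℝ →L[ℝ] (ℝ² × ℝ) × ℝ →L[ℝ] ℝ from
    LinearMap.toContinuousLinearMap ((LinearMap.toContinuousLinearMap : ((ℝ² × ℝ) × ℝ →ₗ[ℝ] ℝ) ≃ₗ[ℝ] _).toLinearMap ∘ₗ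
      (LinearMap.mk₂ ℝ (fun u w : (ℝ² × ℝ) × ℝ ↦ M.hodge₂ F x u w) (fun u u' w ↦ M.hodge₂_add_left u u' w) (fun c u w ↦ M.hodge₂_smul_left c u w)
        (fun u w w' ↦ M.hodge₂_add_right w w' u) (fun c u w ↦ M.hodge₂_smul_right c w u)))

lemma hodgeForm_apply (F : Cov₂ I4 M.carrier) (x : M.carrier) (u w : T[I4] x) :
    M.hodgeForm F x u w = M.hodge₂ F x u w := rfl

lemma vol_orthonormal_sq (hf : M.IsONFrame f) : M.vol x f ^ 2 = 1 := by
  rw [M.vol_sq, show (Matrix.of fun i j ↦ M.g x (f i) (f j)) = Matrix.diagonal eta by ext i j; rw [Matrix.of_apply, hf, Matrix.diagonal_apply],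
    Matrix.det_diagonal, Fin.prod_univ_four, eta_zero, eta_one, eta_two, eta_three]
  norm_num

lemma vol_smooth4 {A B C D : Vec I4 M.carrier} (hA : V∞[I4] A x) (hB : V∞[I4] B x)
    (hC : V∞[I4] C x) (hD : V∞[I4] D x) : C∞[I4] (fun y ↦ M.vol y ![A y, B y, C y, D y]) x := by
  have := M.vol_smooth x ![A, B, C, D] (fun i ↦ by fin_cases i <;> assumption)
  refine this.congr_of_eventuallyEq (Eventually.of_forall fun y ↦ ?_)
  refine congrArg (M.vol y) ?_
  ext i
  fin_cases i <;> rfl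

/-- In a smooth local frame the Hodge dual is a smooth combination of the components. -/
lemma hodgeForm_smooth (hF : TensorSmoothAt I4 F x) : TensorSmoothAt I4 (M.hodgeForm F) x := by
  intro A B hA hB
  obtain ⟨V, hV, -, hVo⟩ := exists_orthonormal_frame M.isPseudoMetric (M.frame_orthonormal x)
  have h1 : C∞[I4] (fun y ↦ (1 / 2 : ℝ) * ∑ c, ∑ d, eta c * eta d * M.vol y ![A y, B y, V c y, V d y] * F y (V c y) (V d y)) x :=
    contMDiffAt_const.mul (contMDiffAt_sum fun c _ ↦ contMDiffAt_sum fun d _ ↦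
      (contMDiffAt_const.mul (M.vol_smooth4 hA hB (hV c) (hV d))).mul (hF _ _ (hV c) (hV d)))
  refine h1.congr_of_eventuallyEq ?_
  filter_upwards [hVo] with y hy
  rw [hodgeForm_apply, M.hodge₂_eq F hy]



/-! ### Duality in null frames -/

/-- The volume form on the orthonormal frame of a null frame. -/
lemma vol_nullONFrame (e : Fin 2 → T[I4] x) (n l : T[I4] x) : M.vol x (nullONFrame e n l) = -σ[M,e,n,l] := by
  rw [nullONFrame, alt_smul0, alt_smul3, alt_sub3, alt_add0, alt_add0, ← mul_assoc, inv_sqrt_two_mul_self, alt_eq03, alt_eq03,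
    alt_swap01 _ (e 0) n, alt_swap12 _ (e 0) (e 1) n, alt_swap01 _ (e 0) l, alt_swap12 _ (e 0) (e 1) l, alt_swap23 _ (e 0) (e 1) n l]
  ring

lemma vol_null_sq (h : IsNullFrame (M.g) x e n l) : σ[M,e,n,l] ^ 2 = 1 := by
  have := M.vol_orthonormal_sq (h.orthonormal (M.g_symm x))
  rwa [vol_nullONFrame, neg_sq] at this

/-- Two bilinear skew forms at a point of which the second is the Hodge dual of the first, expressed by components in orthonormal frames. -/
structure DualPair (x : M.carrier) (A B : T[I4] x → T[I4] x → ℝ) : Prop where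
  addA : ∀ u u' w, A (u + u') w = A u w + A u' w
  smulA : ∀ (r : ℝ) u w, A (r • u) w = r * A u w
  swapA : ∀ u w, A w u = -A u w
  addB : ∀ u u' w, B (u + u') w = B u w + B u' w
  smulB : ∀ (r : ℝ) u w, B (r • u) w = r * B u w
  swapB : ∀ u w, B w u = -B u w
  comp : ∀ f, M.IsONFrame f → M.DualComponents f A B

/-- Duality of 2-forms in a null frame. -/
lemma DualPair.null {A B : T[I4] x → T[I4] x → ℝ} (hp : M.DualPair x A B) (h : IsNullFrame (M.g) x e n l) :
    B l (e 0) = -(σ[M,e,n,l] * A l (e 1)) ∧ B l (e 1) = σ[M,e,n,l] * A l (e 0) ∧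
    B n (e 0) = σ[M,e,n,l] * A n (e 1) ∧ B n (e 1) = -(σ[M,e,n,l] * A n (e 0)) ∧
    B l n = -(σ[M,e,n,l] * A (e 0) (e 1)) ∧ B (e 0) (e 1) = σ[M,e,n,l] * A l n := by
  have hr : (√2)⁻¹ ≠ 0 := by positivity
  have h2 := inv_sqrt_two_mul_self
  have subl : ∀ {C : T[I4] x → T[I4] x → ℝ}, (∀ u u' w, C (u + u') w = C u w + C u' w) →
      (∀ (r : ℝ) u w, C (r • u) w = r * C u w) → ∀ u u' w, C (u - u') w = C u w - C u' w := by
    intro C ha hs u u' w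
    rw [sub_eq_add_neg, ← neg_one_smul ℝ u', ha, hs]; ring
  obtain ⟨c01, c02, c03, c12, c13, c23⟩ := hp.comp _ (h.orthonormal (M.g_symm x))
  rw [vol_nullONFrame] at c01 c02 c03 c12 c13 c23
  set s := σ[M,e,n,l]
  have A3 : ∀ u, A u ((√2)⁻¹ • (n - l)) = -((√2)⁻¹ * (A n u - A l u)) := fun u ↦ by
    rw [hp.swapA, hp.smulA, subl hp.addA hp.smulA]
  have B3 : ∀ u, B u ((√2)⁻¹ • (n - l)) = -((√2)⁻¹ * (B n u - B l u)) := fun u ↦ by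
    rw [hp.swapB, hp.smulB, subl hp.addB hp.smulB]
  have A0 : ∀ u, A ((√2)⁻¹ • (n + l)) u = (√2)⁻¹ * (A n u + A l u) := fun u ↦ by rw [hp.smulA, hp.addA]
  have B0 : ∀ u, B ((√2)⁻¹ • (n + l)) u = (√2)⁻¹ * (B n u + B l u) := fun u ↦ by rw [hp.smulB, hp.addB]
  have Af : A ((√2)⁻¹ • (n + l)) ((√2)⁻¹ • (n - l)) = A l n := by
    have z1 : A n n = 0 := by linarith [hp.swapA n n]
    have z2 : A l l = 0 := by linarith [hp.swapA l l]
    rw [A3, hp.swapA ((√2)⁻¹ • (n + l)) n, hp.swapA ((√2)⁻¹ • (n + l)) l, A0, A0, hp.swapA l n, z1, z2]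
    linear_combination (2 * A l n) * h2
  have Bf : B ((√2)⁻¹ • (n + l)) ((√2)⁻¹ • (n - l)) = B l n := by
    have z1 : B n n = 0 := by linarith [hp.swapB n n]
    have z2 : B l l = 0 := by linarith [hp.swapB l l]
    rw [B3, hp.swapB ((√2)⁻¹ • (n + l)) n, hp.swapB ((√2)⁻¹ • (n + l)) l, B0, B0, hp.swapB l n, z1, z2]
    linear_combination (2 * B l n) * h2
  simp only [nullONFrame_zero, nullONFrame_one, nullONFrame_two, nullONFrame_three, Af, Bf] at c01 c02 c03 c12 c13 c23
  simp only [A0, A3, B0, B3] at c01 c02 c03 c12 c13 c23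
  have d01 : B n (e 0) + B l (e 0) = s * (A n (e 1) - A l (e 1)) := mul_left_cancel₀ hr (by linear_combination c01)
  have d02 : B n (e 1) + B l (e 1) = -(s * (A n (e 0) - A l (e 0))) := mul_left_cancel₀ hr (by linear_combination c02)
  have d13 : B n (e 0) - B l (e 0) = s * (A n (e 1) + A l (e 1)) := mul_left_cancel₀ hr (by linear_combination -c13)
  have d23 : B n (e 1) - B l (e 1) = -(s * (A n (e 0) + A l (e 0))) := mul_left_cancel₀ hr (by linear_combination -c23)
  refine ⟨?_, ?_, ?_, ?_, ?_, ?_⟩ <;> linarith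

lemma hodge_dualPair (hF : ∀ u, F x u u = 0) : M.DualPair x (fun u w ↦ F x u w) (M.hodge₂ F x) where
  addA u u' w := by rw [map_add, _root_.add_apply]
  smulA r u w := by rw [map_smul, _root_.smul_apply, smul_eq_mul]
  swapA u w := M.skew_of_alternating hF w u
  addB := M.hodge₂_add_left
  smulB := M.hodge₂_smul_left
  swapB := M.hodge₂_swap
  comp _ hf := M.hodge₂_components hF hf

lemma covTensorField_frame {T : Cov₂ I4 M.carrier}
    (hf : M.IsONFrame f) {V : Fin 4 → Vec I4 M.carrier} (hV : ∀ i, V i x = f i)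
    (u : T[I4] x) (i j : Fin 4) :
    covTensorField M.nab T (V i) (V j) x u = ∂[I4] (fun y ↦ T y (V i y) (V j y)) x u
      - ∑ k, eta k * M.g x (M.nab (V i) x u) (f k) * T x (f k) (f j) - ∑ k, eta k * M.g x (M.nab (V j) x u) (f k) * T x (f i) (f k) := by
  have h : ∀ z, z = ∑ k, (eta k * M.g x z (f k)) • f k := orthonormal_expansion M.isPseudoMetric hf
  rw [covTensorField]
  conv_lhs => rw [h (M.nab (V i) x u), h (M.nab (V j) x u)]
  simp only [map_sum, _root_.sum_apply, map_smul, _root_.smul_apply, smul_eq_mul, hV]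

/-- The volume form is parallel, so covariant differentiation commutes with the Hodge dual. -/
lemma covTensor_dualPair (hF : ∀ y u, F y u u = 0) (hFs : TensorSmoothAt I4 F x) (u : T[I4] x) :
    M.DualPair x (covTensor M.nab F x u) (covTensor M.nab (M.hodgeForm F) x u) where
  addA v v' w := covTensor_add₂ hFs hF u v v' w
  smulA r v w := covTensor_smul₂ hFs hF r u v w
  swapA v w := covTensor_swap hF u v w
  addB v v' w := covTensor_add₂ (M.hodgeForm_smooth hFs) (fun _ _ ↦ M.hodge₂_self _) u v v' w
  smulB r v w := covTensor_smul₂ (M.hodgeForm_smooth hFs) (fun _ _ ↦ M.hodge₂_self _) r u v w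
  swapB v w := covTensor_swap (fun _ _ ↦ M.hodge₂_self _) u v w
  comp f hf := by
    have hH : ∀ y u, M.hodgeForm F y u u = 0 := fun _ _ ↦ M.hodge₂_self _
    have hHs := M.hodgeForm_smooth hFs
    obtain ⟨V, hV, hVx, hVo⟩ := exists_orthonormal_frame M.isPseudoMetric hf
    have hc : ∀ i j, covTensor M.nab F x u (f i) (f j) = covTensorField M.nab F (V i) (V j) x u := fun i j ↦ by
      rw [← covTensor_eq hFs hF (hV i) (hV j), hVx, hVx]
    have hd : ∀ i j, covTensor M.nab (M.hodgeForm F) x u (f i) (f j) = covTensorField M.nab (M.hodgeForm F) (V i) (V j) x u := fun i j ↦ by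
      rw [← covTensor_eq hHs hH (hV i) (hV j), hVx, hVx]
    -- the coefficients of the connection in the frame are skew
    have hA : ∀ i j, M.g x (M.nab (V i) x u) (f j) = -M.g x (M.nab (V j) x u) (f i) := by
      intro i j
      have h1 := M.leviCivita.metric x (V i) (V j) (hV i).fieldDiffAt (hV j).fieldDiffAt u
      have h2 : ∂[I4] (fun y ↦ M.g y (V i y) (V j y)) x = ∂[I4] (fun _ : M.carrier ↦ if i = j then eta i else 0) x :=
        mvfderiv_congr (hVo.mono fun y hy ↦ hy i j)
      rw [h2, dd_const, hVx, hVx, M.g_symm x (f i)] at h1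
      linarith
    -- the volume of the frame is locally constant
    set w : M.carrier → ℝ := fun y ↦ M.vol y fun i ↦ V i y with hw
    have hwd : D¹[I4] w x := (M.vol_smooth x V hV).mdiff
    have hwx : w x = M.vol x f := by simp only [hw, hVx]
    have hw2 : ∀ᶠ y in 𝓝 x, w y * w y = 1 := hVo.mono fun y hy ↦ by
      have := M.vol_orthonormal_sq hy
      rwa [sq] at this
    have hwz : ∂[I4] w x u = 0 := by
      have h1 := dd_mul hwd hwd u
      have h2 : ∂[I4] (fun y ↦ w y * w y) x = ∂[I4] (fun _ : M.carrier ↦ (1 : ℝ)) x := mvfderiv_congr hw2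
      rw [h2, dd_const] at h1
      have h3 := hw2.self_of_nhds
      have h4 : w x ≠ 0 := fun h0 ↦ by rw [h0] at h3; norm_num at h3
      exact (mul_eq_zero.1 (show w x * ∂[I4] w x u = 0 by linarith)).resolve_left h4
    have hFd : ∀ i j, D¹[I4] (fun y ↦ F y (V i y) (V j y)) x := fun i j ↦ (hFs _ _ (hV i) (hV j)).mdiff
    have key : ∀ i j k m, ∀ r : ℝ, (∀ᶠ y in 𝓝 x, M.hodgeForm F y (V i y) (V j y) = r * (w y * F y (V k y) (V m y))) →
        ∂[I4] (fun y ↦ M.hodgeForm F y (V i y) (V j y)) x u = r * (w x * ∂[I4] (fun y ↦ F y (V k y) (V m y)) x u) := by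
      intro i j k m r h
      have hd : D¹[I4] (fun y ↦ w y * F y (V k y) (V m y)) x := hwd.mul (hFd k m)
      rw [mvfderiv_congr h, dd_const_mul r hd, dd_mul hwd (hFd k m), hwz]
      ring
    have k := fun y (hy : M.IsONFrame fun i ↦ V i y) ↦ M.hodge₂_components (hF y) hy
    have k01 := key 0 1 2 3 1 (hVo.mono fun y hy ↦ (k y hy).1.trans (one_mul _).symm)
    have k02 := key 0 2 1 3 (-1) (hVo.mono fun y hy ↦ (k y hy).2.1.trans (neg_one_mul _).symm)
    have k03 := key 0 3 1 2 1 (hVo.mono fun y hy ↦ (k y hy).2.2.1.trans (one_mul _).symm)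
    have k12 := key 1 2 0 3 (-1) (hVo.mono fun y hy ↦ (k y hy).2.2.2.1.trans (neg_one_mul _).symm)
    have k13 := key 1 3 0 2 1 (hVo.mono fun y hy ↦ (k y hy).2.2.2.2.1.trans (one_mul _).symm)
    have k23 := key 2 3 0 1 (-1) (hVo.mono fun y hy ↦ (k y hy).2.2.2.2.2.trans (neg_one_mul _).symm)
    obtain ⟨c01, c02, c03, c12, c13, c23⟩ := M.hodge₂_components (hF x) hf
    have s := M.skew_of_alternating (hF x)
    have sH : ∀ v w, M.hodge₂ F x v w = -M.hodge₂ F x w v := fun v w ↦ M.hodge₂_swap w v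
    simp only [DualComponents, hc, hd, M.covTensorField_frame hf hVx, k01, k02, k03, k12, k13, k23, Fin.sum_univ_four, eta_zero, eta_one, eta_two, eta_three, hwx]
    have z : ∀ i, M.g x (M.nab (V i) x u) (f i) = 0 := fun i ↦ by linarith [hA i i]
    simp only [hodgeForm_apply, z, hA 1 0, hA 2 0, hA 3 0, hA 2 1, hA 3 1, hA 3 2, M.hodge₂_self, hF, sH (f 1) (f 0), sH (f 2) (f 0),
      sH (f 2) (f 1), sH (f 3) (f 1), sH (f 3) (f 2), s (f 1) (f 0), s (f 2) (f 0),
      s (f 2) (f 1), s (f 3) (f 1), s (f 3) (f 2), c01, c02, c03, c12, c13, c23]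
    refine ⟨?_, ?_, ?_, ?_, ?_, ?_⟩ <;> ring



/-! ### The Maxwell equations on a null hyperplane -/

/-- The components of the Hodge dual of a 3-form in an orthonormal frame. -/
lemma hodge₃_components (hG : M.IsThreeForm G) (hf : M.IsONFrame f) :
    M.hodge₃ x G (f 0) = -((M.vol x f : ℂ) * G (f 1) (f 2) (f 3)) ∧ M.hodge₃ x G (f 1) = -((M.vol x f : ℂ) * G (f 0) (f 2) (f 3)) ∧
    M.hodge₃ x G (f 2) = (M.vol x f : ℂ) * G (f 0) (f 1) (f 3) ∧ M.hodge₃ x G (f 3) = -((M.vol x f : ℂ) * G (f 0) (f 1) (f 2)) := by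
  have p := hG.perm
  refine ⟨?_, ?_, ?_, ?_⟩ <;> simp only [M.hodge₃_eq hG hf, alt_frame, Fin.sum_univ_four, eta_zero, eta_one, eta_two, eta_three, hG.eq_zero,
    p (f 0) (f 1) (f 2), p (f 0) (f 1) (f 3), p (f 0) (f 2) (f 3), p (f 1) (f 2) (f 3)] <;> norm_num <;> ring

lemma hodge₃_add (u w : T[I4] x) : M.hodge₃ x G (u + w) = M.hodge₃ x G u + M.hodge₃ x G w := by
  simp only [hodge₃, alt_add3, ← mul_add, ← sum_add_distrib]
  exact congrArg _ (sum_congr rfl fun _ _ ↦ sum_congr rfl fun _ _ ↦ sum_congr rfl fun _ _ ↦ by push_cast; ring)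

lemma hodge₃_smul (r : ℝ) (u : T[I4] x) : M.hodge₃ x G (r • u) = r * M.hodge₃ x G u := by
  simp only [hodge₃, alt_smul3, mul_sum]
  exact sum_congr rfl fun _ _ ↦ sum_congr rfl fun _ _ ↦ sum_congr rfl fun _ _ ↦ by push_cast; ring

/-- The Hodge dual of a 3-form on the vectors of a null frame tangent to the null hyperplane. -/
lemma hodge₃_null (hG : M.IsThreeForm G) (h : IsNullFrame (M.g) x e n l) :
    M.hodge₃ x G (e 0) = -((σ[M,e,n,l] : ℂ) * G l n (e 1)) ∧
    M.hodge₃ x G (e 1) = (σ[M,e,n,l] : ℂ) * G l n (e 0) ∧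
    M.hodge₃ x G l = -((σ[M,e,n,l] : ℂ) * G (e 0) (e 1) l) := by
  have hr : ((√2)⁻¹ : ℂ) * ((√2)⁻¹ : ℂ) = 1 / 2 := by
    simpa using congrArg (fun t : ℝ ↦ (t : ℂ)) inv_sqrt_two_mul_self
  obtain ⟨c0, c1, c2, c3⟩ := M.hodge₃_components hG (h.orthonormal (M.g_symm x))
  rw [vol_nullONFrame] at c0 c1 c2 c3
  have f3 : nullONFrame e n l 3 = (√2)⁻¹ • (n + (-1 : ℝ) • l) := by
    rw [neg_one_smul, ← sub_eq_add_neg]; rfl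
  have p := hG.perm
  have g0 (u v) : G ((√2)⁻¹ • (n + l)) u v = ((√2)⁻¹ : ℂ) * (G n u v + G l u v) := by rw [hG.smul, hG.add]; push_cast; rfl
  have g3 (u v) : G u v ((√2)⁻¹ • (n + (-1 : ℝ) • l)) = ((√2)⁻¹ : ℂ) * (G u v n - G u v l) := by
    rw [hG.cycle _ u v, hG.smul, hG.add, hG.smul, hG.cycle n u v, hG.cycle l u v]; push_cast; ring
  have j0 : M.hodge₃ x G (nullONFrame e n l 0) = ((√2)⁻¹ : ℂ) * (M.hodge₃ x G n + M.hodge₃ x G l) := by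
    rw [nullONFrame_zero, hodge₃_smul, hodge₃_add]; push_cast; rfl
  have j3 : M.hodge₃ x G (nullONFrame e n l 3) = ((√2)⁻¹ : ℂ) * (M.hodge₃ x G n - M.hodge₃ x G l) := by
    rw [f3, hodge₃_smul, hodge₃_add, hodge₃_smul]; push_cast; ring
  rw [j0] at c0
  rw [j3] at c3
  simp only [nullONFrame_zero, nullONFrame_one, nullONFrame_two, f3, g0, g3, hG.eq_zero] at c0 c1 c2 c3
  rw [(p l n (e 1)).2.1, (p l n (e 1)).2.2.2.1] at c1
  rw [(p l n (e 0)).2.1, (p l n (e 0)).2.2.2.1] at c2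
  rw [(p (e 0) (e 1) n).2.2.1, (p (e 0) (e 1) l).2.2.1] at c3
  push_cast at c0 c1 c2 c3
  have hr0 : ((√2)⁻¹ : ℂ) ≠ 0 := fun h0 ↦ by rw [h0] at hr; norm_num at hr
  have c0' := mul_left_cancel₀ hr0 (c0.trans (show _ = ((√2)⁻¹ : ℂ) * ((σ[M,e,n,l] : ℂ) * (G (e 0) (e 1) n - G (e 0) (e 1) l)) by ring))
  have c3' := mul_left_cancel₀ hr0 (c3.trans (show _ = ((√2)⁻¹ : ℂ) * ((σ[M,e,n,l] : ℂ) * (G (e 0) (e 1) n + G (e 0) (e 1) l)) by ring))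
  refine ⟨?_, ?_, ?_⟩
  · linear_combination c1 - 2 * (σ[M,e,n,l] : ℂ) * G l n (e 1) * hr
  · linear_combination c2 + 2 * (σ[M,e,n,l] : ℂ) * G l n (e 0) * hr
  · linear_combination (1 / 2) * c0' - (1 / 2) * c3'

/-- The covariant derivative of the complex 2-form `F - i ⋆F`. -/
def covSelfDual (F : Cov₂ I4 M.carrier) (x : M.carrier) (u v w : T[I4] x) : ℂ :=
  (covTensor M.nab F x u v w : ℂ) - Complex.I * (covTensor M.nab (M.hodgeForm F) x u v w : ℂ)

lemma extDeriv_selfDualPart (hF : ∀ y u, F y u u = 0) (hFs : TensorSmoothAt I4 F x) (u v w : T[I4] x) :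
    extDeriv I4 (M.selfDualPart F) x u v w = (extCov M.nab F x u v w : ℂ) - Complex.I * (extCov M.nab (M.hodgeForm F) x u v w : ℂ) :=
  extDeriv_complex M.leviCivita.torsion_free hFs (M.hodgeForm_smooth hFs) hF (fun _ _ ↦ M.hodge₂_self _) u v w

lemma extDeriv_eq_covSelfDual (hF : ∀ y u, F y u u = 0) (hFs : TensorSmoothAt I4 F x) (u v w : T[I4] x) :
    extDeriv I4 (M.selfDualPart F) x u v w = M.covSelfDual F x u v w + M.covSelfDual F x v w u + M.covSelfDual F x w u v := by
  rw [M.extDeriv_selfDualPart hF hFs, extCov, extCov, covSelfDual, covSelfDual, covSelfDual]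
  push_cast
  ring

lemma covSelfDual_swap (hF : ∀ y u, F y u u = 0) (u v w : T[I4] x) : M.covSelfDual F x u w v = -M.covSelfDual F x u v w := by
  rw [covSelfDual, covTensor_swap hF, covTensor_swap (T := M.hodgeForm F) (fun _ _ ↦ M.hodge₂_self _), covSelfDual]
  push_cast
  ring

/-- The components of `⋆d(F - i⋆F)` along a null hyperplane. -/
lemma maxwell_null (hF : ∀ y u, F y u u = 0) (hFs : TensorSmoothAt I4 F x) (h : IsNullFrame (M.g) x e n l) :
    M.maxwell F x (e 0) = -((σ[M,e,n,l] : ℂ) * extDeriv I4 (M.selfDualPart F) x l n (e 1)) ∧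
    M.maxwell F x (e 1) = (σ[M,e,n,l] : ℂ) * extDeriv I4 (M.selfDualPart F) x l n (e 0) ∧
    M.maxwell F x l = -((σ[M,e,n,l] : ℂ) * extDeriv I4 (M.selfDualPart F) x (e 0) (e 1) l) := by
  have hH : ∀ y u, M.hodgeForm F y u u = 0 := fun _ _ ↦ M.hodge₂_self _
  have hHs := M.hodgeForm_smooth hFs
  refine M.hodge₃_null ⟨fun u u' v w ↦ ?_, fun r u v w ↦ ?_, fun u v w ↦ ?_, fun u v w ↦ ?_⟩ h <;> simp only [M.extDeriv_selfDualPart hF hFs]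
  · rw [extCov_add hFs hF, extCov_add hHs hH]; push_cast; ring
  · rw [extCov_smul hFs hF, extCov_smul hHs hH]; push_cast; ring
  · rw [extCov_swap hF, extCov_swap hH]; push_cast; ring
  · rw [extCov_cycle u v w, extCov_cycle u v w]

/-- A self-dual form vanishes on the null vector `l` and the complex direction `e₁ - i s e₂`, where `s` is the orientation of the frame. -/
lemma covSelfDual_l (hF : ∀ y u, F y u u = 0) (hFs : TensorSmoothAt I4 F x) (h : IsNullFrame (M.g) x e n l) (u : T[I4] x) :
    M.covSelfDual F x u l (e 0) - Complex.I * (σ[M,e,n,l] : ℂ) * M.covSelfDual F x u l (e 1) = 0 := by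
  obtain ⟨h0, h1, -⟩ := (M.covTensor_dualPair hF hFs u).null M h
  have hs : (σ[M,e,n,l] : ℂ) ^ 2 = 1 := by exact_mod_cast congrArg (fun t : ℝ ↦ (t : ℂ)) (M.vol_null_sq h)
  rw [covSelfDual, covSelfDual, h0, h1]
  push_cast
  linear_combination (-(covTensor M.nab F x u l (e 0) : ℂ) ) * hs + (σ[M,e,n,l] : ℂ) ^ 2 * (covTensor M.nab F x u l (e 0) : ℂ) * Complex.I_sq

/-- The Maxwell equations intrinsic to a null hyperplane: `J(l) = 0` and the `(⋆ - i)`-part of the pullback of `J` vanishes. -/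
lemma maxwell_iff (hF : ∀ y u, F y u u = 0) (hFs : TensorSmoothAt I4 F x) (h : IsNullFrame (M.g) x e n l) :
    (M.maxwell F x l = 0 ∧ ∀ w ∈ Submodule.span ℝ {e 0, e 1, l},
      (∑ i, M.maxwell F x (e i) * (M.vol x ![e i, w, n, l] : ℂ)) - Complex.I * M.maxwell F x w = 0) ↔
    (extDeriv I4 (M.selfDualPart F) x (e 0) (e 1) l = 0 ∧
      extDeriv I4 (M.selfDualPart F) x l n (e 0) - Complex.I * (σ[M,e,n,l] : ℂ) * extDeriv I4 (M.selfDualPart F) x l n (e 1) = 0) := by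
  obtain ⟨j0, j1, jl⟩ := M.maxwell_null hF hFs h
  have hs : (σ[M,e,n,l] : ℂ) ^ 2 = 1 := by exact_mod_cast congrArg (fun t : ℝ ↦ (t : ℂ)) (M.vol_null_sq h)
  have hs0 : (σ[M,e,n,l] : ℂ) ≠ 0 := fun h0 ↦ by rw [h0] at hs; norm_num at hs
  have hv : M.vol x ![e 1, e 0, n, l] = -σ[M,e,n,l] := alt_swap01 _ _ _ _ _
  constructor
  · rintro ⟨hl, hw⟩
    refine ⟨(mul_eq_zero.1 (neg_eq_zero.1 (jl.symm.trans hl))).resolve_left hs0, ?_⟩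
    -- as `(⋆ - i)` has rank one on the section, its value at `e₀` contains the whole condition
    have := hw (e 0) (Submodule.subset_span (by simp))
    rw [Fin.sum_univ_two, alt_eq01, hv, j0, j1] at this
    push_cast at this
    linear_combination -this + (-extDeriv I4 (M.selfDualPart F) x l n (e 0)) * hs
  · rintro ⟨hl, hm⟩
    have jl0 : M.maxwell F x l = 0 := by rw [jl, hl, mul_zero, neg_zero]
    refine ⟨jl0, fun w hw ↦ ?_⟩
    induction hw using Submodule.span_induction with
    | mem w hw =>
      simp only [Set.mem_insert_iff, Set.mem_singleton_iff] at hw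
      rcases hw with rfl | rfl | rfl
      · rw [Fin.sum_univ_two, alt_eq01, hv, j0, j1]
        push_cast
        linear_combination -hm + (-extDeriv I4 (M.selfDualPart F) x l n (e 0)) * hs
      · rw [Fin.sum_univ_two, alt_eq01, j0, j1]
        push_cast
        linear_combination (-Complex.I * (σ[M,e,n,l] : ℂ)) * hm
          - (σ[M,e,n,l] : ℂ) ^ 2 * extDeriv I4 (M.selfDualPart F) x l n (e 1) * Complex.I_sq
      · rw [Fin.sum_univ_two, alt_eq13, alt_eq13, jl0]
        simp
    | zero =>
      have h1 := M.hodge₃_smul (x := x) (G := extDeriv I4 (M.selfDualPart F) x) 0 0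
      rw [zero_smul, Complex.ofReal_zero, zero_mul] at h1
      have h2 : ∀ i, M.vol x ![e i, 0, n, l] = 0 := fun i ↦ by
        rw [← zero_smul ℝ (0 : T[I4] x), alt_smul1, zero_mul]
      simp only [maxwell, h1, h2, Complex.ofReal_zero, mul_zero, sum_const_zero, sub_zero]
    | add w w' _ _ hw hw' =>
      have h1 : M.maxwell F x (w + w') = M.maxwell F x w + M.maxwell F x w' := M.hodge₃_add w w'
      simp only [Fin.sum_univ_two, alt_add1] at hw hw' ⊢
      rw [h1]
      push_cast
      linear_combination hw + hw'
    | smul r w _ hw =>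
      have h1 : M.maxwell F x (r • w) = r * M.maxwell F x w := M.hodge₃_smul r w
      simp only [Fin.sum_univ_two, alt_smul1] at hw ⊢
      rw [h1]
      push_cast
      linear_combination (r : ℂ) * hw

end Spacetime

section Horizon
variable {S : Type u} [TopologicalSpace S] [ChartedSpace ℝ² S]
  [IsManifold (𝓡 2) ∞ S]

/-! ### 2-forms with eigenvector `ℓ` along the horizon -/

/- `L[Δ,p]` is the null normal and `γ[Δ,p]` the spacetime metric at the point `p` of the horizon. -/
local notation "L[" Δ "," p "]" => IsolatedHorizon.push Δ p (ell p)
local notation "γ[" Δ "," p "]" => Spacetime.g (IsolatedHorizon.M Δ) (IsolatedHorizon.emb Δ p)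

namespace IsolatedHorizon
variable (Δ : IsolatedHorizon S) {p : S × ℝ} {T : Cov₂ I4 Δ.M.carrier}

lemma exists_normalized (p : S × ℝ) : ∃ n, γ[Δ,p] L[Δ,p] n = -1 := by
  obtain ⟨z, hz⟩ : ∃ z, γ[Δ,p] L[Δ,p] z ≠ 0 := by
    by_contra! h
    exact Δ.push_ell_ne_zero p (Δ.M.isPseudoMetric.ext fun z ↦ by rw [h, map_zero]; rfl)
  exact ⟨(-(γ[Δ,p] L[Δ,p] z)⁻¹) • z, by rw [map_smul, smul_eq_mul, neg_mul, inv_mul_cancel₀ hz]⟩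

/-- The tangent space of the horizon is the orthogonal complement of `ℓ`. -/
lemma exists_push {w : T[I4] (Δ.emb p)} (h : γ[Δ,p] L[Δ,p] w = 0) : ∃ u, Δ.push p u = w := by
  let A : ℝ² × ℝ →ₗ[ℝ] (ℝ² × ℝ) × ℝ := (Δ.push p).toLinearMap
  let B : (ℝ² × ℝ) × ℝ →ₗ[ℝ] ℝ := (γ[Δ,p] L[Δ,p]).toLinearMap
  have hB : B ≠ 0 := by
    obtain ⟨n, hn⟩ := Δ.exists_normalized p
    intro h0
    have h1 : B n = 0 := by rw [h0]; rfl
    exact absurd (hn.symm.trans h1) (by norm_num)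
  have h1 : LinearMap.range A ≤ LinearMap.ker B := by
    rintro _ ⟨u, rfl⟩
    exact Δ.null p u
  -- both spaces have dimension `3`
  have h2 : LinearMap.range A = LinearMap.ker B := by
    refine Submodule.eq_of_le_of_finrank_eq h1 ?_
    have k1 := LinearMap.finrank_range_of_inj (f := A) (Δ.push_injective p)
    have k2 := Module.Dual.finrank_ker_add_one_of_ne_zero hB
    rw [k1]
    simp only [Module.finrank_prod, finrank_euclideanSpace, Fintype.card_fin, Module.finrank_self] at k2 ⊢
    omega
  have h3 : w ∈ LinearMap.range A := by rw [h2]; exact h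
  exact h3

/-- If `ℓ` is an eigenvector of the 2-form `T`, the function `a` with `T(ℓ, ·) = a g(ℓ, ·)`. -/
def nullCoeff (T : Cov₂ I4 Δ.M.carrier) (p : S × ℝ) : ℝ :=
  -T (Δ.emb p) L[Δ,p] (Classical.choose (Δ.exists_normalized p))

lemma nullCoeff_spec (hl : ∀ w, T (Δ.emb p) L[Δ,p] (Δ.push p w) = 0) (w : T[I4] (Δ.emb p)) :
    T (Δ.emb p) L[Δ,p] w = Δ.nullCoeff T p * γ[Δ,p] L[Δ,p] w := by
  have hn := Classical.choose_spec (Δ.exists_normalized p)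
  rw [nullCoeff]
  set n := Classical.choose (Δ.exists_normalized p)
  obtain ⟨u, hu⟩ := Δ.exists_push (p := p) (w := w + γ[Δ,p] L[Δ,p] w • n) (by
    rw [map_add, map_smul, hn, smul_eq_mul]; ring)
  have h := hl u
  rw [hu, map_add, map_smul, smul_eq_mul] at h
  linarith

lemma nullCoeff_smooth (hT : TensorSmoothAt I4 T (Δ.emb p)) (hl : ∀ p w, T (Δ.emb p) L[Δ,p] (Δ.push p w) = 0) :
    C∞[I3] (Δ.nullCoeff T) p := by
  obtain ⟨n, hn⟩ := Δ.exists_normalized p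
  obtain ⟨W, hW, rfl⟩ := exists_fieldSmoothAt n
  obtain ⟨L, hL1, -, hL2⟩ := Δ.exists_ext (X := ell) p
  have hL := hL2 (ell_smooth p)
  have hLp : L (Δ.emb p) = L[Δ,p] := hL1.self_of_nhds
  have h1 : C∞[I3] (fun y ↦ T (Δ.emb y) (L (Δ.emb y)) (W (Δ.emb y))) p :=
    ContMDiffAt.comp p (hT L W hL hW) (Δ.emb_contMDiffAt p)
  have h2 : C∞[I3] (fun y ↦ Δ.M.g (Δ.emb y) (L (Δ.emb y)) (W (Δ.emb y))) p :=
    ContMDiffAt.comp p (Δ.M.g_smooth _ L W hL hW) (Δ.emb_contMDiffAt p)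
  have h0 : γ[Δ,p] (L (Δ.emb p)) (W (Δ.emb p)) ≠ 0 := by rw [hLp, hn]; norm_num
  refine (h1.div₀ h2 h0).congr_of_eventuallyEq ?_
  filter_upwards [hL1, h2.continuousAt.eventually_ne h0] with y hy hy0
  have := Δ.nullCoeff_spec (hl y) (W (Δ.emb y))
  rw [← hy] at this
  exact (eq_div_iff hy0).2 this.symm

/-- The derivative of an eigenvector form in directions tangent to the horizon. -/
lemma covTensor_ell (hTa : ∀ x u, T x u u = 0) (hT : TensorSmoothAt I4 T (Δ.emb p))
    (hl : ∀ p w, T (Δ.emb p) L[Δ,p] (Δ.push p w) = 0) (u : T[I3] p) (w : T[I4] (Δ.emb p)) :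
    covTensor Δ.M.nab T (Δ.emb p) (Δ.push p u) L[Δ,p] w =
      ∂[I3] (Δ.nullCoeff T) p u * γ[Δ,p] L[Δ,p] w := by
  obtain ⟨W, hW, rfl⟩ := exists_fieldSmoothAt w
  obtain ⟨L, hL1, -, hL2⟩ := Δ.exists_ext (X := ell) p
  have hL := hL2 (ell_smooth p)
  have hLp : L (Δ.emb p) = L[Δ,p] := hL1.self_of_nhds
  have hsp := Δ.nullCoeff_spec (hl p)
  have hnab : Δ.M.nab L (Δ.emb p) (Δ.push p u) = rotationForm Δ.D p u • L[Δ,p] := by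
    rw [← Δ.push_D (ell_smooth p).fieldDiffAt hL.fieldDiffAt hL1 u, Δ.horizonGeom.nab_ell_eq, map_smul]
  have d1 := (hT L W hL hW).mdifferentiableAt (n := ∞) (by simp)
  have d2 := (Δ.M.g_smooth _ L W hL hW).mdifferentiableAt (n := ∞) (by simp)
  have c1 := mvfderiv_comp' p d1 (Δ.emb_mdiff p) u
  have c2 := mvfderiv_comp' p d2 (Δ.emb_mdiff p) u
  have da : D¹[I3] (Δ.nullCoeff T) p := (Δ.nullCoeff_smooth hT hl).mdiff
  have dg : D¹[I3] (fun y ↦ Δ.M.g (Δ.emb y) (L (Δ.emb y)) (W (Δ.emb y))) p := d2.comp p (Δ.emb_mdiff p)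
  have h1 : ∂[I3] (fun y ↦ T (Δ.emb y) (L (Δ.emb y)) (W (Δ.emb y))) p u =
      ∂[I3] (fun y ↦ Δ.nullCoeff T y * Δ.M.g (Δ.emb y) (L (Δ.emb y)) (W (Δ.emb y))) p u := by
    refine congrArg (fun A : T[I3] p →L[ℝ] ℝ ↦ A u) (mvfderiv_congr ?_)
    filter_upwards [hL1] with y hy
    rw [hy]
    exact Δ.nullCoeff_spec (hl y) _
  have h2 := Δ.M.leviCivita.metric _ L W hL.fieldDiffAt hW.fieldDiffAt (Δ.push p u)
  rw [dd_mul da dg, c1, c2] at h1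
  change ∂[I4] (fun x ↦ T x (L x) (W x)) (Δ.emb p) (Δ.push p u) = Δ.nullCoeff T p * ∂[I4] (fun x ↦ Δ.M.g x (L x) (W x)) (Δ.emb p) (Δ.push p u)
    + ∂[I3] (Δ.nullCoeff T) p u * γ[Δ,p] (L (Δ.emb p)) (W (Δ.emb p)) at h1
  rw [hnab, hLp, map_smul, _root_.smul_apply, smul_eq_mul] at h2
  rw [hLp] at h1
  rw [← hLp, covTensor_eq hT hTa hL hW, covTensorField, hnab, hLp, map_smul, _root_.smul_apply, smul_eq_mul, hsp, hsp]
  linear_combination h1 + Δ.nullCoeff T p * h2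

/-- Flow invariance of the tensor makes the eigenvalue constant along the null geodesics. -/
lemma nullCoeff_invariant (hT : TensorSmoothAt I4 T (Δ.emb p)) (hl : ∀ p w, T (Δ.emb p) L[Δ,p] (Δ.push p w) = 0)
    (hi : Δ.IsFlowInvariant fun x u w ↦ T x u w) : ∂[I3] (Δ.nullCoeff T) p (ell p) = 0 := by
  have da : D¹[I3] (Δ.nullCoeff T) p := (Δ.nullCoeff_smooth hT hl).mdiff
  have hf := (ell_smooth p).fieldDiffAt
  obtain ⟨n, hn⟩ := Δ.exists_normalized p
  have h := hi p ell (Δ.nullCoeff T • ell) hf (hf.smul da) (Eventually.of_forall fun y w ↦ by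
    have := Δ.nullCoeff_spec (hl y) w
    refine Eq.trans ?_ this.symm
    have e : Δ.push y ((Δ.nullCoeff T • ell) y) = Δ.nullCoeff T y • Δ.push y (ell y) := map_smul (Δ.push y) (Δ.nullCoeff T y) (ell y)
    rw [e, map_smul]
    rfl) n
  rw [br_smul_right da hf, mlieBracket_self] at h
  simp only [Pi.zero_apply, smul_zero, map_zero, _root_.zero_apply, add_zero, map_smul, _root_.smul_apply, smul_eq_mul, hn] at h
  linarith

/-- The derivative along `ℓ` of a flow invariant 2-form with eigenvector `ℓ`. -/
lemma covTensor_ell_dir (hTa : ∀ x u, T x u u = 0) (hT : ∀ p, TensorSmoothAt I4 T (Δ.emb p)) (hl : ∀ p w, T (Δ.emb p) L[Δ,p] (Δ.push p w) = 0)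
    (hi : Δ.IsFlowInvariant fun x u w ↦ T x u w) {u z : T[I3] p} (hz : ∀ w, γ[Δ,p] (Δ.push p z) w = T (Δ.emb p) (Δ.push p u) w)
    (w : T[I4] (Δ.emb p)) :
    covTensor Δ.M.nab T (Δ.emb p) L[Δ,p] (Δ.push p u) w =
      (rotationForm Δ.D p z - rotationForm Δ.D p u * Δ.nullCoeff T p) * γ[Δ,p] L[Δ,p] w := by
  obtain ⟨W, hW, rfl⟩ := exists_fieldSmoothAt w
  obtain ⟨Y, hY, rfl⟩ := exists_fieldSmoothAt u
  obtain ⟨L, hL1, -, hL2⟩ := Δ.exists_ext (X := ell) p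
  obtain ⟨Y', hY1, -, hY2⟩ := Δ.exists_ext (X := Y) p
  have hL := hL2 (ell_smooth p)
  have hY' := hY2 hY
  have hLp : L (Δ.emb p) = L[Δ,p] := hL1.self_of_nhds
  have hYp : Y' (Δ.emb p) = Δ.push p (Y p) := hY1.self_of_nhds
  -- the field metrically equivalent to `T(Y, ·)` is tangent to the horizon
  let Z' : Vec I4 Δ.M.carrier := fun x ↦ sharp Δ.M.isPseudoMetric x (T x (Y' x))
  have hZ'g : ∀ x w, Δ.M.g x (Z' x) w = T x (Y' x) w := fun x w ↦ sharp_spec Δ.M.isPseudoMetric x (T x (Y' x)) w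
  have hZ' : V∞[I4] Z' (Δ.emb p) := fieldSmoothAt_of_metric Δ.M.isPseudoMetric fun Q hQ ↦ by
    simp only [hZ'g]
    exact hT p Y' Q hY' hQ
  have hZt : ∀ y, ∃ a : T[I3] y, Y' (Δ.emb y) = Δ.push y (Y y) → Δ.push y a = Z' (Δ.emb y) := by
    intro y
    by_cases hy : Y' (Δ.emb y) = Δ.push y (Y y)
    · obtain ⟨a, ha⟩ := Δ.exists_push (p := y) (w := Z' (Δ.emb y)) (by
        rw [Δ.M.g_symm, hZ'g, hy, tensor_skew hTa, hl y, neg_zero])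
      exact ⟨a, fun _ ↦ ha⟩
    · exact ⟨0, fun h ↦ absurd h hy⟩
  choose Z hZ0 using hZt
  have hZ1 : ∀ᶠ y in 𝓝 p, Z' (Δ.emb y) = Δ.push y (Z y) := hY1.mono fun y hy ↦ (hZ0 y hy).symm
  have hZ : V∞[I3] Z p := fieldSmoothAt_of_along (Δ.immersion p) hZ' hZ1
  have hZp : Z' (Δ.emb p) = Δ.push p (Z p) := hZ1.self_of_nhds
  have hzZ : z = Z p := Δ.push_injective p (Δ.M.isPseudoMetric.ext fun w ↦ by rw [hz, ← hZp, hZ'g, hYp])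
  have hinv := hi p Y Z hY.fieldDiffAt hZ.fieldDiffAt (by
    filter_upwards [hZ1, hY1] with y h1 h2 w
    rw [← h1, hZ'g, h2]) (W (Δ.emb p))
  have b1 := Δ.push_bracket (ell_smooth p).fieldDiffAt hZ.fieldDiffAt hL.fieldDiffAt hZ'.fieldDiffAt hL1 hZ1
  have b2 := Δ.push_bracket (ell_smooth p).fieldDiffAt hY.fieldDiffAt hL.fieldDiffAt hY'.fieldDiffAt hL1 hY1
  have n1 : ∀ v, Δ.M.nab L (Δ.emb p) (Δ.push p v) = rotationForm Δ.D p v • L[Δ,p] := fun v ↦ by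
    rw [← Δ.push_D (ell_smooth p).fieldDiffAt hL.fieldDiffAt hL1 v, Δ.horizonGeom.nab_ell_eq, map_smul]
  rw [b1, b2, ← nab_torsion Δ.M.leviCivita.torsion_free hL.fieldDiffAt hZ'.fieldDiffAt, ← nab_torsion Δ.M.leviCivita.torsion_free hL.fieldDiffAt hY'.fieldDiffAt,
    hLp, hZp, hYp, n1, n1] at hinv
  simp only [map_sub, map_smul, _root_.sub_apply, _root_.smul_apply, smul_eq_mul, Δ.nullCoeff_spec (hl p)] at hinv
  have hm := Δ.M.leviCivita.metric _ Z' W hZ'.fieldDiffAt hW.fieldDiffAt L[Δ,p]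
  have e : (fun x ↦ Δ.M.g x (Z' x) (W x)) = fun x ↦ T x (Y' x) (W x) := funext fun x ↦ hZ'g x _
  rw [e] at hm
  rw [← hYp, covTensor_eq (hT p) hTa hY' hW, covTensorField, hm, hZ'g, hzZ]
  linarith

end IsolatedHorizon

/-! ### Electromagnetic fields aligned with the horizon -/

namespace Spacetime
variable (M : Spacetime.{u}) {x : M.carrier} {e : Fin 2 → T[I4] x} {n l : T[I4] x}
  {F : Cov₂ I4 M.carrier}

lemma null_expansion (h : IsNullFrame (M.g) x e n l) (u : T[I4] x) :
    u = (∑ i, M.g x u (e i) • e i) - M.g x u n • l - M.g x u l • n := by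
  let B : T[I4] x →ₗ[ℝ] T[I4] x →ₗ[ℝ] T[I4] x := LinearMap.mk₂ ℝ (fun z z' ↦ M.g x u z • z')
    (fun z z' w ↦ by rw [map_add, add_smul]) (fun c z w ↦ by rw [map_smul, smul_eq_mul, mul_smul]) (fun z w w' ↦ smul_add _ _ _)
    (fun c z w ↦ smul_comm _ _ _)
  have h1 := IsNullFrame.sum_eta B e n l
  have h2 := orthonormal_expansion M.isPseudoMetric (h.orthonormal (M.g_symm x)) u
  have h3 : ∑ i, eta i • B (nullONFrame e n l i) (nullONFrame e n l i) = u := by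
    conv_rhs => rw [h2]
    exact sum_congr rfl fun i _ ↦ (mul_smul _ _ _).symm
  rw [Fin.sum_univ_two]
  exact h3.symm.trans h1

/-- The energy-momentum tensor on a null hyperplane whose normal is an eigenvector of the field. -/
lemma stressEnergy_null (hF : ∀ u, F x u u = 0) (h : IsNullFrame (M.g) x e n l) (hl : ∀ i, F x l (e i) = 0) {u w : T[I4] x}
    (hu : M.g x u l = 0) (hw : M.g x w l = 0) :
    8 * Real.pi * M.stressEnergy F x u w = (F x l n ^ 2 + F x (e 0) (e 1) ^ 2) * M.g x u w := by
  have h2 := inv_sqrt_two_mul_self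
  have s := M.skew_of_alternating hF
  rw [M.stressEnergy_eq F (h.orthonormal (M.g_symm x))]
  let A : T[I4] x →ₗ[ℝ] T[I4] x →ₗ[ℝ] ℝ := LinearMap.mk₂ ℝ (fun z z' ↦ F x u z * F x w z')
    (fun z z' y ↦ by rw [map_add]; ring) (fun c z y ↦ by rw [map_smul, smul_eq_mul, smul_eq_mul]; ring) (fun z y y' ↦ by rw [map_add]; ring)
    (fun c z y ↦ by rw [map_smul, smul_eq_mul, smul_eq_mul]; ring)
  have h1 : ∑ c, eta c * F x u (nullONFrame e n l c) * F x w (nullONFrame e n l c) = A (e 0) (e 0) + A (e 1) (e 1) - A n l - A l n := by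
    rw [← IsNullFrame.sum_eta A e n l]
    exact sum_congr rfl fun i _ ↦ mul_assoc _ _ _
  have hz : ∀ z, M.g x z l = 0 → F x z l = 0 ∧ F x z (e 0) = -(M.g x z (e 1) * F x (e 0) (e 1)) ∧ F x z (e 1) = M.g x z (e 0) * F x (e 0) (e 1) := by
    intro z hz
    have hexp := M.null_expansion h z
    rw [hz, zero_smul, sub_zero, Fin.sum_univ_two] at hexp
    have hz' : ∀ y, F x z y = M.g x z (e 0) * F x (e 0) y + M.g x z (e 1) * F x (e 1) y - M.g x z n * F x l y := fun y ↦ by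
      conv_lhs => rw [hexp]
      rw [map_sub, map_add, map_smul, map_smul, map_smul]
      rfl
    rw [hz', hz', hz', s (e 0) l, s (e 1) l, s (e 1) (e 0), hF, hF, hF, hl, hl]
    refine ⟨?_, ?_, ?_⟩ <;> ring
  obtain ⟨u1, u2, u3⟩ := hz u hu
  obtain ⟨w1, w2, w3⟩ := hz w hw
  have hg : M.g x u w = M.g x u (e 0) * M.g x w (e 0) + M.g x u (e 1) * M.g x w (e 1) := by
    have hexp := M.null_expansion h w
    rw [hw, zero_smul, sub_zero, Fin.sum_univ_two] at hexp
    conv_lhs => rw [hexp]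
    rw [map_sub, map_add, map_smul, map_smul, map_smul, hu]
    simp only [smul_eq_mul]; ring
  have hA : ∀ y y', A y y' = F x u y * F x w y' := fun _ _ ↦ rfl
  rw [h1, hA, hA, hA, hA, u1, u2, u3, w1, w2, w3]
  simp only [Fin.sum_univ_four, nullONFrame_zero, nullONFrame_one, nullONFrame_two, nullONFrame_three, eta_zero, eta_one, eta_two, eta_three, map_smul, map_add, map_sub, _root_.smul_apply, _root_.add_apply,
    _root_.sub_apply, smul_eq_mul, hF, hl, s (e 0) l, s (e 1) l, s n l, s (e 0) n, s (e 1) n, s (e 1) (e 0)]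
  rw [hg]
  have hpi := Real.pi_ne_zero
  field_simp
  have h4 : √2 ^ 4 = 4 := by
    rw [show √2 ^ 4 = (√2 ^ 2) ^ 2 by ring, Real.sq_sqrt (by norm_num)]; norm_num
  ring_nf
  simp only [h4]
  ring

end Spacetime

namespace IsolatedHorizon
variable (Δ : IsolatedHorizon S) {p : S × ℝ}
  {qh : Cov₂ (𝓡 2) S} {omh : Cov (𝓡 2) S}

/-- An electromagnetic field for which `ℓ` is a null eigenvector of `F` and `⋆F` and which is invariant under the flow of `ℓ`. -/
structure IsAligned (F : Cov₂ I4 Δ.M.carrier) : Prop where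
  alternating : ∀ x u, F x u u = 0
  smooth : ∀ p, TensorSmoothAt I4 F (Δ.emb p)
  ell_re : ∀ p w, F (Δ.emb p) L[Δ,p] (Δ.push p w) = 0
  ell_im : ∀ p w, Δ.M.hodgeForm F (Δ.emb p) L[Δ,p] (Δ.push p w) = 0
  invariant_re : Δ.IsFlowInvariant (fun x u w ↦ F x u w)
  invariant_im : Δ.IsFlowInvariant (fun x u w ↦ Δ.M.hodgeForm F x u w)

variable {F : Cov₂ I4 Δ.M.carrier}

/-- Of the electrovac conditions, alignment keeps all but the field equations. -/
lemma MakesElectrovac.isAligned (h : Δ.MakesElectrovac F) : Δ.IsAligned F where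
  alternating := h.alternating
  smooth := h.smooth
  ell_re p w := by
    have := congrArg Complex.re (h.ell_contraction p w)
    simpa [Spacetime.selfDualPart] using this
  ell_im p w := by
    have := congrArg Complex.im (h.ell_contraction p w)
    simpa [Spacetime.selfDualPart, Spacetime.hodgeForm_apply] using this
  invariant_re := h.invariant_re
  invariant_im := h.invariant_im

lemma g_ell_push (w : T[I3] p) : γ[Δ,p] L[Δ,p] (Δ.push p w) = 0 := Δ.null p w

lemma g_push_ell (w : T[I3] p) : γ[Δ,p] (Δ.push p w) L[Δ,p] = 0 :=
  (Δ.M.g_symm _ _ _).trans (Δ.null p w)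

/-- The function `α` with `(F - i⋆F)(ℓ, ·) = α g(ℓ, ·)`. -/
def charge (F : Cov₂ I4 Δ.M.carrier) (p : S × ℝ) : ℂ :=
  (Δ.nullCoeff F p : ℂ) - Complex.I * (Δ.nullCoeff (Δ.M.hodgeForm F) p : ℂ)

/-- The charge gives the components of the field in `(ℓ, n)` and along the section. -/
lemma IsAligned.components (h : Δ.IsAligned F) {e : Fin 2 → T[I4] (Δ.emb p)} {n : T[I4] (Δ.emb p)}
    (hf : IsNullFrame Δ.M.g (Δ.emb p) e n L[Δ,p]) :
    F (Δ.emb p) L[Δ,p] n = -Δ.nullCoeff F p ∧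
      F (Δ.emb p) (e 0) (e 1) = σ[Δ.M,e,n,L[Δ,p]] * Δ.nullCoeff (Δ.M.hodgeForm F) p := by
  have h1 := Δ.nullCoeff_spec (h.ell_re p) n
  have h2 := Δ.nullCoeff_spec (h.ell_im p) n
  obtain ⟨-, -, -, -, h3, -⟩ := (Δ.M.hodge_dualPair (h.alternating (Δ.emb p))).null _ hf
  have hs := Δ.M.vol_null_sq hf
  rw [Δ.M.g_symm, hf.nl] at h1 h2
  refine ⟨by linarith, ?_⟩
  have h4 : Δ.M.hodgeForm F (Δ.emb p) L[Δ,p] n =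
    -(σ[Δ.M,e,n,L[Δ,p]] * F (Δ.emb p) (e 0) (e 1)) := h3
  rw [h2] at h4
  linear_combination (-F (Δ.emb p) (e 0) (e 1)) * hs + σ[Δ.M,e,n,L[Δ,p]] * h4

lemma charge_normSq (p : S × ℝ) : ‖Δ.charge F p‖ ^ 2 = Δ.nullCoeff F p ^ 2 + Δ.nullCoeff (Δ.M.hodgeForm F) p ^ 2 := by
  rw [← Complex.normSq_eq_norm_sq, Complex.normSq_apply, charge]
  simp
  ring

/-- The energy-momentum tensor of an aligned field is determined by its charge. -/
lemma IsAligned.stressEnergy (h : Δ.IsAligned F) (hd : GeomData Δ.qForm Δ.D qh omh) (u w : T[I3] p) :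
    8 * Real.pi * Δ.M.stressEnergy F (Δ.emb p) (Δ.push p u) (Δ.push p w) = ‖Δ.charge F p‖ ^ 2 * qh p.1 (dPi p u) (dPi p w) := by
  obtain ⟨e, -, he, -⟩ := hd.exists_adapted_frame Δ.horizonGeom isFoliationFunction_snd p
  obtain ⟨n, hf⟩ := Δ.exists_transversal p he
  obtain ⟨c1, c2⟩ := h.components Δ hf
  rw [Δ.M.stressEnergy_null (h.alternating _) hf (fun i ↦ h.ell_re p (e i)) (Δ.g_push_ell u) (Δ.g_push_ell w),
    c1, c2, charge_normSq, ← hd.metric, qForm_eq]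
  have hs := Δ.M.vol_null_sq hf
  linear_combination Δ.nullCoeff (Δ.M.hodgeForm F) p ^ 2 * γ[Δ,p] (Δ.push p u) (Δ.push p w) * hs

/-- The covariant derivative along `ℓ` of an aligned field in the transversal direction. -/
lemma IsAligned.cov_transversal (h : Δ.IsAligned F) (h0 : ∀ p, rotationForm Δ.D p (ell p) = 0) {e : Fin 2 → T[I3] p} {n : T[I4] (Δ.emb p)}
    (hf : IsNullFrame Δ.M.g (Δ.emb p) (fun i ↦ Δ.push p (e i)) n L[Δ,p]) (i : Fin 2) :
    covTensor Δ.M.nab F (Δ.emb p) L[Δ,p] (Δ.push p (e i)) n =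
      rotationForm Δ.D p (e i) * Δ.nullCoeff F p - ∑ j, F (Δ.emb p) (Δ.push p (e i)) (Δ.push p (e j)) * rotationForm Δ.D p (e j) := by
  have hsh : ∀ w, γ[Δ,p] (sharp Δ.M.isPseudoMetric (Δ.emb p) (F (Δ.emb p) (Δ.push p (e i)))) w = F (Δ.emb p) (Δ.push p (e i)) w :=
    fun w ↦ sharp_spec Δ.M.isPseudoMetric _ _ w
  obtain ⟨z, hz⟩ := Δ.exists_push (p := p) (w := sharp Δ.M.isPseudoMetric (Δ.emb p) (F (Δ.emb p) (Δ.push p (e i)))) (by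
    rw [Δ.M.g_symm, hsh, tensor_skew h.alternating, h.ell_re, neg_zero])
  have hzg : ∀ w, γ[Δ,p] (Δ.push p z) w = F (Δ.emb p) (Δ.push p (e i)) w := fun w ↦ by rw [hz, hsh]
  have hexp := Δ.M.null_expansion hf (Δ.push p z)
  have hzl : γ[Δ,p] (Δ.push p z) L[Δ,p] = 0 := (Δ.M.g_symm _ _ _).trans (Δ.null p z)
  have hz2 : z = (∑ j, F (Δ.emb p) (Δ.push p (e i)) (Δ.push p (e j)) • e j) - F (Δ.emb p) (Δ.push p (e i)) n • ell p := by
    apply Δ.push_injective p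
    rw [map_sub, map_sum, map_smul]
    simp only [map_smul]
    refine hexp.trans ?_
    rw [hzl, zero_smul, sub_zero]
    simp only [hzg]
  have hω : rotationForm Δ.D p z = ∑ j, F (Δ.emb p) (Δ.push p (e i)) (Δ.push p (e j)) * rotationForm Δ.D p (e j) := by
    conv_lhs => rw [hz2]
    rw [map_sub, map_sum, map_smul, h0, smul_zero, sub_zero]
    simp only [map_smul, smul_eq_mul]
  rw [Δ.covTensor_ell_dir h.alternating h.smooth h.ell_re h.invariant_re hzg, Δ.M.g_symm, hf.nl, hω]
  ring

/-- On an extremal horizon the exterior derivative of an aligned self-dual field reduces to the constraint on its charge. -/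
lemma IsAligned.extDeriv_eq (h : Δ.IsAligned F) (h0 : ∀ p, rotationForm Δ.D p (ell p) = 0) {e : Fin 2 → T[I3] p} {n : T[I4] (Δ.emb p)}
    (hf : IsNullFrame Δ.M.g (Δ.emb p) (fun i ↦ Δ.push p (e i)) n L[Δ,p]) {s : ℝ}
    (hs : Δ.M.vol (Δ.emb p) ![Δ.push p (e 0), Δ.push p (e 1), n, L[Δ,p]] = s) :
    extDeriv I4 (Δ.M.selfDualPart F) (Δ.emb p) (Δ.push p (e 0)) (Δ.push p (e 1)) L[Δ,p] = 0 ∧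
    extDeriv I4 (Δ.M.selfDualPart F) (Δ.emb p) L[Δ,p] n (Δ.push p (e 0))
      - Complex.I * s * extDeriv I4 (Δ.M.selfDualPart F) (Δ.emb p) L[Δ,p] n (Δ.push p (e 1)) =
    -(((∂[I3] (Δ.nullCoeff F) p (e 0) - Complex.I * ∂[I3] (Δ.nullCoeff (Δ.M.hodgeForm F)) p (e 0) : ℂ)
      - Complex.I * s * (∂[I3] (Δ.nullCoeff F) p (e 1) - Complex.I * ∂[I3] (Δ.nullCoeff (Δ.M.hodgeForm F)) p (e 1) : ℂ))
      + 2 * ((rotationForm Δ.D p (e 0) : ℂ) - Complex.I * s * (rotationForm Δ.D p (e 1) : ℂ)) * Δ.charge F p) := by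
  have hs2 : s ^ 2 = 1 := by rw [← hs]; exact Δ.M.vol_null_sq hf
  have hs0 : s ≠ 0 := fun h ↦ by rw [h] at hs2; norm_num at hs2
  have hH : ∀ y u, Δ.M.hodgeForm F y u u = 0 := fun _ _ ↦ Δ.M.hodge₂_self _
  have hHs := fun p ↦ Δ.M.hodgeForm_smooth (h.smooth p)
  have ln : γ[Δ,p] L[Δ,p] n = -1 := (Δ.M.g_symm _ _ _).trans hf.nl
  have cF := fun u w ↦ Δ.covTensor_ell (p := p) h.alternating (h.smooth p) h.ell_re u w
  have cH := fun u w ↦ Δ.covTensor_ell (p := p) hH (hHs p) h.ell_im u w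
  have dF : ∂[I3] (Δ.nullCoeff F) p (ell p) = 0 := Δ.nullCoeff_invariant (h.smooth p) h.ell_re h.invariant_re
  have dH : ∂[I3] (Δ.nullCoeff (Δ.M.hodgeForm F)) p (ell p) = 0 := Δ.nullCoeff_invariant (hHs p) h.ell_im h.invariant_im
  obtain ⟨-, -, q1, q2, q3, q4⟩ := (Δ.M.covTensor_dualPair h.alternating (h.smooth p) L[Δ,p]).null _ hf
  rw [hs] at q1 q2 q3 q4
  -- derivatives of `F - i⋆F` in directions of the section, contracted with `ℓ`, only see the charge
  have hnull : ∀ i j, Δ.M.covSelfDual F (Δ.emb p) (Δ.push p (e i)) L[Δ,p] (Δ.push p (e j)) = 0 := fun i j ↦ by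
    rw [Spacetime.covSelfDual, cF, cH, g_ell_push]
    simp
  have hln : ∀ i, Δ.M.covSelfDual F (Δ.emb p) (Δ.push p (e i)) L[Δ,p] n =
      -(∂[I3] (Δ.nullCoeff F) p (e i) - Complex.I * ∂[I3] (Δ.nullCoeff (Δ.M.hodgeForm F)) p (e i) : ℂ) := fun i ↦ by
    rw [Spacetime.covSelfDual, cF, cH, ln]
    push_cast
    ring
  have sw := fun u v w ↦ Δ.M.covSelfDual_swap (x := Δ.emb p) h.alternating u v w
  refine ⟨?_, ?_⟩
  · -- by duality the derivative along `ℓ` of the component on the section is that of the charge, which is zero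
    have k1 : covTensor Δ.M.nab (Δ.M.hodgeForm F) (Δ.emb p) L[Δ,p] (Δ.push p (e 0)) (Δ.push p (e 1)) = 0 := by
      rw [q4, cF, dF, zero_mul, mul_zero]
    have k2 : covTensor Δ.M.nab F (Δ.emb p) L[Δ,p] (Δ.push p (e 0)) (Δ.push p (e 1)) = 0 := by
      rw [cH, dH, zero_mul] at q3
      exact (mul_eq_zero.1 (neg_eq_zero.1 q3.symm)).resolve_left hs0
    rw [Δ.M.extDeriv_eq_covSelfDual h.alternating (h.smooth p), sw _ L[Δ,p], hnull, hnull, Spacetime.covSelfDual, k1, k2]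
    simp
  · -- self-duality relates the derivatives along `n` of the components on `(ℓ, e₀)` and `(ℓ, e₁)`
    have hm := Δ.M.covSelfDual_l h.alternating (h.smooth p) hf n
    rw [hs] at hm
    have t0 := h.cov_transversal Δ h0 hf 0
    have t1 := h.cov_transversal Δ h0 hf 1
    obtain ⟨-, c2⟩ := h.components Δ hf
    rw [hs] at c2
    rw [Fin.sum_univ_two, h.alternating, c2] at t0
    rw [Fin.sum_univ_two, h.alternating, tensor_skew h.alternating, c2] at t1
    have wF := fun (v w : T[I4] (Δ.emb p)) ↦ covTensor_swap (nab := Δ.M.nab) h.alternating L[Δ,p] v w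
    rw [wF (Δ.push p (e 1)) n, t1] at q1
    rw [wF (Δ.push p (e 0)) n, t0] at q2
    have hs2c : (s : ℂ) ^ 2 = 1 := by exact_mod_cast congrArg (fun t : ℝ ↦ (t : ℂ)) hs2
    have v0 : Δ.M.covSelfDual F (Δ.emb p) L[Δ,p] n (Δ.push p (e 0)) =
        -((rotationForm Δ.D p (e 0) : ℂ) * Δ.nullCoeff F p - s * Δ.nullCoeff (Δ.M.hodgeForm F) p * rotationForm Δ.D p (e 1))
        + Complex.I * s * (rotationForm Δ.D p (e 1) * Δ.nullCoeff F p + s * Δ.nullCoeff (Δ.M.hodgeForm F) p * rotationForm Δ.D p (e 0)) := by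
      rw [Spacetime.covSelfDual, q1, wF (Δ.push p (e 0)) n, t0]
      push_cast
      ring
    have v1 : Δ.M.covSelfDual F (Δ.emb p) L[Δ,p] n (Δ.push p (e 1)) =
        -((rotationForm Δ.D p (e 1) : ℂ) * Δ.nullCoeff F p + s * Δ.nullCoeff (Δ.M.hodgeForm F) p * rotationForm Δ.D p (e 0))
        - Complex.I * s * (rotationForm Δ.D p (e 0) * Δ.nullCoeff F p - s * Δ.nullCoeff (Δ.M.hodgeForm F) p * rotationForm Δ.D p (e 1)) := by
      rw [Spacetime.covSelfDual, q2, wF (Δ.push p (e 1)) n, t1]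
      push_cast
      ring
    rw [Δ.M.extDeriv_eq_covSelfDual h.alternating (h.smooth p), Δ.M.extDeriv_eq_covSelfDual h.alternating (h.smooth p), sw n L[Δ,p],
      sw n L[Δ,p], hln, hln, v0, v1, charge]
    linear_combination -hm + ((s : ℂ) ^ 2 * ((rotationForm Δ.D p (e 0) : ℂ) * Δ.nullCoeff F p - s * Δ.nullCoeff (Δ.M.hodgeForm F) p * rotationForm Δ.D p (e 1))
        + 2 * s * Δ.nullCoeff (Δ.M.hodgeForm F) p * rotationForm Δ.D p (e 1)) * Complex.I_sq
      + (-((rotationForm Δ.D p (e 0) : ℂ) * Δ.nullCoeff F p - s * Δ.nullCoeff (Δ.M.hodgeForm F) p * rotationForm Δ.D p (e 1))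
        + 2 * Complex.I * Δ.nullCoeff (Δ.M.hodgeForm F) p * rotationForm Δ.D p (e 0)) * hs2c

end IsolatedHorizon

/-! ### Maxwell and Einstein equations of aligned fields -/

namespace IsolatedHorizon
variable (Δ : IsolatedHorizon S) {p : S × ℝ}
  {qh : Cov₂ (𝓡 2) S} {omh : Cov (𝓡 2) S}
  {nabh : Conn[𝓡 2,ℝ²,S]}
  {F : Cov₂ I4 Δ.M.carrier}

/-- Four vectors tangent to the horizon are linearly dependent. -/
lemma vol_push (p : S × ℝ) (a b c d : T[I3] p) : Δ.M.vol (Δ.emb p) ![Δ.push p a, Δ.push p b, Δ.push p c, Δ.push p d] = 0 := by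
  have h : ¬ LinearIndependent ℝ ![a, b, c, d] := by
    intro h
    have h1 := h.fintype_card_le_finrank
    have h2 : Module.finrank ℝ (T[I3] p) = 3 := by
      change Module.finrank ℝ (ℝ² × ℝ) = 3
      simp
    rw [h2] at h1
    simp at h1
  refine AlternatingMap.map_linearDependent _ _ fun h' ↦ h ?_
  refine LinearIndependent.of_comp (Δ.push p).toLinearMap ?_
  have e : (Δ.push p).toLinearMap ∘ ![a, b, c, d] = ![Δ.push p a, Δ.push p b, Δ.push p c, Δ.push p d] := by
    ext i
    fin_cases i <;> rfl
  rw [e]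
  exact h'

/-- The area form `vol(·, ·, n, ℓ)` does not depend on the choice of the transversal vector. -/
lemma vol_transversal {n n' : T[I4] (Δ.emb p)} (h : γ[Δ,p] n L[Δ,p] = γ[Δ,p] n' L[Δ,p])
    (u w : T[I3] p) : Δ.M.vol (Δ.emb p) ![Δ.push p u, Δ.push p w, n, L[Δ,p]] =
      Δ.M.vol (Δ.emb p) ![Δ.push p u, Δ.push p w, n', L[Δ,p]] := by
  obtain ⟨z, hz⟩ := Δ.exists_push (p := p) (w := n - n') (by rw [map_sub, Δ.M.g_symm, h, Δ.M.g_symm, sub_self])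
  have e : n = n' + Δ.push p z := by rw [hz]; abel
  rw [e, alt_add2, vol_push, add_zero]

/-- The charge is smooth, with the differential expected from its definition. -/
lemma charge_smooth (h : Δ.IsAligned F) : ContMDiffAt I3 𝓘(ℝ, ℂ) ∞ (Δ.charge F) p ∧
    ∀ u, ∂[I3] (Δ.charge F) p u = (∂[I3] (Δ.nullCoeff F) p u : ℂ) - Complex.I * (∂[I3] (Δ.nullCoeff (Δ.M.hodgeForm F)) p u : ℂ) := by
  have h1 := Δ.nullCoeff_smooth (h.smooth p) h.ell_re
  have h2 := Δ.nullCoeff_smooth (Δ.M.hodgeForm_smooth (h.smooth p)) h.ell_im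
  have s1 : ContMDiffAt I3 𝓘(ℝ, ℂ) ∞ (fun y ↦ Complex.ofRealCLM (Δ.nullCoeff F y)) p := Complex.ofRealCLM.contMDiff.contMDiffAt.comp p h1
  have s2 : ContMDiffAt I3 𝓘(ℝ, ℂ) ∞ (fun y ↦ (Complex.I • Complex.ofRealCLM) (Δ.nullCoeff (Δ.M.hodgeForm F) y)) p :=
    (Complex.I • Complex.ofRealCLM).contMDiff.contMDiffAt.comp p h2
  have e : Δ.charge F = fun y ↦ Complex.ofRealCLM (Δ.nullCoeff F y) - (Complex.I • Complex.ofRealCLM) (Δ.nullCoeff (Δ.M.hodgeForm F) y) := rfl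
  refine ⟨s1.sub s2, fun u ↦ ?_⟩
  rw [e]
  refine (dd_sub (s1.mdiff) (s2.mdiff) u).trans ?_
  rw [dd_clm _ (h1.mdiff), dd_clm _ (h2.mdiff)]
  rfl

/-- The Maxwell equations of an aligned field on an extremal horizon amount to a first-order equation on its charge. -/
lemma IsAligned.maxwell_iff (h : Δ.IsAligned F) (hd : GeomData Δ.qForm Δ.D qh omh) (h0 : ∀ p, rotationForm Δ.D p (ell p) = 0) (p : S × ℝ) :
    (Δ.M.maxwell F (Δ.emb p) L[Δ,p] = 0 ∧
      ∀ (n : T[I4] (Δ.emb p)) (e : Fin 2 → T[I3] p), γ[Δ,p] n L[Δ,p] = -1 →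
        (∀ i j, Δ.q p (e i) (e j) = if i = j then 1 else 0) → ∀ w : T[I3] p,
        (∑ i, Δ.M.maxwell F (Δ.emb p) (Δ.push p (e i)) * (Δ.M.vol (Δ.emb p) ![Δ.push p (e i), Δ.push p w, n, L[Δ,p]] : ℂ))
          - Complex.I * Δ.M.maxwell F (Δ.emb p) (Δ.push p w) = 0) ↔
    (∀ (n : T[I4] (Δ.emb p)) (e : Fin 2 → T[I3] p), IsNullFrame Δ.M.g (Δ.emb p) (fun i ↦ Δ.push p (e i)) n L[Δ,p] →
      (∂[I3] (Δ.charge F) p (e 0)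
        - Complex.I * Δ.M.vol (Δ.emb p) ![Δ.push p (e 0), Δ.push p (e 1), n, L[Δ,p]] * ∂[I3] (Δ.charge F) p (e 1))
      + 2 * ((rotationForm Δ.D p (e 0) : ℂ)
        - Complex.I * Δ.M.vol (Δ.emb p) ![Δ.push p (e 0), Δ.push p (e 1), n, L[Δ,p]] * (rotationForm Δ.D p (e 1) : ℂ)) * Δ.charge F p = 0) := by
  constructor
  · rintro ⟨hl, ht⟩ n e hf
    have h1 := (Δ.M.maxwell_iff h.alternating (h.smooth p) hf).1 ⟨hl, fun w hw ↦ by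
      obtain ⟨z, rfl⟩ : ∃ z, Δ.push p z = w := by
        induction hw using Submodule.span_induction with
        | mem w hw =>
          rcases hw with rfl | rfl | rfl
          exacts [⟨_, rfl⟩, ⟨_, rfl⟩, ⟨_, rfl⟩]
        | zero => exact ⟨0, map_zero _⟩
        | add w w' _ _ h h' =>
          obtain ⟨a, rfl⟩ := h
          obtain ⟨b, rfl⟩ := h'
          exact ⟨a + b, map_add _ _ _⟩
        | smul r w _ h =>
          obtain ⟨a, rfl⟩ := h
          exact ⟨r • a, map_smul _ _ _⟩
      exact ht n e hf.nl hf.ee z⟩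
    have h2 := (h.extDeriv_eq Δ h0 hf rfl).2
    rw [(Δ.charge_smooth h).2, (Δ.charge_smooth h).2]
    exact neg_eq_zero.1 (h2.symm.trans h1.2)
  · intro hc
    obtain ⟨e0, -, he0, -⟩ := hd.exists_adapted_frame Δ.horizonGeom isFoliationFunction_snd p
    have main : ∀ e : Fin 2 → T[I3] p, (∀ i j, Δ.qForm p (e i) (e j) = if i = j then 1 else 0) → ∃ n, IsNullFrame Δ.M.g (Δ.emb p) (fun i ↦ Δ.push p (e i)) n L[Δ,p] ∧
        Δ.M.maxwell F (Δ.emb p) L[Δ,p] = 0 ∧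
        ∀ w ∈ Submodule.span ℝ {Δ.push p (e 0), Δ.push p (e 1), L[Δ,p]},
          (∑ i, Δ.M.maxwell F (Δ.emb p) (Δ.push p (e i)) * (Δ.M.vol (Δ.emb p) ![Δ.push p (e i), w, n, L[Δ,p]] : ℂ))
          - Complex.I * Δ.M.maxwell F (Δ.emb p) w = 0 := by
      intro e he
      obtain ⟨n, hf⟩ := Δ.exists_transversal p he
      obtain ⟨h1, h2⟩ := h.extDeriv_eq Δ h0 hf rfl
      have h3 := hc n e hf
      rw [(Δ.charge_smooth h).2, (Δ.charge_smooth h).2] at h3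
      exact ⟨n, hf, (Δ.M.maxwell_iff h.alternating (h.smooth p) hf).2 ⟨h1, h2.trans (neg_eq_zero.2 h3)⟩⟩
    refine ⟨(main e0 he0).choose_spec.2.1, fun n' e hn' he w ↦ ?_⟩
    obtain ⟨n, hf, -, hm⟩ := main e he
    have hw : Δ.push p w ∈ Submodule.span ℝ {Δ.push p (e 0), Δ.push p (e 1), L[Δ,p]} := by
      have hexp := Δ.M.null_expansion hf (Δ.push p w)
      rw [Δ.g_push_ell, zero_smul, sub_zero, Fin.sum_univ_two] at hexp
      rw [hexp]
      refine Submodule.sub_mem _ (Submodule.add_mem _ ?_ ?_) ?_ <;> refine Submodule.smul_mem _ _ (Submodule.subset_span ?_) <;> simp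
    have h1 := hm _ hw
    have h2 : ∀ i, Δ.M.vol (Δ.emb p) ![Δ.push p (e i), Δ.push p w, n', L[Δ,p]] = Δ.M.vol (Δ.emb p) ![Δ.push p (e i), Δ.push p w, n, L[Δ,p]] :=
      fun i ↦ Δ.vol_transversal (hn'.trans hf.nl.symm) _ _
    simp only [h2]
    exact h1

/-- The Einstein equation pulled back to the horizon in terms of the data on the surface. -/
lemma IsAligned.einstein_iff (h : Δ.IsAligned F) (hd : GeomData Δ.qForm Δ.D qh omh) (hn : IsLeviCivita (𝓡 2) qh nabh) (u w : T[I3] p) :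
    ricci I4 Δ.M.nab (Δ.emb p) (Δ.push p u) (Δ.push p w) - 8 * Real.pi * Δ.M.stressEnergy F (Δ.emb p) (Δ.push p u) (Δ.push p w) = 0 ↔
    (1 / 2) * (covDerivForm (𝓡 2) nabh (fun y z ↦ omh y z) p.1 (dPi p u) (dPi p w) + covDerivForm (𝓡 2) nabh (fun y z ↦ omh y z) p.1 (dPi p w) (dPi p u))
      + omh p.1 (dPi p u) * omh p.1 (dPi p w) - (1 / 2) * ricci (𝓡 2) nabh p.1 (dPi p u) (dPi p w)
      + 2 * ‖Δ.charge F p / 2‖ ^ 2 * qh p.1 (dPi p u) (dPi p w) = 0 := by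
  rw [Δ.ricci_push hd hn, h.stressEnergy Δ hd, norm_div, Complex.norm_ofNat]
  constructor <;> intro h <;> linarith

end IsolatedHorizon

/-! ### The constraints on the surface -/

namespace IsolatedHorizon
variable (Δ : IsolatedHorizon S) {p : S × ℝ} {x : S}
  {qh : Cov₂ (𝓡 2) S} {omh : Cov (𝓡 2) S}
  {F : Cov₂ I4 Δ.M.carrier}

/-- The differential at `x` of the section `x ↦ (x, 0)`. -/
def dSec (x : S) : T[𝓡 2] x →L[ℝ] T[I3] (x, (0 : ℝ)) := mfderiv (𝓡 2) I3 (fun y : S ↦ (y, (0 : ℝ))) x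

lemma dPi_dSec (x : S) (u : T[𝓡 2] x) : dPi (x, (0 : ℝ)) (dSec x u) = u := by
  have h : dSec x u = ((u, 0) : ℝ² × ℝ) := mfderiv_slice (I := 𝓡 2) 0 x u
  rw [h]
  exact dfst_mk (I := 𝓡 2) (x, (0 : ℝ)) u 0

lemma dSec_apply (X : Vec (𝓡 2) S) (x : S) : dSec x (X x) = lift X (x, (0 : ℝ)) := mfderiv_slice (I := 𝓡 2) 0 x (X x)

/-- The area form `vol(·, ·, n, ℓ)` of the section `t = 0` of the horizon, transported to the surface. -/
def areaForm (x : S) : T[𝓡 2] x →L[ℝ] T[𝓡 2] x →L[ℝ] ℝ :=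
  show ℝ² →L[ℝ] ℝ² →L[ℝ] ℝ from
    LinearMap.toContinuousLinearMap ((LinearMap.toContinuousLinearMap : (ℝ² →ₗ[ℝ] ℝ) ≃ₗ[ℝ] _).toLinearMap ∘ₗ
      (LinearMap.mk₂ ℝ (fun u w : ℝ² ↦ Δ.M.vol (Δ.emb (x, 0)) ![Δ.push (x, 0) (dSec x u), Δ.push (x, 0) (dSec x w),
          Classical.choose (Δ.exists_normalized (x, 0)), Δ.push (x, 0) (ell (x, 0))])
        (fun u u' w ↦ by
          have e : Δ.push (x, 0) (dSec x (u + u')) = Δ.push (x, 0) (dSec x u) + Δ.push (x, 0) (dSec x u') :=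
            (congrArg (Δ.push (x, 0)) (map_add (dSec x) u u')).trans (map_add _ _ _)
          rw [e, alt_add0])
        (fun c u w ↦ by
          have e : Δ.push (x, 0) (dSec x (c • u)) = c • Δ.push (x, 0) (dSec x u) :=
            (congrArg (Δ.push (x, 0)) (map_smul (dSec x) c u)).trans (map_smul _ _ _)
          rw [e, alt_smul0]; rfl)
        (fun u w w' ↦ by
          have e : Δ.push (x, 0) (dSec x (w + w')) = Δ.push (x, 0) (dSec x w) + Δ.push (x, 0) (dSec x w') :=
            (congrArg (Δ.push (x, 0)) (map_add (dSec x) w w')).trans (map_add _ _ _)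
          rw [e, alt_add1])
        (fun c u w ↦ by
          have e : Δ.push (x, 0) (dSec x (c • w)) = c • Δ.push (x, 0) (dSec x w) :=
            (congrArg (Δ.push (x, 0)) (map_smul (dSec x) c w)).trans (map_smul _ _ _)
          rw [e, alt_smul1]; rfl)))

lemma areaForm_eq {n : T[I4] (Δ.emb (x, 0))} (hn : Δ.M.g (Δ.emb (x, 0)) (Δ.push (x, 0) (ell (x, 0))) n = -1) (u w : T[𝓡 2] x) :
    Δ.areaForm x u w = Δ.M.vol (Δ.emb (x, 0)) ![Δ.push (x, 0) (dSec x u), Δ.push (x, 0) (dSec x w), n, Δ.push (x, 0) (ell (x, 0))] :=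
  Δ.vol_transversal (((Δ.M.g_symm _ _ _).trans (Classical.choose_spec (Δ.exists_normalized (x, 0)))).trans (hn.symm.trans (Δ.M.g_symm _ _ _))) _ _

lemma q_dSec (hd : GeomData Δ.qForm Δ.D qh omh) (u w : T[𝓡 2] x) :
    Δ.M.g (Δ.emb (x, 0)) (Δ.push (x, 0) (dSec x u)) (Δ.push (x, 0) (dSec x w)) = qh x u w := by
  have := hd.metric (x, 0) (dSec x u) (dSec x w)
  rw [qForm_eq, dPi_dSec, dPi_dSec] at this
  exact this

lemma areaForm_isAreaForm (hd : GeomData Δ.qForm Δ.D qh omh) : IsAreaForm qh Δ.areaForm where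
  smooth := by
    intro x X Y hX hY
    obtain ⟨n, hn⟩ := Δ.exists_normalized (x, 0)
    obtain ⟨N, hN, rfl⟩ := exists_fieldSmoothAt n
    obtain ⟨L, hL1, -, hL2⟩ := Δ.exists_ext (X := ell) (x, 0)
    obtain ⟨X', hX1, -, hX2⟩ := Δ.exists_ext (X := lift X) (x, 0)
    obtain ⟨Y', hY1, -, hY2⟩ := Δ.exists_ext (X := lift Y) (x, 0)
    have hL := hL2 (ell_smooth _)
    have hX' := hX2 (lift_smooth (I := 𝓡 2) (p := (x, (0 : ℝ))) hX)
    have hY' := hY2 (lift_smooth (I := 𝓡 2) (p := (x, (0 : ℝ))) hY)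
    have hgs := Δ.M.g_smooth _ L N hL hN
    have hg0 : Δ.M.g (Δ.emb (x, 0)) (L (Δ.emb (x, 0))) (N (Δ.emb (x, 0))) ≠ 0 := by rw [hL1.self_of_nhds, hn]; norm_num
    have hv := Δ.M.vol_smooth4 hX' hY' hN hL
    have h1 : C∞[I4] (fun y ↦ -(Δ.M.vol y ![X' y, Y' y, N y, L y] / Δ.M.g y (L y) (N y))) (Δ.emb (x, 0)) := (hv.div₀ hgs hg0).neg
    have hsl : ContMDiffAt (𝓡 2) I3 ∞ (fun y : S ↦ (y, (0 : ℝ))) x := (contMDiff_slice (I := 𝓡 2) (0 : ℝ)).contMDiffAt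
    have h2 : ContMDiffAt (𝓡 2) I4 ∞ (fun y : S ↦ Δ.emb (y, (0 : ℝ))) x := ContMDiffAt.comp x (Δ.emb_contMDiffAt (x, 0)) hsl
    have h3 := ContMDiffAt.comp x h1 h2
    refine h3.congr_of_eventuallyEq ?_
    have hgc : C∞[𝓡 2] (fun y : S ↦ Δ.M.g (Δ.emb (y, (0 : ℝ))) (L (Δ.emb (y, (0 : ℝ)))) (N (Δ.emb (y, (0 : ℝ))))) x :=
      ContMDiffAt.comp x hgs h2
    have hg1 : ∀ᶠ y in 𝓝 x, Δ.M.g (Δ.emb (y, (0 : ℝ))) (L (Δ.emb (y, (0 : ℝ)))) (N (Δ.emb (y, (0 : ℝ)))) ≠ 0 :=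
      hgc.continuousAt.eventually_ne hg0
    filter_upwards [hg1, hsl.continuousAt.eventually hL1, hsl.continuousAt.eventually hX1, hsl.continuousAt.eventually hY1] with y k0 k1 k2 k3
    change _ = -(Δ.M.vol (Δ.emb (y, (0 : ℝ))) ![X' (Δ.emb (y, (0 : ℝ))), Y' (Δ.emb (y, (0 : ℝ))), N (Δ.emb (y, (0 : ℝ))), L (Δ.emb (y, (0 : ℝ)))] /
      Δ.M.g (Δ.emb (y, (0 : ℝ))) (L (Δ.emb (y, (0 : ℝ)))) (N (Δ.emb (y, (0 : ℝ)))))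
    rw [k1] at k0
    rw [k1, k2, k3, Δ.areaForm_eq (n := (-(Δ.M.g (Δ.emb (y, (0 : ℝ))) (Δ.push (y, 0) (ell (y, 0))) (N (Δ.emb (y, (0 : ℝ)))))⁻¹) • N (Δ.emb (y, (0 : ℝ))))
      (by rw [map_smul, smul_eq_mul, neg_mul, inv_mul_cancel₀ k0]), alt_smul2, dSec_apply, dSec_apply, div_eq_inv_mul, neg_mul]
  alternating x u := by
    rw [Δ.areaForm_eq (Classical.choose_spec (Δ.exists_normalized (x, 0))), alt_eq01]
  sq x u w := by
    obtain ⟨n, hn⟩ := Δ.exists_normalized (x, 0)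
    rw [Δ.areaForm_eq hn, Δ.M.vol_sq]
    have hn' := (Δ.M.g_symm _ _ _).trans hn
    have hw : qh x w u = qh x u w := by rw [← Δ.q_dSec hd, Δ.M.g_symm, Δ.q_dSec hd]
    simp [Matrix.det_succ_row_zero, Fin.sum_univ_succ, Fin.succAbove, Δ.q_dSec hd, Δ.g_ell_push, Δ.g_push_ell, hn, hn', hw]
    ring

/-- The data of an extremal electrovac horizon solve the constraints. -/
lemma MakesElectrovac.solvesConstraints (h : Δ.MakesElectrovac F) (hd : GeomData Δ.qForm Δ.D qh omh) (h0 : ∀ p, rotationForm Δ.D p (ell p) = 0) :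
    SolvesConstraints qh omh where
  riemannian := hd.riemannian Δ.horizonGeom
  smooth := hd.omh_smooth Δ.horizonGeom
  constraints := by
    have ha := h.isAligned
    obtain ⟨nabh, hn⟩ := exists_leviCivita (hd.riemannian Δ.horizonGeom).isPseudoMetric
    have hsl : ∀ x : S, ContMDiffAt (𝓡 2) I3 ∞ (fun y : S ↦ (y, (0 : ℝ))) x := fun x ↦ (contMDiff_slice (I := 𝓡 2) (0 : ℝ)).contMDiffAt
    have hα : ∀ x : S, ContMDiffAt (𝓡 2) 𝓘(ℝ, ℂ) ∞ (fun y : S ↦ Δ.charge F (y, 0)) x := fun x ↦ ContMDiffAt.comp x (Δ.charge_smooth ha).1 (hsl x)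
    have hΦ : (fun y : S ↦ Δ.charge F (y, 0) / 2) = fun y ↦ ((1 / 2 : ℝ) • ContinuousLinearMap.id ℝ ℂ) (Δ.charge F (y, 0)) := by
      ext y
      simp
      ring
    refine ⟨nabh, Δ.areaForm, fun y ↦ Δ.charge F (y, 0) / 2, hn, Δ.areaForm_isAreaForm hd, ?_, fun x u w ↦ ?_, fun x e₁ e₂ h1 h2 h3 hε ↦ ?_⟩
    · rw [hΦ]
      exact fun x ↦ ((1 / 2 : ℝ) • ContinuousLinearMap.id ℝ ℂ).contMDiff.contMDiffAt.comp x (hα x)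
    · have := (ha.einstein_iff Δ hd hn (p := (x, 0)) (dSec x u) (dSec x w)).1 (h.einstein (x, 0) (dSec x u) (dSec x w))
      rwa [dPi_dSec, dPi_dSec] at this
    · have he : ∀ i j, Δ.qForm (x, 0) (![dSec x e₁, dSec x e₂] i) (![dSec x e₁, dSec x e₂] j) = if i = j then 1 else 0 := by
        have h4 : qh x e₂ e₁ = 0 := by rw [(hd.riemannian Δ.horizonGeom).symm, h3]
        intro i j
        rw [qForm_eq]
        fin_cases i <;> fin_cases j
        · exact (Δ.q_dSec hd e₁ e₁).trans h1
        · exact (Δ.q_dSec hd e₁ e₂).trans h3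
        · exact (Δ.q_dSec hd e₂ e₁).trans h4
        · exact (Δ.q_dSec hd e₂ e₂).trans h2
      obtain ⟨n, hf⟩ := Δ.exists_transversal (x, 0) he
      have hs : Δ.M.vol (Δ.emb (x, 0)) ![Δ.push (x, 0) (dSec x e₁), Δ.push (x, 0) (dSec x e₂), n, Δ.push (x, 0) (ell (x, 0))] = 1 := by
        rw [← Δ.areaForm_eq ((Δ.M.g_symm _ _ _).trans hf.nl), hε]
      have key := (ha.maxwell_iff Δ hd h0 (x, 0)).1 ⟨h.maxwell_ell (x, 0), h.maxwell_tangent (x, 0)⟩ n _ hf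
      have hd1 : ∀ u, ∂[𝓡 2] (fun y : S ↦ Δ.charge F (y, 0) / 2) x u = ∂[I3] (Δ.charge F) (x, 0) (dSec x u) / 2 := by
        intro u
        rw [hΦ, dd_clm _ ((hα x).mdiff), mvfderiv_comp' x ((Δ.charge_smooth ha).1.mdiff) ((hsl x).mdiff)]
        simp [dSec]
        ring
      have ho : ∀ u, rotationForm Δ.D (x, 0) (dSec x u) = omh x u := fun u ↦ by
        rw [hd.rotationForm_eq Δ.horizonGeom, pull_apply, dPi_dSec]
      rw [hd1, hd1]
      simp only [Matrix.cons_val_zero, Matrix.cons_val_one] at key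
      rw [hs, ho, ho] at key
      push_cast at key
      linear_combination (1 / 2) * key

end IsolatedHorizon

end Horizon

section Fields
variable {E : Type*} [NormedAddCommGroup E] [NormedSpace ℝ E] [FiniteDimensional ℝ E]
  {H : Type*} [TopologicalSpace H] {I : ModelWithCorners ℝ E H} [I.Boundaryless]
  {M : Type*} [TopologicalSpace M] [ChartedSpace H M] [IsManifold I ∞ M]
  {F : Type*} [NormedAddCommGroup F] [NormedSpace ℝ F]
  {E' : Type*} [NormedAddCommGroup E'] [NormedSpace ℝ E'] [FiniteDimensional ℝ E']
  {H' : Type*} [TopologicalSpace H'] {J : ModelWithCorners ℝ E' H'} [J.Boundaryless]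
  {N : Type*} [TopologicalSpace N] [ChartedSpace H' N] [IsManifold J ∞ N]

/-! ### Pullbacks and their Lie derivatives -/

lemma dd_sum_mul {ι : Type*} (s : Finset ι) {a b : ι → M → ℝ} {x : M} (ha : ∀ i, D¹[I] (a i) x)
    (hb : ∀ i, D¹[I] (b i) x) (u : T[I] x) :
    ∂[I] (fun y ↦ ∑ i ∈ s, a i y * b i y) x u = ∑ i ∈ s, (a i x * ∂[I] (b i) x u + ∂[I] (a i) x u * b i x) := by
  classical
  suffices h : D¹[I] (fun y ↦ ∑ i ∈ s, a i y * b i y) x ∧ ∂[I] (fun y ↦ ∑ i ∈ s, a i y * b i y) x u =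
    ∑ i ∈ s, (a i x * ∂[I] (b i) x u + ∂[I] (a i) x u * b i x) from h.2
  have hab : ∀ i, D¹[I] (fun y ↦ a i y * b i y) x := fun i ↦ (ha i).mul (hb i)
  induction s using Finset.induction_on with
  | empty => simpa using ⟨mdifferentiableAt_const, dd_const (I := I) (x := x) (0 : ℝ) u⟩
  | insert j t hj ih =>
    simp only [sum_insert hj]
    refine ⟨(hab j).add ih.1, ?_⟩
    rw [dd_add (hab j) ih.1, dd_mul (ha j) (hb j), ih.2]

section Pullback
variable {π : N → M} {y : N}

/-- The pullback of a 1-form. -/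
def pullForm (α : Cov I M) (π : N → M) (y : N) : T[J] y →L[ℝ] ℝ :=
  (α (π y)).comp (mfderiv J I π y)

/-- The pullback of a covariant 2-tensor. -/
def pullTensor (T : Cov₂ I M) (π : N → M) (y : N) :
    T[J] y →L[ℝ] T[J] y →L[ℝ] ℝ :=
  show E' →L[ℝ] E' →L[ℝ] ℝ from ContinuousLinearMap.bilinearComp (show E →L[ℝ] E →L[ℝ] ℝ from T (π y))
    (show E' →L[ℝ] E from mfderiv J I π y) (show E' →L[ℝ] E from mfderiv J I π y)

/-- The tensor product of two covectors. -/
def tprod {y : N} (a b : T[J] y →L[ℝ] ℝ) : T[J] y →L[ℝ] T[J] y →L[ℝ] ℝ :=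
  show E' →L[ℝ] E' →L[ℝ] ℝ from ContinuousLinearMap.smulRight (show E' →L[ℝ] ℝ from a) (show E' →L[ℝ] ℝ from b)

lemma pullForm_apply (α : Cov I M) (u : T[J] y) :
    pullForm α π y u = α (π y) (mfderiv J I π y u) := rfl

lemma pullTensor_apply (T : Cov₂ I M) (u w : T[J] y) :
    pullTensor T π y u w = T (π y) (mfderiv J I π y u) (mfderiv J I π y w) := rfl

lemma pullForm_smooth {α : Cov I M} (hπ : ContMDiffAt J I ∞ π y) (hα : FormSmoothAt I α (π y)) :
    FormSmoothAt J (pullForm α π) y := fun _ hX ↦ hα.along hπ (hX.along_mfderiv hπ)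

lemma pullTensor_smooth {T : Cov₂ I M} (hπ : ContMDiffAt J I ∞ π y)
    (hT : TensorSmoothAt I T (π y)) : TensorSmoothAt J (pullTensor T π) y :=
  fun _ _ hX hY ↦ hT.along hπ (hX.along_mfderiv hπ) (hY.along_mfderiv hπ)

variable {X Y Z : Vec J N}

/-- The Lie derivative of an exact 1-form along a field annihilating the potential up to a constant vanishes. -/
lemma lie_exact {f : N → ℝ} (hf : C∞[J] f y) {c : ℝ} (hX : FieldDiffAt J X y) (hY : FieldDiffAt J Y y)
    (hc : ∀ᶠ z in 𝓝 y, ∂[J] f z (X z) = c) :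
    ∂[J] (fun z ↦ ∂[J] f z (Y z)) y (X y) = ∂[J] f y (mlieBracket J X Y y) := by
  rw [mvfderiv_mlieBracket hf hX hY, dd_eventually_const hc, sub_zero]

lemma dd_comp_zero {f : M → ℝ} (hf : D¹[I] f (π y)) (hπ : ContMDiffAt J I ∞ π y) {u : T[J] y}
    (h : mfderiv J I π y u = 0) : ∂[J] (fun z ↦ f (π z)) y u = 0 := by
  rw [mvfderiv_comp' y hf (hπ.mdiff), h, map_zero]

lemma smooth_coord_comp (hπ : ContMDiffAt J I ∞ π y) (i) :
    C∞[J] (fun z ↦ (Module.finBasis ℝ E).coord i (extChartAt I (π y) (π z))) y :=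
  contMDiffAt_coord (contMDiffAt_chart_comp hπ) i

lemma dd_coord_comp (hπ : ContMDiffAt J I ∞ π y) :
    ∀ᶠ z in 𝓝 y, ∀ i (u : T[J] z), ∂[J] (fun z ↦ (Module.finBasis ℝ E).coord i (extChartAt I (π y) (π z))) z u =
      (Module.finBasis ℝ E).coord i (∂[I] (extChartAt I (π y)) (π z) (mfderiv J I π z u)) := by
  filter_upwards [eventually_mdiff_map hπ, eventually_chart_mem (H := H) hπ.continuousAt] with z h1 h2 i u
  rw [← mvfderiv_comp' z (mdifferentiableAt_chart h2) h1]
  exact dd_clm ((Module.finBasis ℝ E).coord i).toContinuousLinearMap (MDifferentiableAt.comp z (mdifferentiableAt_chart h2) h1) u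

/-- A pulled back 1-form is invariant along fields tangent to the fibres. -/
lemma lie_pullForm {α : Cov I M} (hπ : ContMDiffAt J I ∞ π y) (hα : FormSmoothAt I α (π y))
    (hX : FieldDiffAt J X y) (hY : FieldDiffAt J Y y) (h0 : ∀ᶠ z in 𝓝 y, mfderiv J I π z (X z) = 0) :
    ∂[J] (fun z ↦ pullForm α π z (Y z)) y (X y) = pullForm α π y (mlieBracket J X Y y) := by
  set c := fun i z ↦ (Module.finBasis ℝ E).coord i (extChartAt I (π y) (π z)) with hc
  have hdc := dd_coord_comp (J := J) hπ
  have hex : ∀ᶠ z in 𝓝 y, ∀ u : T[J] z, pullForm α π z u = ∑ i, ∂[J] (c i) z u * α (π z) (coordField I (π y) i (π z)) := by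
    filter_upwards [hdc, eventually_chart_mem (H := H) hπ.continuousAt] with z h1 h2 u
    rw [pullForm_apply]
    conv_lhs => rw [field_chart_expansion h2 (mfderiv J I π z u)]
    simp only [map_sum, map_smul, smul_eq_mul, hc, h1]
  have hαi : ∀ i, D¹[I] (fun x ↦ α x (coordField I (π y) i x)) (π y) := fun i ↦
    (hα _ (coordField_smooth_self _)).mdiff
  have h1 : ∀ i, D¹[J] (fun z ↦ ∂[J] (c i) z (Y z)) y := fun i ↦ hY.mdifferentiableAt_mvfderiv (smooth_coord_comp hπ i)
  have h2 : ∀ i, D¹[J] (fun z ↦ α (π z) (coordField I (π y) i (π z))) y := fun i ↦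
    MDifferentiableAt.comp (g := fun x ↦ α x (coordField I (π y) i x)) y (hαi i) (hπ.mdiff)
  rw [mvfderiv_congr (hex.mono fun z h ↦ h (Y z)), dd_sum_mul _ h1 h2, hex.self_of_nhds]
  refine sum_congr rfl fun i _ ↦ ?_
  rw [dd_comp_zero (hαi i) hπ h0.self_of_nhds, mul_zero, zero_add,
    lie_exact (c := 0) (smooth_coord_comp hπ i) hX hY]
  filter_upwards [hdc, h0] with z h3 h4
  rw [h3, h4, map_zero, map_zero]

/-- A pulled back covariant 2-tensor is invariant along fields tangent to the fibres. -/
lemma lie_pullTensor {T : Cov₂ I M} (hπ : ContMDiffAt J I ∞ π y) (hT : TensorSmoothAt I T (π y))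
    (hX : FieldDiffAt J X y) (hY : FieldDiffAt J Y y) (hZ : FieldDiffAt J Z y) (h0 : ∀ᶠ z in 𝓝 y, mfderiv J I π z (X z) = 0) :
    ∂[J] (fun z ↦ pullTensor T π z (Y z) (Z z)) y (X y) =
      pullTensor T π y (mlieBracket J X Y y) (Z y) + pullTensor T π y (Y y) (mlieBracket J X Z y) := by
  set c := fun i z ↦ (Module.finBasis ℝ E).coord i (extChartAt I (π y) (π z)) with hc
  have hdc := dd_coord_comp (J := J) hπ
  have hex : ∀ᶠ z in 𝓝 y, ∀ u w : T[J] z, pullTensor T π z u w =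
      ∑ i, ∂[J] (c i) z u * pullForm (fun x ↦ T x (coordField I (π y) i x)) π z w := by
    filter_upwards [hdc, eventually_chart_mem (H := H) hπ.continuousAt] with z h1 h2 u w
    rw [pullTensor_apply]
    conv_lhs => rw [field_chart_expansion h2 (mfderiv J I π z u)]
    simp only [map_sum, map_smul, smul_eq_mul, hc, h1, _root_.sum_apply, _root_.smul_apply, pullForm_apply]
  have hTi : ∀ i, FormSmoothAt I (fun x ↦ T x (coordField I (π y) i x)) (π y) := fun i X hX ↦ hT _ _ (coordField_smooth_self _) hX
  have h1 : ∀ i, D¹[J] (fun z ↦ ∂[J] (c i) z (Y z)) y := fun i ↦ hY.mdifferentiableAt_mvfderiv (smooth_coord_comp hπ i)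
  have h2 : ∀ i, D¹[J] (fun z ↦ pullForm (fun x ↦ T x (coordField I (π y) i x)) π z (Z z)) y := fun i ↦
    (pullForm_smooth hπ (hTi i)).mdifferentiableAt hZ
  rw [mvfderiv_congr (hex.mono fun z h ↦ h (Y z) (Z z)), dd_sum_mul _ h1 h2, hex.self_of_nhds, hex.self_of_nhds,
    ← sum_add_distrib]
  refine sum_congr rfl fun i _ ↦ ?_
  rw [lie_pullForm hπ (hTi i) hX hZ h0, lie_exact (c := 0) (smooth_coord_comp hπ i) hX hY, add_comm]
  filter_upwards [hdc, h0] with z h3 h4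
  rw [h3, h4, map_zero, map_zero]

end Pullback

/-! ### The metric near the horizon -/

section NearHorizon
variable {qh T : Cov₂ I M} {om : Cov I M}
  {π : N → M} {V r : N → ℝ} {y : N} {X Y Z W n : Vec J N} {a b : ℝ}

/-- The 1-form `θ = dr - 2 r π^*ω`. -/
def tiltForm (om : Cov I M) (π : N → M) (r : N → ℝ) (y : N) : T[J] y →L[ℝ] ℝ :=
  ∂[J] r y - (2 * r y) • pullForm om π y

/-- The metric `π^*q - dV ⊗ θ - θ ⊗ dV` with `θ = dr - 2 r π^*ω`, for which `r = 0` is a null hypersurface. -/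
def nearMetric (qh : Cov₂ I M) (om : Cov I M)
    (π : N → M) (V r : N → ℝ) (y : N) : T[J] y →L[ℝ] T[J] y →L[ℝ] ℝ :=
  pullTensor qh π y - tprod (∂[J] V y) (tiltForm om π r y) - tprod (tiltForm om π r y) (∂[J] V y)

lemma tiltForm_apply (u : T[J] y) : tiltForm om π r y u = ∂[J] r y u - 2 * r y * pullForm om π y u := rfl

lemma nearMetric_apply (u w : T[J] y) : nearMetric qh om π V r y u w =
    pullTensor qh π y u w - ∂[J] V y u * tiltForm om π r y w - tiltForm om π r y u * ∂[J] V y w := rfl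

variable (J) in
/-- The ingredients of `nearMetric` are smooth, and the tensor on the base is symmetric. -/
structure NearData (qh : Cov₂ I M) (om : Cov I M)
    (π : N → M) (V r : N → ℝ) : Prop where
  pi : ∀ y, ContMDiffAt J I ∞ π y
  pot : ∀ y, C∞[J] V y
  rad : ∀ y, C∞[J] r y
  form : ∀ x, FormSmoothAt I om x
  metric : ∀ x, TensorSmoothAt I qh x
  symm : ∀ x u w, qh x u w = qh x w u

variable (I J) in
/-- `X` is the field `a ∂/∂V + b ∂/∂r`. -/
structure IsFibreField (π : N → M) (V r : N → ℝ) (a b : ℝ) (X : Vec J N) : Prop where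
  diff : ∀ y, FieldDiffAt J X y
  pi : ∀ y, mfderiv J I π y (X y) = 0
  pot : ∀ y, ∂[J] V y (X y) = a
  rad : ∀ y, ∂[J] r y (X y) = b

lemma NearData.nearMetric_symm (h : NearData J qh om π V r) (y : N) (u w : T[J] y) :
    nearMetric qh om π V r y u w = nearMetric qh om π V r y w u := by
  rw [nearMetric_apply, nearMetric_apply, pullTensor_apply, pullTensor_apply, h.symm]; ring

lemma NearData.tiltForm_smooth (h : NearData J qh om π V r) (y : N) : FormSmoothAt J (tiltForm om π r) y := fun _ hX ↦
  (hX.contMDiffAt_mvfderiv (h.rad y)).sub ((contMDiffAt_const.mul (h.rad y)).mul (pullForm_smooth (h.pi y) (h.form _) _ hX))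

lemma NearData.dd_tiltForm (h : NearData J qh om π V r) (hY : FieldDiffAt J Y y) (u : T[J] y) :
    ∂[J] (fun z ↦ tiltForm om π r z (Y z)) y u = ∂[J] (fun z ↦ ∂[J] r z (Y z)) y u -
      (2 * r y * ∂[J] (fun z ↦ pullForm om π z (Y z)) y u + 2 * ∂[J] r y u * pullForm om π y (Y y)) := by
  have h1 : D¹[J] r y := (h.rad y).mdiff
  have h2 : D¹[J] (fun z ↦ 2 * r z) y := mdifferentiableAt_const.mul h1
  have h3 := (pullForm_smooth (J := J) (h.pi y) (h.form _)).mdifferentiableAt hY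
  have h4 : D¹[J] (fun z ↦ 2 * r z * pullForm om π z (Y z)) y := h2.mul h3
  rw [← dd_const_mul 2 h1, ← dd_mul h2 h3, ← dd_sub (hY.mdifferentiableAt_mvfderiv (h.rad y)) h4]
  rfl

lemma NearData.nearMetric_smooth (h : NearData J qh om π V r) (y : N) : TensorSmoothAt J (nearMetric qh om π V r) y := fun _ _ hX hY ↦
  ((pullTensor_smooth (h.pi y) (h.metric _) _ _ hX hY).sub ((hX.contMDiffAt_mvfderiv (h.pot y)).mul (h.tiltForm_smooth y _ hY))).sub
    ((h.tiltForm_smooth y _ hX).mul (hY.contMDiffAt_mvfderiv (h.pot y)))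

lemma NearData.dd_nearMetric (h : NearData J qh om π V r) (hY : FieldDiffAt J Y y) (hZ : FieldDiffAt J Z y) (u : T[J] y) :
    ∂[J] (fun z ↦ nearMetric qh om π V r z (Y z) (Z z)) y u = ∂[J] (fun z ↦ pullTensor qh π z (Y z) (Z z)) y u
      - (∂[J] V y (Y y) * ∂[J] (fun z ↦ tiltForm om π r z (Z z)) y u + ∂[J] (fun z ↦ ∂[J] V z (Y z)) y u * tiltForm om π r y (Z y))
      - (tiltForm om π r y (Y y) * ∂[J] (fun z ↦ ∂[J] V z (Z z)) y u + ∂[J] (fun z ↦ tiltForm om π r z (Y z)) y u * ∂[J] V y (Z y)) := by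
  have a := (pullTensor_smooth (J := J) (h.pi y) (h.metric _)).mdifferentiableAt hY hZ
  have b := fun {Y} (hY : FieldDiffAt J Y y) ↦ hY.mdifferentiableAt_mvfderiv (h.pot y)
  have c := fun {Y} (hY : FieldDiffAt J Y y) ↦ (h.tiltForm_smooth y).mdifferentiableAt hY
  have d : D¹[J] (fun z ↦ ∂[J] V z (Y z) * tiltForm om π r z (Z z)) y := (b hY).mul (c hZ)
  have e : D¹[J] (fun z ↦ tiltForm om π r z (Y z) * ∂[J] V z (Z z)) y := (c hY).mul (b hZ)
  have f : D¹[J] (fun z ↦ pullTensor qh π z (Y z) (Z z) - ∂[J] V z (Y z) * tiltForm om π r z (Z z)) y := a.sub d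
  rw [← dd_mul (b hY) (c hZ), ← dd_mul (c hY) (b hZ), ← dd_sub a d, ← dd_sub f e]
  rfl

/-- The field `∂/∂V` is a Killing field. -/
lemma NearData.lie_nearMetric (h : NearData J qh om π V r) (hX : IsFibreField I J π V r a 0 X) (hY : FieldDiffAt J Y y) (hZ : FieldDiffAt J Z y) :
    ∂[J] (fun z ↦ nearMetric qh om π V r z (Y z) (Z z)) y (X y) =
      nearMetric qh om π V r y (mlieBracket J X Y y) (Z y) + nearMetric qh om π V r y (Y y) (mlieBracket J X Z y) := by
  have e0 : ∀ᶠ z in 𝓝 y, mfderiv J I π z (X z) = 0 := Eventually.of_forall hX.pi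
  have e1 : ∀ᶠ z in 𝓝 y, ∂[J] V z (X z) = a := Eventually.of_forall hX.pot
  have e2 : ∀ᶠ z in 𝓝 y, ∂[J] r z (X z) = 0 := Eventually.of_forall hX.rad
  rw [h.dd_nearMetric hY hZ, h.dd_tiltForm hY, h.dd_tiltForm hZ, lie_pullTensor (h.pi y) (h.metric _) (hX.diff y) hY hZ e0,
    lie_pullForm (h.pi y) (h.form _) (hX.diff y) hY e0, lie_pullForm (h.pi y) (h.form _) (hX.diff y) hZ e0, lie_exact (h.pot y) (hX.diff y) hY e1,
    lie_exact (h.pot y) (hX.diff y) hZ e1, lie_exact (h.rad y) (hX.diff y) hY e2, lie_exact (h.rad y) (hX.diff y) hZ e2, hX.rad]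
  simp only [nearMetric_apply, tiltForm_apply]
  ring

lemma IsFibreField.metric_left (hX : IsFibreField I J π V r a b X) (z : N) (u : T[J] z) :
    nearMetric qh om π V r z (X z) u = -(a * tiltForm om π r z u) - b * ∂[J] V z u := by
  have h1 : pullTensor qh π z (X z) u = 0 := by rw [pullTensor_apply, hX.pi, map_zero]; rfl
  have h2 : pullForm om π z (X z) = 0 := by rw [pullForm_apply, hX.pi, map_zero]
  rw [nearMetric_apply, tiltForm_apply (X z), h1, h2, hX.pot, hX.rad]; ring

lemma IsFibreField.metric_right (h : NearData J qh om π V r) (hX : IsFibreField I J π V r a b X) (z : N) (u : T[J] z) :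
    nearMetric qh om π V r z u (X z) = -(a * tiltForm om π r z u) - b * ∂[J] V z u := by
  rw [h.nearMetric_symm, hX.metric_left]

variable {nab : Conn[J,E',N]}

/-- The rotation 1-form of the horizon `r = 0` is the pullback of `ω`. -/
lemma NearData.nab_killing (h : NearData J qh om π V r) (hn : IsLeviCivita J (nearMetric qh om π V r) nab) (hX : IsFibreField I J π V r 1 0 X)
    (hy : r y = 0) (hY : FieldDiffAt J Y y) (hYr : ∂[J] r y (Y y) = 0) (hZ : FieldDiffAt J Z y) :
    nearMetric qh om π V r y (nab X y (Y y)) (Z y) = pullForm om π y (Y y) * nearMetric qh om π V r y (X y) (Z y) := by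
  have h1 := hn.koszul h.nearMetric_symm hY (hX.diff y) hZ
  have h2 := h.lie_nearMetric hX hY hZ
  have h3 := mvfderiv_mlieBracket (h.rad y) hY hZ
  have h4 : nearMetric qh om π V r y (mlieBracket J Y X y) (Z y) = - nearMetric qh om π V r y (mlieBracket J X Y y) (Z y) := by
    rw [br_swap, map_neg]; rfl
  have k : ∀ (z : N) (u : T[J] z), nearMetric qh om π V r z (X z) u = - tiltForm om π r z u := fun z u ↦ by
    rw [hX.metric_left]; ring
  have k' : ∀ (z : N) (u : T[J] z), nearMetric qh om π V r z u (X z) = - tiltForm om π r z u := fun z u ↦ by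
    rw [hX.metric_right h]; ring
  unfold koszul at h1
  simp only [k, k', dd_neg, h.dd_tiltForm hY, h.dd_tiltForm hZ, h4, h2] at h1
  rw [h.nearMetric_symm y (mlieBracket J X Z y) (Y y), tiltForm_apply (mlieBracket J Y Z y), h3, hYr, hy] at h1
  rw [k, tiltForm_apply, hy]
  linarith

/-- The horizon `r = 0` is totally geodesic. -/
lemma NearData.nab_rad (h : NearData J qh om π V r) (hn : IsLeviCivita J (nearMetric qh om π V r) nab) (hX : IsFibreField I J π V r 1 0 X)
    (hy : r y = 0) (hY : FieldDiffAt J Y y) (hYr : ∂[J] r y (Y y) = 0) (hW : FieldDiffAt J W y)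
    (hWr : ∀ᶠ z in 𝓝 y, ∂[J] r z (W z) = 0) : ∂[J] r y (nab W y (Y y)) = 0 := by
  have h1 := hn.metric y W X hW (hX.diff y) (Y y)
  rw [h.nearMetric_symm y (W y), h.nab_killing hn hX hy hY hYr hW, hX.metric_left, hX.metric_right h] at h1
  have k : ∀ (z : N) (u : T[J] z), nearMetric qh om π V r z u (X z) = - tiltForm om π r z u := fun z u ↦ by
    rw [hX.metric_right h]; ring
  simp only [k, dd_neg, h.dd_tiltForm hW, dd_eventually_const hWr] at h1
  simp only [tiltForm_apply, hy, hYr, hWr.self_of_nhds] at h1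
  linarith

/-- The second derivative of `V` along the horizon `r = 0`. -/
lemma NearData.nab_pot (h : NearData J qh om π V r) (hn : IsLeviCivita J (nearMetric qh om π V r) nab) (hX : IsFibreField I J π V r 0 1 n)
    (hy : r y = 0) (hY : FieldDiffAt J Y y) (hYr : ∀ᶠ z in 𝓝 y, ∂[J] r z (Y z) = 0) (hW : FieldDiffAt J W y)
    (hWr : ∀ᶠ z in 𝓝 y, ∂[J] r z (W z) = 0) (nY : mlieBracket J n Y y = 0) (nW : mlieBracket J n W y = 0) :
    ∂[J] V y (nab W y (Y y)) = ∂[J] (fun z ↦ ∂[J] V z (W z)) y (Y y) + ∂[J] V y (Y y) * pullForm om π y (W y)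
      + pullForm om π y (Y y) * ∂[J] V y (W y) := by
  have h1 := hn.koszul h.nearMetric_symm hY hW (hX.diff y)
  have k' : ∀ (z : N) (u : T[J] z), nearMetric qh om π V r z u (n z) = - ∂[J] V z u := fun z u ↦ by
    rw [hX.metric_right h]; ring
  have h3 := mvfderiv_mlieBracket (h.pot y) hY hW
  have Yn : mlieBracket J Y n y = 0 := by rw [br_swap, nY, neg_zero]
  have Wn : mlieBracket J W n y = 0 := by rw [br_swap, nW, neg_zero]
  have e0 : ∀ᶠ z in 𝓝 y, mfderiv J I π z (n z) = 0 := Eventually.of_forall hX.pi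
  have e1 : ∀ᶠ z in 𝓝 y, ∂[J] V z (n z) = 0 := Eventually.of_forall hX.pot
  unfold koszul at h1
  simp only [k', dd_neg] at h1
  rw [h.dd_nearMetric hY hW, h.dd_tiltForm hY, h.dd_tiltForm hW, lie_pullTensor (h.pi y) (h.metric _) (hX.diff y) hY hW e0,
    lie_exact (h.pot y) (hX.diff y) hY e1, lie_exact (h.pot y) (hX.diff y) hW e1, dd_eventually_const hYr, dd_eventually_const hWr, Yn, Wn, nY, nW, hy,
    hX.rad, h3, map_zero, map_zero, map_zero, map_zero] at h1
  simp only [_root_.zero_apply] at h1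
  linarith

end NearHorizon

/-! ### Volume form, electromagnetic field and slices -/

section NearFrame
variable {qh ε : Cov₂ I M} {om : Cov I M}
  {π : N → M} {V r : N → ℝ} {y : N} {X n : Vec J N} {a b : ℝ} {f : Π x : M, Fin 2 → T[I] x}

lemma IsFibreField.tilt (hX : IsFibreField I J π V r a b X) (z : N) : tiltForm om π r z (X z) = b := by
  rw [tiltForm_apply, hX.rad, pullForm_apply, hX.pi, map_zero, mul_zero, sub_zero]

/-- Orthonormal vectors of the base lift to a null frame. -/
lemma IsFibreField.exists_null_frame (hX : IsFibreField I J π V r 1 0 X) (hn : IsFibreField I J π V r 0 1 n)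
    (hsurj : Function.Surjective (mfderiv J I π y)) {w : Fin 2 → T[I] (π y)} (hw : ∀ i j, qh (π y) (w i) (w j) = if i = j then 1 else 0) :
    ∃ e, IsNullFrame (nearMetric qh om π V r) y e (n y) (X y) ∧ (∀ i, mfderiv J I π y (e i) = w i) ∧
      (∀ i, ∂[J] V y (e i) = 0) ∧ ∀ i, tiltForm om π r y (e i) = 0 := by
  choose u hu using fun i ↦ hsurj (w i)
  -- subtracting multiples of `X` and `n` makes `dV` and `θ` vanish
  let e : Fin 2 → T[J] y := fun i ↦ u i - ∂[J] V y (u i) • X y - tiltForm om π r y (u i) • n y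
  have e1 : ∀ i, mfderiv J I π y (e i) = w i := fun i ↦ by simp only [e, map_sub, map_smul, hX.pi, hn.pi, hu, smul_zero, sub_zero]
  have e2 : ∀ i, ∂[J] V y (e i) = 0 := fun i ↦ by simp only [e, map_sub, map_smul, hX.pot, hn.pot, smul_eq_mul]; ring
  have e3 : ∀ i, tiltForm om π r y (e i) = 0 := fun i ↦ by simp only [e, map_sub, map_smul, hX.tilt, hn.tilt, smul_eq_mul]; ring
  refine ⟨e, ⟨fun i j ↦ ?_, fun i ↦ ?_, fun i ↦ ?_, ?_, ?_, ?_⟩, e1, e2, e3⟩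
  · rw [nearMetric_apply, pullTensor_apply, e1, e1, hw, e2, e2, zero_mul, mul_zero, sub_zero, sub_zero]
  · rw [hn.metric_left, e2]; ring
  · rw [hX.metric_left, e3]; ring
  · rw [hn.metric_left, hn.pot]; ring
  · rw [hX.metric_left, hX.tilt]; ring
  · rw [hn.metric_left, hX.pot]; ring

lemma NearData.isPseudoMetric (h : NearData J qh om π V r) (hX : IsFibreField I J π V r 1 0 X) (hn : IsFibreField I J π V r 0 1 n)
    (hsurj : ∀ y, Function.Surjective (mfderiv J I π y)) (hf : ∀ x i j, qh x (f x i) (f x j) = if i = j then 1 else 0)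
    (hdim : Module.finrank ℝ E' = 4) : IsPseudoMetric J eta (nearMetric qh om π V r) where
  smooth := h.nearMetric_smooth
  symm := h.nearMetric_symm
  sign i := by unfold eta; split_ifs <;> norm_num
  frame y := by
    obtain ⟨e, he, -⟩ := hX.exists_null_frame hn (hsurj y) (hf (π y))
    have ho := he.orthonormal (h.nearMetric_symm y)
    have hl := linearIndependent_of_orthonormal (s := eta) (fun i ↦ by unfold eta; split_ifs <;> norm_num) ho
    have hc : Fintype.card (Fin 4) = Module.finrank ℝ (T[J] y) := by rw [Fintype.card_fin]; exact hdim.symm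
    refine ⟨basisOfLinearIndependentOfCardEqFinrank hl hc, fun i j ↦ ?_⟩
    rw [coe_basisOfLinearIndependentOfCardEqFinrank]
    exact ho i j

/-- The forms `q(f₁, ·), q(f₂, ·), θ, dV`, evaluated on a vector. -/
def nearCoframe (qh : Cov₂ I M) (om : Cov I M)
    (f : Π x : M, Fin 2 → T[I] x) (π : N → M) (V r : N → ℝ) (y : N) : T[J] y →ₗ[ℝ] (Fin 4 → ℝ) :=
  LinearMap.pi fun k ↦ ((![pullForm (fun x ↦ qh x (f x 0)) π y, pullForm (fun x ↦ qh x (f x 1)) π y, tiltForm om π r y, ∂[J] V y] :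
    Fin 4 → T[J] y →L[ℝ] ℝ) k).toLinearMap

/-- The volume form `q(f₁, ·) ∧ q(f₂, ·) ∧ θ ∧ dV`. -/
def nearVol (qh : Cov₂ I M) (om : Cov I M)
    (f : Π x : M, Fin 2 → T[I] x) (π : N → M) (V r : N → ℝ) (y : N) : T[J] y [⋀^Fin 4]→ₗ[ℝ] ℝ :=
  (Matrix.detRowAlternating : (Fin 4 → ℝ) [⋀^Fin 4]→ₗ[ℝ] ℝ).compLinearMap (nearCoframe qh om f π V r y)

/-- Laplace expansion along two pairs of columns. -/
lemma det_four_columns (a c t d : Fin 4 → ℝ) : (Matrix.of fun i ↦ ![a i, c i, t i, d i]).det =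
    (a 0 * c 1 - a 1 * c 0) * (t 2 * d 3 - t 3 * d 2) - (a 0 * c 2 - a 2 * c 0) * (t 1 * d 3 - t 3 * d 1)
      + (a 0 * c 3 - a 3 * c 0) * (t 1 * d 2 - t 2 * d 1) + (a 1 * c 2 - a 2 * c 1) * (t 0 * d 3 - t 3 * d 0)
      - (a 1 * c 3 - a 3 * c 1) * (t 0 * d 2 - t 2 * d 0) + (a 2 * c 3 - a 3 * c 2) * (t 0 * d 1 - t 1 * d 0) := by
  simp [Matrix.det_succ_row_zero, Fin.sum_univ_succ, Fin.succAbove]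
  ring

/-- As a function of the area form `ε`, the volume form is visibly smooth although the frame `f` need not be continuous. -/
lemma nearVol_apply (u : Fin 4 → T[J] y) (hε : ∀ x u w, ε x u w = qh x (f x 0) u * qh x (f x 1) w - qh x (f x 0) w * qh x (f x 1) u) :
    nearVol qh om f π V r y u =
    pullTensor ε π y (u 0) (u 1) * (tiltForm om π r y (u 2) * ∂[J] V y (u 3) - tiltForm om π r y (u 3) * ∂[J] V y (u 2))
      - pullTensor ε π y (u 0) (u 2) * (tiltForm om π r y (u 1) * ∂[J] V y (u 3) - tiltForm om π r y (u 3) * ∂[J] V y (u 1))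
      + pullTensor ε π y (u 0) (u 3) * (tiltForm om π r y (u 1) * ∂[J] V y (u 2) - tiltForm om π r y (u 2) * ∂[J] V y (u 1))
      + pullTensor ε π y (u 1) (u 2) * (tiltForm om π r y (u 0) * ∂[J] V y (u 3) - tiltForm om π r y (u 3) * ∂[J] V y (u 0))
      - pullTensor ε π y (u 1) (u 3) * (tiltForm om π r y (u 0) * ∂[J] V y (u 2) - tiltForm om π r y (u 2) * ∂[J] V y (u 0))
      + pullTensor ε π y (u 2) (u 3) * (tiltForm om π r y (u 0) * ∂[J] V y (u 1) - tiltForm om π r y (u 1) * ∂[J] V y (u 0)) := by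
  simp only [pullTensor_apply, hε]
  rw [← det_four_columns (fun i ↦ qh (π y) (f (π y) 0) (mfderiv J I π y (u i))) (fun i ↦ qh (π y) (f (π y) 1) (mfderiv J I π y (u i)))
    (fun i ↦ tiltForm om π r y (u i)) (fun i ↦ ∂[J] V y (u i))]
  refine congrArg (Matrix.det : Matrix (Fin 4) (Fin 4) ℝ → ℝ) ?_
  ext i j
  fin_cases j <;> rfl

/-- In the coframe of the volume form the metric has a constant matrix of determinant `-1`. -/
lemma nearVol_sq (hq : ∀ x u w, qh x u w = qh x (f x 0) u * qh x (f x 0) w + qh x (f x 1) u * qh x (f x 1) w) (u : Fin 4 → T[J] y) :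
    nearVol qh om f π V r y u ^ 2 = -(Matrix.of fun i j ↦ nearMetric qh om π V r y (u i) (u j)).det := by
  set C : Matrix (Fin 4) (Fin 4) ℝ := Matrix.of fun i ↦ nearCoframe qh om f π V r y (u i) with hC
  have h1 : nearVol qh om f π V r y u = C.det := rfl
  -- the Gram matrix is that of the metric in the coframe, conjugated by the coframe matrix
  have h2 : (Matrix.of fun i j ↦ nearMetric qh om π V r y (u i) (u j)) = C * !![1, 0, 0, 0; 0, 1, 0, 0; 0, 0, 0, -1; 0, 0, -1, 0] * C.transpose := by
    ext i j
    rw [Matrix.of_apply, nearMetric_apply, pullTensor_apply, hq]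
    simp [Matrix.mul_apply, Fin.sum_univ_four, hC, nearCoframe, pullForm_apply]
    ring
  have h3 : (!![1, 0, 0, 0; 0, 1, 0, 0; 0, 0, 0, -1; 0, 0, -1, 0] : Matrix (Fin 4) (Fin 4) ℝ).det = -1 := by
    simp [Matrix.det_succ_row_zero, Fin.sum_univ_succ, Fin.succAbove]
  rw [h1, h2, Matrix.det_mul, Matrix.det_mul, h3, Matrix.det_transpose]
  ring

lemma NearData.nearVol_smooth (h : NearData J qh om π V r) (hs : ∀ x, TensorSmoothAt I ε x)
    (hε : ∀ x u w, ε x u w = qh x (f x 0) u * qh x (f x 1) w - qh x (f x 0) w * qh x (f x 1) u) (y : N) (X : Fin 4 → Vec J N)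
    (hX : ∀ i, FieldSmoothAt J (X i) y) : C∞[J] (fun y ↦ nearVol qh om f π V r y (fun i ↦ X i y)) y := by
  have a := fun i j ↦ pullTensor_smooth (h.pi y) (hs _) _ _ (hX i) (hX j)
  have b := fun i j ↦ (h.tiltForm_smooth y _ (hX i)).mul ((hX j).contMDiffAt_mvfderiv (h.pot y))
  simp only [nearVol_apply _ hε]
  exact ((((((a 0 1).mul ((b 2 3).sub (b 3 2))).sub ((a 0 2).mul ((b 1 3).sub (b 3 1)))).add ((a 0 3).mul ((b 1 2).sub (b 2 1)))).add
    ((a 1 2).mul ((b 0 3).sub (b 3 0)))).sub ((a 1 3).mul ((b 0 2).sub (b 2 0)))).add ((a 2 3).mul ((b 0 1).sub (b 1 0)))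

/-- The 2-form `A dV ∧ θ + B π^*ε`. -/
def nearField (ε : Cov₂ I M) (om : Cov I M) (A B : M → ℝ)
    (π : N → M) (V r : N → ℝ) (y : N) : T[J] y →L[ℝ] T[J] y →L[ℝ] ℝ :=
  A (π y) • (tprod (∂[J] V y) (tiltForm om π r y) - tprod (tiltForm om π r y) (∂[J] V y)) + B (π y) • pullTensor ε π y

lemma nearField_apply {A B : M → ℝ} (u w : T[J] y) : nearField ε om A B π V r y u w =
    A (π y) * (∂[J] V y u * tiltForm om π r y w - tiltForm om π r y u * ∂[J] V y w) + B (π y) * pullTensor ε π y u w := rfl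

lemma NearData.nearField_smooth (h : NearData J qh om π V r) (hs : ∀ x, TensorSmoothAt I ε x) {A B : M → ℝ} (hA : ContMDiff I 𝓘(ℝ, ℝ) ∞ A)
    (hB : ContMDiff I 𝓘(ℝ, ℝ) ∞ B) (y : N) : TensorSmoothAt J (nearField ε om A B π V r) y := fun X Y hX hY ↦ by
  have a : C∞[J] (fun z ↦ A (π z)) y := hA.contMDiffAt.comp y (h.pi y)
  have b : C∞[J] (fun z ↦ B (π z)) y := hB.contMDiffAt.comp y (h.pi y)
  have t := fun {X} (hX : FieldSmoothAt J X y) ↦ h.tiltForm_smooth y X hX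
  have d := fun {X} (hX : FieldSmoothAt J X y) ↦ hX.contMDiffAt_mvfderiv (h.pot y)
  exact (a.mul (((d hX).mul (t hY)).sub ((t hX).mul (d hY)))).add (b.mul (pullTensor_smooth (h.pi y) (hs _) X Y hX hY))

end NearFrame

section Slice

lemma dfst_slice (x : M) (u : T[I] x) (c : ℝ) :
    mfderiv Cyl[I] I Prod.fst (x, c) (mfderiv I Cyl[I] (fun x : M ↦ (x, c)) x u) = u :=
  (congrArg (mfderiv Cyl[I] I Prod.fst (x, c)) (mfderiv_slice c x u)).trans (dfst_mk (x, c) u 0)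

lemma dsnd_slice (x : M) (u : T[I] x) (c : ℝ) :
    ∂[Cyl[I]] (Prod.snd : M × ℝ → ℝ) (x, c) (mfderiv I Cyl[I] (fun x : M ↦ (x, c)) x u) = 0 :=
  (congrArg (∂[Cyl[I]] (Prod.snd : M × ℝ → ℝ) (x, c)) (mfderiv_slice c x u)).trans (dsnd_mk (x, c) u 0)

lemma slice_lift (Y : Vec I M) (x : M) (c : ℝ) :
    mfderiv I Cyl[I] (fun x : M ↦ (x, c)) x (Y x) = lift Y (x, c) := mfderiv_slice c x (Y x)

/-- The connection induced on the slice `M × {0}` of a product with the line by projection along the line. -/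
def sliceConn (nab : Conn[Cyl[I],E × ℝ,M × ℝ]) :
    Conn[I,E,M] where
  toFun Y x := (mfderiv Cyl[I] I Prod.fst (x, (0 : ℝ))).comp ((nab (lift Y) (x, 0)).comp (mfderiv I Cyl[I] (fun x : M ↦ (x, (0 : ℝ))) x))
  isCovariantDerivativeOnUniv :=
    { add := by
        intro Y Y' x hY hY' _
        have h : lift (Y + Y') = lift Y + lift (I := I) Y' := by
          ext1 p
          exact Prod.ext rfl (add_zero (0 : ℝ)).symm
        have h1 := nab_add nab (X := lift Y) (Y := lift Y') (x := (x, (0 : ℝ))) (lift_diff hY) (lift_diff hY')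
        rw [h]
        ext1 u
        exact (congrArg (mfderiv Cyl[I] I Prod.fst (x, (0 : ℝ))) (h1 _)).trans (map_add _ _ _)
      leibniz := by
        intro Y f x hY hf _
        have h : lift (f • Y) = (fun p : M × ℝ ↦ f p.1) • lift (I := I) Y := by
          ext1 p
          exact Prod.ext rfl (mul_zero (f p.1)).symm
        have hf' : D¹[Cyl[I]] (fun p : M × ℝ ↦ f p.1) (x, 0) :=
          MDifferentiableAt.comp (g := f) (x, (0 : ℝ)) hf (mdiff_fst _)
        have h1 := nab_smul nab (x := (x, (0 : ℝ))) hf' (lift_diff (X := Y) hY)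
        rw [h]
        ext1 u
        refine (congrArg (mfderiv Cyl[I] I Prod.fst (x, (0 : ℝ))) (h1 (mfderiv I Cyl[I] (fun x : M ↦ (x, (0 : ℝ))) x u))).trans ?_
        rw [map_add, map_smul, map_smul, mvfderiv_comp' (x, (0 : ℝ)) hf (mdiff_fst _), dfst_slice, dfst_lift]
        rfl }

lemma sliceConn_apply (nab : Conn[Cyl[I],E × ℝ,M × ℝ])
    (Y : Vec I M) (x : M) (u : T[I] x) :
    sliceConn nab Y x u = mfderiv Cyl[I] I Prod.fst (x, (0 : ℝ)) (nab (lift Y) (x, 0) (mfderiv I Cyl[I] (fun x : M ↦ (x, (0 : ℝ))) x u)) := rfl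

/-- If the slice is totally geodesic, the induced connection is the restriction of the ambient one. -/
lemma push_sliceConn {nab : Conn[Cyl[I],E × ℝ,M × ℝ]}
    {Y : Vec I M} {x : M} {u : T[I] x}
    (h : ∂[Cyl[I]] (Prod.snd : M × ℝ → ℝ) (x, 0) (nab (lift Y) (x, 0) (mfderiv I Cyl[I] (fun x : M ↦ (x, (0 : ℝ))) x u)) = 0) :
    mfderiv I Cyl[I] (fun x : M ↦ (x, (0 : ℝ))) x (sliceConn nab Y x u) = nab (lift Y) (x, 0) (mfderiv I Cyl[I] (fun x : M ↦ (x, (0 : ℝ))) x u) := by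
  apply prod_tangent_ext
  · rw [dfst_slice, sliceConn_apply]
  · rw [dsnd_slice, h]

end Slice

end Fields

section Horizon
variable {S : Type u} [TopologicalSpace S] [ChartedSpace ℝ² S]
  [IsManifold (𝓡 2) ∞ S]

/-! ### The spacetime with given data -/

variable {qh ε : Cov₂ (𝓡 2) S} {omh : Cov (𝓡 2) S}
  {v : S × ℝ → ℝ} {f : Π x : S, Fin 2 → T[𝓡 2] x}

/-- The inclusion of the cylinder in spacetime. -/
def slice (p : S × ℝ) : (S × ℝ) × ℝ := (p, 0)

lemma slice_embedding : Manifold.IsSmoothEmbedding I3 I4 ∞ (slice (S := S)) := by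
  refine ⟨⟨ℝ, inferInstance, inferInstance, fun p ↦ ?_⟩, ?_⟩
  · refine Manifold.IsImmersionAtOfComplement.mk_of_continuousAt (by unfold slice; fun_prop)
      (ContinuousLinearEquiv.refl ℝ _) (chartAt _ p) (chartAt _ (slice p)) (mem_chart_source _ p) (mem_chart_source _ _)
      (IsManifold.chart_mem_maximalAtlas p) (IsManifold.chart_mem_maximalAtlas _) ?_
    intro z hz
    have h1 := (extChartAt I3 p).right_inv hz
    exact Prod.ext h1 rfl
  · exact Topology.IsEmbedding.of_comp (by unfold slice; fun_prop) continuous_fst Topology.IsEmbedding.id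

/-- The projection of spacetime to the surface. -/
def toSurface (z : (S × ℝ) × ℝ) : S := z.1.1

/-- The potential of the foliation, extended to spacetime. -/
def extendPot (v : S × ℝ → ℝ) (z : (S × ℝ) × ℝ) : ℝ := v z.1

/- The fields `∂/∂V` and `∂/∂r`. -/
local notation "ℓ₄" => lift (I := I3) (M := S × ℝ) ell
local notation "n₄" => vert (I := I3) (M := S × ℝ)

lemma toSurface_smooth (z : (S × ℝ) × ℝ) : ContMDiffAt I4 (𝓡 2) ∞ (toSurface (S := S)) z :=
  ContMDiffAt.comp (g := Prod.fst) z (contMDiffAt_fst' z.1) (contMDiffAt_fst' z)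

lemma extendPot_smooth (hv : IsFoliationFunction v) (z : (S × ℝ) × ℝ) : C∞[I4] (extendPot v) z :=
  ContMDiffAt.comp (g := v) z hv.1.contMDiffAt (contMDiffAt_fst' z)

lemma d_toSurface (z : (S × ℝ) × ℝ) (u : T[I4] z) :
    mfderiv I4 (𝓡 2) toSurface z u = dPi z.1 (mfderiv I4 I3 Prod.fst z u) :=
  mfderiv_comp_apply (g := (Prod.fst : S × ℝ → S)) z (mdiff_fst z.1) (mdiff_fst z) u

lemma d_extendPot (hv : IsFoliationFunction v) (z : (S × ℝ) × ℝ) (u : T[I4] z) :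
    ∂[I4] (extendPot v) z u = ∂[I3] v z.1 (mfderiv I4 I3 Prod.fst z u) :=
  mvfderiv_comp' (g := v) z (hv.1.contMDiffAt.mdiff) (mdiff_fst z) u

lemma toSurface_surjective (z : (S × ℝ) × ℝ) : Function.Surjective (mfderiv I4 (𝓡 2) toSurface z) := fun w ↦
  ⟨lift (lift (extend₂ w)) z, by
    rw [d_toSurface]
    exact ((congrArg (dPi z.1) (dfst_lift (I := I3) _ z)).trans (dPi_lift _ z.1)).trans (extend_apply_self _ _)⟩

lemma ell_fibreField (hv : IsFoliationFunction v) : IsFibreField (𝓡 2) I4 toSurface (extendPot v) Prod.snd 1 0 ℓ₄ where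
  diff z := lift_diff (I := I3) (ell_smooth z.1).fieldDiffAt
  pi z := by rw [d_toSurface]; exact (congrArg (dPi z.1) (dfst_lift (I := I3) ell z)).trans (dPi_ell z.1)
  pot z := by rw [d_extendPot hv]; exact (congrArg (∂[I3] v z.1) (dfst_lift (I := I3) ell z)).trans (hv.2 z.1)
  rad z := dsnd_lift (I := I3) ell z

lemma vert_fibreField (hv : IsFoliationFunction v) : IsFibreField (𝓡 2) I4 toSurface (extendPot v) Prod.snd 0 1 n₄ where
  diff z := (vert_smooth (I := I3) z).fieldDiffAt
  pi z := by rw [d_toSurface]; exact (congrArg (dPi z.1) (dfst_vert (I := I3) z)).trans (map_zero _)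
  pot z := by rw [d_extendPot hv]; exact (congrArg (∂[I3] v z.1) (dfst_vert (I := I3) z)).trans (map_zero _)
  rad z := dsnd_vert (I := I3) z

/-- `f` is a (possibly discontinuous) choice of orthonormal frames of `q` of the orientation given by the area form `ε`. -/
structure IsOrientedFrame (qh ε : Cov₂ (𝓡 2) S) (f : Π x : S, Fin 2 → T[𝓡 2] x) : Prop where
  ortho : ∀ x i j, qh x (f x i) (f x j) = if i = j then 1 else 0
  metric : ∀ x u w, qh x u w = qh x (f x 0) u * qh x (f x 0) w + qh x (f x 1) u * qh x (f x 1) w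
  area : ∀ x u w, ε x u w = qh x (f x 0) u * qh x (f x 1) w - qh x (f x 0) w * qh x (f x 1) u

lemma IsAreaForm.exists_orientedFrame (hε : IsAreaForm qh ε) (hq : IsRiemannian (𝓡 2) qh) : ∃ f, IsOrientedFrame qh ε f := by
  have key : ∀ x : S, ∃ e : Fin 2 → T[𝓡 2] x, (∀ i j, qh x (e i) (e j) = if i = j then 1 else 0) ∧ ε x (e 0) (e 1) = 1 := by
    intro x
    obtain ⟨b, hb⟩ := exists_orthonormal_of_pos (hq.symm x) (hq.pos x)
    have h1 : ε x (b 0) (b 1) ^ 2 = 1 := by rw [hε.sq, hb, hb, hb]; norm_num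
    refine ⟨![b 0, ε x (b 0) (b 1) • b 1], fun i j ↦ ?_, ?_⟩
    · fin_cases i <;> fin_cases j <;> simp [hb]
      rw [← pow_two, h1]
    · show ε x (b 0) (ε x (b 0) (b 1) • b 1) = 1
      rw [map_smul, smul_eq_mul, ← pow_two, h1]
  choose f hf1 hf2 using key
  have hexp : ∀ x (u : T[𝓡 2] x), u = qh x (f x 0) u • f x 0 + qh x (f x 1) u • f x 1 := fun x u ↦ by
    have := orthonormal_expansion hq.isPseudoMetric (hf1 x) u
    rwa [Fin.sum_univ_two, one_mul, one_mul, hq.symm x u, hq.symm x u] at this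
  have hskew : ∀ x (u w : T[𝓡 2] x), ε x u w = - ε x w u := fun x u w ↦ by
    have := hε.alternating x (u + w)
    simp only [map_add, _root_.add_apply, hε.alternating] at this
    linarith
  refine ⟨f, hf1, fun x u w ↦ ?_, fun x u w ↦ ?_⟩
  · conv_lhs => rw [hexp x w]
    rw [map_add, map_smul, map_smul, hq.symm x u (f x 0), hq.symm x u (f x 1), smul_eq_mul, smul_eq_mul]
    ring
  · conv_lhs => rw [hexp x u, hexp x w]
    simp only [map_add, map_smul, smul_eq_mul, _root_.add_apply, _root_.smul_apply, hε.alternating, hf2, hskew x (f x 1) (f x 0)]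
    ring

/- The metric and electromagnetic field of the spacetime, and the differential of the inclusion of the cylinder. -/
local notation "gN" => nearMetric qh omh toSurface (extendPot v) Prod.snd
local notation "NF[" A "," B "]" => nearField ε omh A B toSurface (extendPot v) Prod.snd
local notation "dι[" p "]" => mfderiv I3 I4 slice p

lemma nearData_of_foliation (hq : IsRiemannian (𝓡 2) qh) (ho : ∀ x, FormSmoothAt (𝓡 2) omh x) (hv : IsFoliationFunction v) :
    NearData I4 qh omh toSurface (extendPot v) Prod.snd :=
  ⟨toSurface_smooth, extendPot_smooth hv, fun z ↦ contMDiffAt_snd' (I := I3) z, ho, hq.smooth, hq.symm⟩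

section AmbientSpacetime
variable [T2Space S] [SecondCountableTopology S] (h : NearData I4 qh omh toSurface (extendPot v) Prod.snd) (hv : IsFoliationFunction v) (hf : IsOrientedFrame qh ε f) (hε : IsAreaForm qh ε)

include h hv hf in
lemma nearMetric_isPseudoMetric :
    IsPseudoMetric I4 eta gN :=
  h.isPseudoMetric (ell_fibreField hv) (vert_fibreField hv) toSurface_surjective hf.ortho (by simp)

/-- The spacetime in which the horizon with data `q, ω` and foliation `v` is embedded. -/
abbrev nearSpacetime : Spacetime.{u} where
  carrier := (S × ℝ) × ℝ
  g := gN
  g_smooth := h.nearMetric_smooth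
  g_symm := h.nearMetric_symm
  g_lorentz := (nearMetric_isPseudoMetric h hv hf).frame
  nab := Classical.choose (exists_leviCivita (nearMetric_isPseudoMetric h hv hf))
  leviCivita := Classical.choose_spec (exists_leviCivita (nearMetric_isPseudoMetric h hv hf))
  vol := nearVol qh omh f toSurface (extendPot v) Prod.snd
  vol_sq _ u := nearVol_sq hf.metric u
  vol_smooth := h.nearVol_smooth hε.smooth hf.area

local notation "M₄" => nearSpacetime h hv hf hε

/-! ### The horizon in the spacetime -/

section Construction
variable {p : S × ℝ}
  {nab : Conn[I4,(ℝ² × ℝ) × ℝ,(S × ℝ) × ℝ]}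

lemma slice_smooth (p : S × ℝ) : ContMDiffAt I3 I4 ∞ (slice (S := S)) p := (contMDiff_slice (I := I3) (0 : ℝ)).contMDiffAt

lemma slice_mdiff (p : S × ℝ) : MDifferentiableAt I3 I4 (slice (S := S)) p := (slice_smooth p).mdiff

lemma dfst_dslice (u : T[I3] p) : mfderiv I4 I3 Prod.fst (slice p) (dι[p] u) = u := dfst_slice (I := I3) p u 0

lemma rad_dslice (u : T[I3] p) : ∂[I4] (Prod.snd : (S × ℝ) × ℝ → ℝ) (slice p) (dι[p] u) = 0 := dsnd_slice (I := I3) p u 0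

lemma dslice_field (Y : Vec I3 (S × ℝ)) (p : S × ℝ) : dι[p] (Y p) = lift (I := I3) Y (slice p) := slice_lift (I := I3) Y p 0

lemma toSurface_dslice (u : T[I3] p) : mfderiv I4 (𝓡 2) toSurface (slice p) (dι[p] u) = dPi p u := by
  rw [d_toSurface, dfst_dslice]; rfl

lemma pot_dslice (hv : IsFoliationFunction v) (u : T[I3] p) :
    ∂[I4] (extendPot v) (slice p) (dι[p] u) = ∂[I3] v p u := by
  rw [d_extendPot hv, dfst_dslice]; rfl

lemma tilt_dslice (u : T[I3] p) : tiltForm omh toSurface Prod.snd (slice p) (dι[p] u) = 0 := by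
  rw [tiltForm_apply, rad_dslice]; show 0 - 2 * (0 : ℝ) * _ = 0; ring

lemma nearMetric_dslice (u w : T[I3] p) :
    gN (slice p) (dι[p] u) (dι[p] w) = pullTensor (J := I3) qh Prod.fst p u w := by
  rw [nearMetric_apply, tilt_dslice, tilt_dslice, pullTensor_apply, toSurface_dslice, toSurface_dslice, mul_zero, zero_mul, sub_zero, sub_zero]
  rfl

lemma rad_lift (Y : Vec I3 (S × ℝ)) (z : (S × ℝ) × ℝ) : ∂[I4] (Prod.snd : (S × ℝ) × ℝ → ℝ) z (lift (I := I3) Y z) = 0 := dsnd_lift (I := I3) Y z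

include h hv in
/-- The horizon is totally geodesic. -/
lemma dslice_conn (hn : IsLeviCivita I4 gN nab) {Y : Vec I3 (S × ℝ)} (hY : V¹[I3] Y p)
    (u : T[I3] p) : dι[p] (sliceConn (I := I3) nab Y p u) = nab (lift (I := I3) Y) (slice p) (dι[p] u) := by
  obtain ⟨U, hU, rfl⟩ := exists_fieldDiffAt u
  have h1 := h.nab_rad hn (ell_fibreField hv) (y := slice p) rfl (lift_diff (I := I3) (p := slice p) hU) (rad_lift U _)
    (lift_diff (I := I3) (p := slice p) hY) (Eventually.of_forall (rad_lift Y))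
  rw [← dslice_field] at h1
  exact push_sliceConn (I := I3) h1

include h hv in
/-- The flow of `ℓ` preserves the connection of the horizon, as `ℓ` extends to a Killing field. -/
lemma sliceConn_symmetry (hn : IsLeviCivita I4 gN nab) (hg : IsPseudoMetric I4 eta gN)
    {Y Z : Vec I3 (S × ℝ)} (hY : V∞[I3] Y p) (hZ : V∞[I3] Z p) :
    mlieBracket I3 ell (fun p' ↦ sliceConn (I := I3) nab Z p' (Y p')) p =
      sliceConn (I := I3) nab Z p (mlieBracket I3 ell Y p) + sliceConn (I := I3) nab (fun p' ↦ mlieBracket I3 ell Z p') p (Y p) := by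
  have hc := hn.isSmoothConn hg
  have hL : V∞[I4] ℓ₄ (slice p) := lift_smooth (I := I3) (p := slice p) (ell_smooth p)
  have hYl : V∞[I4] (lift (I := I3) Y) (slice p) := lift_smooth (I := I3) (p := slice p) hY
  have hZl : V∞[I4] (lift (I := I3) Z) (slice p) := lift_smooth (I := I3) (p := slice p) hZ
  have hW := hc (slice p) _ _ hYl hZl
  have e1 : ∀ᶠ p' in 𝓝 p, nab (lift (I := I3) Z) (slice p') (lift (I := I3) Y (slice p')) = dι[p'] (sliceConn (I := I3) nab Z p' (Y p')) := by
    filter_upwards [hZ.eventually_fieldDiffAt] with p' hp'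
    rw [dslice_conn h hv hn hp', dslice_field]
  have hD : V∞[I3] (fun p' ↦ sliceConn (I := I3) nab Z p' (Y p')) p :=
    fieldSmoothAt_of_along (slice_embedding.isImmersion.isImmersionAt p) hW e1
  have hbr : ∀ {Y : Vec I3 (S × ℝ)} {z : (S × ℝ) × ℝ}, V¹[I3] Y z.1 →
      mlieBracket I4 (lift (I := I3) ell) (lift (I := I3) Y) z = lift (I := I3) (mlieBracket I3 ell Y) z :=
    fun {Y z} hY ↦ bracket_lift_lift (I := I3) (ell_smooth z.1).fieldDiffAt hY
  have b0 := mfderiv_mlieBracket_of_related (slice_smooth p) (ell_smooth p).fieldDiffAt hD.fieldDiffAt hL.fieldDiffAt hW.fieldDiffAt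
    (Eventually.of_forall fun p' ↦ (dslice_field ell p').symm) e1
  have hlie := br_smooth (ell_smooth p) hZ
  have b1 : ∀ᶠ z in 𝓝 (slice p), mlieBracket I4 (lift (I := I3) ell) (lift (I := I3) Z) z = lift (I := I3) (mlieBracket I3 ell Z) z := by
    filter_upwards [(contMDiffAt_fst' (I := I3) (slice p)).continuousAt.eventually hZ.eventually_fieldDiffAt] with z hz
    exact hbr hz
  have key : mlieBracket I4 (lift (I := I3) ell) (fun z ↦ nab (lift (I := I3) Z) z (lift (I := I3) Y z)) (slice p)
      - nab (lift (I := I3) Z) (slice p) (mlieBracket I4 (lift (I := I3) ell) (lift (I := I3) Y) (slice p))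
      - nab (fun z ↦ mlieBracket I4 (lift (I := I3) ell) (lift (I := I3) Z) z) (slice p) (lift (I := I3) Y (slice p)) = 0 := by
    refine hg.ext fun w ↦ ?_
    obtain ⟨W, hWs, rfl⟩ := exists_fieldSmoothAt w
    rw [lie_nab_of_killing hn hc h.nearMetric_smooth h.nearMetric_symm hL
      (Eventually.of_forall fun z Y Z hY hZ ↦ h.lie_nearMetric (ell_fibreField hv) hY hZ) hYl hZl hWs, map_zero]
    rfl
  rw [nab_congr nab (lift_diff (I := I3) (p := slice p) hlie.fieldDiffAt) b1, hbr hY.fieldDiffAt, ← dslice_field, ← dslice_field, ← b0,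
    ← dslice_conn h hv hn hZ.fieldDiffAt, ← dslice_conn h hv hn hlie.fieldDiffAt, ← map_sub, ← map_sub] at key
  have := congrArg (mfderiv I4 I3 Prod.fst (slice p)) key
  rw [dfst_dslice, map_zero] at this
  rw [← sub_eq_zero, ← sub_sub]
  exact this

/-- The isolated horizon with data `q, ω` and vanishing `μ, λ` for the foliation `v`. -/
abbrev nearHorizon : IsolatedHorizon S where
  M := M₄
  emb := slice
  emb_smooth := slice_embedding
  null p w := by
    show gN (slice p) _ _ = 0
    rw [nearMetric_dslice, pullTensor_apply]
    have : mfderiv I3 (𝓡 2) Prod.fst p (ell p) = 0 := dPi_ell p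
    rw [this, map_zero]
    rfl
  D := sliceConn (I := I3) (M₄).nab
  D_induced p Y Y' hY hY' hYY w := by
    have h1 := dslice_conn h hv (M₄).leviCivita hY w
    refine h1.trans (nab_congr_along _ (slice_mdiff p) (lift_diff (I := I3) (p := slice p) hY) hY' ?_ w)
    filter_upwards [hYY] with p' hp'
    rw [hp', dslice_field]
  ell_symmetry :=
    { smooth := ell_smooth
      lie_q := fun p Y Z hY hZ ↦ by
        have := lie_pullTensor (J := I3) (contMDiffAt_fst' p) (h.metric _) (ell_smooth p).fieldDiffAt hY hZ (Eventually.of_forall dPi_ell)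
        simp only [← nearMetric_dslice (omh := omh) (v := v)] at this
        exact this
      lie_D := fun p Y Z hY hZ ↦ sliceConn_symmetry h hv (M₄).leviCivita (nearMetric_isPseudoMetric h hv hf) hY hZ }

end Construction

local notation "Δ₄" => nearHorizon h hv hf hε

/-! ### Data and electromagnetic field of the constructed horizon -/

section HorizonData
variable {A B : S → ℝ}

/-- The rotation form is the covariant derivative of the Killing field `∂/∂V` at `r = 0`. -/
lemma nearHorizon_hasData : (Δ₄).HasData qh omh where
  metric p u w := nearMetric_dslice u w
  rotation p u := by
    have hg := nearMetric_isPseudoMetric h hv hf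
    have key : (M₄).nab ℓ₄ (slice p) (dι[p] u) =
        omh p.1 (dPi p u) • ℓ₄ (slice p) := by
      refine hg.ext fun w ↦ ?_
      obtain ⟨W, hW, rfl⟩ := exists_fieldDiffAt w
      obtain ⟨U, hU, rfl⟩ := exists_fieldDiffAt u
      rw [dslice_field, h.nab_killing (M₄).leviCivita (ell_fibreField hv) rfl (lift_diff (I := I3) (p := slice p) hU)
        (rad_lift U _) hW, ← dslice_field U, pullForm_apply, toSurface_dslice, map_smul]
      rfl
    have := congrArg (mfderiv I4 I3 Prod.fst (slice p)) key
    rw [map_smul] at this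
    exact this.trans (congrArg (omh p.1 (dPi p u) • ·) (dfst_lift (I := I3) ell (slice p)))

lemma nearHorizon_isExtremal : (Δ₄).IsExtremal := fun p ↦ by
  rw [(nearHorizon_hasData h hv hf hε).rotation, dPi_ell, map_zero, zero_smul]

/-- On `r = 0` the covariant derivatives of `dV` are those required by the symmetry equation. -/
lemma nearHorizon_muLambdaVanish : (Δ₄).MuLambdaVanish v := by
  have hd := (Δ₄).geomData_iff.2 (nearHorizon_hasData h hv hf hε)
  refine ((Δ₄).muLambdaVanish_iff hd hv).2 fun p u w ↦ ?_
  obtain ⟨U, hU, rfl⟩ := exists_fieldDiffAt u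
  obtain ⟨W, hW, rfl⟩ := exists_fieldDiffAt w
  have hvp := hv.1.contMDiffAt (x := p)
  have h1 := h.nab_pot (M₄).leviCivita (vert_fibreField hv) (y := slice p) rfl (lift_diff (I := I3) (p := slice p) hU)
    (Eventually.of_forall (rad_lift U)) (lift_diff (I := I3) (p := slice p) hW) (Eventually.of_forall (rad_lift W))
    (bracket_vert_lift (I := I3) (p := slice p) hU) (bracket_vert_lift (I := I3) (p := slice p) hW)
  have h2 : (fun z ↦ ∂[I4] (extendPot v) z (lift (I := I3) W z)) = fun z : (S × ℝ) × ℝ ↦ ∂[I3] v z.1 (W z.1) := by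
    funext z
    rw [d_extendPot hv]
    exact congrArg (∂[I3] v z.1) (dfst_lift (I := I3) W z)
  rw [h2, ← dslice_field U, ← dslice_field W, pot_dslice hv, pot_dslice hv, pullForm_apply, pullForm_apply, toSurface_dslice, toSurface_dslice,
    d_extendPot hv, mvfderiv_comp' (g := fun y ↦ ∂[I3] v y (W y)) (slice p) (hW.mdifferentiableAt_mvfderiv hvp) (mdiff_fst (I := I3) (slice p)),
    dfst_dslice] at h1
  rw [hess_eq hvp hW, hd.rotationForm_eq (Δ₄).horizonGeom, pull_apply, pull_apply]
  have h3 : ∂[I3] v p (sliceConn (I := I3) (M₄).nab W p (U p)) =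
    ∂[I3] (fun y ↦ ∂[I3] v y (W y)) p (U p) + ∂[I3] v p (U p) * omh p.1 (dPi p (W p)) + omh p.1 (dPi p (U p)) * ∂[I3] v p (W p) := h1
  rw [show (Δ₄).D W p (U p) = sliceConn (I := I3) (M₄).nab W p (U p) from rfl, h3]
  ring

end HorizonData

section Electromagnetic
variable {A B : S → ℝ}

/-- Two skew forms which agree on a null frame are equal. -/
lemma IsNullFrame.ext_skew {M : Spacetime.{u}} {z : M.carrier} {e : Fin 2 → T[I4] z} {n l : T[I4] z} (he : IsNullFrame M.g z e n l)
    {T T' : T[I4] z →L[ℝ] T[I4] z →L[ℝ] ℝ} (hT : ∀ u w, T w u = -T u w) (hT' : ∀ u w, T' w u = -T' u w)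
    (h0 : T l (e 0) = T' l (e 0)) (h1 : T l (e 1) = T' l (e 1)) (h2 : T n (e 0) = T' n (e 0)) (h3 : T n (e 1) = T' n (e 1))
    (h4 : T l n = T' l n) (h5 : T (e 0) (e 1) = T' (e 0) (e 1)) (u w : T[I4] z) : T u w = T' u w := by
  have hd : ∀ {T : T[I4] z →L[ℝ] T[I4] z →L[ℝ] ℝ}, (∀ u w, T w u = -T u w) → ∀ u, T u u = 0 := fun h u ↦ by
    linarith [h u u]
  have hu := M.null_expansion he u
  have hw := M.null_expansion he w
  rw [Fin.sum_univ_two] at hu hw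
  rw [hu, hw]
  simp only [map_sub, map_add, map_smul, _root_.add_apply, _root_.sub_apply, _root_.smul_apply, smul_eq_mul, hd hT, hd hT',
    hT l (e 0), hT l (e 1), hT n (e 0), hT n (e 1), hT l n, hT (e 0) (e 1), hT' l (e 0), hT' l (e 1), hT' n (e 0), hT' n (e 1), hT' l n, hT' (e 0) (e 1),
    h0, h1, h2, h3, h4, h5]

/-- The Hodge dual exchanges the two invariant 2-forms `dV ∧ θ` and `π^* ε`. -/
lemma hodge_nearField (z : (S × ℝ) × ℝ) (u w : T[I4] z) :
    (M₄).hodge₂ NF[A,B] z u w =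
      NF[fun x ↦ -B x,A] z u w := by
  have hl := ell_fibreField hv
  have hn := vert_fibreField hv
  obtain ⟨e, he, e1, e2, e3⟩ := hl.exists_null_frame (om := omh) hn (toSurface_surjective z) (hf.ortho (toSurface z))
  have hee : ∀ x u, ε x u u = 0 := hε.alternating
  have ee01 : ε (toSurface z) (f (toSurface z) 0) (f (toSurface z) 1) = 1 := by
    rw [hf.area, hf.ortho, hf.ortho, hf.ortho, hf.ortho]; norm_num
  have tl : tiltForm omh toSurface Prod.snd z (ℓ₄ z) = 0 := hl.tilt z
  have tn : tiltForm omh toSurface Prod.snd z (n₄ z) = 1 := hn.tilt z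
  have zl : ∀ {X : T[I4] z} (w), mfderiv I4 (𝓡 2) toSurface z X = 0 → ε (toSurface z) (mfderiv I4 (𝓡 2) toSurface z X) w = 0 := fun w hX ↦
    congrArg (fun L : T[𝓡 2] (toSurface z) →L[ℝ] ℝ ↦ L w) ((congrArg (ε (toSurface z)) hX).trans (map_zero _))
  have nf : ∀ (C D : S → ℝ) (u w : T[I4] z), NF[C,D] z u w =
      C (toSurface z) * (∂[I4] (extendPot v) z u * tiltForm omh toSurface Prod.snd z w - tiltForm omh toSurface Prod.snd z u * ∂[I4] (extendPot v) z w)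
        + D (toSurface z) * ε (toSurface z) (mfderiv I4 (𝓡 2) toSurface z u) (mfderiv I4 (𝓡 2) toSurface z w) := fun _ _ _ _ ↦ rfl
  have hF : ∀ u, NF[A,B] z u u = 0 := fun u ↦ by rw [nf, hee]; ring
  have hs : (M₄).vol z ![e 0, e 1, n₄ z, ℓ₄ z] = 1 := by
    refine (nearVol_apply (qh := qh) (ε := ε) (om := omh) (π := toSurface) (V := extendPot v) (r := Prod.snd) (f := f) (J := I4) (y := z) _ hf.area).trans ?_
    simp [pullTensor_apply, e1, e2, e3, hl.pi, hn.pi, hl.pot, hn.pot, tl, tn, ee01]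
  have hH := ((M₄).hodge_dualPair (x := z) hF).null (M := M₄) he
  rw [hs] at hH
  simp only [one_mul, nf, e1, e2, e3, hl.pot, hn.pot, tl, tn, zl _ (hl.pi z), zl _ (hn.pi z), ee01, mul_zero, mul_one, sub_zero, add_zero, zero_add, neg_zero] at hH
  obtain ⟨h1, h2, h3, h4, h5, h6⟩ := hH
  have sk : ∀ {C D : S → ℝ} (u w : T[I4] z), NF[C,D] z w u = -NF[C,D] z u w := by
    intro C D u w
    rw [nf, nf, hf.area, hf.area]
    ring
  refine IsNullFrame.ext_skew (M := M₄) he (T := (M₄).hodgeForm NF[A,B] z)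
    (T' := NF[fun x ↦ -B x,A] z) ((M₄).hodge₂_swap) sk
    (h1.trans ?_) (h2.trans ?_) (h3.trans ?_) (h4.trans ?_) (h5.trans ?_) (h6.trans ?_) u w
  all_goals simp only [nf, e1, e2, e3, hl.pot, hn.pot, tl, tn, zl _ (hl.pi z), zl _ (hn.pi z), ee01, mul_zero, mul_one, sub_zero, add_zero, zero_add]

/-- Along the horizon, a form `A dV ∧ θ + B π^* ε` maps `Y` to a tangent field `Z` exactly if `Z` and `Y` are related by the factors `-A` along the generators and by
`B` times the rotation on the sections. -/
lemma nearField_related_iff (hv : IsFoliationFunction v) (p : S × ℝ) (y z : T[I3] p) :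
    (∀ w, gN (slice p) (dι[p] z) w =
        NF[A,B] (slice p) (dι[p] y) w) ↔
      ∂[I3] v p z = -(A p.1 * ∂[I3] v p y) ∧ ∀ w, qh p.1 (dPi p z) w = B p.1 * ε p.1 (dPi p y) w := by
  have hn := vert_fibreField hv
  have nf : ∀ w, NF[A,B] (slice p) (dι[p] y) w =
      A p.1 * (∂[I3] v p y * tiltForm omh toSurface Prod.snd (slice p) w)
        + B p.1 * ε p.1 (dPi p y) (mfderiv I4 (𝓡 2) toSurface (slice p) w) := fun w ↦ by
    rw [nearField_apply, pullTensor_apply, pot_dslice hv, tilt_dslice, toSurface_dslice, zero_mul, sub_zero]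
    rfl
  have nm : ∀ w, gN (slice p) (dι[p] z) w =
      -(∂[I3] v p z * tiltForm omh toSurface Prod.snd (slice p) w)
        + qh p.1 (dPi p z) (mfderiv I4 (𝓡 2) toSurface (slice p) w) := fun w ↦ by
    rw [nearMetric_apply, pullTensor_apply, pot_dslice hv, tilt_dslice, toSurface_dslice]
    rw [zero_mul, sub_zero]
    exact (neg_add_eq_sub _ _).symm
  simp only [nf, nm]
  constructor
  · intro h
    have h1 : ∂[I3] v p z = -(A p.1 * ∂[I3] v p y) := by
      have := h (n₄ (slice p))
      have z1 : ∀ L : T[𝓡 2] p.1 →L[ℝ] ℝ, L (mfderiv I4 (𝓡 2) toSurface (slice p) (n₄ (slice p))) = 0 :=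
        fun L ↦ (congrArg L (hn.pi (slice p))).trans (map_zero L)
      rw [hn.tilt, z1, z1] at this
      linarith
    refine ⟨h1, fun w ↦ ?_⟩
    obtain ⟨u, rfl⟩ := toSurface_surjective (slice p) w
    have := h u
    rw [h1] at this
    linarith
  · rintro ⟨h1, h2⟩ w
    have := h2 (mfderiv I4 (𝓡 2) toSurface (slice p) w)
    rw [h1]
    linarith

/-- The coefficients and both invariant 2-forms do not depend on the position along the generators. -/
lemma nearField_isFlowInvariant (hA : ContMDiff (𝓡 2) 𝓘(ℝ, ℝ) ∞ A) (hB : ContMDiff (𝓡 2) 𝓘(ℝ, ℝ) ∞ B) :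
    (Δ₄).IsFlowInvariant fun z u w ↦ NF[A,B] z u w := by
  intro p Y Z hY hZ hYZ
  have hl := (ell_smooth p).fieldDiffAt
  have hvp := hv.1.contMDiffAt (x := p)
  have h1 : ∀ᶠ p' in 𝓝 p, ∂[I3] v p' (Z p') = -(A p'.1 * ∂[I3] v p' (Y p')) ∧
      ∀ w, qh p'.1 (dPi p' (Z p')) w = B p'.1 * ε p'.1 (dPi p' (Y p')) w := by
    filter_upwards [hYZ] with p' hp'
    exact (nearField_related_iff hv p' _ _).1 hp'
  have dA : ∀ {A : S → ℝ}, ContMDiff (𝓡 2) 𝓘(ℝ, ℝ) ∞ A → D¹[I3] (fun p : S × ℝ ↦ A p.1) p ∧ ∂[I3] (fun p : S × ℝ ↦ A p.1) p (ell p) = 0 :=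
    fun hA ↦ ⟨MDifferentiableAt.comp (I' := 𝓡 2) p (hA.contMDiffAt.mdiff) (mdiff_fst p),
      dd_comp_zero (I := 𝓡 2) (π := Prod.fst) (hA.contMDiffAt.mdiff) (contMDiffAt_fst' p) (dPi_ell p)⟩
  refine (nearField_related_iff hv p _ _).2 ⟨?_, fun w ↦ ?_⟩
  · have hdY := hY.mdifferentiableAt_mvfderiv hvp
    rw [← lie_exact hvp hl hZ (Eventually.of_forall hv.2), ← lie_exact hvp hl hY (Eventually.of_forall hv.2),
      mvfderiv_congr (h1.mono fun _ h ↦ h.1), dd_neg, dd_mul (dA hA).1 hdY, (dA hA).2]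
    ring
  · have hW : V¹[I3] (lift (I := 𝓡 2) (extend₂ w)) p := lift_diff (I := 𝓡 2) (p := p) (fieldDiffAt_extend_self w)
    have hbr : mlieBracket I3 ell (lift (I := 𝓡 2) (extend₂ w)) p = 0 := bracket_ell_lift (p := p) (fieldDiffAt_extend_self w)
    have hWp : mfderiv I3 (𝓡 2) Prod.fst p (lift (I := 𝓡 2) (extend₂ w) p) = w :=
      (dPi_lift _ p).trans (extend_apply_self _ _)
    have l1 := lie_pullTensor (I := 𝓡 2) (J := I3) (π := Prod.fst) (contMDiffAt_fst' p) (h.metric _) hl hZ hW (Eventually.of_forall dPi_ell)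
    have l2 := lie_pullTensor (I := 𝓡 2) (J := I3) (π := Prod.fst) (contMDiffAt_fst' p) (hε.smooth _) hl hY hW (Eventually.of_forall dPi_ell)
    have dε := (pullTensor_smooth (J := I3) (contMDiffAt_fst' p) (hε.smooth _)).mdifferentiableAt hY hW
    have h2 : (fun y ↦ pullTensor (J := I3) qh Prod.fst y (Z y) (lift (I := 𝓡 2) (extend₂ w) y)) =ᶠ[𝓝 p]
        fun y ↦ B y.1 * pullTensor (J := I3) ε Prod.fst y (Y y) (lift (I := 𝓡 2) (extend₂ w) y) :=
      h1.mono fun y hy ↦ hy.2 _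
    rw [hbr, map_zero, add_zero] at l1 l2
    rw [mvfderiv_congr h2, dd_mul (dA hB).1 dε, l2, (dA hB).2, zero_mul, add_zero, pullTensor_apply, pullTensor_apply, hWp] at l1
    exact l1.symm

/-- The Hodge dual is a field of the same form, so all conditions need to be checked for one such field only. -/
lemma nearField_isAligned (hA : ContMDiff (𝓡 2) 𝓘(ℝ, ℝ) ∞ A) (hB : ContMDiff (𝓡 2) 𝓘(ℝ, ℝ) ∞ B) :
    (Δ₄).IsAligned NF[A,B] := by
  have hl : ∀ (A B : S → ℝ) (p : S × ℝ) (w : T[I3] p),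
      NF[A,B] (slice p) (dι[p] (ell p)) (dι[p] w) = 0 := fun A B p w ↦ by
    have z0 : ε p.1 (dPi p (ell p)) (dPi p w) = 0 := by rw [dPi_ell, map_zero]; rfl
    rw [nearField_apply, pullTensor_apply, tilt_dslice, tilt_dslice, toSurface_dslice, toSurface_dslice]
    exact (congrArg (_ + B p.1 * ·) z0).trans (by ring)
  refine ⟨fun z u ↦ ?_, fun p ↦ h.nearField_smooth hε.smooth hA hB _, hl A B, fun p w ↦ (hodge_nearField h hv hf hε _ _ _).trans (hl _ _ p w),
    nearField_isFlowInvariant h hv hf hε hA hB, ?_⟩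
  · rw [nearField_apply (J := I4), pullTensor_apply, hε.alternating]; ring
  · have := nearField_isFlowInvariant h hv hf hε (A := fun x ↦ -B x) hB.neg hA
    have e : (fun z u w ↦ (M₄).hodgeForm NF[A,B] z u w) =
        fun z u w ↦ NF[fun x ↦ -B x,A] z u w :=
      funext fun z ↦ funext fun u ↦ funext fun w ↦ hodge_nearField h hv hf hε z u w
    exact e ▸ this

/-- Evaluation on `(ℓ, n)`, where `g(ℓ, n) = -1` and `dV ∧ θ` has the value `1`; the Hodge dual has the value `-B`. -/
lemma nearField_charge (hA : ContMDiff (𝓡 2) 𝓘(ℝ, ℝ) ∞ A) (hB : ContMDiff (𝓡 2) 𝓘(ℝ, ℝ) ∞ B) (p : S × ℝ) :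
    (Δ₄).charge NF[A,B] p = -((A p.1 : ℂ) + Complex.I * B p.1) := by
  have ha := nearField_isAligned h hv hf hε hA hB
  have hn := vert_fibreField hv
  have gl : gN (slice p) (dι[p] (ell p)) (n₄ (slice p)) = -1 := by
    rw [hn.metric_right h, pot_dslice hv, hv.2]; ring
  have fl : ∀ A B : S → ℝ, NF[A,B] (slice p) (dι[p] (ell p)) (n₄ (slice p)) = A p.1 := by
    intro A B
    have z1 : ∀ L : T[𝓡 2] (toSurface (slice p)) →L[ℝ] ℝ, L (mfderiv I4 (𝓡 2) toSurface (slice p) (n₄ (slice p))) = 0 :=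
      fun L ↦ (congrArg L (hn.pi (slice p))).trans (map_zero L)
    rw [nearField_apply, pullTensor_apply, pot_dslice hv, hv.2, hn.tilt, tilt_dslice, z1]
    show A p.1 * _ + _ = _
    ring
  have h1 := (Δ₄).nullCoeff_spec (ha.ell_re p) (n₄ (slice p))
  have h2 := (Δ₄).nullCoeff_spec (ha.ell_im p) (n₄ (slice p))
  have c1 : (Δ₄).nullCoeff NF[A,B] p = -A p.1 := by
    have := (fl A B).symm.trans (h1.trans (congrArg (_ * ·) gl))
    simp only at this; linarith
  have c2 : (Δ₄).nullCoeff ((M₄).hodgeForm NF[A,B]) p = B p.1 := by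
    have := (fl (fun x ↦ -B x) A).symm.trans ((hodge_nearField h hv hf hε _ _ _).symm.trans (h2.trans (congrArg (_ * ·) gl)))
    simp only at this; linarith
  refine (congrArg₂ (fun a b : ℝ ↦ (a : ℂ) - Complex.I * b) c1 c2).trans ?_
  push_cast
  ring

/-- The field with `A + i B = -2 Φ`, that is with charge `2 Φ`, makes the horizon electrovac if `Φ` solves the constraints. -/
lemma nearField_makesElectrovac {nabh : Conn[𝓡 2,ℝ²,S]} {Φ : S → ℂ}
    (hn : IsLeviCivita (𝓡 2) qh nabh) (hΦ : ContMDiff (𝓡 2) 𝓘(ℝ, ℂ) ∞ Φ)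
    (hE : ∀ (x : S) (u w : T[𝓡 2] x),
      (1 / 2) * (covDerivForm (𝓡 2) nabh (fun y z ↦ omh y z) x u w + covDerivForm (𝓡 2) nabh (fun y z ↦ omh y z) x w u)
        + omh x u * omh x w - (1 / 2) * ricci (𝓡 2) nabh x u w + 2 * ‖Φ x‖ ^ 2 * qh x u w = 0)
    (hM : ∀ (x : S) (e₁ e₂ : T[𝓡 2] x), qh x e₁ e₁ = 1 → qh x e₂ e₂ = 1 → qh x e₁ e₂ = 0 → ε x e₁ e₂ = 1 →
      (∂[𝓡 2] Φ x e₁ - Complex.I * ∂[𝓡 2] Φ x e₂) + 2 * ((omh x e₁ : ℂ) - Complex.I * (omh x e₂ : ℂ)) * Φ x = 0) :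
    (Δ₄).MakesElectrovac
      NF[fun x ↦ -2 * (Φ x).re,fun x ↦ -2 * (Φ x).im] := by
  have hA : ContMDiff (𝓡 2) 𝓘(ℝ, ℝ) ∞ (fun x ↦ -2 * (Φ x).re) := ((-2 : ℝ) • Complex.reCLM).contMDiff.comp hΦ
  have hB : ContMDiff (𝓡 2) 𝓘(ℝ, ℝ) ∞ (fun x ↦ -2 * (Φ x).im) := ((-2 : ℝ) • Complex.imCLM).contMDiff.comp hΦ
  have ha := nearField_isAligned h hv hf hε hA hB
  have hD := nearHorizon_hasData h hv hf hε
  have hd := (Δ₄).geomData_iff.2 hD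
  have hr : ∀ p u, rotationForm (Δ₄).D p u = omh p.1 (dPi p u) := fun p u ↦ by
    rw [hd.rotationForm_eq (Δ₄).horizonGeom, pull_apply]
  have hc : (Δ₄).charge NF[fun x ↦ -2 * (Φ x).re,fun x ↦ -2 * (Φ x).im] =
      fun p ↦ ((2 : ℝ) • ContinuousLinearMap.id ℝ ℂ) (Φ p.1) := funext fun p ↦ by
    rw [nearField_charge h hv hf hε hA hB]
    refine Complex.ext ?_ ?_ <;> simp
  have hdc : ∀ (p : S × ℝ) (u : T[I3] p), ∂[I3] (fun p : S × ℝ ↦ ((2 : ℝ) • ContinuousLinearMap.id ℝ ℂ) (Φ p.1)) p u = 2 * ∂[𝓡 2] Φ p.1 (dPi p u) := by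
    intro p u
    have hΦp := hΦ.contMDiffAt (x := p.1) |>.mdiff
    have d1 : MDifferentiableAt I3 𝓘(ℝ, ℂ) (fun p : S × ℝ ↦ Φ p.1) p := MDifferentiableAt.comp (I' := 𝓡 2) p hΦp (mdiff_fst p)
    rw [dd_clm _ d1, mvfderiv_comp' (g := Φ) p hΦp (mdiff_fst p)]
    refine (Complex.real_smul (x := 2)).trans ?_
    push_cast
    rfl
  have hmax := fun p ↦ (ha.maxwell_iff Δ₄ hd (fun p ↦ by rw [hr, dPi_ell, map_zero]) p).2 fun n e he ↦ by
    have hq' : ∀ i j, qh p.1 (dPi p (e i)) (dPi p (e j)) = if i = j then 1 else 0 := fun i j ↦ (hD.metric p _ _).symm.trans (he.ee i j)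
    -- the area form of the horizon is the given one
    have hs : (Δ₄).M.vol (slice p) ![dι[p] (e 0), dι[p] (e 1), n, dι[p] (ell p)]
        = ε p.1 (dPi p (e 0)) (dPi p (e 1)) := by
      have hl : tiltForm omh toSurface Prod.snd (slice p) n = 1 := by
        have h1 := he.nl
        have h2 : gN (slice p) n (ℓ₄ (slice p)) = -1 := by
          rw [← dslice_field]; exact h1
        rw [(ell_fibreField hv).metric_right h] at h2
        linarith
      refine (nearVol_apply (qh := qh) (ε := ε) (om := omh) (π := toSurface) (V := extendPot v) (r := Prod.snd) (f := f) (J := I4) (y := slice p) _ hf.area).trans ?_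
      simp [pullTensor_apply, tilt_dslice, toSurface_dslice, pot_dslice hv, hv.2, hl, dPi_ell]
      have zr : ∀ u, ε p.1 u 0 = 0 := fun u ↦ map_zero _
      refine (congrArg₂ (fun a b ↦ _ + -(a * _) + b * _) (zr _) (zr _)).trans ?_
      simp only [zero_mul, neg_zero, add_zero]
      rfl
    set s := ε p.1 (dPi p (e 0)) (dPi p (e 1)) with hsdef
    have hs2 : s ^ 2 = 1 := by rw [hsdef, hε.sq, hq', hq', hq']; norm_num
    -- multiplication of `e₁` by the orientation `s = ±1` gives a positively oriented frame
    have key := hM p.1 (dPi p (e 0)) (s • dPi p (e 1)) (hq' 0 0) (by simp [hq', ← pow_two, hs2]) (by simp [hq']) (by rw [map_smul, smul_eq_mul, ← hsdef, ← pow_two, hs2])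
    rw [hc, hdc, hdc, hr, hr]
    refine (congrArg (fun t : ℝ ↦ (_ - Complex.I * (t : ℂ) * _) + 2 * (_ - Complex.I * (t : ℂ) * _) * _) hs).trans ?_
    rw [map_smul, map_smul] at key
    simp only [Complex.real_smul, smul_eq_mul, Complex.ofReal_mul] at key
    have h2 : ((2 : ℝ) • ContinuousLinearMap.id ℝ ℂ) (Φ p.1) = 2 * Φ p.1 := by simp
    beta_reduce
    rw [h2]
    linear_combination 2 * key
  exact
    { alternating := ha.alternating
      smooth := ha.smooth
      einstein := fun p u w ↦ (ha.einstein_iff Δ₄ hd hn u w).2 (by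
        have h2 : (Δ₄).charge NF[fun x ↦ -2 * (Φ x).re,fun x ↦ -2 * (Φ x).im] p / 2 = Φ p.1 := by
          rw [hc]; simp
        rw [h2]
        exact hE p.1 (dPi p u) (dPi p w))
      maxwell_ell := fun p ↦ (hmax p).1
      maxwell_tangent := fun p ↦ (hmax p).2
      ell_contraction := fun p w ↦ by
        have h1 := ha.ell_re p w
        have h2 := ha.ell_im p w
        rw [Spacetime.hodgeForm_apply] at h2
        rw [Spacetime.selfDualPart, h1, h2]
        simp
      invariant_re := ha.invariant_re
      invariant_im := ha.invariant_im }

end Electromagnetic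

end AmbientSpacetime

/-! ### Null symmetry and existence -/

namespace IsolatedHorizon
variable (Δ : IsolatedHorizon S) {qh : Cov₂ (𝓡 2) S} {omh : Cov (𝓡 2) S}

lemma exists_geomData (h : Δ.IsExtremal) : ∃ qh omh, GeomData Δ.qForm Δ.D qh omh := Δ.horizonGeom.exists_data h

lemma rotationForm_ell (h : GeomData Δ.qForm Δ.D qh omh) (p : S × ℝ) : rotationForm Δ.D p (ell p) = 0 := by
  rw [h.rotationForm_eq Δ.horizonGeom, pull_apply, dPi_ell, map_zero]

/-- Null symmetries are solutions of the symmetry equation, and so are the potentials of foliations with `μ = λ = 0`. -/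
lemma isNullSymmetric_iff [PreconnectedSpace S] [CompactSpace S] [Nonempty S] (h : GeomData Δ.qForm Δ.D qh omh) :
    Δ.IsNullSymmetric ↔ ∃ v : S × ℝ → ℝ, IsFoliationFunction v ∧ Δ.MuLambdaVanish v :=
  (Δ.horizonGeom.exists_symmetry_iff (Δ.rotationForm_ell h)).trans
    (exists_congr fun _ ↦ and_congr_right fun hv ↦ (Δ.muLambdaVanish_iff h hv).symm)

end IsolatedHorizon

/-- Every solution of the constraints and every foliation potential come from a horizon. -/
lemma exists_isolatedHorizon {qh : Cov₂ (𝓡 2) S} {omh : Cov (𝓡 2) S}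
   [T2Space S] [SecondCountableTopology S] (hc : SolvesConstraints qh omh) {v : S × ℝ → ℝ} (hv : IsFoliationFunction v) :
   ∃ Δ : IsolatedHorizon S, Δ.IsExtremal ∧ Δ.IsElectrovac ∧ Δ.HasData qh omh ∧ Δ.MuLambdaVanish v := by
  obtain ⟨nabh, ε, Φ, hn, hε, hΦ, hE, hM⟩ := hc.constraints
  obtain ⟨f, hf⟩ := hε.exists_orientedFrame hc.riemannian
  have h := nearData_of_foliation hc.riemannian hc.smooth hv
  exact ⟨nearHorizon h hv hf hε, nearHorizon_isExtremal h hv hf hε, ⟨_, nearField_makesElectrovac h hv hf hε hn hΦ hE hM⟩,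
    nearHorizon_hasData h hv hf hε, nearHorizon_muLambdaVanish h hv hf hε⟩

end Horizon

end ExtremalIH

end

theorem proposition2 {S : Type u} [TopologicalSpace S]
    [ChartedSpace (EuclideanSpace ℝ (Fin 2)) S] [IsManifold (𝓡 2) ∞ S]
    (hS : Nonempty (S ≃ₜ Metric.sphere (0 : EuclideanSpace ℝ (Fin 3)) 1)) :
    (∀ 𝓗 : ExtremalIH.IsolatedHorizon S, 𝓗.IsExtremal → 𝓗.IsElectrovac →
      (𝓗.IsNullSymmetric ↔
        ∃ v : S × ℝ → ℝ, ExtremalIH.IsFoliationFunction v ∧ 𝓗.MuLambdaVanish v) ∧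
      (𝓗.IsNullSymmetric →
        (∃ qh omh, 𝓗.HasData qh omh ∧ ExtremalIH.SolvesConstraints qh omh) ∧
        ∀ v : S × ℝ → ℝ, ExtremalIH.IsFoliationFunction v → 𝓗.MuLambdaVanish v →
          LinearIndependent ℝ
            ![(ExtremalIH.ell : Π p : S × ℝ, TangentSpace ExtremalIH.I3 p),
              fun p ↦ v p • ExtremalIH.ell p] ∧
          {X | 𝓗.IsNullSymmetry X} =
            (Submodule.span ℝ {ExtremalIH.ell, fun p ↦ v p • ExtremalIH.ell p} :
              Set (Π p : S × ℝ, TangentSpace ExtremalIH.I3 p)) ∧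
          (∀ p : S × ℝ, VectorField.mlieBracket ExtremalIH.I3 ExtremalIH.ell
            (fun p' ↦ v p' • ExtremalIH.ell p') p = ExtremalIH.ell p) ∧
          ∀ φ : Diffeomorph ExtremalIH.I3 ExtremalIH.I3 (S × ℝ) (S × ℝ) ∞,
            𝓗.IsNullSymmetryMap φ ↔
              (∀ p, (φ p).1 = p.1) ∧ ∃ c a : ℝ, ∀ p, v (φ p) = c * v p + a)) ∧
    (∀ qh omh, ExtremalIH.SolvesConstraints qh omh →
      ∀ v : S × ℝ → ℝ, ExtremalIH.IsFoliationFunction v →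
        ∃ 𝓗 : ExtremalIH.IsolatedHorizon S, 𝓗.IsExtremal ∧ 𝓗.IsElectrovac ∧
          𝓗.IsNullSymmetric ∧ 𝓗.HasData qh omh ∧ 𝓗.MuLambdaVanish v) ∧
    (∀ (v : S × ℝ → ℝ) qh omh (𝓗 𝓗' : ExtremalIH.IsolatedHorizon S),
      ExtremalIH.IsFoliationFunction v →
      𝓗.HasData qh omh → 𝓗.MuLambdaVanish v → 𝓗'.HasData qh omh → 𝓗'.MuLambdaVanish v →
        (∀ p u w, 𝓗.q p u w = 𝓗'.q p u w) ∧
        ∀ (p : S × ℝ) (Z : Π p : S × ℝ, TangentSpace ExtremalIH.I3 p),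
          ExtremalIH.FieldDiffAt ExtremalIH.I3 Z p → ∀ u, 𝓗.D Z p u = 𝓗'.D Z p u) := by
  obtain ⟨φ⟩ := hS
  have hfr : Module.finrank ℝ (EuclideanSpace ℝ (Fin 3)) = 3 := finrank_euclideanSpace_fin
  have hconn : ConnectedSpace (Metric.sphere (0 : EuclideanSpace ℝ (Fin 3)) 1) :=
    Subtype.connectedSpace (isConnected_sphere (by rw [rank_eq_card_basis (EuclideanSpace.basisFun (Fin 3) ℝ).toBasis]; simp) 0 zero_le_one)
  have : CompactSpace S := φ.symm.compactSpace
  have : T2Space S := φ.symm.t2Space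
  have : SecondCountableTopology S := φ.secondCountableTopology
  have : ConnectedSpace S := φ.symm.surjective.connectedSpace φ.symm.continuous
  refine ⟨fun 𝓗 hex hel ↦ ?_, fun qh omh hc v hv ↦ ?_, fun v qh omh 𝓗 𝓗' hv hd hm hd' hm' ↦ ?_⟩
  · obtain ⟨qh, omh, hd⟩ := 𝓗.exists_geomData hex
    obtain ⟨F, hF⟩ := hel
    have h0 := 𝓗.rotationForm_ell hd
    refine ⟨𝓗.isNullSymmetric_iff hd, fun _ ↦ ⟨⟨qh, omh, 𝓗.geomData_iff.1 hd, hF.solvesConstraints 𝓗 hd h0⟩, fun v hv hm ↦ ?_⟩⟩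
    have hs := (𝓗.muLambdaVanish_iff hd hv).1 hm
    refine ⟨ExtremalIH.linearIndependent_ell hv, 𝓗.horizonGeom.symmetries_eq_span h0 hv hs, ExtremalIH.bracket_ell_smul_ell hv, fun ψ ↦ ?_⟩
    constructor
    · intro h
      exact ⟨h.fibre, (𝓗.horizonGeom.nullSymmetryMap_iff hd hv hs ψ h.fibre).1 h.map_D⟩
    · rintro ⟨hf, hca⟩
      exact ⟨hf, fun p u w ↦ hd.q_map hf p u w, (𝓗.horizonGeom.nullSymmetryMap_iff hd hv hs ψ hf).2 hca⟩
  · obtain ⟨𝓗, h1, h2, h3, h4⟩ := ExtremalIH.exists_isolatedHorizon hc hv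
    exact ⟨𝓗, h1, h2, (𝓗.isNullSymmetric_iff (𝓗.geomData_iff.2 h3)).2 ⟨v, hv, h4⟩, h3, h4⟩
  · have k := 𝓗.geomData_iff.2 hd
    have k' := 𝓗'.geomData_iff.2 hd'
    have hq : 𝓗.qForm = 𝓗'.qForm := by
      ext p u w
      rw [k.metric, k'.metric]
    refine ⟨fun p u w ↦ congrArg (fun q : Π p : S × ℝ, TangentSpace ExtremalIH.I3 p →L[ℝ] TangentSpace ExtremalIH.I3 p →L[ℝ] ℝ ↦ q p u w) hq, fun p Z hZ u ↦ ?_⟩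
    have h' := 𝓗'.horizonGeom
    rw [← hq] at h'
    exact 𝓗.horizonGeom.unique h' ((k.rotationForm_eq 𝓗.horizonGeom).trans (k'.rotationForm_eq 𝓗'.horizonGeom).symm) hv
      ((𝓗.muLambdaVanish_iff k hv).1 hm) ((𝓗'.muLambdaVanish_iff k' hv).1 hm') hZ u
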